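/- **Proposition 3.4.** *Setting.* Let $n\ge2$, write $\xi=(k,\lambda)\in\mathbb R^3\times\{-\tfrac12,\tfrac12\}$ and $\int d\xi=\sum_\lambda\int dk$. Let $\mathcal F=\bigoplus_{l\ge0}\otimes_a^l L^2(\mathbb R^3\times\{-\frac12,\frac12\})$ be the antisymmetric Fock space and $\mathcal H=\bigotimes_{i=1}^n\mathcal F$. Let $b_i^*(\xi),b_i(\xi)$ be the fermionic creation and annihilation operators of the $i$-th species, where operators of different species anticommute. Let $m_2,\dots,m_n>0$ be fixed, and for $m_1>0$ let $$H_{m_1}=\sum_{i=1}^n \mathrm d\Gamma\big(\sqrt{k_i^2+m_i^2}\big)+H_I,\qquad H_I=\sum_{p=0}^n\ \sum_{(i_1,\dots,i_n)\in\mathfrak I_p}\Big(\int G^{(p)}_{i_1,\dots,i_n}(\xi_1,\dots,\xi_n)\,b^*_{i_1}(\xi_{i_1})\cdots b^*_{i_p}(\xi_{i_p})\,b_{i_{p+1}}(\xi_{i_{p+1}})\cdots b_{i_n}(\xi_{i_n})\,d\xi_1\cdots d\xi_n+\mathrm{h.c.}\Big),$$ with square integrable kernels $G^{(p)}_{i_1,\dots,i_n}$.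 Here $\mathfrak I_p$ is the set of orderings of $\{1,\dots,n\}$ with $i_1<\dots<i_p$, $i_{p+1}<\dots<i_n$ and $i_1<i_{p+1}$, where conditions that involve a missing index are dropped; in particular $i_1=1$ always. The operator $H_{m_1}$ is defined on $\mathcal D(H_f)$, $H_f=\sum_i\mathrm d\Gamma(\sqrt{k_i^2+m_i^2})$, by its quadratic form. Let $\mathrm h_i^j=-\partial_{k_{i,j}}^2+k_{i,j}^2$ for $j=1,2,3$, with powers defined by the spectral theorem. *Statement.* Let $i_0\in\{1,\dots,n\}$ and $\varepsilon>0$; if $n=2$ and $i_0=1$, assume in addition $\varepsilon\ge\frac12$. Suppose that, for all $p\in\{0,\dots,n\}$ and all $(i_1,\dots,i_n)\in\mathfrak I_p$, $$G^{(p)}_{i_1,\dots,i_n}\in\mathcal D\Big(\Big(\prod_{\substack{2\le i\le n,\ i\ne i_0\\ 1\le j\le3}}(\mathrm h_i^j)^{\frac12-\frac1{n-1}+\varepsilon}\Big)\Big(\prod_{\substack{i=1,\ i\neq i_0\\ 1\le j\le3}}(\mathrm h_i^j)^{\frac12-\frac56\frac1{n-1}+\varepsilon}\Big)\Big),$$ where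 the second product is empty if $i_0=1$. Then there is a constant $C_0>0$, independent of $m_1$, such that for every $m_1>0$, every normalized ground state $\Phi_{m_1}$ of $H_{m_1}$ (that is, $\Phi_{m_1}\in\mathcal D(H_{m_1})$, $\|\Phi_{m_1}\|=1$, $H_{m_1}\Phi_{m_1}=E_{m_1}\Phi_{m_1}$ with $E_{m_1}=\inf\sigma(H_{m_1})$) and almost every $\xi_1=(k_1,\lambda_1)$ with $k_1\ne0$: the vector $b_1(\xi_1)\Phi_{m_1}$ belongs to $\mathcal H$, the kernels $G^{(p)}_{1,i_2,\dots,i_n}(\xi_1,\cdot,\dots,\cdot)$ belong to the domain of the operator on the right, and $$\|b_1(\xi_1)\Phi_{m_1}\|\le C_0\,|k_1|^{-1}\sum_{p=0}^n\ \sum_{(1,i_2,\dots,i_n)\in\mathfrak I_p}\Big\|\Big(\prod_{\substack{2\le i\le n,\ i\ne i_0\\ 1\le j\le3}}(\mathrm h_i^j)^{\frac12-\frac1{n-1}+\varepsilon}\Big)G^{(p)}_{1,i_2,\dots,i_n}(\xi_1,\cdot,\dots,\cdot)\Big\|_2 .$$ The statement covers both even and odd $n$. -/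

import Mathlib

open MeasureTheory

noncomputable section

namespace FermionModel

/-! ### One-particle configurations -/

/-- The two values of the spin variable, `true` for `1/2` and `false` for `-1/2`. -/
abbrev Spin : Type := Bool

/-- A one-particle variable `ξ = (k, λ)`: a momentum in `ℝ³` and a spin. -/
abbrev Xi : Type := EuclideanSpace ℝ (Fin 3) × Spin

/-- `∫ f(ξ) dξ` is the sum over the spin of the Lebesgue integrals over the momentum. -/
def xiMeasure : Measure Xi := (volume : Measure (EuclideanSpace ℝ (Fin 3))).prod Measure.count

instance : SigmaFinite xiMeasure := by
  unfold xiMeasure; infer_instance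

/-! ### Interaction kernels and powers of the harmonic oscillators -/

/-- The product measure `dξ₁ ⋯ dξₙ`. -/
def kernelMeasure (ι : Type) [Fintype ι] : Measure (ι → Xi) := Measure.pi fun _ => xiMeasure

/-- `⊗_{i ∈ ι} L²(ℝ³ × {-1/2, 1/2})`, as the space of square integrable functions of `(ξᵢ)_{i ∈ ι}`. -/
abbrev Kernel (ι : Type) [Fintype ι] : Type := Lp ℂ 2 (kernelMeasure ι)

/-- The `l`-th normalized Hermite function
`e_l(x) = (l! √π)^{-1/2} He_l(√2 x) exp(-x²/2)`, where `He_l` is the (probabilists') Hermite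
polynomial. These functions form an orthonormal basis of `L²(ℝ)`, and `e_l` is an eigenvector of
`-d²/dx² + x²` for the eigenvalue `2 l + 1`, see `hermiteFun_eigen`. -/
def hermiteFun (l : ℕ) (x : ℝ) : ℝ :=
  (Real.sqrt (l.factorial * Real.sqrt Real.pi))⁻¹ *
    (Polynomial.aeval (Real.sqrt 2 * x) (Polynomial.hermite l) * Real.exp (-(x ^ 2 / 2)))

/-- The Hermite basis function of the variables `(ξᵢ)_{i ∈ ι}`: the product over `i`, `j` of
`e_{α i j}(k_{i,j})` times the indicator function of the spin configuration `s`. -/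
def basisFun {ι : Type} [Fintype ι] (α : ι → Fin 3 → ℕ) (s : ι → Spin) (x : ι → Xi) : ℂ :=
  ∏ i, (((∏ j, hermiteFun (α i j) ((x i).1 j)) * (if (x i).2 = s i then 1 else 0) : ℝ) : ℂ)


theorem derivative_hermite_succ (l : ℕ) : Polynomial.derivative (Polynomial.hermite (l + 1)) =
    ((l : Polynomial ℤ) + 1) * Polynomial.hermite l := by
  induction l with
  | zero => simp [Polynomial.hermite_succ]
  | succ l ih =>
    rw [Polynomial.hermite_succ (l + 1)]
    have h := congrArg Polynomial.derivative ih
    simp only [Polynomial.derivative_sub, Polynomial.derivative_mul, Polynomial.derivative_X,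
      Polynomial.derivative_add, Polynomial.derivative_natCast, Polynomial.derivative_one] at h ⊢
    rw [h, ih, Polynomial.hermite_succ l]
    push_cast
    ring

theorem hermiteFun_eq (l : ℕ) : hermiteFun l = fun x =>
    (Real.sqrt (l.factorial * Real.sqrt Real.pi))⁻¹ *
    (((Polynomial.hermite l).map (Int.castRingHom ℝ)).eval (Real.sqrt 2 * x) *
      Real.exp (-(x ^ 2 / 2))) := by
  funext x
  simp [hermiteFun, Polynomial.aeval_def, Polynomial.eval_map]

/-- The eigenvalue equation `-e_l'' + x² e_l = (2 l + 1) e_l`. -/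
theorem hermiteFun_eigen (l : ℕ) (x : ℝ) :
    -(deriv (deriv (hermiteFun l)) x) + x ^ 2 * hermiteFun l x = (2 * l + 1) * hermiteFun l x := by
  have key : ∀ (p : Polynomial ℝ) (c x : ℝ), HasDerivAt
      (fun x : ℝ => c * (p.eval (Real.sqrt 2 * x) * Real.exp (-(x ^ 2 / 2))))
      (c * ((Polynomial.C (Real.sqrt 2) * p.derivative
        - Polynomial.C (Real.sqrt 2 / 2) * Polynomial.X * p).eval (Real.sqrt 2 * x)
          * Real.exp (-(x ^ 2 / 2)))) x := by
    intro p c x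
    have h1 : HasDerivAt (fun x : ℝ => p.eval (Real.sqrt 2 * x))
        (p.derivative.eval (Real.sqrt 2 * x) * (Real.sqrt 2 * 1)) x :=
      (p.hasDerivAt (Real.sqrt 2 * x)).comp x ((hasDerivAt_id x).const_mul (Real.sqrt 2))
    have h2 : HasDerivAt (fun x : ℝ => Real.exp (-(x ^ 2 / 2)))
        (Real.exp (-(x ^ 2 / 2)) * (-((2 : ℕ) * x ^ (2 - 1) / 2))) x :=
      (((hasDerivAt_pow 2 x).div_const 2).fun_neg).exp
    refine ((h1.mul h2).const_mul c).congr_deriv ?_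
    have hs : Real.sqrt 2 * Real.sqrt 2 = 2 := Real.mul_self_sqrt (by norm_num)
    simp only [Polynomial.eval_sub, Polynomial.eval_mul, Polynomial.eval_C, Polynomial.eval_X]
    push_cast
    linear_combination (c * x * p.eval (Real.sqrt 2 * x) * Real.exp (-(x ^ 2 / 2)) / 2) * hs
  set P := (Polynomial.hermite l).map (Int.castRingHom ℝ) with hP
  have ode : P.derivative.derivative = Polynomial.X * P.derivative - (l : Polynomial ℝ) * P := by
    have h := derivative_hermite_succ l
    rw [Polynomial.hermite_succ] at h
    have h' := congrArg (Polynomial.map (Int.castRingHom ℝ)) h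
    simp only [Polynomial.derivative_sub, Polynomial.derivative_mul, Polynomial.derivative_X,
      Polynomial.map_sub, Polynomial.map_add, Polynomial.map_mul, Polynomial.map_X,
      Polynomial.map_one, Polynomial.map_natCast, ← Polynomial.derivative_map, ← hP] at h'
    linear_combination -h'
  have e1 := hermiteFun_eq l
  have d1 := funext fun x => (key P (Real.sqrt (l.factorial * Real.sqrt Real.pi))⁻¹ x).deriv
  rw [e1, ← hP, d1, (key _ _ x).deriv]
  have hs : Real.sqrt 2 ^ 2 = 2 := Real.sq_sqrt (by norm_num)
  have o := congrArg (Polynomial.eval (Real.sqrt 2 * x)) ode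
  simp only [Polynomial.eval_sub, Polynomial.eval_mul, Polynomial.eval_X,
    Polynomial.eval_natCast] at o
  simp only [Polynomial.derivative_sub, Polynomial.derivative_mul, Polynomial.derivative_C,
    Polynomial.derivative_X, Polynomial.eval_sub, Polynomial.eval_mul, Polynomial.eval_C,
    Polynomial.eval_X, Polynomial.eval_add, Polynomial.eval_zero, Polynomial.eval_one]
  generalize (Real.sqrt (l.factorial * Real.sqrt Real.pi))⁻¹ = c at *
  generalize Real.exp (-(x ^ 2 / 2)) = E at *
  generalize Polynomial.eval (Real.sqrt 2 * x) P.derivative.derivative = P2 at *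
  generalize Polynomial.eval (Real.sqrt 2 * x) P.derivative = P1 at *
  generalize Polynomial.eval (Real.sqrt 2 * x) P = P0 at *
  generalize Real.sqrt 2 = r at *
  subst o
  linear_combination (c * E) * (-(r * x * P1 - l * P0) + (r * x * P1) + P0 / 2
    - x ^ 2 * P0 * (r ^ 2 + 2) / 4) * hs

theorem integrable_polynomial_mul_gaussian (p : Polynomial ℝ) :
    Integrable (fun x : ℝ => p.eval x * Real.exp (-x ^ 2)) := by
  induction p using Polynomial.induction_on' with
  | add p q hp hq =>
    refine (hp.add hq).congr (Filter.Eventually.of_forall fun x => ?_)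
    simp [add_mul]
  | monomial n a =>
    have hn : (-1 : ℝ) < n := by
      have : (0 : ℝ) ≤ n := by positivity
      linarith
    have := integrable_rpow_mul_exp_neg_mul_sq (b := 1) one_pos (s := n) hn
    simpa [mul_assoc] using this.const_mul a

theorem continuous_hermiteFun (l : ℕ) : Continuous (hermiteFun l) := by
  rw [hermiteFun_eq]; fun_prop

theorem integrable_hermiteFun_sq (l : ℕ) : Integrable (fun x => hermiteFun l x ^ 2) := by
  set p := ((Polynomial.hermite l).map (Int.castRingHom ℝ)).comp
    (Polynomial.C (Real.sqrt 2) * Polynomial.X) with hp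
  refine ((integrable_polynomial_mul_gaussian (p ^ 2)).const_mul
    ((Real.sqrt (l.factorial * Real.sqrt Real.pi))⁻¹ ^ 2)).congr
    (Filter.Eventually.of_forall fun x => ?_)
  have : Real.exp (-(x ^ 2 / 2)) ^ 2 = Real.exp (-x ^ 2) := by
    rw [← Real.exp_nat_mul]; congr 1; push_cast; ring
  simp only [hermiteFun_eq, hp, mul_pow, this, Polynomial.eval_pow, Polynomial.eval_comp,
    Polynomial.eval_mul, Polynomial.eval_C, Polynomial.eval_X]

theorem basisFun_memLp {ι : Type} [Fintype ι] (α : ι → Fin 3 → ℕ) (s : ι → Spin) :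
    MemLp (basisFun α s) 2 (kernelMeasure ι) := by
  have hm : Measurable (basisFun α s) := by
    unfold basisFun
    refine Finset.measurable_prod _ fun i _ => ?_
    refine Complex.measurable_ofReal.comp (Measurable.mul ?_ ?_)
    · refine Finset.measurable_prod _ fun j _ => (continuous_hermiteFun _).measurable.comp ?_
      fun_prop
    · refine Measurable.ite ?_ measurable_const measurable_const
      exact ((measurable_pi_apply i).snd) (measurableSet_singleton (s i))
  rw [memLp_two_iff_integrable_sq_norm hm.aestronglyMeasurable]
  have h1 : ∀ a : Fin 3 → ℕ, Integrable
      (fun k : EuclideanSpace ℝ (Fin 3) => ∏ j, hermiteFun (a j) (k j) ^ 2) := by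
    intro a
    have := Integrable.fintype_prod (𝕜 := ℝ) (ι := Fin 3) (μ := fun _ => volume)
      (f := fun j x => hermiteFun (a j) x ^ 2) fun j => integrable_hermiteFun_sq (a j)
    exact (EuclideanSpace.volume_preserving_symm_measurableEquiv_toLp
      (Fin 3)).integrable_comp_of_integrable this
  have h2 : ∀ i, Integrable (fun x : Xi =>
      (∏ j, hermiteFun (α i j) (x.1 j) ^ 2) * (if x.2 = s i then (1 : ℝ) else 0)) xiMeasure :=
    fun i => (h1 (α i)).mul_prod
      (Integrable.of_finite (f := fun t : Spin => if t = s i then (1 : ℝ) else 0))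
  refine (Integrable.fintype_prod (𝕜 := ℝ) h2).congr (Filter.Eventually.of_forall fun x => ?_)
  simp only [basisFun, norm_prod, Complex.norm_real, ← Finset.prod_pow, Real.norm_eq_abs, sq_abs,
    mul_pow]
  refine Finset.prod_congr rfl fun i _ => ?_
  split_ifs <;> simp

/-- The Hermite basis functions as vectors of `⊗_{i ∈ ι} L²(ℝ³ × {-1/2, 1/2})`. -/
def basisVec {ι : Type} [Fintype ι] (α : ι → Fin 3 → ℕ) (s : ι → Spin) : Kernel ι :=
  (basisFun_memLp α s).toLp (basisFun α s)

/-- The operator `∏_{i ∈ ι} ∏_{j ∈ {1, 2, 3}} (h_i^j)^{r i}` in `⊗_{i ∈ ι} L²(ℝ³ × {-1/2, 1/2})`, where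
`h_i^j = -∂²/∂k_{i,j}² + k_{i,j}²`. It is the function of the strongly commuting harmonic
oscillators that their joint spectral theorem defines: on the Hermite basis vector with indices
`α` it is the multiplication by `∏ (2 α_{i,j} + 1)^{r i}`, and its domain is the set of all
vectors `F` for which the resulting coefficients are those of a square integrable function. Exponents `0`
leave the corresponding variables alone. -/
def oscPow {ι : Type} [Fintype ι] (r : ι → ℝ) : Kernel ι →ₗ.[ℂ] Kernel ι :=
  Submodule.toLinearPMap
    { carrier := {q | ∀ (α : ι → Fin 3 → ℕ) (s : ι → Spin), inner ℂ (basisVec α s) q.2 =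
        ((∏ i, ∏ j, (2 * (α i j : ℝ) + 1) ^ r i : ℝ) : ℂ) * inner ℂ (basisVec α s) q.1}
      add_mem' := fun {a b} ha hb α s => by
        simp only [Prod.fst_add, Prod.snd_add, inner_add_right, ha α s, hb α s, mul_add]
      zero_mem' := fun α s => by simp
      smul_mem' := fun c a ha α s => by
        simp only [Prod.smul_fst, Prod.smul_snd, inner_smul_right, ha α s]; ring }

/-! ### The Fock space -/

/-- Configurations of finitely many particles of one species: their number `l` and the variables
`ξ^{(1)}, …, ξ^{(l)}`. -/
abbrev Particles : Type := Σ l : ℕ, (Fin l → Xi)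

/-- The measure on configurations for which `L²(particlesMeasure)` is the Hilbert space direct sum over
`l ≥ 0` of the spaces `L²((ℝ³ × {-1/2, 1/2})^l)`. -/
def particlesMeasure : Measure Particles :=
  Measure.sum fun l => (Measure.pi fun _ : Fin l => xiMeasure).map (Sigma.mk l)

/-- The measure on configurations of `n` species of particles; its `L²` space is the `n`-fold
Hilbert tensor power of `L²(particlesMeasure)`. -/
def configMeasure (n : ℕ) : Measure (Fin n → Particles) := Measure.pi fun _ => particlesMeasure

/-- Antisymmetry under permutations of the particles inside each species. -/
def Antisymmetric {n : ℕ} (f : (Fin n → Particles) → ℂ) : Prop :=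
  ∀ (y : Fin n → Particles) (i : Fin n) (π : Equiv.Perm (Fin (y i).1)),
    f (Function.update y i ⟨(y i).1, (y i).2 ∘ π⟩) = ((Equiv.Perm.sign π : ℤ) : ℂ) * f y

/-- The Hilbert space `ℋ = ⊗_{i=1}^n ℱ`, with `ℱ = ⊕_l ⊗_a^l L²(ℝ³ × {-1/2, 1/2})`: the square
integrable functions that are antisymmetric in the variables of each species. -/
def fockSpace (n : ℕ) : Submodule ℂ (Lp ℂ 2 (configMeasure n)) where
  carrier := {Ψ | ∃ f, Antisymmetric f ∧ ⇑Ψ =ᵐ[configMeasure n] f}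
  add_mem' := by
    rintro a b ⟨f, hf, haf⟩ ⟨g, hg, hbg⟩
    refine ⟨f + g, fun y i π => ?_, (Lp.coeFn_add a b).trans (haf.add hbg)⟩
    simp only [Pi.add_apply, hf y i π, hg y i π, mul_add]
  zero_mem' := ⟨0, fun y i π => by simp, Lp.coeFn_zero _ _ _⟩
  smul_mem' := by
    rintro c a ⟨f, hf, haf⟩
    refine ⟨c • f, fun y i π => ?_, (Lp.coeFn_smul c a).trans (haf.const_smul c)⟩
    simp only [Pi.smul_apply, smul_eq_mul, hf y i π]; ring

/-- The function of the configuration that represents a vector of the Fock space. -/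
def fn {n : ℕ} (Ψ : fockSpace n) : (Fin n → Particles) → ℂ := ⇑(Ψ : Lp ℂ 2 (configMeasure n))

theorem fn_add {n : ℕ} (a b : fockSpace n) : fn (a + b) =ᵐ[configMeasure n] fn a + fn b :=
  Lp.coeFn_add _ _

theorem fn_smul {n : ℕ} (c : ℂ) (a : fockSpace n) : fn (c • a) =ᵐ[configMeasure n] c • fn a :=
  Lp.coeFn_smul _ _

theorem fn_zero {n : ℕ} : fn (0 : fockSpace n) =ᵐ[configMeasure n] 0 :=
  Lp.coeFn_zero _ _ _

/-- The annihilation operator `b_i(ξ)`. In the `i`-th Fock space it acts as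
`(b(ξ) ψ)^{(l)}(ξ₁, …, ξ_l) = √(l + 1) ψ^{(l + 1)}(ξ, ξ₁, …, ξ_l)`; the sign
`(-1)^{N_1 + ⋯ + N_{i - 1}}` makes the operators of different species anticommute. -/
def annih {n : ℕ} (i : Fin n) (ξ : Xi) (f : (Fin n → Particles) → ℂ) :
    (Fin n → Particles) → ℂ := fun y =>
  (-1) ^ (∑ j ∈ Finset.univ.filter (· < i), (y j).1) * (Real.sqrt ((y i).1 + 1) : ℂ) *
    f (Function.update y i ⟨(y i).1 + 1, Fin.cons ξ (y i).2⟩)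

/-- `b_{i₁}(ξ_{i₁}) ⋯ b_{iₖ}(ξ_{iₖ})` for the list `i₁, …, iₖ` of species. -/
def annihList {n : ℕ} (L : List (Fin n)) (ξ : Fin n → Xi) (f : (Fin n → Particles) → ℂ) :
    (Fin n → Particles) → ℂ :=
  L.foldr (fun i g => annih i (ξ i) g) f

theorem annihList_add {n : ℕ} (L : List (Fin n)) (ξ : Fin n → Xi)
    (f g : (Fin n → Particles) → ℂ) :
    annihList L ξ (f + g) = annihList L ξ f + annihList L ξ g := by
  induction L with
  | nil => rfl
  | cons i L ih =>
    simp only [annihList, List.foldr_cons] at ih ⊢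
    rw [ih]; funext y; simp only [annih, Pi.add_apply, mul_add]

theorem annihList_smul {n : ℕ} (L : List (Fin n)) (ξ : Fin n → Xi) (c : ℂ)
    (f : (Fin n → Particles) → ℂ) :
    annihList L ξ (c • f) = c • annihList L ξ f := by
  induction L with
  | nil => rfl
  | cons i L ih =>
    simp only [annihList, List.foldr_cons] at ih ⊢
    rw [ih]; funext y; simp only [annih, Pi.smul_apply, smul_eq_mul]; ring

/-! ### The Hamiltonian -/

/-- The relativistic dispersion relation `ω(k) = √(k² + m²)`. -/
def omega (m : ℝ) (k : EuclideanSpace ℝ (Fin 3)) : ℝ := Real.sqrt (‖k‖ ^ 2 + m ^ 2)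

/-- The total free energy of a configuration of particles of masses `m`. -/
def freeEnergy {n : ℕ} (m : Fin n → ℝ) (y : Fin n → Particles) : ℝ :=
  ∑ i, ∑ a, omega (m i) ((y i).2 a).1

/-- The free Hamiltonian `H_f = ∑ᵢ dΓ(ωᵢ)`, i.e. the multiplication by the total free energy on its
maximal domain. -/
def freeHamiltonian {n : ℕ} (m : Fin n → ℝ) : fockSpace n →ₗ.[ℂ] fockSpace n :=
  Submodule.toLinearPMap
    { carrier := {q | fn q.2 =ᵐ[configMeasure n] fun y => (freeEnergy m y : ℂ) * fn q.1 y}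
      add_mem' := by
        rintro a b ha hb
        simp only [Set.mem_ofPred_eq, Prod.fst_add, Prod.snd_add] at ha hb ⊢
        filter_upwards [ha, hb, fn_add a.1 b.1, fn_add a.2 b.2] with y h1 h2 h3 h4
        rw [h4, h3, Pi.add_apply, Pi.add_apply, h1, h2, mul_add]
      zero_mem' := by
        simp only [Set.mem_ofPred_eq, Prod.fst_zero, Prod.snd_zero]
        filter_upwards [fn_zero (n := n)] with y h
        rw [h]; simp
      smul_mem' := by
        rintro c a ha
        simp only [Set.mem_ofPred_eq, Prod.smul_fst, Prod.smul_snd] at ha ⊢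
        filter_upwards [ha, fn_smul c a.1, fn_smul c a.2] with y h1 h2 h3
        rw [h3, h2, Pi.smul_apply, Pi.smul_apply, h1, smul_eq_mul, smul_eq_mul]; ring }

/-- The index set `ℑ_p`. An ordering `i₁, …, iₙ` of the `n` species is a permutation `σ`, with
`σ 0, …, σ (p - 1)` the created species and `σ p, …, σ (n - 1)` the annihilated ones, such that
`i₁ < ⋯ < i_p`, `i_{p+1} < ⋯ < iₙ` and `i₁ < i_{p+1}`, where conditions that mention a missing
index are empty. So `i₁` is always the first species. -/
def processes (n p : ℕ) : Finset (Equiv.Perm (Fin n)) :=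
  open Classical in Finset.univ.filter fun σ =>
    (∀ a b : Fin n, a < b → b.val < p → σ a < σ b) ∧
    (∀ a b : Fin n, p ≤ a.val → a < b → σ a < σ b) ∧
    (∀ a b : Fin n, 0 < p → a.val = 0 → b.val = p → σ a < σ b)

/-- The created species `i₁, …, i_p`, in this order. -/
def created {n : ℕ} (p : ℕ) (σ : Equiv.Perm (Fin n)) : List (Fin n) :=
  ((List.finRange n).map σ).take p

/-- The annihilated species `i_{p+1}, …, iₙ`, in this order. -/
def annihilated {n : ℕ} (p : ℕ) (σ : Equiv.Perm (Fin n)) : List (Fin n) :=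
  ((List.finRange n).map σ).drop p

/-- The integrand of the quadratic form `⟨φ, H_I^{(p)}(G) f⟩` of
`∫ G(ξ₁, …, ξₙ) b*_{i₁}(ξ_{i₁}) ⋯ b*_{i_p}(ξ_{i_p}) b_{i_{p+1}}(ξ_{i_{p+1}}) ⋯ b_{iₙ}(ξ_{iₙ}) dξ₁ ⋯ dξₙ`,
in which the creation operators are moved to the left entry as annihilation operators. The first variable is
`(ξ₁, …, ξₙ)`, the second one is the variable of the scalar product of `ℋ`. -/
def formIntegrand {n : ℕ} (p : ℕ) (σ : Equiv.Perm (Fin n)) (G : (Fin n → Xi) → ℂ)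
    (φ f : (Fin n → Particles) → ℂ) (z : (Fin n → Xi) × (Fin n → Particles)) : ℂ :=
  G z.1 * starRingEnd ℂ (annihList (created p σ).reverse z.1 φ z.2) *
    annihList (annihilated p σ) z.1 f z.2

/-- The integrand of the form of the hermitian conjugate: `⟨φ, A* f⟩` is the complex conjugate of
`⟨f, A φ⟩`. -/
def formIntegrandHC {n : ℕ} (p : ℕ) (σ : Equiv.Perm (Fin n)) (G : (Fin n → Xi) → ℂ)
    (φ f : (Fin n → Particles) → ℂ) (z : (Fin n → Xi) × (Fin n → Particles)) : ℂ :=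
  starRingEnd ℂ (formIntegrand p σ G f φ z)

/-- The measure `dξ₁ ⋯ dξₙ` times the measure of the scalar product of `ℋ`. -/
def formMeasure (n : ℕ) : Measure ((Fin n → Xi) × (Fin n → Particles)) :=
  (kernelMeasure (Fin n)).prod (configMeasure n)

/-- Vectors with finitely many particles: all components with more than `M` particles of some
species vanish, for some `M`. -/
def FiniteParticle {n : ℕ} (φ : fockSpace n) : Prop :=
  ∃ M : ℕ, ∀ᵐ y ∂configMeasure n, (∃ i, M < (y i).1) → fn φ y = 0

/-- The interaction Hamiltonian `H_I = ∑_p ∑_{ℑ_p} (H_I^{(p)}(G^{(p)}) + h.c.)`, as the operator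
that represents its quadratic form: `H_I Ψ = η` when `⟨φ, η⟩` is the value of the form at
`(φ, Ψ)`, for every finite particle vector `φ`. For such `φ` all the integrals converge absolutely, and they
do not depend on the function `f` chosen to represent `Ψ`. -/
def interaction {n : ℕ} (G : ℕ → Equiv.Perm (Fin n) → Kernel (Fin n)) :
    fockSpace n →ₗ.[ℂ] fockSpace n :=
  Submodule.toLinearPMap
    { carrier := {q | ∃ f, fn q.1 =ᵐ[configMeasure n] f ∧ ∀ φ : fockSpace n, FiniteParticle φ →
        (∀ p ∈ Finset.range (n + 1), ∀ σ ∈ processes n p,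
          Integrable (formIntegrand p σ (G p σ) (fn φ) f) (formMeasure n) ∧
          Integrable (formIntegrandHC p σ (G p σ) (fn φ) f) (formMeasure n)) ∧
        inner ℂ φ q.2 = ∑ p ∈ Finset.range (n + 1), ∑ σ ∈ processes n p,
          ((∫ z, formIntegrand p σ (G p σ) (fn φ) f z ∂formMeasure n) +
            ∫ z, formIntegrandHC p σ (G p σ) (fn φ) f z ∂formMeasure n)}
      add_mem' := by
        rintro a b ⟨f, hf, h⟩ ⟨g, hg, h'⟩
        refine ⟨f + g, (fn_add a.1 b.1).trans (hf.add hg), fun φ hφ => ?_⟩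
        obtain ⟨hi, he⟩ := h φ hφ
        obtain ⟨hi', he'⟩ := h' φ hφ
        have e1 : ∀ p σ, formIntegrand p σ (G p σ) (fn φ) (f + g) =
            formIntegrand p σ (G p σ) (fn φ) f + formIntegrand p σ (G p σ) (fn φ) g := by
          intro p σ; funext z
          simp only [formIntegrand, annihList_add, Pi.add_apply]; ring
        have e2 : ∀ p σ, formIntegrandHC p σ (G p σ) (fn φ) (f + g) =
            formIntegrandHC p σ (G p σ) (fn φ) f + formIntegrandHC p σ (G p σ) (fn φ) g := by
          intro p σ; funext z
          simp only [formIntegrandHC, formIntegrand, annihList_add, Pi.add_apply, map_mul, map_add]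
          ring
        refine ⟨fun p hp σ hσ => ?_, ?_⟩
        · rw [e1, e2]
          exact ⟨(hi p hp σ hσ).1.add (hi' p hp σ hσ).1, (hi p hp σ hσ).2.add (hi' p hp σ hσ).2⟩
        · rw [Prod.snd_add, inner_add_right, he, he', ← Finset.sum_add_distrib]
          refine Finset.sum_congr rfl fun p hp => ?_
          rw [← Finset.sum_add_distrib]
          refine Finset.sum_congr rfl fun σ hσ => ?_
          rw [e1, e2, integral_add' (hi p hp σ hσ).1 (hi' p hp σ hσ).1,
            integral_add' (hi p hp σ hσ).2 (hi' p hp σ hσ).2]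
          ring
      zero_mem' := by
        have e0 : ∀ (L : List (Fin n)) (ξ : Fin n → Xi), annihList L ξ 0 = 0 := fun L ξ => by
          simpa using annihList_smul L ξ 0 0
        refine ⟨0, fn_zero, fun φ _ => ⟨fun p _ σ _ => ?_, ?_⟩⟩
        · constructor <;>
            exact (integrable_zero _ _ _).congr (Filter.Eventually.of_forall fun z => by
              simp [formIntegrandHC, formIntegrand, e0])
        · simp [formIntegrandHC, formIntegrand, e0]
      smul_mem' := by
        rintro c a ⟨f, hf, h⟩
        refine ⟨c • f, (fn_smul c a.1).trans (hf.const_smul c), fun φ hφ => ?_⟩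
        obtain ⟨hi, he⟩ := h φ hφ
        have e1 : ∀ p σ, formIntegrand p σ (G p σ) (fn φ) (c • f) =
            fun z => c * formIntegrand p σ (G p σ) (fn φ) f z := by
          intro p σ; funext z
          simp only [formIntegrand, annihList_smul, Pi.smul_apply, smul_eq_mul]; ring
        have e2 : ∀ p σ, formIntegrandHC p σ (G p σ) (fn φ) (c • f) =
            fun z => c * formIntegrandHC p σ (G p σ) (fn φ) f z := by
          intro p σ; funext z
          simp only [formIntegrandHC, formIntegrand, annihList_smul, Pi.smul_apply, smul_eq_mul,
            map_mul, Complex.conj_conj]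
          ring
        refine ⟨fun p hp σ hσ => ?_, ?_⟩
        · rw [e1, e2]
          exact ⟨(hi p hp σ hσ).1.const_mul c, (hi p hp σ hσ).2.const_mul c⟩
        · rw [Prod.smul_snd, inner_smul_right, he, Finset.mul_sum]
          refine Finset.sum_congr rfl fun p hp => ?_
          rw [Finset.mul_sum]
          refine Finset.sum_congr rfl fun σ hσ => ?_
          rw [e1, e2, integral_const_mul, integral_const_mul, mul_add] }

/-- The total Hamiltonian `H = H_f + H_I`. -/
def hamiltonian {n : ℕ} (m : Fin n → ℝ) (G : ℕ → Equiv.Perm (Fin n) → Kernel (Fin n)) :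
    fockSpace n →ₗ.[ℂ] fockSpace n :=
  freeHamiltonian m + interaction G

/-! ### Ground states -/

/-- `R` is a bounded two-sided inverse of `T - z`. -/
def IsResolvent {E : Type} [NormedAddCommGroup E] [NormedSpace ℂ E] (T : E →ₗ.[ℂ] E) (z : ℂ)
    (R : E →L[ℂ] E) : Prop :=
  (∀ x, ∃ h : R x ∈ T.domain, T ⟨R x, h⟩ - z • R x = x) ∧
    ∀ x : T.domain, R (T x - z • (x : E)) = x

/-- The spectrum of an operator that is only defined on a domain. -/
def opSpectrum {E : Type} [NormedAddCommGroup E] [NormedSpace ℂ E] (T : E →ₗ.[ℂ] E) : Set ℂ :=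
  {z | ¬ ∃ R : E →L[ℂ] E, IsResolvent T z R}

/-- `Φ` is a normalized ground state of `T`: `E = inf σ(T)` is an eigenvalue, and `Φ` is a unit
eigenvector for it. -/
def IsGroundState {E : Type} [NormedAddCommGroup E] [NormedSpace ℂ E] (T : E →ₗ.[ℂ] E)
    (Φ : E) : Prop :=
  ‖Φ‖ = 1 ∧ ∃ e : ℝ, IsGLB {x : ℝ | (x : ℂ) ∈ opSpectrum T} e ∧
    ∃ h : Φ ∈ T.domain, T ⟨Φ, h⟩ = (e : ℂ) • Φ

end FermionModel

namespace FermionModel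

open Set Filter Topology ENNReal
open scoped ComplexConjugate

local notation "𝓒(" n ")" => configMeasure (n + 1)

local notation "𝓚(" ι ")" => kernelMeasure (Fin ι)

theorem integral_congr_forall {X : Type*} [MeasurableSpace X] {μ : Measure X} {f g : X → ℂ}
    (h : ∀ x, f x = g x) : ∫ x, f x ∂μ = ∫ x, g x ∂μ :=
  integral_congr_ae (Eventually.of_forall h)

/-! ### Hermite functions of one variable -/

theorem sqrt_norm_const_succ (l : ℕ) : (Real.sqrt (l.factorial * Real.sqrt Real.pi))⁻¹ =
    Real.sqrt (l + 1) * (Real.sqrt ((l + 1).factorial * Real.sqrt Real.pi))⁻¹ := by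
  have h1 : (0 : ℝ) < l + 1 := by positivity
  have h2 : (((l + 1).factorial : ℕ) : ℝ) = (l + 1) * l.factorial := by
    rw [Nat.factorial_succ]; push_cast; ring
  rw [h2, mul_assoc, Real.sqrt_mul h1.le, mul_inv, ← mul_assoc,
    mul_inv_cancel₀ (Real.sqrt_pos.2 h1).ne', one_mul]

theorem hasDerivAt_polynomial_mul_gaussian (p : Polynomial ℝ) (c x : ℝ) : HasDerivAt
    (fun x : ℝ => c * (p.eval (Real.sqrt 2 * x) * Real.exp (-(x ^ 2 / 2))))
    (c * (Real.sqrt 2 * p.derivative.eval (Real.sqrt 2 * x)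
      - x * p.eval (Real.sqrt 2 * x)) * Real.exp (-(x ^ 2 / 2))) x := by
  have h1 : HasDerivAt (fun x : ℝ => p.eval (Real.sqrt 2 * x))
      (p.derivative.eval (Real.sqrt 2 * x) * (Real.sqrt 2 * 1)) x :=
    (p.hasDerivAt (Real.sqrt 2 * x)).comp x ((hasDerivAt_id x).const_mul (Real.sqrt 2))
  have h2 : HasDerivAt (fun x : ℝ => Real.exp (-(x ^ 2 / 2)))
      (Real.exp (-(x ^ 2 / 2)) * (-((2 : ℕ) * x ^ (2 - 1) / 2))) x :=
    (((hasDerivAt_pow 2 x).div_const 2).fun_neg).exp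
  refine ((h1.mul h2).const_mul c).congr_deriv ?_
  push_cast
  ring

theorem hasDerivAt_hermiteFun (l : ℕ) (x : ℝ) : HasDerivAt (hermiteFun l)
    (x * hermiteFun l x - Real.sqrt (2 * (l + 1)) * hermiteFun (l + 1) x) x := by
  have h := hasDerivAt_polynomial_mul_gaussian ((Polynomial.hermite l).map (Int.castRingHom ℝ))
    (Real.sqrt (l.factorial * Real.sqrt Real.pi))⁻¹ x
  rw [hermiteFun_eq l, hermiteFun_eq (l + 1)]
  refine h.congr_deriv ?_
  have hs : Real.sqrt 2 * Real.sqrt 2 = 2 := Real.mul_self_sqrt (by norm_num)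
  rw [Polynomial.hermite_succ l, sqrt_norm_const_succ l, Real.sqrt_mul (by norm_num : (0 : ℝ) ≤ 2)]
  simp only [Polynomial.map_sub, Polynomial.map_mul, Polynomial.map_X, Polynomial.eval_sub,
    Polynomial.eval_mul, Polynomial.eval_X, ← Polynomial.derivative_map]
  generalize Polynomial.eval (Real.sqrt 2 * x)
    (Polynomial.derivative ((Polynomial.hermite l).map (Int.castRingHom ℝ))) = P1
  generalize Polynomial.eval (Real.sqrt 2 * x) ((Polynomial.hermite l).map (Int.castRingHom ℝ)) = P0
  generalize Real.sqrt ((l : ℝ) + 1) = b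
  generalize (Real.sqrt (((l + 1).factorial : ℕ) * Real.sqrt Real.pi))⁻¹ = c
  generalize Real.exp (-(x ^ 2 / 2)) = E
  generalize Real.sqrt 2 = r at *
  linear_combination (b * c * E * x * P0) * hs

theorem hasDerivAt_hermiteFun_succ (l : ℕ) (x : ℝ) : HasDerivAt (hermiteFun (l + 1))
    (-x * hermiteFun (l + 1) x + Real.sqrt (2 * (l + 1)) * hermiteFun l x) x := by
  have h := hasDerivAt_polynomial_mul_gaussian
    ((Polynomial.hermite (l + 1)).map (Int.castRingHom ℝ))
    (Real.sqrt ((l + 1).factorial * Real.sqrt Real.pi))⁻¹ x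
  rw [hermiteFun_eq l, hermiteFun_eq (l + 1)]
  refine h.congr_deriv ?_
  have hb : Real.sqrt ((l : ℝ) + 1) * Real.sqrt ((l : ℝ) + 1) = l + 1 :=
    Real.mul_self_sqrt (by positivity)
  rw [Polynomial.derivative_map, derivative_hermite_succ l, sqrt_norm_const_succ l,
    Real.sqrt_mul (by norm_num : (0 : ℝ) ≤ 2)]
  simp only [Polynomial.map_mul, Polynomial.map_add, Polynomial.map_natCast, Polynomial.map_one,
    Polynomial.eval_mul, Polynomial.eval_add, Polynomial.eval_natCast, Polynomial.eval_one]
  generalize Polynomial.eval (Real.sqrt 2 * x) ((Polynomial.hermite l).map (Int.castRingHom ℝ)) = P0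
  generalize (Real.sqrt (((l + 1).factorial : ℕ) * Real.sqrt Real.pi))⁻¹ = c
  generalize Real.exp (-(x ^ 2 / 2)) = E
  generalize Real.sqrt ((l : ℝ) + 1) = b at *
  generalize Real.sqrt 2 = r at *
  linear_combination (-c * r * P0 * E) * hb

theorem hasDerivAt_hermiteFun_zero (x : ℝ) : HasDerivAt (hermiteFun 0) (-x * hermiteFun 0 x) x := by
  have h := hasDerivAt_polynomial_mul_gaussian ((Polynomial.hermite 0).map (Int.castRingHom ℝ))
    (Real.sqrt ((0 : ℕ).factorial * Real.sqrt Real.pi))⁻¹ x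
  rw [hermiteFun_eq 0]
  refine h.congr_deriv ?_
  simp
  ring

theorem memLp_hermiteFun (l : ℕ) : MemLp (hermiteFun l) 2 := by
  rw [memLp_two_iff_integrable_sq (continuous_hermiteFun l).aestronglyMeasurable]
  exact integrable_hermiteFun_sq l

theorem integrable_hermiteFun_mul (a b : ℕ) :
    Integrable (fun x => hermiteFun a x * hermiteFun b x) :=
  (memLp_hermiteFun a).integrable_mul (memLp_hermiteFun b)

theorem integral_hermiteFun_succ_zero (a : ℕ) : ∫ x, hermiteFun (a + 1) x * hermiteFun 0 x = 0 := by
  have hd : ∀ x, HasDerivAt (fun x => hermiteFun a x * hermiteFun 0 x)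
      (-(Real.sqrt (2 * (a + 1))) * (hermiteFun (a + 1) x * hermiteFun 0 x)) x := fun x =>
    ((hasDerivAt_hermiteFun a x).mul (hasDerivAt_hermiteFun_zero x)).congr_deriv (by ring)
  have h := integral_eq_zero_of_hasDerivAt_of_integrable hd
    ((integrable_hermiteFun_mul _ _).const_mul _) (integrable_hermiteFun_mul _ _)
  rw [integral_const_mul] at h
  have : -Real.sqrt (2 * ((a : ℝ) + 1)) ≠ 0 :=
    neg_ne_zero.2 (Real.sqrt_pos.2 (by positivity)).ne'
  exact (mul_eq_zero.1 h).resolve_left this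

theorem integral_hermiteFun_succ_succ (a b : ℕ) :
    Real.sqrt (a + 1) * ∫ x, hermiteFun (a + 1) x * hermiteFun (b + 1) x =
      Real.sqrt (b + 1) * ∫ x, hermiteFun a x * hermiteFun b x := by
  have hd : ∀ x, HasDerivAt (fun x => hermiteFun a x * hermiteFun (b + 1) x)
      (-(Real.sqrt (2 * (a + 1))) * (hermiteFun (a + 1) x * hermiteFun (b + 1) x) +
        Real.sqrt (2 * (b + 1)) * (hermiteFun a x * hermiteFun b x)) x := fun x =>
    ((hasDerivAt_hermiteFun a x).mul (hasDerivAt_hermiteFun_succ b x)).congr_deriv (by ring)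
  have h := integral_eq_zero_of_hasDerivAt_of_integrable hd
    (((integrable_hermiteFun_mul _ _).const_mul _).add ((integrable_hermiteFun_mul _ _).const_mul _))
    (integrable_hermiteFun_mul _ _)
  rw [integral_add ((integrable_hermiteFun_mul _ _).const_mul _)
    ((integrable_hermiteFun_mul _ _).const_mul _), integral_const_mul, integral_const_mul,
    Real.sqrt_mul (by norm_num), Real.sqrt_mul (by norm_num)] at h
  have h2 : Real.sqrt 2 ≠ 0 := by positivity
  apply mul_left_cancel₀ h2
  linarith

theorem integral_hermiteFun_zero_zero : ∫ x, hermiteFun 0 x * hermiteFun 0 x = 1 := by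
  have h : ∀ x, hermiteFun 0 x * hermiteFun 0 x = (Real.sqrt Real.pi)⁻¹ * Real.exp (-1 * x ^ 2) := by
    intro x
    have h1 : Real.exp (-(x ^ 2 / 2)) * Real.exp (-(x ^ 2 / 2)) = Real.exp (-1 * x ^ 2) := by
      rw [← Real.exp_add]; congr 1; ring
    have h2 : (Real.sqrt (Real.sqrt Real.pi)) * (Real.sqrt (Real.sqrt Real.pi)) = Real.sqrt Real.pi :=
      Real.mul_self_sqrt (by positivity)
    rw [← h1, ← h2, mul_inv]
    simp [hermiteFun, Polynomial.hermite_zero]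
    ring
  simp_rw [h]
  rw [integral_const_mul, integral_gaussian, div_one,
    inv_mul_cancel₀ (Real.sqrt_pos.2 Real.pi_pos).ne']

theorem integral_hermiteFun (a b : ℕ) :
    ∫ x, hermiteFun a x * hermiteFun b x = if a = b then 1 else 0 := by
  induction a generalizing b with
  | zero =>
    cases b with
    | zero => simpa using integral_hermiteFun_zero_zero
    | succ b =>
      simp_rw [mul_comm (hermiteFun 0 _)]
      simpa using integral_hermiteFun_succ_zero b
  | succ a ih =>
    cases b with
    | zero => simpa using integral_hermiteFun_succ_zero a
    | succ b =>
      have h := integral_hermiteFun_succ_succ a b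
      have ha : Real.sqrt ((a : ℝ) + 1) ≠ 0 := (Real.sqrt_pos.2 (by positivity)).ne'
      rw [ih b] at h
      by_cases hab : a = b
      · subst hab
        apply mul_left_cancel₀ ha
        simpa using h
      · apply mul_left_cancel₀ ha
        simpa [hab] using h

theorem integral_abs_hermiteFun_mul_le (a b : ℕ) : ∫ x, |hermiteFun a x * hermiteFun b x| ≤ 1 := by
  have h : ∫ x, |hermiteFun a x * hermiteFun b x| ≤
      ∫ x, (1 / 2 * (hermiteFun a x * hermiteFun a x) +
        1 / 2 * (hermiteFun b x * hermiteFun b x)) := by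
    refine integral_mono (integrable_hermiteFun_mul _ _).abs
      (((integrable_hermiteFun_mul _ _).const_mul _).add
        ((integrable_hermiteFun_mul _ _).const_mul _)) fun x => ?_
    rw [abs_mul]
    have h1 := abs_mul_abs_self (hermiteFun a x)
    have h2 := abs_mul_abs_self (hermiteFun b x)
    dsimp only
    nlinarith [sq_nonneg (|hermiteFun a x| - |hermiteFun b x|)]
  rw [integral_add ((integrable_hermiteFun_mul _ _).const_mul _)
    ((integrable_hermiteFun_mul _ _).const_mul _), integral_const_mul, integral_const_mul,
    integral_hermiteFun, integral_hermiteFun] at h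
  norm_num at h
  simpa [abs_mul] using h

theorem hasDerivAt_sum_hermiteFun_sq (K : ℕ) (x : ℝ) :
    HasDerivAt (fun x => ∑ a ∈ Finset.range (K + 1), hermiteFun a x ^ 2)
      (-Real.sqrt (2 * (K + 1)) * (hermiteFun (K + 1) x * hermiteFun K x)) x := by
  induction K with
  | zero =>
    simp only [zero_add, Finset.range_one, Finset.sum_singleton]
    have h1 := (hasDerivAt_hermiteFun 0 x).mul (hasDerivAt_hermiteFun_zero x)
    have : (fun x => hermiteFun 0 x ^ 2) = hermiteFun 0 * hermiteFun 0 := by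
      funext x; simp [sq]
    rw [this]
    refine h1.congr_deriv ?_
    simp only [Nat.cast_zero, zero_add]
    ring
  | succ K ih =>
    have h1 := (hasDerivAt_hermiteFun (K + 1) x).mul (hasDerivAt_hermiteFun_succ K x)
    have h2 := ih.add h1
    have : (fun x => ∑ a ∈ Finset.range (K + 1 + 1), hermiteFun a x ^ 2) =
        (fun x => ∑ a ∈ Finset.range (K + 1), hermiteFun a x ^ 2) +
          hermiteFun (K + 1) * hermiteFun (K + 1) := by
      funext x; rw [Finset.sum_range_succ]; simp [sq]
    rw [this]
    refine h2.congr_deriv ?_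
    push_cast
    ring

/-- The density of the first `K` Hermite functions is at most `√(2 K)`. -/
theorem sum_hermiteFun_sq_le (K : ℕ) (x : ℝ) :
    ∑ a ∈ Finset.range K, hermiteFun a x ^ 2 ≤ Real.sqrt (2 * K) := by
  cases K with
  | zero => simp
  | succ K =>
    have hi : Integrable (fun x => ∑ a ∈ Finset.range (K + 1), hermiteFun a x ^ 2) :=
      integrable_finsetSum _ fun a _ => integrable_hermiteFun_sq a
    have hi' : Integrable (fun x => -Real.sqrt (2 * (K + 1)) *
        (hermiteFun (K + 1) x * hermiteFun K x)) := (integrable_hermiteFun_mul _ _).const_mul _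
    have ht := tendsto_zero_of_hasDerivAt_of_integrableOn_Ioi (a := x)
      (fun y _ => hasDerivAt_sum_hermiteFun_sq K y) hi'.integrableOn hi.integrableOn
    have h := integral_Ioi_of_hasDerivAt_of_tendsto' (a := x)
      (fun y _ => hasDerivAt_sum_hermiteFun_sq K y) hi'.integrableOn ht
    rw [integral_const_mul, zero_sub, neg_mul, neg_inj] at h
    rw [← h]
    have h3 : ∫ y in Ioi x, hermiteFun (K + 1) y * hermiteFun K y ≤ 1 := by
      refine le_trans ?_ (integral_abs_hermiteFun_mul_le (K + 1) K)
      refine le_trans (integral_mono (integrable_hermiteFun_mul _ _).integrableOn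
        (integrable_hermiteFun_mul (K + 1) K).abs.integrableOn fun y => le_abs_self _) ?_
      exact setIntegral_le_integral (integrable_hermiteFun_mul _ _).abs
        (Eventually.of_forall fun y => abs_nonneg _)
    push_cast
    nlinarith [Real.sqrt_nonneg (2 * ((K : ℝ) + 1))]

/-! ### Square integrals -/

/-- The square integral `∫ |f|²` as an extended nonnegative number. -/
def sqInt {X : Type*} [MeasurableSpace X] (μ : Measure X) (f : X → ℂ) : ℝ≥0∞ := ∫⁻ x, ‖f x‖ₑ ^ 2 ∂μ

section
variable {X Y : Type*} [MeasurableSpace X] [MeasurableSpace Y] {μ : Measure X} {ν : Measure Y}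

theorem sqInt_lt_top {f : X → ℂ} (hf : MemLp f 2 μ) : sqInt μ f < ∞ := by
  have := (eLpNorm_lt_top_iff_lintegral_rpow_enorm_lt_top (by norm_num) (by norm_num)).1 hf.2
  simpa [sqInt] using this

theorem memLp_two_of_sqInt {f : X → ℂ} (hf : AEStronglyMeasurable f μ) (h : sqInt μ f < ∞) :
    MemLp f 2 μ := by
  refine ⟨hf, ?_⟩
  rw [eLpNorm_lt_top_iff_lintegral_rpow_enorm_lt_top (by norm_num) (by norm_num)]
  simpa [sqInt] using h

theorem sqInt_congr_ae {f g : X → ℂ} (h : f =ᵐ[μ] g) : sqInt μ f = sqInt μ g :=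
  lintegral_congr_ae (h.mono fun x hx => by simp only [hx])

theorem lintegral_mul_sq_le {f g : X → ℝ≥0∞} (hf : AEMeasurable f μ) (hg : AEMeasurable g μ) :
    (∫⁻ x, f x * g x ∂μ) ^ 2 ≤ (∫⁻ x, f x ^ 2 ∂μ) * ∫⁻ x, g x ^ 2 ∂μ := by
  have h := ENNReal.lintegral_mul_le_Lp_mul_Lq μ Real.HolderConjugate.two_two hf hg
  have h2 := ENNReal.pow_le_pow_left h (n := 2)
  rw [mul_pow, ← ENNReal.rpow_natCast, ← ENNReal.rpow_natCast ((∫⁻ x, f x ^ (2 : ℝ) ∂μ) ^ _),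
    ← ENNReal.rpow_natCast ((∫⁻ x, g x ^ (2 : ℝ) ∂μ) ^ _), ← ENNReal.rpow_mul,
    ← ENNReal.rpow_mul] at h2
  norm_num at h2
  exact h2

theorem enorm_integral_mul_sq_le {f g : X → ℂ} (hf : AEStronglyMeasurable f μ)
    (hg : AEStronglyMeasurable g μ) : ‖∫ x, f x * g x ∂μ‖ₑ ^ 2 ≤ sqInt μ f * sqInt μ g := by
  refine le_trans (ENNReal.pow_le_pow_left (enorm_integral_le_lintegral_enorm _)) ?_
  simp_rw [enorm_mul]
  exact lintegral_mul_sq_le hf.enorm hg.enorm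

theorem sqInt_const_mul (c : ℂ) (f : X → ℂ) :
    sqInt μ (fun x => c * f x) = ‖c‖ₑ ^ 2 * sqInt μ f := by
  simp only [sqInt, enorm_mul, mul_pow]
  rw [lintegral_const_mul' _ _ (by simp)]

theorem sqInt_prod [SFinite μ] [SFinite ν] {f : X × Y → ℂ}
    (hf : AEStronglyMeasurable f (μ.prod ν)) :
    sqInt (μ.prod ν) f = ∫⁻ x, sqInt ν (fun y => f (x, y)) ∂μ :=
  lintegral_prod _ (hf.enorm.pow_const 2)

theorem sqInt_prod_symm [SFinite μ] [SFinite ν] {f : X × Y → ℂ}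
    (hf : AEStronglyMeasurable f (μ.prod ν)) :
    sqInt (μ.prod ν) f = ∫⁻ y, sqInt μ (fun x => f (x, y)) ∂ν :=
  lintegral_prod_symm _ (hf.enorm.pow_const 2)

theorem _root_.MeasureTheory.MemLp.ae_memLp_left [SFinite μ] [SFinite ν] {f : X × Y → ℂ}
    (hf : MemLp f 2 (μ.prod ν)) : ∀ᵐ x ∂μ, MemLp (fun y => f (x, y)) 2 ν := by
  have h1 := sqInt_lt_top hf
  rw [sqInt_prod hf.1] at h1
  filter_upwards [hf.1.prodMk_left, ae_lt_top' (hf.1.enorm.pow_const 2).lintegral_prod_right' h1.ne]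
    with x hx hx' using memLp_two_of_sqInt hx hx'

theorem _root_.MeasureTheory.MemLp.ae_memLp_right [SFinite μ] [SFinite ν] {f : X × Y → ℂ}
    (hf : MemLp f 2 (μ.prod ν)) : ∀ᵐ y ∂ν, MemLp (fun x => f (x, y)) 2 μ := by
  have : MemLp (fun z : Y × X => f z.swap) 2 (ν.prod μ) :=
    hf.comp_measurePreserving Measure.measurePreserving_swap
  exact this.ae_memLp_left

theorem memLp_mul_prod [SFinite μ] [SFinite ν] {f : X → ℂ} {g : Y → ℂ} (hf : MemLp f 2 μ)
    (hg : MemLp g 2 ν) : MemLp (fun z : X × Y => f z.1 * g z.2) 2 (μ.prod ν) := by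
  have hm : AEStronglyMeasurable (fun z : X × Y => f z.1 * g z.2) (μ.prod ν) :=
    hf.1.comp_fst.mul hg.1.comp_snd
  refine memLp_two_of_sqInt hm ?_
  rw [sqInt_prod hm]
  simp_rw [sqInt_const_mul]
  rw [lintegral_mul_const' _ _ (sqInt_lt_top hg).ne]
  exact ENNReal.mul_lt_top (sqInt_lt_top hf) (sqInt_lt_top hg)

/-! ### Bounds for coefficients -/

/-- The weighted square sum of the coefficients of `v` with respect to the real functions `e a`
is at most `∫ ρ |v|²`. -/
def CoeffBound {A : Type*} (μ : Measure X) (e : A → X → ℝ) (c : A → ℝ≥0∞) (ρ : X → ℝ≥0∞) : Prop :=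
  ∀ v : X → ℂ, MemLp v 2 μ →
    ∑' a, c a * ‖∫ x, (e a x : ℂ) * v x ∂μ‖ₑ ^ 2 ≤ ∫⁻ x, ρ x * ‖v x‖ₑ ^ 2 ∂μ

theorem CoeffBound.mono_right {A : Type*} {e : A → X → ℝ} {c : A → ℝ≥0∞} {ρ ρ' : X → ℝ≥0∞}
    (h : CoeffBound μ e c ρ) (hρ : ∀ x, ρ x ≤ ρ' x) : CoeffBound μ e c ρ' := fun v hv =>
  (h v hv).trans (lintegral_mono fun x => mul_le_mul_left (hρ x) _)

theorem CoeffBound.comp_equiv {A B : Type*} {e : A → X → ℝ} {c : A → ℝ≥0∞} {ρ : X → ℝ≥0∞}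
    (h : CoeffBound μ e c ρ) (Φ : Y ≃ᵐ X) (hΦ : MeasurePreserving Φ ν μ) (φ : B ≃ A) :
    CoeffBound ν (fun b y => e (φ b) (Φ y)) (fun b => c (φ b)) (fun y => ρ (Φ y)) := by
  intro v hv
  have hΦ' := hΦ.symm
  have h1 := h (fun x => v (Φ.symm x)) (hv.comp_measurePreserving hΦ')
  have h2 : ∀ a, ∫ x, (e a x : ℂ) * v (Φ.symm x) ∂μ = ∫ y, (e a (Φ y) : ℂ) * v y ∂ν := by
    intro a
    rw [← hΦ.integral_comp Φ.measurableEmbedding]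
    simp
  have h3 : ∫⁻ x, ρ x * ‖v (Φ.symm x)‖ₑ ^ 2 ∂μ = ∫⁻ y, ρ (Φ y) * ‖v y‖ₑ ^ 2 ∂ν := by
    rw [← hΦ.lintegral_comp_emb Φ.measurableEmbedding]
    simp
  simp_rw [h2] at h1
  rw [h3, ← φ.tsum_eq] at h1
  exact h1

theorem CoeffBound.prod {A B : Type*} [Countable A] [SFinite μ] [SFinite ν] {e : A → X → ℝ}
    {c : A → ℝ≥0∞} {ρ : X → ℝ≥0∞} {e' : B → Y → ℝ} {c' : B → ℝ≥0∞} {ρ' : Y → ℝ≥0∞}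
    (h : CoeffBound μ e c ρ) (h' : CoeffBound ν e' c' ρ')
    (he : ∀ a, MemLp (fun x => (e a x : ℂ)) 2 μ) (he' : ∀ b, MemLp (fun y => (e' b y : ℂ)) 2 ν)
    (hρ : Measurable ρ) (hρ' : Measurable ρ') :
    CoeffBound (μ.prod ν) (fun (p : A × B) z => e p.1 z.1 * e' p.2 z.2) (fun p => c p.1 * c' p.2)
      (fun z => ρ z.1 * ρ' z.2) := by
  intro v hv
  set V : A → Y → ℂ := fun a y => ∫ x, (e a x : ℂ) * v (x, y) ∂μ with hV
  have hVm : ∀ a, AEStronglyMeasurable (V a) ν := fun a =>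
    ((he a).1.comp_snd.mul hv.1.prod_swap).integral_prod_right'
  have hVL : ∀ a, MemLp (V a) 2 ν := by
    intro a
    refine memLp_two_of_sqInt (hVm a) ?_
    calc sqInt ν (V a) ≤ ∫⁻ y, sqInt μ (fun x => (e a x : ℂ)) * sqInt μ (fun x => v (x, y)) ∂ν := by
          refine lintegral_mono_ae ?_
          filter_upwards [hv.ae_memLp_right] with y hy
          exact enorm_integral_mul_sq_le (he a).1 hy.1
      _ = sqInt μ (fun x => (e a x : ℂ)) * sqInt (μ.prod ν) v := by
          rw [lintegral_const_mul' _ _ (sqInt_lt_top (he a)).ne, sqInt_prod_symm hv.1]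
      _ < ∞ := ENNReal.mul_lt_top (sqInt_lt_top (he a)) (sqInt_lt_top hv)
  have hint : ∀ a b, ∫ z, ((e a z.1 * e' b z.2 : ℝ) : ℂ) * v z ∂(μ.prod ν) =
      ∫ y, (e' b y : ℂ) * V a y ∂ν := by
    intro a b
    have hi : Integrable (fun z : X × Y => ((e a z.1 : ℂ) * (e' b z.2 : ℂ)) * v z) (μ.prod ν) :=
      (memLp_mul_prod (he a) (he' b)).integrable_mul hv
    push_cast
    rw [integral_prod_symm _ hi]
    refine integral_congr_forall fun y => ?_
    simp only [hV]
    rw [← integral_const_mul]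
    refine integral_congr_forall fun x => ?_
    ring
  simp_rw [hint]
  rw [ENNReal.tsum_prod (f := fun a b => c a * c' b * ‖∫ y, (e' b y : ℂ) * V a y ∂ν‖ₑ ^ 2)]
  calc ∑' a, ∑' b, c a * c' b * ‖∫ y, (e' b y : ℂ) * V a y ∂ν‖ₑ ^ 2
      ≤ ∑' a, ∫⁻ y, c a * (ρ' y * ‖V a y‖ₑ ^ 2) ∂ν := by
        refine ENNReal.tsum_le_tsum fun a => ?_
        simp_rw [mul_assoc]
        rw [ENNReal.tsum_mul_left, lintegral_const_mul'']
        · exact mul_le_mul_right (h' _ (hVL a)) _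
        · exact hρ'.aemeasurable.mul ((hVm a).enorm.pow_const 2)
    _ = ∫⁻ y, ρ' y * ∑' a, c a * ‖V a y‖ₑ ^ 2 ∂ν := by
        refine (lintegral_tsum (f := fun a y => c a * (ρ' y * ‖V a y‖ₑ ^ 2)) fun a =>
          (hρ'.aemeasurable.mul ((hVm a).enorm.pow_const 2)).const_mul _).symm.trans ?_
        refine lintegral_congr fun y => ?_
        rw [← ENNReal.tsum_mul_left]
        refine tsum_congr fun a => by ring
    _ ≤ ∫⁻ y, ρ' y * ∫⁻ x, ρ x * ‖v (x, y)‖ₑ ^ 2 ∂μ ∂ν := by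
        refine lintegral_mono_ae ?_
        filter_upwards [hv.ae_memLp_right] with y hy
        exact mul_le_mul_right (h _ hy) _
    _ = ∫⁻ z, ρ z.1 * ρ' z.2 * ‖v z‖ₑ ^ 2 ∂(μ.prod ν) := by
        have hm2 : AEMeasurable (fun z : X × Y => ρ z.1 * ρ' z.2 * ‖v z‖ₑ ^ 2) (μ.prod ν) :=
          ((hρ.comp measurable_fst).mul (hρ'.comp measurable_snd)).aemeasurable.mul
            (hv.1.enorm.pow_const 2)
        rw [lintegral_prod_symm _ hm2]
        refine lintegral_congr_ae ?_
        filter_upwards [hv.ae_memLp_right] with y hy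
        refine (lintegral_const_mul'' (f := fun x => ρ x * ‖v (x, y)‖ₑ ^ 2) _
          (hρ.aemeasurable.mul (hy.1.enorm.pow_const 2))).symm.trans ?_
        refine lintegral_congr fun x => ?_
        ring

/-- Bessel's inequality for an orthonormal family of real functions. -/
theorem coeffBound_of_orthonormal {A : Type*} {e : A → X → ℝ}
    (he : ∀ a, MemLp (fun x => (e a x : ℂ)) 2 μ)
    (ho : ∀ a b, ∫ x, (e a x : ℂ) * (e b x : ℂ) ∂μ = open Classical in if a = b then 1 else 0) :
    CoeffBound μ e 1 1 := by
  classical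
  intro v hv
  have hon : Orthonormal ℂ (fun a => (he a).toLp) := by
    rw [orthonormal_iff_ite]
    intro a b
    rw [L2.inner_def, show (if a = b then (1 : ℂ) else 0) = _ from (by convert (ho a b).symm)]
    refine integral_congr_ae ?_
    filter_upwards [(he a).coeFn_toLp, (he b).coeFn_toLp] with x h1 h2
    rw [h1, h2]
    simp [mul_comm]
  have h1 : ∀ a, inner ℂ ((he a).toLp) (hv.toLp) = ∫ x, (e a x : ℂ) * v x ∂μ := by
    intro a
    rw [L2.inner_def]
    refine integral_congr_ae ?_
    filter_upwards [(he a).coeFn_toLp, hv.coeFn_toLp] with x h1 h2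
    rw [h1, h2]
    simp [mul_comm]
  have h2 : ENNReal.ofReal (‖hv.toLp‖ ^ 2) = sqInt μ v := by
    rw [ENNReal.ofReal_pow (norm_nonneg _), ofReal_norm, Lp.enorm_toLp,
      eLpNorm_eq_lintegral_rpow_enorm_toReal (by norm_num) (by norm_num), ← ENNReal.rpow_natCast,
      ← ENNReal.rpow_mul]
    simp [sqInt]
  simp only [Pi.one_apply, one_mul]
  change _ ≤ sqInt μ v
  rw [← h2]
  rw [ENNReal.tsum_eq_iSup_sum]
  refine iSup_le fun s => ?_
  have h3 := hon.sum_inner_products_le (s := s) (hv.toLp)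
  simp_rw [h1] at h3
  refine le_trans (le_of_eq ?_) (ENNReal.ofReal_le_ofReal h3)
  rw [ENNReal.ofReal_sum_of_nonneg fun _ _ => by positivity]
  refine Finset.sum_congr rfl fun a _ => ?_
  rw [ENNReal.ofReal_pow (norm_nonneg _), ofReal_norm]

/-- Bounds on products of several variables. -/
theorem CoeffBound.pi {A : Type} [Countable A] [SigmaFinite μ] {e : A → X → ℝ}
    {c : A → ℝ≥0∞} {ρ : X → ℝ≥0∞} (h : CoeffBound μ e c ρ)
    (he : ∀ a, MemLp (fun x => (e a x : ℂ)) 2 μ) (hρ : Measurable ρ) (m : ℕ) :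
    CoeffBound (Measure.pi fun _ : Fin m => μ) (fun (α : Fin m → A) x => ∏ j, e (α j) (x j))
      (fun α => ∏ j, c (α j)) (fun x => ∏ j, ρ (x j)) ∧
    ∀ α : Fin m → A, MemLp (fun x => ((∏ j, e (α j) (x j) : ℝ) : ℂ)) 2
      (Measure.pi fun _ : Fin m => μ) := by
  induction m with
  | zero =>
    constructor
    · intro v hv
      rw [Measure.pi_of_empty]
      simp [tsum_fintype]
    · intro α
      simp only [Finset.univ_eq_empty, Finset.prod_empty, Complex.ofReal_one]
      rw [Measure.pi_of_empty]
      exact memLp_const _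
  | succ m ih =>
    have hp := measurePreserving_piFinSuccAbove (fun _ : Fin (m + 1) => μ) 0
    constructor
    · have h1 := (h.prod ih.1 he ih.2 hρ (Finset.measurable_prod _ fun j _ =>
        hρ.comp (measurable_pi_apply j))).comp_equiv _ hp (Fin.consEquiv fun _ => A).symm
      convert h1 using 1
      · funext α x; rw [Fin.prod_univ_succ]; rfl
      · funext α; rw [Fin.prod_univ_succ]; rfl
      · funext x; rw [Fin.prod_univ_succ]; rfl
    · intro α
      have h1 := (memLp_mul_prod (he (α 0)) (ih.2 (Fin.tail α))).comp_measurePreserving hp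
      convert h1 using 1
      funext x
      rw [Fin.prod_univ_succ]
      push_cast
      rfl

end

/-! ### A Hardy inequality for Hermite coefficients -/

theorem coeffBound_hermiteFun : CoeffBound volume hermiteFun 1 1 := by
  refine coeffBound_of_orthonormal (fun a => (memLp_hermiteFun a).ofReal) fun a b => ?_
  have := integral_hermiteFun a b
  rw [← Complex.ofReal_inj, ← integral_complex_ofReal] at this
  push_cast at this
  rw [this]
  split_ifs <;> simp

theorem lintegral_Ioo_rpow {R : ℝ} (hR : 0 < R) :
    ∫⁻ x in Ioo (-R) R, ENNReal.ofReal (|x| ^ (-(1 / 3) : ℝ)) ≤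
      ENNReal.ofReal (3 * R ^ (2 / 3 : ℝ)) := by
  have h1 : ∫⁻ x in Ioc 0 R, ENNReal.ofReal (|x| ^ (-(1 / 3) : ℝ)) =
      ENNReal.ofReal (3 / 2 * R ^ (2 / 3 : ℝ)) := by
    have hi : IntervalIntegrable (fun x : ℝ => x ^ (-(1 / 3) : ℝ)) volume 0 R :=
      intervalIntegral.intervalIntegrable_rpow' (by norm_num)
    have hi' : IntegrableOn (fun x : ℝ => x ^ (-(1 / 3) : ℝ)) (Ioc 0 R) :=
      (intervalIntegrable_iff_integrableOn_Ioc_of_le hR.le).1 hi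
    have hv := integral_rpow (a := 0) (b := R) (r := -(1 / 3)) (Or.inl (by norm_num))
    rw [intervalIntegral.integral_of_le hR.le] at hv
    calc ∫⁻ x in Ioc 0 R, ENNReal.ofReal (|x| ^ (-(1 / 3) : ℝ))
        = ∫⁻ x in Ioc 0 R, ENNReal.ofReal (x ^ (-(1 / 3) : ℝ)) := by
          refine setLIntegral_congr_fun measurableSet_Ioc fun x hx => ?_
          simp only [abs_of_pos hx.1]
      _ = ENNReal.ofReal (∫ x in Ioc 0 R, x ^ (-(1 / 3) : ℝ)) := by
          rw [ofReal_integral_eq_lintegral_ofReal hi']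
          filter_upwards [ae_restrict_mem measurableSet_Ioc] with x hx
          exact Real.rpow_nonneg hx.1.le _
      _ = _ := by
          rw [hv]; congr 1
          rw [Real.zero_rpow (by norm_num)]
          norm_num
          ring
  have h2 : ∫⁻ x in Ico (-R) 0, ENNReal.ofReal (|x| ^ (-(1 / 3) : ℝ)) =
      ENNReal.ofReal (3 / 2 * R ^ (2 / 3 : ℝ)) := by
    rw [← h1, ← (Measure.measurePreserving_neg (volume : Measure ℝ)).setLIntegral_comp_preimage_emb
      (MeasurableEquiv.neg ℝ).measurableEmbedding _ (Ioc 0 R)]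
    simp
  have h3 : Ioo (-R) R ⊆ Ico (-R) 0 ∪ ({0} ∪ Ioc 0 R) := by
    intro x hx
    rcases lt_trichotomy x 0 with h | h | h
    · exact Or.inl ⟨hx.1.le, h⟩
    · exact Or.inr (Or.inl h)
    · exact Or.inr (Or.inr ⟨h, hx.2.le⟩)
  calc _ ≤ _ := lintegral_mono_set h3
    _ ≤ _ := lintegral_union_le _ _ _
    _ ≤ _ := add_le_add le_rfl (lintegral_union_le _ _ _)
    _ = _ := by
      rw [h1, h2]
      simp only [Measure.restrict_singleton, Real.volume_singleton, zero_smul,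
        lintegral_zero_measure, zero_add]
      rw [← ENNReal.ofReal_add (by positivity) (by positivity)]
      congr 1; ring

theorem enorm_add_sq_le (a b : ℂ) : ‖a + b‖ₑ ^ 2 ≤ 2 * ‖a‖ₑ ^ 2 + 2 * ‖b‖ₑ ^ 2 := by
  simp only [← ofReal_norm]
  rw [← ENNReal.ofReal_pow (norm_nonneg _), ← ENNReal.ofReal_pow (norm_nonneg _),
    ← ENNReal.ofReal_pow (norm_nonneg _), show (2 : ℝ≥0∞) = ENNReal.ofReal 2 by simp,
    ← ENNReal.ofReal_mul (by norm_num), ← ENNReal.ofReal_mul (by norm_num),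
    ← ENNReal.ofReal_add (by positivity) (by positivity)]
  refine ENNReal.ofReal_le_ofReal ?_
  have := norm_add_le a b
  nlinarith [norm_nonneg (a + b), sq_nonneg (‖a‖ - ‖b‖), norm_nonneg a, norm_nonneg b]

theorem sum_coeff_hermiteFun_le {v : ℝ → ℂ} (hv : MemLp v 2) {N : ℕ} (hN : 1 ≤ N) :
    ∑ a ∈ Finset.range N, ‖∫ x, (hermiteFun a x : ℂ) * v x‖ₑ ^ 2 ≤
      ENNReal.ofReal (11 * (N : ℝ) ^ (1 / 6 : ℝ)) *
        ∫⁻ x, ENNReal.ofReal (|x| ^ (1 / 3 : ℝ)) * ‖v x‖ₑ ^ 2 := by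
  have hN0 : (0 : ℝ) < N := by exact_mod_cast hN
  set R : ℝ := (N : ℝ) ^ (-(1 / 2) : ℝ) with hRdef
  have hR : 0 < R := by positivity
  set S := Ioo (-R) R with hS
  set m := ∫⁻ x, ENNReal.ofReal (|x| ^ (1 / 3 : ℝ)) * ‖v x‖ₑ ^ 2 with hm
  have hmeas : AEMeasurable (fun x => ENNReal.ofReal (|x| ^ (1 / 6 : ℝ)) * ‖v x‖ₑ) volume :=
    (by fun_prop : Measurable fun x : ℝ => ENNReal.ofReal (|x| ^ (1 / 6 : ℝ))).aemeasurable.mul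
      hv.1.enorm
  have hi : ∀ a, Integrable (fun x => (hermiteFun a x : ℂ) * v x) := fun a =>
    (memLp_hermiteFun a).ofReal.integrable_mul hv
  have hsplit : ∀ a, ‖∫ x, (hermiteFun a x : ℂ) * v x‖ₑ ^ 2 ≤
      2 * ‖∫ x in S, (hermiteFun a x : ℂ) * v x‖ₑ ^ 2 +
      2 * ‖∫ x, (hermiteFun a x : ℂ) * Sᶜ.indicator v x‖ₑ ^ 2 := by
    intro a
    have : ∫ x, (hermiteFun a x : ℂ) * Sᶜ.indicator v x = ∫ x in Sᶜ, (hermiteFun a x : ℂ) * v x := by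
      rw [← integral_indicator (measurableSet_Ioo.compl : MeasurableSet Sᶜ)]
      congr 1; funext x
      by_cases hx : x ∈ Sᶜ
      · rw [indicator_of_mem hx]
        exact (indicator_of_mem hx fun x => (hermiteFun a x : ℂ) * v x).symm
      · rw [indicator_of_notMem hx, mul_zero]
        exact (indicator_of_notMem hx fun x => (hermiteFun a x : ℂ) * v x).symm
    rw [this, ← integral_add_compl measurableSet_Ioo (hi a)]
    exact enorm_add_sq_le _ _
  have hfar : ∑ a ∈ Finset.range N, ‖∫ x, (hermiteFun a x : ℂ) * Sᶜ.indicator v x‖ₑ ^ 2 ≤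
      ENNReal.ofReal ((N : ℝ) ^ (1 / 6 : ℝ)) * m := by
    have h1 := coeffBound_hermiteFun _ (hv.indicator (measurableSet_Ioo (a := -R) (b := R)).compl)
    simp only [Pi.one_apply, one_mul] at h1
    refine le_trans (ENNReal.sum_le_tsum _) (h1.trans ?_)
    rw [hm, ← lintegral_const_mul' _ _ (by simp)]
    refine lintegral_mono fun x => ?_
    by_cases hx : x ∈ Sᶜ
    · rw [indicator_of_mem hx, ← mul_assoc]
      refine le_mul_of_one_le_left (by positivity) ?_
      rw [← ENNReal.ofReal_mul (by positivity), ENNReal.one_le_ofReal]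
      have hx' : R ≤ |x| := by
        by_contra hcon
        push Not at hcon
        exact hx (abs_lt.1 hcon)
      calc (1 : ℝ) = (N : ℝ) ^ (1 / 6 : ℝ) * R ^ (1 / 3 : ℝ) := by
            rw [hRdef, ← Real.rpow_mul hN0.le, ← Real.rpow_add hN0]; norm_num
        _ ≤ _ := by gcongr
    · rw [indicator_of_notMem hx]; simp
  have hnear1 : ∀ a, ‖∫ x in S, (hermiteFun a x : ℂ) * v x‖ₑ ^ 2 ≤
      (∫⁻ x in S, ENNReal.ofReal (|x| ^ (-(1 / 3) : ℝ)) * ENNReal.ofReal (hermiteFun a x ^ 2)) * m := by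
    intro a
    have h0 : ∀ᵐ x ∂(volume.restrict S), x ≠ 0 := by
      refine ae_restrict_of_ae ?_
      exact Measure.ae_ne volume 0
    calc ‖∫ x in S, (hermiteFun a x : ℂ) * v x‖ₑ ^ 2
        ≤ (∫⁻ x in S, ‖(hermiteFun a x : ℂ) * v x‖ₑ) ^ 2 :=
          ENNReal.pow_le_pow_left (enorm_integral_le_lintegral_enorm _)
      _ = (∫⁻ x in S, (ENNReal.ofReal (|x| ^ (-(1 / 6) : ℝ)) * ENNReal.ofReal |hermiteFun a x|) *
            (ENNReal.ofReal (|x| ^ (1 / 6 : ℝ)) * ‖v x‖ₑ)) ^ 2 := by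
          congr 1
          refine lintegral_congr_ae ?_
          filter_upwards [h0] with x hx
          have h1 : ENNReal.ofReal (|x| ^ (-(1 / 6) : ℝ)) * ENNReal.ofReal (|x| ^ (1 / 6 : ℝ)) = 1 := by
            rw [← ENNReal.ofReal_mul (by positivity), ← Real.rpow_add (abs_pos.2 hx)]
            norm_num
          rw [enorm_mul]
          have h2 : ‖(hermiteFun a x : ℂ)‖ₑ = ENNReal.ofReal |hermiteFun a x| := by
            rw [← ofReal_norm, Complex.norm_real, Real.norm_eq_abs]
          rw [h2]
          calc ENNReal.ofReal |hermiteFun a x| * ‖v x‖ₑ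
              = 1 * (ENNReal.ofReal |hermiteFun a x| * ‖v x‖ₑ) := (one_mul _).symm
            _ = _ := by rw [← h1]; ring
      _ ≤ (∫⁻ x in S, (ENNReal.ofReal (|x| ^ (-(1 / 6) : ℝ)) * ENNReal.ofReal |hermiteFun a x|) ^ 2) *
            ∫⁻ x in S, (ENNReal.ofReal (|x| ^ (1 / 6 : ℝ)) * ‖v x‖ₑ) ^ 2 := by
          refine lintegral_mul_sq_le ?_ hmeas.restrict
          have := (continuous_hermiteFun a).measurable
          fun_prop
      _ ≤ _ := by
          refine mul_le_mul' (le_of_eq ?_) ?_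
          · refine lintegral_congr_ae ?_
            filter_upwards [h0] with x hx
            rw [mul_pow, ← ENNReal.ofReal_pow (by positivity), ← ENNReal.ofReal_pow (by positivity),
              sq_abs, ← Real.rpow_natCast, ← Real.rpow_mul (abs_nonneg _)]
            norm_num
          · refine (setLIntegral_le_lintegral _ _).trans (lintegral_mono fun x => le_of_eq ?_)
            rw [mul_pow, ← ENNReal.ofReal_pow (by positivity), ← Real.rpow_natCast,
              ← Real.rpow_mul (abs_nonneg _)]
            norm_num
  have hnear : ∑ a ∈ Finset.range N, ‖∫ x in S, (hermiteFun a x : ℂ) * v x‖ₑ ^ 2 ≤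
      ENNReal.ofReal (9 / 2 * (N : ℝ) ^ (1 / 6 : ℝ)) * m := by
    refine (Finset.sum_le_sum fun a _ => hnear1 a).trans ?_
    rw [← Finset.sum_mul]
    refine mul_le_mul' ?_ le_rfl
    rw [← lintegral_finsetSum']
    · calc ∫⁻ x in S, ∑ a ∈ Finset.range N, ENNReal.ofReal (|x| ^ (-(1 / 3) : ℝ)) *
            ENNReal.ofReal (hermiteFun a x ^ 2)
          ≤ ∫⁻ x in S, ENNReal.ofReal (Real.sqrt (2 * N)) * ENNReal.ofReal (|x| ^ (-(1 / 3) : ℝ)) := by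
            refine lintegral_mono fun x => ?_
            rw [← Finset.mul_sum, mul_comm, ← ENNReal.ofReal_sum_of_nonneg fun _ _ => sq_nonneg _]
            exact mul_le_mul' (ENNReal.ofReal_le_ofReal (sum_hermiteFun_sq_le N x)) le_rfl
        _ ≤ ENNReal.ofReal (Real.sqrt (2 * N)) * ENNReal.ofReal (3 * R ^ (2 / 3 : ℝ)) := by
            rw [lintegral_const_mul' _ _ ENNReal.ofReal_ne_top]
            exact mul_le_mul' le_rfl (lintegral_Ioo_rpow hR)
        _ ≤ _ := by
            rw [← ENNReal.ofReal_mul (by positivity)]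
            refine ENNReal.ofReal_le_ofReal ?_
            have h1 : (N : ℝ) ^ (1 / 2 : ℝ) * R ^ (2 / 3 : ℝ) = (N : ℝ) ^ (1 / 6 : ℝ) := by
              rw [hRdef, ← Real.rpow_mul hN0.le, ← Real.rpow_add hN0]; norm_num
            rw [Real.sqrt_mul (by norm_num), Real.sqrt_eq_rpow (N : ℝ), ← h1]
            have h2 : Real.sqrt 2 ≤ 3 / 2 := by
              rw [Real.sqrt_le_left (by norm_num)]; norm_num
            have h3 : 0 ≤ (N : ℝ) ^ (1 / 2 : ℝ) * R ^ (2 / 3 : ℝ) := by positivity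
            nlinarith
    · intro a _
      have := (continuous_hermiteFun a).measurable
      fun_prop
  calc _ ≤ ∑ a ∈ Finset.range N, (2 * ‖∫ x in S, (hermiteFun a x : ℂ) * v x‖ₑ ^ 2 +
      2 * ‖∫ x, (hermiteFun a x : ℂ) * Sᶜ.indicator v x‖ₑ ^ 2) :=
        Finset.sum_le_sum fun a _ => hsplit a
    _ ≤ 2 * (ENNReal.ofReal (9 / 2 * (N : ℝ) ^ (1 / 6 : ℝ)) * m) +
        2 * (ENNReal.ofReal ((N : ℝ) ^ (1 / 6 : ℝ)) * m) := by
        rw [Finset.sum_add_distrib, ← Finset.mul_sum, ← Finset.mul_sum]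
        gcongr
    _ = _ := by
        rw [show (2 : ℝ≥0∞) = ENNReal.ofReal 2 by simp, ← mul_assoc, ← mul_assoc,
          ← ENNReal.ofReal_mul (by norm_num), ← ENNReal.ofReal_mul (by norm_num), ← add_mul,
          ← ENNReal.ofReal_add (by positivity) (by positivity)]
        congr 2; ring

theorem exists_coeffBound_hermiteFun {p : ℝ} (hp : 1 / 6 < p) : ∃ C : ℝ≥0∞, C ≠ ∞ ∧
    CoeffBound volume hermiteFun (fun a => ENNReal.ofReal ((2 * (a : ℝ) + 1) ^ (-p)))
      (fun x => C * ENNReal.ofReal (|x| ^ (1 / 3 : ℝ))) := by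
  set r : ℝ := 2 ^ (-(p - 1 / 6)) with hr
  have hr1 : r < 1 := Real.rpow_lt_one_of_one_lt_of_neg (by norm_num) (by linarith)
  refine ⟨ENNReal.ofReal (2 ^ p) * (ENNReal.ofReal 11 * (1 - ENNReal.ofReal r)⁻¹), ?_, ?_⟩
  · refine ENNReal.mul_ne_top (by simp) (ENNReal.mul_ne_top (by simp) (ENNReal.inv_ne_top.2 ?_))
    exact (tsub_pos_of_lt (by simpa using hr1)).ne'
  intro v hv
  set m := ∫⁻ x, ENNReal.ofReal (|x| ^ (1 / 3 : ℝ)) * ‖v x‖ₑ ^ 2 with hm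
  set x : ℕ → ℝ≥0∞ := fun a => ‖∫ x, (hermiteFun a x : ℂ) * v x‖ₑ ^ 2 with hx
  have h1 : ∀ a : ℕ, ENNReal.ofReal ((2 * (a : ℝ) + 1) ^ (-p)) * x a ≤
      ∑' j : ℕ, ENNReal.ofReal (2 ^ p) * (ENNReal.ofReal (((2 : ℝ) ^ j) ^ (-p)) *
        if a < 2 ^ j then x a else 0) := by
    intro a
    have h2 : 2 * a + 1 ≤ 2 ^ Nat.clog 2 (2 * a + 1) := Nat.le_pow_clog (by norm_num) _
    have h3 : 2 ^ Nat.clog 2 (2 * a + 1) ≤ 2 * (2 * a + 1) := by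
      rcases Nat.eq_zero_or_pos a with rfl | ha
      · simp
      · have h4 := Nat.pow_pred_clog_lt_self (b := 2) (x := 2 * a + 1) (by norm_num) (by omega)
        have h5 : 0 < Nat.clog 2 (2 * a + 1) := Nat.clog_pos (by norm_num) (by omega)
        obtain ⟨k, hk⟩ := Nat.exists_eq_succ_of_ne_zero h5.ne'
        rw [hk] at h4 ⊢
        simp only [Nat.pred_eq_sub_one, Nat.succ_eq_add_one, Nat.add_sub_cancel] at h4
        rw [Nat.succ_eq_add_one, pow_succ]; omega
    refine le_trans ?_ (ENNReal.le_tsum (Nat.clog 2 (2 * a + 1)))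
    rw [if_pos (by omega), ← mul_assoc, ← ENNReal.ofReal_mul (by positivity)]
    refine mul_le_mul' (ENNReal.ofReal_le_ofReal ?_) le_rfl
    have h6 : (((2 : ℝ) ^ Nat.clog 2 (2 * a + 1))) ≤ 2 * (2 * (a : ℝ) + 1) := by exact_mod_cast h3
    calc (2 * (a : ℝ) + 1) ^ (-p) = 2 ^ p * (2 * (2 * (a : ℝ) + 1)) ^ (-p) := by
          rw [Real.mul_rpow (by norm_num) (by positivity), ← mul_assoc,
            ← Real.rpow_add (by norm_num)]
          simp
      _ ≤ _ := by
          refine mul_le_mul_of_nonneg_left ?_ (by positivity)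
          exact Real.rpow_le_rpow_of_nonpos (by positivity) h6 (by linarith)
  have h2 : ∀ j : ℕ, ∑' a, (if a < 2 ^ j then x a else 0) ≤
      ENNReal.ofReal (11 * ((2 : ℝ) ^ j) ^ (1 / 6 : ℝ)) * m := by
    intro j
    have := sum_coeff_hermiteFun_le hv (N := 2 ^ j) Nat.one_le_two_pow
    push_cast at this
    refine le_trans (le_of_eq ?_) this
    rw [tsum_eq_sum (s := Finset.range (2 ^ j))]
    · exact Finset.sum_congr rfl fun a ha => if_pos (Finset.mem_range.1 ha)
    · intro a ha; exact if_neg (by simpa using ha)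
  calc _ ≤ ∑' a, ∑' j : ℕ, ENNReal.ofReal (2 ^ p) * (ENNReal.ofReal (((2 : ℝ) ^ j) ^ (-p)) *
        if a < 2 ^ j then x a else 0) := ENNReal.tsum_le_tsum h1
    _ = ENNReal.ofReal (2 ^ p) * ∑' j : ℕ, ENNReal.ofReal (((2 : ℝ) ^ j) ^ (-p)) *
        ∑' a, if a < 2 ^ j then x a else 0 := by
        rw [ENNReal.tsum_comm, ← ENNReal.tsum_mul_left]
        refine tsum_congr fun j => ?_
        rw [← ENNReal.tsum_mul_left, ← ENNReal.tsum_mul_left]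
    _ ≤ ENNReal.ofReal (2 ^ p) * ∑' j : ℕ, ENNReal.ofReal 11 * m * ENNReal.ofReal r ^ j := by
        refine mul_le_mul' le_rfl (ENNReal.tsum_le_tsum fun j => ?_)
        refine (mul_le_mul' le_rfl (h2 j)).trans (le_of_eq ?_)
        rw [← mul_assoc, ← ENNReal.ofReal_mul (by positivity), ← ENNReal.ofReal_pow (by positivity),
          mul_right_comm, ← ENNReal.ofReal_mul (by norm_num)]
        congr 2
        have : r ^ j = ((2 : ℝ) ^ j) ^ (-p) * ((2 : ℝ) ^ j) ^ (1 / 6 : ℝ) := by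
          rw [hr, ← Real.rpow_natCast, ← Real.rpow_mul (by norm_num), ← Real.rpow_natCast,
            ← Real.rpow_mul (by norm_num), ← Real.rpow_mul (by norm_num),
            ← Real.rpow_add (by norm_num)]
          congr 1; ring
        rw [this]; ring
    _ = _ := by
        rw [ENNReal.tsum_mul_left, ENNReal.tsum_geometric]
        simp_rw [mul_assoc]
        rw [lintegral_const_mul' _ _ (by simp), lintegral_const_mul' _ _ (by simp),
          lintegral_const_mul' _ _ (ENNReal.inv_ne_top.2 (tsub_pos_of_lt (by simpa using hr1)).ne')]
        ring

/-! ### The Hermite basis of one particle -/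

/-- The indices of the Hermite basis functions of one particle. -/
abbrev Mode : Type := (Fin 3 → ℕ) × Spin

/-- The Hermite basis functions of one particle. -/
def modeFun (b : Mode) (ξ : Xi) : ℝ :=
  (∏ j, hermiteFun (b.1 j) (ξ.1 j)) * (if ξ.2 = b.2 then 1 else 0)

/-- The eigenvalue of the product of the three oscillators. -/
def modeVal (b : Mode) : ℝ := ∏ j, (2 * (b.1 j : ℝ) + 1)

theorem one_le_modeVal (b : Mode) : 1 ≤ modeVal b := by
  unfold modeVal
  have : ∀ j ∈ Finset.univ, (1 : ℝ) ≤ 2 * (b.1 j : ℝ) + 1 := fun j _ => by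
    have : (0 : ℝ) ≤ b.1 j := by positivity
    linarith
  calc (1 : ℝ) = ∏ j : Fin 3, 1 := by simp
    _ ≤ _ := Finset.prod_le_prod (fun _ _ => zero_le_one) this

theorem modeVal_pos (b : Mode) : 0 < modeVal b := one_pos.trans_le (one_le_modeVal b)

theorem coeffBound_spin : CoeffBound (Measure.count : Measure Spin)
    (fun s t => if t = s then 1 else 0) 1 1 := by
  intro v hv
  simp [integral_count, tsum_fintype, lintegral_count]

theorem memLp_spin (s : Spin) :
    MemLp (fun t : Spin => (((if t = s then 1 else 0 : ℝ)) : ℂ)) 2 Measure.count :=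
  MemLp.of_discrete

theorem coeffBound_modeFun {c : ℕ → ℝ≥0∞} {ρ : ℝ → ℝ≥0∞} (h : CoeffBound volume hermiteFun c ρ)
    (hρ : Measurable ρ) :
    CoeffBound xiMeasure modeFun (fun b => ∏ j, c (b.1 j)) (fun ξ => ∏ j, ρ (ξ.1 j)) := by
  obtain ⟨h1, h2⟩ := h.pi (fun a => (memLp_hermiteFun a).ofReal) hρ 3
  have hp := EuclideanSpace.volume_preserving_symm_measurableEquiv_toLp (Fin 3)
  have h3 := h1.comp_equiv (MeasurableEquiv.toLp 2 (Fin 3 → ℝ)).symm hp (Equiv.refl _)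
  have h4 := h3.prod coeffBound_spin (fun α => (h2 α).comp_measurePreserving hp) memLp_spin
    (Finset.measurable_prod _ fun j _ => hρ.comp (by fun_prop)) measurable_one
  simp only [Pi.one_apply, mul_one] at h4
  exact h4

theorem memLp_modeFun (b : Mode) : MemLp (fun ξ => (modeFun b ξ : ℂ)) 2 xiMeasure := by
  obtain ⟨-, h2⟩ := coeffBound_hermiteFun.pi (fun a => (memLp_hermiteFun a).ofReal) measurable_one 3
  have hp := EuclideanSpace.volume_preserving_symm_measurableEquiv_toLp (Fin 3)
  have := memLp_mul_prod ((h2 b.1).comp_measurePreserving hp) (memLp_spin b.2)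
  have h3 : (fun ξ => (modeFun b ξ : ℂ)) = fun z => ((fun x : Fin 3 → ℝ =>
      ((∏ j, hermiteFun (b.1 j) (x j) : ℝ) : ℂ)) ∘ ⇑(MeasurableEquiv.toLp 2 (Fin 3 → ℝ)).symm) z.1 *
        ((if z.2 = b.2 then 1 else 0 : ℝ) : ℂ) := by
    funext ξ
    simp only [modeFun, Function.comp_apply]
    push_cast
    rfl
  rw [h3]
  exact this

/-- Bessel's inequality for the Hermite functions of one particle. -/
theorem modeFun_bessel : CoeffBound xiMeasure modeFun 1 1 := by
  have := coeffBound_modeFun coeffBound_hermiteFun measurable_one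
  simp only [Pi.one_apply, Finset.prod_const_one] at this
  exact this

/-- The Hardy inequality for the Hermite coefficients of one particle. -/
theorem exists_modeFun_hardy {p : ℝ} (hp : 1 / 6 < p) : ∃ C : ℝ≥0∞, C ≠ ∞ ∧
    CoeffBound xiMeasure modeFun (fun b => ENNReal.ofReal (modeVal b ^ (-p)))
      (fun ξ => C * ‖ξ.1‖ₑ) := by
  obtain ⟨C, hC, h⟩ := exists_coeffBound_hermiteFun hp
  refine ⟨C ^ 3, by simp [hC], ?_⟩
  have h1 := coeffBound_modeFun h (by fun_prop)
  have h2 : (fun b : Mode => ENNReal.ofReal (modeVal b ^ (-p))) =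
      fun b => ∏ j, ENNReal.ofReal ((2 * (b.1 j : ℝ) + 1) ^ (-p)) := by
    funext b
    rw [← ENNReal.ofReal_prod_of_nonneg fun j _ => by positivity, modeVal,
      Real.finsetProd_rpow _ _ fun j _ => by positivity]
  rw [h2]
  refine h1.mono_right fun ξ => ?_
  rw [Finset.prod_mul_distrib, Finset.prod_const, Finset.card_univ, Fintype.card_fin]
  refine mul_le_mul' le_rfl ?_
  rw [← ENNReal.ofReal_prod_of_nonneg fun j _ => by positivity, ← ofReal_norm]
  refine ENNReal.ofReal_le_ofReal ?_
  have h3 : ∀ j, |ξ.1 j| ^ (1 / 3 : ℝ) ≤ ‖ξ.1‖ ^ (1 / 3 : ℝ) := fun j =>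
    Real.rpow_le_rpow (abs_nonneg _) (PiLp.norm_apply_le ξ.1 j) (by norm_num)
  calc ∏ j, |ξ.1 j| ^ (1 / 3 : ℝ) ≤ ∏ _j : Fin 3, ‖ξ.1‖ ^ (1 / 3 : ℝ) :=
        Finset.prod_le_prod (fun _ _ => by positivity) fun j _ => h3 j
    _ = ‖ξ.1‖ := by
        rw [Finset.prod_const, Finset.card_univ, Fintype.card_fin, ← Real.rpow_natCast,
          ← Real.rpow_mul (norm_nonneg _)]
        norm_num

theorem tsum_pi_prod_eq_pow {A : Type} (c : A → ℝ≥0∞) (m : ℕ) :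
    ∑' α : Fin m → A, ∏ j, c (α j) = (∑' a, c a) ^ m := by
  induction m with
  | zero => simp [tsum_fintype]
  | succ m ih =>
    rw [← (Fin.consEquiv fun _ => A).tsum_eq]
    have : ∀ q : A × (Fin m → A), ∏ j, c ((Fin.consEquiv fun _ => A) q j) =
        c q.1 * ∏ j, c (q.2 j) := by
      intro q
      rw [Fin.prod_univ_succ]; rfl
    simp_rw [this]
    rw [ENNReal.tsum_prod (f := fun a (α : Fin m → A) => c a * ∏ j, c (α j))]
    simp_rw [ENNReal.tsum_mul_left, ih, ENNReal.tsum_mul_right]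
    rw [pow_succ, mul_comm]

theorem tsum_modeVal_rpow_ne_top {q : ℝ} (hq : 1 < q) :
    ∑' b : Mode, ENNReal.ofReal (modeVal b ^ (-q)) ≠ ∞ := by
  have h2 : ∀ b : Mode, ENNReal.ofReal (modeVal b ^ (-q)) =
      ∏ j, ENNReal.ofReal ((2 * (b.1 j : ℝ) + 1) ^ (-q)) := by
    intro b
    rw [← ENNReal.ofReal_prod_of_nonneg fun j _ => by positivity, modeVal,
      Real.finsetProd_rpow _ _ fun j _ => by positivity]
  simp_rw [h2]
  rw [ENNReal.tsum_prod (f := fun (α : Fin 3 → ℕ) (_ : Spin) =>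
    ∏ j, ENNReal.ofReal ((2 * (α j : ℝ) + 1) ^ (-q)))]
  have h3 : ∑' a : ℕ, ENNReal.ofReal ((2 * (a : ℝ) + 1) ^ (-q)) ≠ ∞ := by
    have hs : Summable fun a : ℕ => (((a + 1 : ℕ)) : ℝ) ^ (-q) :=
      (summable_nat_add_iff 1).2 (Real.summable_nat_rpow.2 (by linarith))
    have hs2 : Summable fun a : ℕ => (2 * (a : ℝ) + 1) ^ (-q) := by
      refine hs.of_nonneg_of_le (fun a => by positivity) fun a => ?_
      refine Real.rpow_le_rpow_of_nonpos (by positivity) ?_ (by linarith)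
      push_cast
      have : (0 : ℝ) ≤ a := by positivity
      linarith
    exact hs2.tsum_ofReal_ne_top
  simp only [tsum_fintype, Finset.sum_const, Finset.card_univ, Fintype.card_bool, nsmul_eq_mul]
  rw [ENNReal.tsum_mul_left, tsum_pi_prod_eq_pow fun a : ℕ => ENNReal.ofReal ((2 * (a : ℝ) + 1) ^ (-q))]
  exact ENNReal.mul_ne_top (by simp) (by simp [h3])

/-! ### Completeness of the Hermite functions -/

theorem mul_hermiteFun_succ (l : ℕ) (x : ℝ) : x * hermiteFun (l + 1) x =
    1 / 2 * (Real.sqrt (2 * (l + 1)) * hermiteFun l x +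
      Real.sqrt (2 * ((l + 1 : ℕ) + 1)) * hermiteFun (l + 2) x) := by
  have := (hasDerivAt_hermiteFun (l + 1) x).unique (hasDerivAt_hermiteFun_succ l x)
  linarith

theorem mul_hermiteFun_zero (x : ℝ) : x * hermiteFun 0 x =
    1 / 2 * (Real.sqrt (2 * ((0 : ℕ) + 1)) * hermiteFun 1 x) := by
  have := (hasDerivAt_hermiteFun 0 x).unique (hasDerivAt_hermiteFun_zero x)
  norm_num at this ⊢
  linarith

theorem memLp_pow_mul_hermiteFun (n l : ℕ) : MemLp (fun x => x ^ n * hermiteFun l x) 2 := by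
  induction n generalizing l with
  | zero => simpa using memLp_hermiteFun l
  | succ n ih =>
    cases l with
    | zero =>
      refine (((ih 1).const_mul (Real.sqrt (2 * ((0 : ℕ) + 1)))).const_mul (1 / 2)).ae_eq
        (Eventually.of_forall fun x => ?_)
      simp only
      rw [pow_succ, mul_assoc, mul_hermiteFun_zero]; ring
    | succ l =>
      refine ((((ih l).const_mul (Real.sqrt (2 * (l + 1)))).add
        ((ih (l + 2)).const_mul (Real.sqrt (2 * ((l + 1 : ℕ) + 1))))).const_mul (1 / 2)).ae_eq
        (Eventually.of_forall fun x => ?_)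
      simp only [Pi.add_apply]
      rw [pow_succ, mul_assoc, mul_hermiteFun_succ]; ring

theorem integral_pow_mul_hermiteFun_eq_zero {v : ℝ → ℂ} (hv : MemLp v 2)
    (h : ∀ l, ∫ x, (hermiteFun l x : ℂ) * v x = 0) (n l : ℕ) :
    ∫ x, ((x ^ n * hermiteFun l x : ℝ) : ℂ) * v x = 0 := by
  have hi : ∀ n l, Integrable (fun x => ((x ^ n * hermiteFun l x : ℝ) : ℂ) * v x) := fun n l =>
    (memLp_pow_mul_hermiteFun n l).ofReal.integrable_mul hv
  induction n generalizing l with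
  | zero => simpa using h l
  | succ n ih =>
    cases l with
    | zero =>
      have : ∀ x, ((x ^ (n + 1) * hermiteFun 0 x : ℝ) : ℂ) * v x =
          ((1 / 2 * Real.sqrt (2 * ((0 : ℕ) + 1)) : ℝ) : ℂ) *
            (((x ^ n * hermiteFun 1 x : ℝ) : ℂ) * v x) := by
        intro x
        rw [pow_succ, mul_assoc, mul_hermiteFun_zero]; push_cast; ring
      simp_rw [this]
      rw [integral_const_mul, ih, mul_zero]
    | succ l =>
      have : ∀ x, ((x ^ (n + 1) * hermiteFun (l + 1) x : ℝ) : ℂ) * v x =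
          ((1 / 2 * Real.sqrt (2 * (l + 1)) : ℝ) : ℂ) * (((x ^ n * hermiteFun l x : ℝ) : ℂ) * v x) +
          ((1 / 2 * Real.sqrt (2 * ((l + 1 : ℕ) + 1)) : ℝ) : ℂ) *
            (((x ^ n * hermiteFun (l + 2) x : ℝ) : ℂ) * v x) := by
        intro x
        rw [pow_succ, mul_assoc, mul_hermiteFun_succ]; push_cast; ring
      simp_rw [this]
      rw [integral_add ((hi _ _).const_mul _) ((hi _ _).const_mul _), integral_const_mul,
        integral_const_mul, ih, ih, mul_zero, mul_zero, add_zero]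

theorem memLp_exp_mul_hermiteFun_zero (t : ℝ) :
    MemLp (fun x => Real.exp (|t * x|) * hermiteFun 0 x) 2 := by
  have hc : Continuous (fun x => Real.exp (|t * x|) * hermiteFun 0 x) := by
    have := continuous_hermiteFun 0
    fun_prop
  rw [memLp_two_iff_integrable_sq hc.aestronglyMeasurable]
  set c := (Real.sqrt ((0 : ℕ).factorial * Real.sqrt Real.pi))⁻¹
  have hg : Integrable (fun x : ℝ => c ^ 2 * Real.exp (2 * t ^ 2) * Real.exp (-(1 / 2) * x ^ 2)) :=
    (integrable_exp_neg_mul_sq (by norm_num)).const_mul _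
  refine hg.mono' (hc.pow 2).aestronglyMeasurable (Eventually.of_forall fun x => ?_)
  have h0 : hermiteFun 0 x = c * Real.exp (-(x ^ 2 / 2)) := by
    rw [hermiteFun_eq]; simp [c]
  rw [Real.norm_of_nonneg (sq_nonneg _), h0, mul_pow, mul_pow, mul_left_comm, mul_assoc]
  refine mul_le_mul_of_nonneg_left ?_ (sq_nonneg _)
  rw [← Real.exp_nat_mul, ← Real.exp_nat_mul, ← Real.exp_add, ← Real.exp_add]
  refine Real.exp_le_exp.2 ?_
  push_cast
  rw [abs_mul]
  nlinarith [sq_nonneg (2 * |t| - |x|), sq_abs t, sq_abs x]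

theorem integral_exp_mul_eq_zero {v : ℝ → ℂ} (hv : MemLp v 2)
    (h : ∀ l, ∫ x, (hermiteFun l x : ℂ) * v x = 0) (t : ℝ) :
    ∫ x : ℝ, Complex.exp (t * x * Complex.I) * ((hermiteFun 0 x : ℂ) * v x) = 0 := by
  have hb : Integrable (fun x => ‖((Real.exp (|t * x|) * hermiteFun 0 x : ℝ) : ℂ) * v x‖) :=
    ((memLp_exp_mul_hermiteFun_zero t).ofReal.integrable_mul hv).norm
  have hs : ∀ x : ℝ, HasSum (fun k : ℕ => (t * x * Complex.I) ^ k / (k.factorial : ℂ))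
      (Complex.exp (t * x * Complex.I)) := fun x => by
    rw [Complex.exp_eq_exp_ℂ]
    exact NormedSpace.expSeries_div_hasSum_exp (t * x * Complex.I : ℂ)
  have hs' : ∀ x : ℝ, HasSum (fun k : ℕ => |t * x| ^ k / (k.factorial : ℝ)) (Real.exp |t * x|) :=
    fun x => by
      rw [Real.exp_eq_exp_ℝ]
      exact NormedSpace.expSeries_div_hasSum_exp |t * x|
  have hm : ∀ k : ℕ, AEStronglyMeasurable (fun x : ℝ => (t * x * Complex.I) ^ k / (k.factorial : ℂ) *
      ((hermiteFun 0 x : ℂ) * v x)) volume := fun k => by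
    refine AEStronglyMeasurable.mul (by fun_prop) (AEStronglyMeasurable.mul ?_ hv.1)
    exact (Complex.continuous_ofReal.comp (continuous_hermiteFun 0)).aestronglyMeasurable
  have key := hasSum_integral_of_dominated_convergence
    (F := fun (k : ℕ) (x : ℝ) => (t * x * Complex.I) ^ k / (k.factorial : ℂ) *
      ((hermiteFun 0 x : ℂ) * v x))
    (bound := fun k x => |t * x| ^ k / (k.factorial : ℝ) * ‖(hermiteFun 0 x : ℂ) * v x‖)
    (f := fun x => Complex.exp (t * x * Complex.I) * ((hermiteFun 0 x : ℂ) * v x)) (μ := volume)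
    hm (fun k => Eventually.of_forall fun x => by
      rw [norm_mul, norm_div, norm_pow, norm_mul, Complex.norm_I, mul_one, ← Complex.ofReal_mul,
        Complex.norm_real, Real.norm_eq_abs]
      simp)
    (Eventually.of_forall fun x => (hs' x).summable.mul_right _)
    (by
      refine hb.congr (Eventually.of_forall fun x => ?_)
      simp only
      rw [tsum_mul_right, (hs' x).tsum_eq, norm_mul, norm_mul, Complex.ofReal_mul, norm_mul,
        Complex.norm_real, Real.norm_of_nonneg (Real.exp_nonneg _), mul_assoc])
    (Eventually.of_forall fun x => (hs x).mul_right _)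
  have hz : ∀ k : ℕ, ∫ x : ℝ, (t * x * Complex.I) ^ k / (k.factorial : ℂ) *
      ((hermiteFun 0 x : ℂ) * v x) = 0 := by
    intro k
    have : ∀ x : ℝ, (t * x * Complex.I) ^ k / (k.factorial : ℂ) * ((hermiteFun 0 x : ℂ) * v x) =
        ((t * Complex.I) ^ k / (k.factorial : ℂ)) * (((x ^ k * hermiteFun 0 x : ℝ) : ℂ) * v x) := by
      intro x; push_cast; ring
    simp_rw [this]
    rw [integral_const_mul, integral_pow_mul_hermiteFun_eq_zero hv h, mul_zero]
  simp_rw [hz] at key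
  exact key.unique hasSum_zero

theorem ae_eq_zero_of_forall_integral_exp_real {w : ℝ → ℝ} (hw : Integrable w)
    (h : ∀ t : ℝ, ∫ x : ℝ, Complex.exp (t * x * Complex.I) * (w x : ℂ) = 0) : w =ᵐ[volume] 0 := by
  have hf1 : IsFiniteMeasure (volume.withDensity fun x => ENNReal.ofReal (w x)) :=
    isFiniteMeasure_withDensity_ofReal hw.2
  have hf2 : IsFiniteMeasure (volume.withDensity fun x => ENNReal.ofReal (-w x)) :=
    isFiniteMeasure_withDensity_ofReal hw.neg.2
  have hb : ∀ t : ℝ, ∀ g : ℝ → ℝ, Integrable g →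
      Integrable (fun x : ℝ => Complex.exp (t * x * Complex.I) * (g x : ℂ)) := fun t g hg => by
    refine hg.ofReal.bdd_mul (c := 1) (by fun_prop) (Eventually.of_forall fun x => ?_)
    rw [← Complex.ofReal_mul, Complex.norm_exp_ofReal_mul_I]
  have heq : volume.withDensity (fun x => ENNReal.ofReal (w x)) =
      volume.withDensity fun x => ENNReal.ofReal (-w x) := by
    refine Measure.ext_of_charFun ?_
    funext t
    have e : ∀ g : ℝ → ℝ, Integrable g →
        charFun (volume.withDensity fun x => ENNReal.ofReal (g x)) t =
        ∫ x : ℝ, Complex.exp (t * x * Complex.I) * ((max (g x) 0 : ℝ) : ℂ) := by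
      intro g hg
      rw [charFun_apply_real, integral_withDensity_eq_integral_toReal_smul₀
        (by exact hg.aemeasurable.ennreal_ofReal) (by simp)]
      refine integral_congr_forall fun x => ?_
      simp only [ENNReal.toReal_ofReal']
      rw [Complex.real_smul, mul_comm]
    rw [e w hw, e (fun x => -w x) hw.neg, ← sub_eq_zero, ← integral_sub (hb t _ hw.pos_part)
      (hb t (fun x => max (-w x) 0) hw.neg.pos_part), ← h t]
    refine integral_congr_forall fun x => ?_
    rw [← mul_sub, ← Complex.ofReal_sub]
    congr 2
    rcases le_total (w x) 0 with h0 | h0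
    · rw [max_eq_right h0, max_eq_left (by linarith)]; ring
    · rw [max_eq_left h0, max_eq_right (by linarith)]; ring
  have h3 := (withDensity_eq_iff hw.aemeasurable.ennreal_ofReal
    hw.neg.aemeasurable.ennreal_ofReal (by
      have := hw.lintegral_lt_top; exact this.ne)).1 heq
  filter_upwards [h3] with x hx
  simp only [Pi.neg_apply, Pi.zero_apply] at hx ⊢
  rcases lt_trichotomy (w x) 0 with h0 | h0 | h0
  · rw [ENNReal.ofReal_of_nonpos h0.le, eq_comm, ENNReal.ofReal_eq_zero] at hx; linarith
  · exact h0
  · rw [ENNReal.ofReal_of_nonpos (by linarith : -w x ≤ 0), ENNReal.ofReal_eq_zero] at hx; linarith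

section
variable {X Y : Type*} [MeasurableSpace X] [MeasurableSpace Y] {μ : Measure X} {ν : Measure Y}

/-- A square integrable function is determined by its coefficients with respect to the `e a`. -/
def CoeffTotal {A : Type*} (μ : Measure X) (e : A → X → ℝ) : Prop :=
  ∀ v : X → ℂ, MemLp v 2 μ → (∀ a, ∫ x, (e a x : ℂ) * v x ∂μ = 0) → v =ᵐ[μ] 0

theorem coeffTotal_hermiteFun : CoeffTotal volume hermiteFun := by
  intro v hv h
  set g : ℝ → ℂ := fun x => (hermiteFun 0 x : ℂ) * v x with hg
  have hgi : Integrable g := (memLp_hermiteFun 0).ofReal.integrable_mul hv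
  have h1 := integral_exp_mul_eq_zero hv h
  have hexp : ∀ t : ℝ, Integrable (fun x : ℝ => Complex.exp (t * x * Complex.I) * g x) := fun t => by
    refine hgi.bdd_mul (c := 1) (by fun_prop) (Eventually.of_forall fun x => ?_)
    rw [← Complex.ofReal_mul, Complex.norm_exp_ofReal_mul_I]
  have hci : Integrable (fun x => conj (g x)) := by
    rw [← integrable_norm_iff (Complex.continuous_conj.comp_aestronglyMeasurable hgi.1)]
    simpa using hgi.norm
  have hexpc : ∀ t : ℝ, Integrable (fun x : ℝ =>
      Complex.exp (t * x * Complex.I) * conj (g x)) := fun t => by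
    refine hci.bdd_mul (c := 1) (by fun_prop) (Eventually.of_forall fun x => ?_)
    rw [← Complex.ofReal_mul, Complex.norm_exp_ofReal_mul_I]
  have h2 : ∀ t : ℝ, ∫ x : ℝ, Complex.exp (t * x * Complex.I) * conj (g x) = 0 := by
    intro t
    have h3 := congrArg (conj) (h1 (-t))
    rw [← integral_conj, map_zero] at h3
    rw [← h3]
    refine integral_congr_forall fun x => ?_
    simp only [map_mul, ← Complex.exp_conj, hg]
    simp
  have hre : (fun x => (g x).re) =ᵐ[volume] 0 := by
    refine ae_eq_zero_of_forall_integral_exp_real hgi.re fun t => ?_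
    have : ∀ x : ℝ, Complex.exp (t * x * Complex.I) * ((g x).re : ℂ) =
        (1 / 2) * (Complex.exp (t * x * Complex.I) * g x) +
          (1 / 2) * (Complex.exp (t * x * Complex.I) * conj (g x)) := by
      intro x
      rw [Complex.re_eq_add_conj]; ring
    simp_rw [this]
    rw [integral_add ((hexp t).const_mul _) ((hexpc t).const_mul _), integral_const_mul,
      integral_const_mul, h2 t]
    simp only [hg]
    rw [h1 t]
    simp
  have him : (fun x => (g x).im) =ᵐ[volume] 0 := by
    refine ae_eq_zero_of_forall_integral_exp_real hgi.im fun t => ?_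
    have : ∀ x : ℝ, Complex.exp (t * x * Complex.I) * ((g x).im : ℂ) =
        (1 / (2 * Complex.I)) * (Complex.exp (t * x * Complex.I) * g x) -
          (1 / (2 * Complex.I)) * (Complex.exp (t * x * Complex.I) * conj (g x)) := by
      intro x
      rw [Complex.im_eq_sub_conj]; ring
    simp_rw [this]
    rw [integral_sub ((hexp t).const_mul _) ((hexpc t).const_mul _), integral_const_mul,
      integral_const_mul, h2 t]
    simp only [hg]
    rw [h1 t]
    simp
  filter_upwards [hre, him] with x hx1 hx2
  have h0 : hermiteFun 0 x ≠ 0 := by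
    rw [hermiteFun_eq]
    simp only [Polynomial.hermite_zero, map_one, Polynomial.map_one, Polynomial.eval_one, one_mul]
    have : 0 < Real.sqrt Real.pi := Real.sqrt_pos.2 Real.pi_pos
    simp [this.ne']
  have h4 : g x = 0 := Complex.ext hx1 hx2
  simpa [hg, h0] using h4

theorem CoeffTotal.comp_equiv {A B : Type*} {e : A → X → ℝ}
    (h : CoeffTotal μ e) (Φ : Y ≃ᵐ X) (hΦ : MeasurePreserving Φ ν μ) (φ : B ≃ A) :
    CoeffTotal ν (fun b y => e (φ b) (Φ y)) := by
  intro v hv hz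
  have hΦ' := hΦ.symm
  have h2 : ∀ a, ∫ x, (e a x : ℂ) * v (Φ.symm x) ∂μ = ∫ y, (e a (Φ y) : ℂ) * v y ∂ν := by
    intro a
    rw [← hΦ.integral_comp Φ.measurableEmbedding]
    simp
  have h1 := h (fun x => v (Φ.symm x)) (hv.comp_measurePreserving hΦ') fun a => by
    rw [h2, ← hz (φ.symm a)]; simp
  have h3 := hΦ.quasiMeasurePreserving.ae_eq_comp h1
  filter_upwards [h3] with y hy
  simpa using hy

theorem CoeffTotal.prod {A B : Type*} [Countable A] [Countable B] [SFinite μ] [SFinite ν]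
    {e : A → X → ℝ} {e' : B → Y → ℝ} (h : CoeffTotal μ e) (h' : CoeffTotal ν e')
    (he : ∀ a, MemLp (fun x => (e a x : ℂ)) 2 μ) (he' : ∀ b, MemLp (fun y => (e' b y : ℂ)) 2 ν) :
    CoeffTotal (μ.prod ν) (fun (p : A × B) z => e p.1 z.1 * e' p.2 z.2) := by
  intro v hv hz
  set V : A → Y → ℂ := fun a y => ∫ x, (e a x : ℂ) * v (x, y) ∂μ with hV
  have hVm : ∀ a, AEStronglyMeasurable (V a) ν := fun a =>
    ((he a).1.comp_snd.mul hv.1.prod_swap).integral_prod_right'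
  have hVL : ∀ a, MemLp (V a) 2 ν := by
    intro a
    refine memLp_two_of_sqInt (hVm a) ?_
    calc sqInt ν (V a) ≤ ∫⁻ y, sqInt μ (fun x => (e a x : ℂ)) * sqInt μ (fun x => v (x, y)) ∂ν := by
          refine lintegral_mono_ae ?_
          filter_upwards [hv.ae_memLp_right] with y hy
          exact enorm_integral_mul_sq_le (he a).1 hy.1
      _ = sqInt μ (fun x => (e a x : ℂ)) * sqInt (μ.prod ν) v := by
          rw [lintegral_const_mul' _ _ (sqInt_lt_top (he a)).ne, sqInt_prod_symm hv.1]
      _ < ∞ := ENNReal.mul_lt_top (sqInt_lt_top (he a)) (sqInt_lt_top hv)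
  have hint : ∀ a b, ∫ y, (e' b y : ℂ) * V a y ∂ν = 0 := by
    intro a b
    have hi : Integrable (fun z : X × Y => ((e a z.1 : ℂ) * (e' b z.2 : ℂ)) * v z) (μ.prod ν) :=
      (memLp_mul_prod (he a) (he' b)).integrable_mul hv
    have := hz (a, b)
    push_cast at this
    rw [integral_prod_symm _ hi] at this
    rw [← this]
    refine integral_congr_forall fun y => ?_
    simp only [hV]
    rw [← integral_const_mul]
    refine integral_congr_forall fun x => ?_
    ring
  have h0 : ∀ᵐ y ∂ν, ∀ a, V a y = 0 := ae_all_iff.2 fun a => h' _ (hVL a) (hint a)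
  have h1 : ∀ᵐ y ∂ν, (fun x => v (x, y)) =ᵐ[μ] 0 := by
    filter_upwards [h0, hv.ae_memLp_right] with y hy hy2
    exact h _ hy2 hy
  have hsq : sqInt (μ.prod ν) v = 0 := by
    rw [sqInt_prod_symm hv.1]
    refine lintegral_eq_zero_of_ae_eq_zero ?_
    filter_upwards [h1] with y hy
    rw [sqInt_congr_ae hy]
    simp [sqInt]
  rw [sqInt, lintegral_eq_zero_iff' (hv.1.enorm.pow_const 2)] at hsq
  filter_upwards [hsq] with z hz
  simpa using hz

theorem CoeffTotal.pi {A : Type} [Countable A] [SigmaFinite μ] {e : A → X → ℝ}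
    (h : CoeffTotal μ e) (he : ∀ a, MemLp (fun x => (e a x : ℂ)) 2 μ)
    (hL : ∀ m, ∀ α : Fin m → A, MemLp (fun x => ((∏ j, e (α j) (x j) : ℝ) : ℂ)) 2
      (Measure.pi fun _ : Fin m => μ)) (m : ℕ) :
    CoeffTotal (Measure.pi fun _ : Fin m => μ) (fun (α : Fin m → A) x => ∏ j, e (α j) (x j)) := by
  induction m with
  | zero =>
    intro v hv hz
    have := hz isEmptyElim
    rw [Measure.pi_of_empty] at this
    simp only [Finset.univ_eq_empty, Finset.prod_empty, Complex.ofReal_one, one_mul,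
      integral_dirac] at this
    exact Eventually.of_forall fun x => by
      rw [Subsingleton.elim x fun a => isEmptyElim a]; exact this
  | succ m ih =>
    have hp := measurePreserving_piFinSuccAbove (fun _ : Fin (m + 1) => μ) 0
    have h1 := (h.prod ih he (hL m)).comp_equiv _ hp (Fin.consEquiv fun _ => A).symm
    convert h1 using 1
    funext α x; rw [Fin.prod_univ_succ]; rfl

end

/-! ### The Hermite basis of several particles -/

theorem coeffTotal_spin : CoeffTotal (Measure.count : Measure Spin)
    (fun s t => if t = s then 1 else 0) := by
  intro v hv h
  refine Eventually.of_forall fun s => ?_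
  have := h s
  rw [integral_count] at this
  cases s <;> simpa using this

theorem coeffTotal_modeFun : CoeffTotal xiMeasure modeFun := by
  have hL := fun m => (coeffBound_hermiteFun.pi (fun a => (memLp_hermiteFun a).ofReal)
    measurable_one m).2
  have h1 := coeffTotal_hermiteFun.pi (fun a => (memLp_hermiteFun a).ofReal) hL 3
  have hp := EuclideanSpace.volume_preserving_symm_measurableEquiv_toLp (Fin 3)
  have h3 := h1.comp_equiv (MeasurableEquiv.toLp 2 (Fin 3 → ℝ)).symm hp (Equiv.refl _)
  exact h3.prod coeffTotal_spin (fun α => (hL 3 α).comp_measurePreserving hp) memLp_spin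

theorem integral_modeFun_mul (a b : Mode) :
    ∫ ξ, modeFun a ξ * modeFun b ξ ∂xiMeasure = if a = b then 1 else 0 := by
  have h1 : ∀ ξ : Xi, modeFun a ξ * modeFun b ξ =
      (∏ j, (hermiteFun (a.1 j) (ξ.1 j) * hermiteFun (b.1 j) (ξ.1 j))) *
        ((if ξ.2 = a.2 then 1 else 0) * (if ξ.2 = b.2 then 1 else 0)) := by
    intro ξ; simp only [modeFun, Finset.prod_mul_distrib]; ring
  simp_rw [h1]
  rw [xiMeasure, integral_prod_mul (μ := (volume : Measure (EuclideanSpace ℝ (Fin 3))))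
    (ν := (Measure.count : Measure Spin))
    (fun k => ∏ j, (hermiteFun (a.1 j) (k j) * hermiteFun (b.1 j) (k j)))
    (fun s => (if s = a.2 then (1 : ℝ) else 0) * (if s = b.2 then 1 else 0))]
  have hp := EuclideanSpace.volume_preserving_symm_measurableEquiv_toLp (Fin 3)
  have h2 : ∫ k : EuclideanSpace ℝ (Fin 3), ∏ j, (hermiteFun (a.1 j) (k j) * hermiteFun (b.1 j) (k j))
      = ∏ j, (if a.1 j = b.1 j then 1 else 0) := by
    have h3 := hp.integral_comp (MeasurableEquiv.measurableEmbedding _)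
      (fun x : Fin 3 → ℝ => ∏ j, (hermiteFun (a.1 j) (x j) * hermiteFun (b.1 j) (x j)))
    refine Eq.trans h3 ?_
    rw [volume_pi, integral_fintype_prod_eq_prod (𝕜 := ℝ)
      (fun j x => hermiteFun (a.1 j) x * hermiteFun (b.1 j) x)]
    exact Finset.prod_congr rfl fun j _ => integral_hermiteFun _ _
  rw [h2, integral_count]
  obtain ⟨a1, a2⟩ := a
  obtain ⟨b1, b2⟩ := b
  by_cases h3 : a1 = b1
  · subst h3
    cases a2 <;> cases b2 <;> simp
  · obtain ⟨j, hj⟩ := Function.ne_iff.1 h3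
    rw [Finset.prod_eq_zero (Finset.mem_univ j) (by simp [hj])]
    simp [h3]

/-- The Hermite basis functions of several particles. -/
def modesFun {m : ℕ} (β : Fin m → Mode) (x : Fin m → Xi) : ℝ := ∏ i, modeFun (β i) (x i)

/-- The factor by which `oscPow r` multiplies the Hermite basis functions. -/
def oscWeight {m : ℕ} (r : Fin m → ℝ) (β : Fin m → Mode) : ℝ := ∏ i, modeVal (β i) ^ r i

theorem oscWeight_pos {m : ℕ} (r : Fin m → ℝ) (β : Fin m → Mode) : 0 < oscWeight r β :=
  Finset.prod_pos fun _ _ => Real.rpow_pos_of_pos (modeVal_pos _) _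

theorem oscWeight_mono {m : ℕ} {r r' : Fin m → ℝ} (h : ∀ i, r i ≤ r' i) (β : Fin m → Mode) :
    oscWeight r β ≤ oscWeight r' β :=
  Finset.prod_le_prod (fun _ _ => (Real.rpow_pos_of_pos (modeVal_pos _) _).le) fun i _ =>
    Real.rpow_le_rpow_of_exponent_le (one_le_modeVal _) (h i)

theorem memLp_modesFun {m : ℕ} (β : Fin m → Mode) : MemLp (fun x => (modesFun β x : ℂ)) 2 𝓚(m) :=
  (modeFun_bessel.pi memLp_modeFun measurable_one m).2 β

theorem coeffTotal_modesFun (m : ℕ) : CoeffTotal 𝓚(m) (modesFun : (Fin m → Mode) → _) :=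
  coeffTotal_modeFun.pi memLp_modeFun
    (fun m => (modeFun_bessel.pi memLp_modeFun measurable_one m).2) m

/-- The vector of `L²` of a Hermite basis function. -/
def modesVec {m : ℕ} (β : Fin m → Mode) : Kernel (Fin m) := (memLp_modesFun β).toLp

theorem basisVec_eq_modesVec {m : ℕ} (α : Fin m → Fin 3 → ℕ) (s : Fin m → Spin) :
    basisVec α s = modesVec fun i => (α i, s i) := by
  unfold basisVec modesVec
  congr 1
  funext x
  simp only [basisFun, modesFun, modeFun]
  push_cast
  rfl

theorem inner_modesVec {m : ℕ} (β : Fin m → Mode) (F : Kernel (Fin m)) :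
    inner ℂ (modesVec β) F = ∫ x, (modesFun β x : ℂ) * F x ∂𝓚(m) := by
  rw [L2.inner_def]
  refine integral_congr_ae ?_
  filter_upwards [(memLp_modesFun β).coeFn_toLp] with x h1
  unfold modesVec
  rw [h1]
  simp [mul_comm]

theorem orthonormal_modesVec (m : ℕ) : Orthonormal ℂ (modesVec : (Fin m → Mode) → _) := by
  rw [orthonormal_iff_ite]
  intro a b
  rw [inner_modesVec]
  have h1 : ∫ x, (modesFun a x : ℂ) * modesVec b x ∂𝓚(m) =
      ∫ x, ((∏ i, modeFun (a i) (x i) * modeFun (b i) (x i) : ℝ) : ℂ) ∂𝓚(m) := by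
    refine integral_congr_ae ?_
    filter_upwards [(memLp_modesFun b).coeFn_toLp] with x h1
    unfold modesVec
    rw [h1, Finset.prod_mul_distrib]
    simp only [modesFun]
    push_cast
    rfl
  rw [h1, integral_complex_ofReal, kernelMeasure, integral_fintype_prod_eq_prod (𝕜 := ℝ)
    (fun i x => modeFun (a i) x * modeFun (b i) x)]
  simp_rw [integral_modeFun_mul]
  by_cases h : a = b
  · subst h; simp
  · obtain ⟨j, hj⟩ := Function.ne_iff.1 h
    rw [Finset.prod_eq_zero (Finset.mem_univ j) (by simp [hj])]
    simp [h]

/-- The Hermite functions as a Hilbert basis. -/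
def modesBasis (m : ℕ) : HilbertBasis (Fin m → Mode) ℂ (Kernel (Fin m)) :=
  HilbertBasis.mkOfOrthogonalEqBot (orthonormal_modesVec m) (by
    rw [Submodule.eq_bot_iff]
    intro F hF
    rw [Submodule.mem_orthogonal] at hF
    have h1 := coeffTotal_modesFun m F (Lp.memLp F) fun β => by
      rw [← inner_modesVec]
      exact hF _ (Submodule.subset_span ⟨β, rfl⟩)
    exact Lp.ext (h1.trans (Lp.coeFn_zero _ _ _).symm))

theorem modesBasis_apply {m : ℕ} (β : Fin m → Mode) : modesBasis m β = modesVec β := by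
  simp [modesBasis]

theorem kernel_ext {m : ℕ} {F K : Kernel (Fin m)}
    (h : ∀ β, inner ℂ (modesVec β) F = inner ℂ (modesVec β) K) : F = K := by
  apply (modesBasis m).repr.injective
  ext β
  simpa [HilbertBasis.repr_apply_apply, modesBasis_apply] using h β

/-! ### Powers of the oscillators -/

/-- `K` is the image of `F` under the power `r` of the oscillators. -/
def IsOscPow {m : ℕ} (r : Fin m → ℝ) (F K : Kernel (Fin m)) : Prop :=
  ∀ β, inner ℂ (modesVec β) K = (oscWeight r β : ℂ) * inner ℂ (modesVec β) F

theorem isOscPow_iff {m : ℕ} (r : Fin m → ℝ) (F K : Kernel (Fin m)) : IsOscPow r F K ↔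
    ∀ (α : Fin m → Fin 3 → ℕ) (s : Fin m → Spin), inner ℂ (basisVec α s) K =
        ((∏ i, ∏ j, (2 * (α i j : ℝ) + 1) ^ r i : ℝ) : ℂ) * inner ℂ (basisVec α s) F := by
  have hw : ∀ β : Fin m → Mode, oscWeight r β = ∏ i, ∏ j, (2 * ((β i).1 j : ℝ) + 1) ^ r i := by
    intro β
    refine Finset.prod_congr rfl fun i _ => ?_
    rw [modeVal, Real.finsetProd_rpow _ _ fun j _ => by positivity]
  constructor
  · intro h α s
    rw [basisVec_eq_modesVec, h, hw]
  · intro h β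
    rw [hw]
    have := h (fun i => (β i).1) (fun i => (β i).2)
    rwa [basisVec_eq_modesVec] at this

theorem oscPow_eq_of_isOscPow {m : ℕ} {r : Fin m → ℝ} {F K : Kernel (Fin m)} (h : IsOscPow r F K) :
    ∃ hF : F ∈ (oscPow r).domain, oscPow r ⟨F, hF⟩ = K := by
  have hF : F ∈ (oscPow r).domain :=
    Submodule.mem_map.2 ⟨(F, K), (isOscPow_iff r F K).1 h, rfl⟩
  refine ⟨hF, ?_⟩
  have hm := Submodule.mem_graph_toLinearPMap (hg := ?_) (⟨F, hF⟩ : (oscPow r).domain)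
  · have hm' : IsOscPow r F (oscPow r ⟨F, hF⟩) := (isOscPow_iff _ _ _).2 hm
    exact kernel_ext fun β => by rw [hm' β, h β]
  · rintro x hx h0
    have hx' : IsOscPow r x.1 x.2 := (isOscPow_iff _ _ _).2 hx
    refine kernel_ext fun β => ?_
    rw [hx' β, h0]; simp

theorem isOscPow_oscPow {m : ℕ} {r : Fin m → ℝ} (F : (oscPow r).domain) :
    IsOscPow r (F : Kernel (Fin m)) (oscPow r F) := by
  obtain ⟨q, hq, hqF⟩ := Submodule.mem_map.1 F.2
  have h1 : IsOscPow r (F : Kernel (Fin m)) q.2 := by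
    rw [← hqF]; exact (isOscPow_iff _ _ _).2 hq
  obtain ⟨hF, h2⟩ := oscPow_eq_of_isOscPow h1
  have : F = ⟨F, hF⟩ := rfl
  rw [this, h2]
  exact h1

theorem isOscPow_zero {m : ℕ} {r : Fin m → ℝ} (hr : ∀ i, r i = 0) (F : Kernel (Fin m)) :
    IsOscPow r F F := fun β => by simp [oscWeight, hr]

theorem exists_isOscPow_mono {m : ℕ} {r r' : Fin m → ℝ} (hr : ∀ i, r i ≤ r' i)
    {F K : Kernel (Fin m)} (h : IsOscPow r' F K) : ∃ K', IsOscPow r F K' := by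
  have hmem : Memℓp (fun β => (oscWeight r β : ℂ) * inner ℂ (modesVec β) F) 2 := by
    have h1 := lp.memℓp ((modesBasis m).repr K)
    have h2 := (memℓp_gen_iff (by norm_num)).1 h1
    refine (memℓp_gen_iff (by norm_num)).2 (h2.of_nonneg_of_le (fun β => by positivity) fun β => ?_)
    refine Real.rpow_le_rpow (norm_nonneg _) ?_ (by norm_num)
    rw [HilbertBasis.repr_apply_apply, modesBasis_apply, h β, norm_mul, norm_mul]
    refine mul_le_mul_of_nonneg_right ?_ (norm_nonneg _)
    rw [Complex.norm_real, Complex.norm_real, Real.norm_of_nonneg (oscWeight_pos _ _).le,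
      Real.norm_of_nonneg (oscWeight_pos _ _).le]
    exact oscWeight_mono hr β
  refine ⟨(modesBasis m).repr.symm ⟨_, hmem⟩, fun β => ?_⟩
  rw [← modesBasis_apply, ← HilbertBasis.repr_apply_apply, LinearIsometryEquiv.apply_symm_apply]
  simp [modesBasis_apply]

theorem sqInt_eq_enorm {X : Type*} [MeasurableSpace X] {μ : Measure X} (F : Lp ℂ 2 μ) :
    sqInt μ F = ‖F‖ₑ ^ 2 := by
  rw [Lp.enorm_def, eLpNorm_eq_lintegral_rpow_enorm_toReal (by norm_num) (by norm_num),
    ← ENNReal.rpow_natCast, ← ENNReal.rpow_mul]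
  simp [sqInt]

/-- Parseval's identity with weights. -/
theorem tsum_oscWeight_eq {m : ℕ} {r : Fin m → ℝ} {F K : Kernel (Fin m)} (h : IsOscPow r F K) :
    ∑' β, ENNReal.ofReal (oscWeight r β) ^ 2 * ‖inner ℂ (modesVec β) F‖ₑ ^ 2 = sqInt 𝓚(m) K := by
  rw [sqInt_eq_enorm]
  have h1 := lp.norm_rpow_eq_tsum (p := 2) (by norm_num) ((modesBasis m).repr K)
  have h2 := (memℓp_gen_iff (by norm_num)).1 (lp.memℓp ((modesBasis m).repr K))
  norm_num at h1 h2
  rw [← ofReal_norm, ← ENNReal.ofReal_pow (norm_nonneg _), h1,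
    ENNReal.ofReal_tsum_of_nonneg (fun _ => by positivity) h2]
  refine tsum_congr fun β => ?_
  rw [HilbertBasis.repr_apply_apply, modesBasis_apply, h β, norm_mul, mul_pow, Complex.norm_real,
    Real.norm_of_nonneg (oscWeight_pos _ _).le, ENNReal.ofReal_mul (sq_nonneg _),
    ENNReal.ofReal_pow (oscWeight_pos _ _).le, ENNReal.ofReal_pow (norm_nonneg _), ofReal_norm]

/-- A pairing is bounded by the weighted coefficients. -/
theorem enorm_integral_mul_sq_le_tsum {m : ℕ} {r : Fin m → ℝ} {F K : Kernel (Fin m)}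
    (h : IsOscPow r F K) {J : (Fin m → Xi) → ℂ} (hJ : MemLp J 2 𝓚(m)) :
    ‖∫ x, F x * J x ∂𝓚(m)‖ₑ ^ 2 ≤ sqInt 𝓚(m) K * ∑' β, (ENNReal.ofReal (oscWeight r β)⁻¹) ^ 2 *
        ‖∫ x, (modesFun β x : ℂ) * J x ∂𝓚(m)‖ₑ ^ 2 := by
  have hJc : MemLp (fun x => conj (J x)) 2 𝓚(m) :=
    memLp_two_of_sqInt (Complex.continuous_conj.comp_aestronglyMeasurable hJ.1) (by
      simpa [sqInt] using sqInt_lt_top hJ)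
  have h1 : ∫ x, F x * J x ∂𝓚(m) = inner ℂ hJc.toLp F := by
    rw [L2.inner_def]
    refine integral_congr_ae ?_
    filter_upwards [hJc.coeFn_toLp] with x hx
    rw [hx]; simp
  have h2 : ∀ β, inner ℂ hJc.toLp (modesVec β) = ∫ x, (modesFun β x : ℂ) * J x ∂𝓚(m) := by
    intro β
    rw [L2.inner_def]
    refine integral_congr_ae ?_
    filter_upwards [hJc.coeFn_toLp, (memLp_modesFun β).coeFn_toLp] with x hx hx2
    unfold modesVec
    rw [hx, hx2]; simp
  have h3 := (modesBasis m).hasSum_inner_mul_inner hJc.toLp F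
  rw [h1, ← h3.tsum_eq, ← tsum_oscWeight_eq h]
  have h4 : ‖∑' β, inner ℂ hJc.toLp (modesBasis m β) * inner ℂ (modesBasis m β) F‖ₑ ≤
      ∑' β, ‖inner ℂ hJc.toLp (modesBasis m β) * inner ℂ (modesBasis m β) F‖ₑ :=
    enorm_tsum_le_tsum_enorm
  refine (ENNReal.pow_le_pow_left h4).trans ?_
  have h5 : ∀ β, ‖inner ℂ hJc.toLp (modesBasis m β) * inner ℂ (modesBasis m β) F‖ₑ =
      (ENNReal.ofReal (oscWeight r β) * ‖inner ℂ (modesVec β) F‖ₑ) *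
        (ENNReal.ofReal (oscWeight r β)⁻¹ * ‖∫ x, (modesFun β x : ℂ) * J x ∂𝓚(m)‖ₑ) := by
    intro β
    have h6 : ENNReal.ofReal (oscWeight r β) * ENNReal.ofReal (oscWeight r β)⁻¹ = 1 := by
      rw [← ENNReal.ofReal_mul (oscWeight_pos r β).le, mul_inv_cancel₀ (oscWeight_pos r β).ne']
      simp
    rw [modesBasis_apply, enorm_mul, h2]
    calc _ = 1 * (‖∫ x, (modesFun β x : ℂ) * J x ∂𝓚(m)‖ₑ *
          ‖inner ℂ (modesVec β) F‖ₑ) := (one_mul _).symm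
      _ = _ := by rw [← h6]; ring
  simp_rw [h5]
  have h7 := lintegral_mul_sq_le (μ := (Measure.count : Measure (Fin m → Mode)))
    (f := fun β => ENNReal.ofReal (oscWeight r β) * ‖inner ℂ (modesVec β) F‖ₑ)
    (g := fun β => ENNReal.ofReal (oscWeight r β)⁻¹ * ‖∫ x, (modesFun β x : ℂ) * J x ∂𝓚(m)‖ₑ)
    (Measurable.of_discrete).aemeasurable (Measurable.of_discrete).aemeasurable
  simpa only [lintegral_count, mul_pow] using h7

/-! ### Slices of kernels -/

theorem memLp_integral_mul {X Y : Type*} [MeasurableSpace X] [MeasurableSpace Y] {μ : Measure X}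
    {ν : Measure Y} [SFinite μ] [SFinite ν] {e : Y → ℂ} {v : X × Y → ℂ} (he : MemLp e 2 ν)
    (hv : MemLp v 2 (μ.prod ν)) : MemLp (fun x => ∫ y, e y * v (x, y) ∂ν) 2 μ := by
  refine memLp_two_of_sqInt (he.1.comp_snd.mul hv.1).integral_prod_right' ?_
  calc sqInt μ (fun x => ∫ y, e y * v (x, y) ∂ν)
      ≤ ∫⁻ x, sqInt ν e * sqInt ν (fun y => v (x, y)) ∂μ := by
        refine lintegral_mono_ae ?_
        filter_upwards [hv.ae_memLp_left] with x hx
        exact enorm_integral_mul_sq_le he.1 hx.1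
    _ = sqInt ν e * sqInt (μ.prod ν) v := by
        rw [lintegral_const_mul' _ _ (sqInt_lt_top he).ne, sqInt_prod hv.1]
    _ < ∞ := ENNReal.mul_lt_top (sqInt_lt_top he) (sqInt_lt_top hv)

theorem measurePreserving_cons (m : ℕ) : MeasurePreserving
    (fun z : Xi × (Fin m → Xi) => (Fin.cons z.1 z.2 : Fin (m + 1) → Xi))
    (xiMeasure.prod 𝓚(m)) 𝓚(m + 1) := by
  have h : MeasurePreserving (MeasurableEquiv.piFinSuccAbove (fun _ : Fin (m + 1) => Xi) 0).symm
      (xiMeasure.prod 𝓚(m)) 𝓚(m + 1) :=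
    (measurePreserving_piFinSuccAbove (fun _ : Fin (m + 1) => xiMeasure) 0).symm
  convert h using 1
  funext z
  exact (Fin.insertNth_zero' z.1 z.2).symm

theorem measurableEmbedding_cons (m : ℕ) : MeasurableEmbedding
    (fun z : Xi × (Fin m → Xi) => (Fin.cons z.1 z.2 : Fin (m + 1) → Xi)) := by
  convert (MeasurableEquiv.piFinSuccAbove (fun _ : Fin (m + 1) => Xi) 0).symm.measurableEmbedding
    using 1
  funext z
  exact (Fin.insertNth_zero' z.1 z.2).symm

instance {ι : Type} [Fintype ι] : SigmaFinite (kernelMeasure ι) := by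
  unfold kernelMeasure; infer_instance

theorem ae_isOscPow_slice {m : ℕ} {r : Fin m → ℝ} {r' : Fin (m + 1) → ℝ} (h0 : r' 0 = 0)
    (hr : ∀ i, r' i.succ = r i) {G K : Kernel (Fin (m + 1))} (h : IsOscPow r' G K) :
    ∀ᵐ ξ ∂xiMeasure, ∃ F L : Kernel (Fin m), IsOscPow r F L ∧
      (F =ᵐ[𝓚(m)] fun x => G (Fin.cons ξ x)) ∧ L =ᵐ[𝓚(m)] fun x => K (Fin.cons ξ x) := by
  have hG : MemLp (fun z : Xi × (Fin m → Xi) => G (Fin.cons z.1 z.2)) 2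
      (xiMeasure.prod 𝓚(m)) :=
    (Lp.memLp G).comp_measurePreserving (measurePreserving_cons m)
  have hK : MemLp (fun z : Xi × (Fin m → Xi) => K (Fin.cons z.1 z.2)) 2
      (xiMeasure.prod 𝓚(m)) :=
    (Lp.memLp K).comp_measurePreserving (measurePreserving_cons m)
  have hz : ∀ β : Fin m → Mode, ∀ᵐ ξ ∂xiMeasure, ∫ x, (modesFun β x : ℂ) * K (Fin.cons ξ x) ∂𝓚(m) -
        (oscWeight r β : ℂ) * ∫ x, (modesFun β x : ℂ) * G (Fin.cons ξ x) ∂𝓚(m)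
        = 0 := by
    intro β
    have hKL := memLp_integral_mul (memLp_modesFun β) hK
    have hGL := memLp_integral_mul (memLp_modesFun β) hG
    refine coeffTotal_modeFun _ (hKL.sub (hGL.const_mul (oscWeight r β : ℂ))) fun b => ?_
    have key : ∀ {V : Kernel (Fin (m + 1))} (hV : MemLp (fun z : Xi × (Fin m → Xi) =>
        V (Fin.cons z.1 z.2)) 2 (xiMeasure.prod 𝓚(m))),
        ∫ ξ, (modeFun b ξ : ℂ) * ∫ x, (modesFun β x : ℂ) * V (Fin.cons ξ x) ∂𝓚(m)
          ∂xiMeasure = inner ℂ (modesVec (Fin.cons b β : Fin (m + 1) → Mode)) V := by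
      intro V hV
      rw [inner_modesVec, ← (measurePreserving_cons m).integral_comp (measurableEmbedding_cons m),
        integral_prod]
      · refine integral_congr_forall fun ξ => ?_
        rw [← integral_const_mul]
        refine integral_congr_forall fun x => ?_
        simp only [modesFun, Fin.prod_univ_succ, Fin.cons_zero, Fin.cons_succ]
        push_cast; ring
      · have := (memLp_mul_prod (memLp_modeFun b) (memLp_modesFun β)).integrable_mul hV
        refine this.congr (Eventually.of_forall fun z => ?_)
        simp only [Pi.mul_apply, modesFun, Fin.prod_univ_succ, Fin.cons_zero, Fin.cons_succ]
        push_cast; ring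
    have i1 : Integrable (fun ξ => (modeFun b ξ : ℂ) * ∫ x, (modesFun β x : ℂ) *
        K (Fin.cons ξ x) ∂𝓚(m)) xiMeasure := (memLp_modeFun b).integrable_mul hKL
    have i2 : Integrable (fun ξ => (modeFun b ξ : ℂ) * ∫ x, (modesFun β x : ℂ) *
        G (Fin.cons ξ x) ∂𝓚(m)) xiMeasure := (memLp_modeFun b).integrable_mul hGL
    have hw : oscWeight r' (Fin.cons b β : Fin (m + 1) → Mode) = oscWeight r β := by
      simp [oscWeight, Fin.prod_univ_succ, h0, hr]
    calc _ = ∫ ξ, (modeFun b ξ : ℂ) * (∫ x, (modesFun β x : ℂ) * K (Fin.cons ξ x)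
              ∂𝓚(m)) - (oscWeight r β : ℂ) * ((modeFun b ξ : ℂ) *
            ∫ x, (modesFun β x : ℂ) * G (Fin.cons ξ x) ∂𝓚(m)) ∂xiMeasure := by
          refine integral_congr_forall fun ξ => ?_
          ring
      _ = 0 := by
          rw [integral_sub i1 (i2.const_mul _), integral_const_mul, key hK, key hG, h, hw, sub_self]
  filter_upwards [ae_all_iff.2 hz, hG.ae_memLp_left, hK.ae_memLp_left] with ξ h1 h2 h3
  refine ⟨h2.toLp, h3.toLp, fun β => ?_, h2.coeFn_toLp, h3.coeFn_toLp⟩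
  rw [inner_modesVec, inner_modesVec]
  have e1 : ∫ x, (modesFun β x : ℂ) * h3.toLp _ x ∂𝓚(m) =
      ∫ x, (modesFun β x : ℂ) * K (Fin.cons ξ x) ∂𝓚(m) := by
    refine integral_congr_ae ?_
    filter_upwards [h3.coeFn_toLp] with x hx
    rw [hx]
  have e2 : ∫ x, (modesFun β x : ℂ) * h2.toLp _ x ∂𝓚(m) =
      ∫ x, (modesFun β x : ℂ) * G (Fin.cons ξ x) ∂𝓚(m) := by
    refine integral_congr_ae ?_
    filter_upwards [h2.coeFn_toLp] with x hx
    rw [hx]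
  rw [e1, e2]
  exact sub_eq_zero.1 (h1 β)

/-! ### Configurations -/

/-- The configuration of `l` given particles. -/
abbrev mkP (l : ℕ) (x : Fin l → Xi) : Particles := ⟨l, x⟩

theorem measurableSet_particles_iff {s : Set Particles} :
    MeasurableSet s ↔ ∀ l, MeasurableSet (mkP l ⁻¹' s) := by
  rw [MeasurableSpace.measurableSet_iInf]; rfl

theorem mkP_injective (l : ℕ) : Function.Injective (mkP l) := fun _ _ h => by
  simpa [mkP] using h

theorem measurable_mkP (l : ℕ) : Measurable (mkP l) :=
  fun _ hs => measurableSet_particles_iff.1 hs l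

theorem measurable_particles {Z : Type*} [MeasurableSpace Z] {f : Particles → Z}
    (h : ∀ l, Measurable fun x : Fin l → Xi => f ⟨l, x⟩) : Measurable f := fun _ hs =>
  measurableSet_particles_iff.2 fun l => h l hs

theorem measurable_number : Measurable (Sigma.fst : Particles → ℕ) :=
  measurable_particles fun _ => measurable_const

theorem measurableEmbedding_mkP (l : ℕ) : MeasurableEmbedding (mkP l) where
  injective := (mkP_injective l)
  measurable := measurable_mkP l
  measurableSet_image' := fun s hs => by
    refine measurableSet_particles_iff.2 fun l' => ?_
    by_cases h : l = l'
    · subst h; rwa [preimage_image_eq _ (mkP_injective l)]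
    · convert MeasurableSet.empty
      ext x
      simp only [mem_preimage, mem_image, mem_empty_iff_false, iff_false]
      rintro ⟨z, -, hz⟩
      exact h (congrArg Sigma.fst hz)

theorem measurable_prod_particles {W Z : Type*} [MeasurableSpace W] [MeasurableSpace Z]
    {f : W × Particles → Z} (h : ∀ l, Measurable fun z : W × (Fin l → Xi) => f (z.1, ⟨l, z.2⟩)) :
    Measurable f := by
  intro s hs
  have : f ⁻¹' s = ⋃ l, (fun z : W × (Fin l → Xi) => (z.1, (⟨l, z.2⟩ : Particles))) ''
      ((fun z : W × (Fin l → Xi) => f (z.1, ⟨l, z.2⟩)) ⁻¹' s) := by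
    ext ⟨w, l, x⟩
    simp only [mem_preimage, mem_iUnion, mem_image, Prod.exists]
    constructor
    · intro h; exact ⟨l, w, x, h, rfl⟩
    · rintro ⟨l', w', x', h, he⟩; rw [← he]; exact h
  rw [this]
  refine MeasurableSet.iUnion fun l => ?_
  exact (MeasurableEmbedding.id.prodMap (measurableEmbedding_mkP l)).measurableSet_image' (h l hs)

theorem lintegral_particles {F : Particles → ℝ≥0∞} (hF : Measurable F) :
    ∫⁻ q, F q ∂particlesMeasure = ∑' l, ∫⁻ x, F ⟨l, x⟩ ∂𝓚(l) := by
  rw [particlesMeasure, lintegral_sum_measure]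
  refine tsum_congr fun l => ?_
  rw [lintegral_map hF (measurable_mkP l)]; rfl

instance : SigmaFinite particlesMeasure := by
  refine Measure.sigmaFinite_of_countable
    (S := range fun p : ℕ × ℕ => mkP p.1 ''
      (spanningSets (kernelMeasure (Fin p.1)) p.2)) (countable_range _) ?_ ?_
  · rintro _ ⟨⟨l, k⟩, rfl⟩
    have hm : MeasurableSet ((mkP l) ''
        (spanningSets 𝓚(l) k)) :=
      (measurableEmbedding_mkP l).measurableSet_image' (measurableSet_spanningSets _ _)
    rw [← lintegral_indicator_one hm, lintegral_particles (measurable_one.indicator hm),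
      tsum_eq_single l]
    · have : ∀ x : Fin l → Xi, ((mkP l) ''
        (spanningSets 𝓚(l) k)).indicator (1 : Particles → ℝ≥0∞) ⟨l, x⟩ =
          (spanningSets 𝓚(l) k).indicator 1 x := by
        intro x
        have hx : (⟨l, x⟩ : Particles) ∈ mkP l '' spanningSets 𝓚(l) k ↔
            x ∈ spanningSets 𝓚(l) k := (mkP_injective l).mem_set_image
        by_cases h : x ∈ spanningSets 𝓚(l) k
        · rw [indicator_of_mem (hx.2 h), indicator_of_mem h]; rfl
        · rw [indicator_of_notMem (fun h' => h (hx.1 h')), indicator_of_notMem h]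
      simp_rw [this]
      rw [lintegral_indicator_one (measurableSet_spanningSets _ _)]
      exact measure_spanningSets_lt_top _ _
    · intro l' hl'
      convert lintegral_zero with x
      refine indicator_of_notMem ?_ _
      rintro ⟨z, -, hz⟩
      exact hl' (congrArg Sigma.fst hz).symm
  · rw [sUnion_range, eq_univ_iff_forall]
    rintro ⟨l, x⟩
    have := iUnion_spanningSets 𝓚(l)
    obtain ⟨k, hk⟩ := mem_iUnion.1 (this.symm ▸ mem_univ x)
    exact mem_iUnion.2 ⟨(l, k), x, hk, rfl⟩

instance (n : ℕ) : SigmaFinite (configMeasure n) := by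
  unfold configMeasure; infer_instance

/-- Insert a particle at position `k`. -/
def insP (k : ℕ) (ξ : Xi) (q : Particles) : Particles :=
  ⟨q.1 + 1, (Fin.ofNat (q.1 + 1) k).insertNth ξ q.2⟩

/-- Remove the particle at position `k`. -/
def delP (k : ℕ) : Particles → Particles
  | ⟨0, x⟩ => ⟨0, x⟩
  | ⟨l + 1, x⟩ => ⟨l, (Fin.ofNat (l + 1) k).removeNth x⟩

/-- The particle at position `k`. -/
def getP (k : ℕ) : Particles → Xi
  | ⟨0, _⟩ => (0, false)
  | ⟨l + 1, x⟩ => x (Fin.ofNat (l + 1) k)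

theorem insP_zero (ξ : Xi) (q : Particles) : insP 0 ξ q = ⟨q.1 + 1, Fin.cons ξ q.2⟩ := by
  unfold insP
  congr 1
  exact Fin.insertNth_zero' ξ q.2

theorem delP_insP (k : ℕ) (ξ : Xi) (q : Particles) : delP k (insP k ξ q) = q := by
  obtain ⟨l, x⟩ := q
  simp [insP, delP]

theorem getP_insP (k : ℕ) (ξ : Xi) (q : Particles) : getP k (insP k ξ q) = ξ := by
  obtain ⟨l, x⟩ := q
  simp [insP, getP]

theorem insP_getP_delP (k : ℕ) {q : Particles} (h : 1 ≤ q.1) :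
    insP k (getP k q) (delP k q) = q := by
  obtain ⟨l | l, x⟩ := q
  · simp at h
  · simp only [insP, getP, delP, Fin.insertNth_self_removeNth]

theorem number_insP (k : ℕ) (ξ : Xi) (q : Particles) : (insP k ξ q).1 = q.1 + 1 := rfl

theorem number_delP (k : ℕ) (q : Particles) : (delP k q).1 = q.1 - 1 := by
  obtain ⟨l | l, x⟩ := q <;> simp [delP]

theorem measurable_insP (k : ℕ) : Measurable fun z : Xi × Particles => insP k z.1 z.2 := by
  refine measurable_prod_particles fun l => (measurable_mkP (l + 1)).comp ?_
  exact (MeasurableEquiv.piFinSuccAbove (fun _ : Fin (l + 1) => Xi) (Fin.ofNat (l + 1) k)).symm.measurable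

theorem measurable_delP (k : ℕ) : Measurable (delP k) := by
  refine measurable_particles fun l => ?_
  rcases l with _ | l
  · exact measurable_mkP 0
  · refine (measurable_mkP l).comp ?_
    exact measurable_pi_iff.2 fun _ => measurable_pi_apply _

theorem measurable_getP (k : ℕ) : Measurable (getP k) := by
  refine measurable_particles fun l => ?_
  rcases l with _ | l
  · exact measurable_const
  · exact measurable_pi_apply _

theorem lintegral_insP {F : Particles → ℝ≥0∞} (hF : Measurable F) (k : ℕ) :
    ∫⁻ q, (if k < q.1 then F q else 0) ∂particlesMeasure =
      ∫⁻ ξ, ∫⁻ q, (if k ≤ q.1 then F (insP k ξ q) else 0) ∂particlesMeasure ∂xiMeasure := by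
  have hm1 : Measurable fun q : Particles => if k < q.1 then F q else 0 :=
    Measurable.ite (measurable_number measurableSet_Ioi) hF measurable_const
  have hm2 : Measurable fun z : Xi × Particles => if k ≤ z.2.1 then F (insP k z.1 z.2) else 0 :=
    Measurable.ite ((measurable_number.comp measurable_snd) measurableSet_Ici)
      (hF.comp (measurable_insP k)) measurable_const
  rw [lintegral_particles hm1, tsum_eq_zero_add' ENNReal.summable]
  have h1 : ∀ ξ, ∫⁻ q, (if k ≤ q.1 then F (insP k ξ q) else 0) ∂particlesMeasure =
      ∑' l, ∫⁻ x, (if k ≤ l then F (insP k ξ ⟨l, x⟩) else 0) ∂𝓚(l) := fun ξ =>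
    lintegral_particles (hm2.comp measurable_prodMk_left)
  simp_rw [h1]
  rw [lintegral_tsum]
  · simp only [_root_.not_lt_zero, if_false, lintegral_zero, zero_add]
    refine tsum_congr fun l => ?_
    by_cases hl : k ≤ l
    · have hl' : k < l + 1 := Nat.lt_succ_of_le hl
      simp only [hl, hl', if_true]
      have hp := (measurePreserving_piFinSuccAbove (fun _ : Fin (l + 1) => xiMeasure)
        (Fin.ofNat (l + 1) k)).symm
      refine (hp.lintegral_comp (hF.comp (measurable_mkP (l + 1)))).symm.trans ?_
      rw [lintegral_prod]
      · rfl
      · exact ((hF.comp (measurable_mkP (l + 1))).comp (MeasurableEquiv.measurable _)).aemeasurable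
    · have hl' : ¬ k < l + 1 := by omega
      simp [hl, hl']
  · intro l
    refine (Measurable.lintegral_prod_right' (f := fun z : Xi × (Fin l → Xi) =>
      (if k ≤ l then F (insP k z.1 ⟨l, z.2⟩) else 0 : ℝ≥0∞)) ?_).aemeasurable
    exact hm2.comp (measurable_fst.prodMk ((measurable_mkP l).comp measurable_snd))

/-- Configurations of `n` species of particles. -/
abbrev Conf (n : ℕ) : Type := Fin n → Particles

local notation "𝓞(" n ")" => Fin (n + 1) → ℕ

local notation "𝓕(" n ")" => Conf (n + 1) → ℂ

/-- Insert a particle of species `i` at position `k`. -/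
def insY {n : ℕ} (i : Fin n) (k : ℕ) (ξ : Xi) (y : Conf n) : Conf n :=
  Function.update y i (insP k ξ (y i))

/-- Remove the particle of species `i` at position `k`. -/
def delY {n : ℕ} (i : Fin n) (k : ℕ) (y : Conf n) : Conf n :=
  Function.update y i (delP k (y i))

theorem insY_same {n : ℕ} (i : Fin n) (k : ℕ) (ξ : Xi) (y : Conf n) :
    insY i k ξ y i = insP k ξ (y i) := by simp [insY]

theorem insY_ne {n : ℕ} {i j : Fin n} (h : j ≠ i) (k : ℕ) (ξ : Xi) (y : Conf n) :
    insY i k ξ y j = y j := by simp [insY, h]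

theorem insY_comm {n : ℕ} {i j : Fin n} (h : i ≠ j) (k l : ℕ) (ξ η : Xi) (y : Conf n) :
    insY i k ξ (insY j l η y) = insY j l η (insY i k ξ y) := by
  rw [insY, insY_ne h, insY, insY, insY_ne h.symm, insY, Function.update_comm h.symm]

theorem delY_insY {n : ℕ} (i : Fin n) (k : ℕ) (ξ : Xi) (y : Conf n) :
    delY i k (insY i k ξ y) = y := by
  simp [delY, insY, delP_insP]

theorem insY_delY {n : ℕ} (i : Fin n) (k : ℕ) {y : Conf n} (h : 1 ≤ (y i).1) :
    insY i k (getP k (y i)) (delY i k y) = y := by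
  simp [delY, insY, insP_getP_delP k h]

theorem measurable_numY {n : ℕ} (i : Fin n) : Measurable fun y : Conf n => (y i).1 :=
  measurable_number.comp (measurable_pi_apply i)

theorem measurable_insY {n : ℕ} (i : Fin n) (k : ℕ) :
    Measurable fun z : Xi × Conf n => insY i k z.1 z.2 := by
  refine measurable_pi_iff.2 fun j => ?_
  by_cases h : j = i
  · subst h
    simp_rw [insY_same]
    exact (measurable_insP k).comp
      (measurable_fst.prodMk ((measurable_pi_apply j).comp measurable_snd))
  · simp_rw [insY_ne h]
    exact (measurable_pi_apply j).comp measurable_snd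

theorem measurable_delY {n : ℕ} (i : Fin n) (k : ℕ) : Measurable (delY i k : Conf n → Conf n) := by
  refine measurable_pi_iff.2 fun j => ?_
  by_cases h : j = i
  · subst h
    simp only [delY, Function.update_self]
    exact (measurable_delP k).comp (measurable_pi_apply j)
  · simp only [delY, ne_eq, h, not_false_eq_true, Function.update_of_ne]
    exact measurable_pi_apply j

theorem lintegral_conf {n : ℕ} (i : Fin (n + 1)) {F : Conf (n + 1) → ℝ≥0∞} (hF : Measurable F) :
    ∫⁻ y, F y ∂𝓒(n) = ∫⁻ y', ∫⁻ q, F (i.insertNth q y') ∂particlesMeasure ∂configMeasure n := by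
  have hp := (measurePreserving_piFinSuccAbove (fun _ : Fin (n + 1) => particlesMeasure) i).symm
  rw [configMeasure, ← hp.lintegral_comp hF]
  exact lintegral_prod_symm' _ (hF.comp (MeasurableEquiv.measurable _))

theorem lintegral_insY {n : ℕ} (i : Fin (n + 1)) (k : ℕ) {F : Conf (n + 1) → ℝ≥0∞}
    (hF : Measurable F) : ∫⁻ y, (if k < (y i).1 then F y else 0) ∂𝓒(n) =
      ∫⁻ ξ, ∫⁻ y, (if k ≤ (y i).1 then F (insY i k ξ y) else 0) ∂𝓒(n) ∂xiMeasure := by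
  have hm1 : Measurable fun y : Conf (n + 1) => if k < (y i).1 then F y else 0 :=
    Measurable.ite (measurable_numY i measurableSet_Ioi) hF measurable_const
  have hm2 : Measurable fun z : Xi × Conf (n + 1) =>
      if k ≤ (z.2 i).1 then F (insY i k z.1 z.2) else 0 :=
    Measurable.ite (((measurable_numY i).comp measurable_snd) measurableSet_Ici)
      (hF.comp (measurable_insY i k)) measurable_const
  have he : Measurable fun z : Particles × Conf n => i.insertNth (α := fun _ => Particles) z.1 z.2 :=
    (MeasurableEquiv.piFinSuccAbove (fun _ : Fin (n + 1) => Particles) i).symm.measurable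
  have hins : ∀ ξ q (y' : Conf n), insY i k ξ (i.insertNth (α := fun _ => Particles) q y') =
      i.insertNth (α := fun _ => Particles) (insP k ξ q) y' := by
    intro ξ q y'
    simp [insY]
  rw [lintegral_conf i hm1]
  have h1 : ∀ ξ, ∫⁻ y, (if k ≤ (y i).1 then F (insY i k ξ y) else 0) ∂𝓒(n) =
      ∫⁻ y', ∫⁻ q, (if k ≤ q.1 then F (i.insertNth (insP k ξ q) y') else 0)
        ∂particlesMeasure ∂configMeasure n := by
    intro ξ
    refine (lintegral_conf i (hm2.comp measurable_prodMk_left)).trans ?_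
    simp [hins]
  simp_rw [h1]
  refine Eq.trans ?_ (lintegral_lintegral_swap ?_).symm
  · refine lintegral_congr fun y' => ?_
    have := lintegral_insP (F := fun q => F (i.insertNth q y'))
      (hF.comp (he.comp measurable_prodMk_right)) k
    simpa using this
  · refine Measurable.aemeasurable ?_
    refine Measurable.lintegral_prod_right' (f := fun w : (Xi × Conf n) × Particles =>
      if k ≤ w.2.1 then F (i.insertNth (insP k w.1.1 w.2) w.1.2) else 0) ?_
    refine Measurable.ite ((measurable_number.comp measurable_snd) measurableSet_Ici) ?_
      measurable_const
    have h2 : Measurable fun w : (Xi × Conf n) × Particles => insP k w.1.1 w.2 :=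
      (measurable_insP k).comp (measurable_fst.fst.prodMk measurable_snd)
    exact hF.comp (he.comp (h2.prodMk measurable_fst.snd))

theorem measurePreserving_insY {n : ℕ} (i : Fin (n + 1)) (k : ℕ) :
    MeasurePreserving (fun z : Xi × Conf (n + 1) => insY i k z.1 z.2)
      ((xiMeasure.prod 𝓒(n)).restrict {z | k ≤ (z.2 i).1}) (𝓒(n).restrict {y | k < (y i).1}) := by
  refine ⟨measurable_insY i k, Measure.ext_of_lintegral _ fun F hF => ?_⟩
  have hs1 : MeasurableSet {z : Xi × Conf (n + 1) | k ≤ (z.2 i).1} :=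
    ((measurable_numY i).comp measurable_snd) measurableSet_Ici
  have hs2 : MeasurableSet {y : Conf (n + 1) | k < (y i).1} := measurable_numY i measurableSet_Ioi
  rw [lintegral_map hF (measurable_insY i k), ← lintegral_indicator hs1, ← lintegral_indicator hs2]
  refine (lintegral_prod _ ((hF.comp (measurable_insY i k)).indicator hs1).aemeasurable).trans ?_
  refine Eq.trans ?_ ((lintegral_insY i k hF).symm.trans ?_)
  · simp only [indicator_apply, mem_ofPred_eq, Function.comp_apply]
  · simp only [indicator_apply, mem_ofPred_eq]

theorem measurePreserving_delY {n : ℕ} (i : Fin (n + 1)) (k : ℕ) :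
    MeasurePreserving (fun y : Conf (n + 1) => (getP k (y i), delY i k y))
      (𝓒(n).restrict {y | k < (y i).1}) ((xiMeasure.prod 𝓒(n)).restrict {z | k ≤ (z.2 i).1}) := by
  have hD : Measurable fun y : Conf (n + 1) => (getP k (y i), delY i k y) :=
    ((measurable_getP k).comp (measurable_pi_apply i)).prodMk (measurable_delY i k)
  refine ⟨hD, ?_⟩
  rw [← (measurePreserving_insY i k).map_eq, Measure.map_map hD (measurable_insY i k)]
  convert Measure.map_id
  funext z
  simp [insY_same, getP_insP, delY_insY]

theorem quasiMeasurePreserving_insY {n : ℕ} (i : Fin (n + 1)) :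
    Measure.QuasiMeasurePreserving (fun z : Xi × Conf (n + 1) => insY i 0 z.1 z.2)
      (xiMeasure.prod 𝓒(n)) 𝓒(n) := by
  have h := (measurePreserving_insY i 0).quasiMeasurePreserving
  have hu : {z : Xi × Conf (n + 1) | 0 ≤ (z.2 i).1} = univ := by ext; simp
  rw [hu, Measure.restrict_univ] at h
  exact h.mono_right Measure.absolutelyContinuous_restrict

/-! ### Antisymmetry -/

/-- Antisymmetry, with the permuted species written out. -/
def Anti {n : ℕ} (f : Conf n → ℂ) : Prop :=
  ∀ (y : Conf n) (i : Fin n) (l : ℕ) (x : Fin l → Xi) (π : Equiv.Perm (Fin l)),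
    f (Function.update y i ⟨l, x ∘ π⟩) =
      ((Equiv.Perm.sign π : ℤ) : ℂ) * f (Function.update y i ⟨l, x⟩)

theorem antisymmetric_iff {n : ℕ} {f : Conf n → ℂ} : Antisymmetric f ↔ Anti f := by
  constructor
  · intro h y i l x π
    have key : ∀ (z : Conf n) (q : Particles), z i = q → ∀ π : Equiv.Perm (Fin q.1),
        f (Function.update z i ⟨q.1, q.2 ∘ π⟩) = ((Equiv.Perm.sign π : ℤ) : ℂ) * f z := by
      rintro z q rfl π
      exact h z i π
    have := key (Function.update y i ⟨l, x⟩) ⟨l, x⟩ (by simp) π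
    simpa using this
  · intro h y i π
    have := h y i (y i).1 (y i).2 π
    rw [this]
    congr 2
    exact Function.update_eq_self i y

theorem Anti.insertion {n : ℕ} {f : Conf n → ℂ} (hf : Anti f) (i : Fin n) {k : ℕ} (ξ : Xi) {y : Conf n}
    (hk : k ≤ (y i).1) : f (insY i k ξ y) = (-1) ^ k * f (insY i 0 ξ y) := by
  have h := hf y i ((y i).1 + 1) (Fin.cons ξ (y i).2) (Fin.ofNat ((y i).1 + 1) k).cycleRange
  have h2 : (Fin.cons ξ (y i).2 : Fin ((y i).1 + 1) → Xi) ∘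
      (Fin.ofNat ((y i).1 + 1) k).cycleRange = (Fin.ofNat ((y i).1 + 1) k).insertNth ξ (y i).2 :=
    Fin.cons_comp_cycleRange _ _ _
  rw [h2, Fin.sign_cycleRange] at h
  have h3 : (Fin.ofNat ((y i).1 + 1) k : ℕ) = k := by
    simp [Fin.ofNat, Nat.mod_eq_of_lt (Nat.lt_succ_of_le hk)]
  rw [h3] at h
  unfold insY
  rw [insP_zero]
  refine h.trans ?_
  push_cast
  rfl

theorem decomposeFin_symm_zero_apply {l : ℕ} (π : Equiv.Perm (Fin l)) (ξ : Xi) (x : Fin l → Xi) :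
    (Fin.cons ξ x : Fin (l + 1) → Xi) ∘ (Equiv.Perm.decomposeFin.symm (0, π)) =
      Fin.cons ξ (x ∘ π) := by
  funext a
  refine Fin.cases ?_ (fun a => ?_) a
  · simp
  · simp [Equiv.Perm.decomposeFin_symm_apply_succ]

theorem sign_decomposeFin_symm_zero {l : ℕ} (π : Equiv.Perm (Fin l)) :
    Equiv.Perm.sign (Equiv.Perm.decomposeFin.symm ((0 : Fin (l + 1)), π)) = Equiv.Perm.sign π := by
  simp

theorem update_insY {n : ℕ} {i j : Fin n} (h : j ≠ i) (k : ℕ) (ξ : Xi) (y : Conf n) (q : Particles) :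
    insY i k ξ (Function.update y j q) = Function.update (insY i k ξ y) j q := by
  unfold insY
  rw [Function.update_of_ne h.symm, Function.update_comm h]

theorem update_delY {n : ℕ} {i j : Fin n} (h : j ≠ i) (k : ℕ) (y : Conf n) (q : Particles) :
    delY i k (Function.update y j q) = Function.update (delY i k y) j q := by
  unfold delY
  rw [Function.update_of_ne h.symm, Function.update_comm h]

/-- The sign that makes the operators of different species anticommute. -/
def jw {n : ℕ} (i : Fin n) (y : Conf n) : ℂ := (-1) ^ (∑ j ∈ Finset.univ.filter (· < i), (y j).1)

theorem jw_congr {n : ℕ} {i : Fin n} {y z : Conf n} (h : ∀ j < i, (y j).1 = (z j).1) :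
    jw i y = jw i z := by
  unfold jw
  congr 1
  exact Finset.sum_congr rfl fun j hj => h j (by simpa using hj)

theorem jw_sq {n : ℕ} (i : Fin n) (y : Conf n) : jw i y * jw i y = 1 := by
  unfold jw
  rw [← pow_add, ← two_mul, pow_mul]; simp

theorem norm_jw {n : ℕ} (i : Fin n) (y : Conf n) : ‖jw i y‖ = 1 := by simp [jw]

theorem conj_jw {n : ℕ} (i : Fin n) (y : Conf n) : conj (jw i y) = jw i y := by
  simp [jw]

theorem jw_insY {n : ℕ} (i : Fin n) {j : Fin n} (k : ℕ) (ξ : Xi) (y : Conf n) :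
    jw i (insY j k ξ y) = if j < i then - jw i y else jw i y := by
  split_ifs with h
  · unfold jw
    rw [← Finset.add_sum_erase _ _ (show j ∈ Finset.univ.filter (· < i) by simpa using h),
      ← Finset.add_sum_erase _ _ (show j ∈ Finset.univ.filter (· < i) by simpa using h)]
    rw [insY_same, number_insP, Finset.sum_congr rfl (g := fun a => (y a).1)]
    · ring
    · intro a ha
      rw [insY_ne (Finset.ne_of_mem_erase ha)]
  · exact jw_congr fun a ha => by
      rw [insY_ne]; rintro rfl; exact h ha

theorem annih_eq {n : ℕ} (i : Fin n) (ξ : Xi) (f : Conf n → ℂ) (y : Conf n) :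
    annih i ξ f y = jw i y * (Real.sqrt ((y i).1 + 1) : ℂ) * f (insY i 0 ξ y) := by
  simp only [annih, jw, insY, insP_zero]

theorem update_number {n : ℕ} (y : Conf n) (j : Fin n) {l : ℕ} (x x' : Fin l → Xi) (a : Fin n) :
    (Function.update y j (⟨l, x⟩ : Particles) a).1 =
      (Function.update y j (⟨l, x'⟩ : Particles) a).1 := by
  by_cases h : a = j
  · subst h; simp
  · simp [h]

theorem Anti.annihilate {n : ℕ} {f : Conf n → ℂ} (hf : Anti f) (i : Fin n) (ξ : Xi) :
    Anti (annih i ξ f) := by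
  intro y j l x π
  rw [annih_eq, annih_eq, jw_congr fun a _ => update_number y j (x ∘ π) x a,
    update_number y j (x ∘ π) x i]
  have : f (insY i 0 ξ (Function.update y j ⟨l, x ∘ π⟩)) =
      ((Equiv.Perm.sign π : ℤ) : ℂ) * f (insY i 0 ξ (Function.update y j ⟨l, x⟩)) := by
    by_cases h : j = i
    · subst h
      have h2 := hf y j (l + 1) (Fin.cons ξ x) (Equiv.Perm.decomposeFin.symm (0, π))
      rw [decomposeFin_symm_zero_apply, sign_decomposeFin_symm_zero] at h2
      simpa [insY, insP_zero] using h2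
    · rw [update_insY h, update_insY h, hf]
  rw [this]; ring

theorem annih_comm {n : ℕ} {i j : Fin n} (h : i ≠ j) (ξ η : Xi) (f : Conf n → ℂ) :
    annih i ξ (annih j η f) = -annih j η (annih i ξ f) := by
  funext y
  simp only [annih_eq, Pi.neg_apply, jw_insY, insY_ne h, insY_ne h.symm]
  rw [insY_comm h]
  rcases lt_or_gt_of_ne h with h' | h'
  · simp only [h', h'.not_gt, if_true, if_false]; ring
  · simp only [h', h'.not_gt, if_true, if_false]; ring

theorem insP_one_insP_zero (ξ η : Xi) (q : Particles) :
    insP 1 ξ (insP 0 η q) = insP 0 η (insP 0 ξ q) := by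
  obtain ⟨l, x⟩ := q
  rw [insP_zero, insP_zero, insP_zero]
  unfold insP
  congr 1
  have : Fin.ofNat (l + 1 + 1) 1 = (0 : Fin (l + 1)).succ := by
    ext; simp [Fin.ofNat]
  simp only [this]
  rw [Fin.insertNth_eq_iff]
  refine ⟨by simp, ?_⟩
  funext a
  refine Fin.cases ?_ (fun a => ?_) a
  · simp [Fin.removeNth]
  · simp [Fin.removeNth]

theorem Anti.annih_comm {n : ℕ} {f : Conf n → ℂ} (hf : Anti f) (i : Fin n) (ξ η : Xi) :
    annih i ξ (annih i η f) = -annih i η (annih i ξ f) := by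
  funext y
  have h1 := hf.insertion i (k := 1) ξ (y := insY i 0 η y) (by
    rw [insY_same, number_insP]; omega)
  have h2 : insY i 1 ξ (insY i 0 η y) = insY i 0 η (insY i 0 ξ y) := by
    rw [insY, insY_same, insP_one_insP_zero]
    simp [insY]
  rw [h2] at h1
  simp only [annih_eq, Pi.neg_apply, jw_insY, insY_same, number_insP, lt_irrefl, if_false, h1]
  ring

/-! ### Creation operators -/

/-- The smeared creation operator `∫ g(ξ) b_i^*(ξ) dξ`. -/
def cre {n : ℕ} (i : Fin n) (g : Xi → ℂ) (f : Conf n → ℂ) (y : Conf n) : ℂ :=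
  jw i y * (Real.sqrt (y i).1 : ℂ)⁻¹ *
    ∑ k ∈ Finset.range (y i).1, (-1) ^ k * (g (getP k (y i)) * f (delY i k y))

theorem getP_succ_insP_zero {k : ℕ} (ξ : Xi) {q : Particles} (h : k < q.1) :
    getP (k + 1) (insP 0 ξ q) = getP k q := by
  obtain ⟨l | l, x⟩ := q
  · simp at h
  · have h' : k < l + 1 := h
    rw [insP_zero]
    have : Fin.ofNat (l + 1 + 1) (k + 1) = (Fin.ofNat (l + 1) k).succ := by
      ext; simp [Fin.ofNat, Nat.mod_eq_of_lt h', Nat.mod_eq_of_lt (Nat.succ_lt_succ h')]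
    simp only [getP, this, Fin.cons_succ]

theorem delP_succ_insP_zero {k : ℕ} (ξ : Xi) {q : Particles} (h : k < q.1) :
    delP (k + 1) (insP 0 ξ q) = insP 0 ξ (delP k q) := by
  obtain ⟨l | l, x⟩ := q
  · simp at h
  · have h' : k < l + 1 := h
    rw [insP_zero, insP_zero]
    have : Fin.ofNat (l + 1 + 1) (k + 1) = (Fin.ofNat (l + 1) k).succ := by
      ext; simp [Fin.ofNat, Nat.mod_eq_of_lt h', Nat.mod_eq_of_lt (Nat.succ_lt_succ h')]
    simp only [delP, this]
    congr 1
    funext a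
    refine Fin.cases ?_ (fun a => ?_) a
    · simp [Fin.removeNth]
    · simp [Fin.removeNth]

/-- The canonical anticommutation relation. -/
theorem annih_cre_same {n : ℕ} (i : Fin n) (ξ : Xi) (g : Xi → ℂ) (f : Conf n → ℂ) (y : Conf n) :
    annih i ξ (cre i g f) y = g ξ * f y - cre i g (annih i ξ f) y := by
  rw [annih_eq, cre, cre, jw_insY, insY_same, number_insP]
  simp only [lt_irrefl, if_false]
  have hs : (Real.sqrt ((y i).1 + 1) : ℂ) * ((Real.sqrt (((y i).1 + 1 : ℕ) : ℝ) : ℂ))⁻¹ = 1 := by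
    push_cast
    refine mul_inv_cancel₀ ?_
    have : (0 : ℝ) < (y i).1 + 1 := by positivity
    exact_mod_cast (Real.sqrt_pos.2 this).ne'
  rw [Finset.sum_range_succ']
  have h0 : (-1 : ℂ) ^ 0 * (g (getP 0 (insP 0 ξ (y i))) * f (delY i 0 (insY i 0 ξ y))) = g ξ * f y := by
    rw [getP_insP, delY_insY]; simp
  rw [h0]
  have h1 : ∑ k ∈ Finset.range (y i).1, (-1 : ℂ) ^ (k + 1) *
      (g (getP (k + 1) (insP 0 ξ (y i))) * f (delY i (k + 1) (insY i 0 ξ y))) =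
      -(jw i y * (Real.sqrt (y i).1 : ℂ)⁻¹ * ∑ k ∈ Finset.range (y i).1, (-1 : ℂ) ^ k *
        (g (getP k (y i)) * annih i ξ f (delY i k y))) := by
    rw [Finset.mul_sum, ← Finset.sum_neg_distrib]
    refine Finset.sum_congr rfl fun k hk => ?_
    have hk' : k < (y i).1 := Finset.mem_range.1 hk
    have h2 : delY i (k + 1) (insY i 0 ξ y) = insY i 0 ξ (delY i k y) := by
      simp [delY, insY, delP_succ_insP_zero ξ hk']
    have h3 : jw i (delY i k y) = jw i y := jw_congr fun j hj => by
      rw [delY, Function.update_of_ne hj.ne]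
    have h4 : (delY i k y i).1 + 1 = (y i).1 := by
      rw [delY, Function.update_self, number_delP]; omega
    have h5 : (Real.sqrt ((delY i k y i).1 + 1) : ℂ) = (Real.sqrt (y i).1 : ℂ) := by
      rw [← h4]; push_cast; rfl
    have h6 : (Real.sqrt (y i).1 : ℂ)⁻¹ * (Real.sqrt (y i).1 : ℂ) = 1 := by
      refine inv_mul_cancel₀ ?_
      have : (0 : ℝ) < (y i).1 := by exact_mod_cast (by omega : 0 < (y i).1)
      exact_mod_cast (Real.sqrt_pos.2 this).ne'
    rw [annih_eq, getP_succ_insP_zero ξ hk', h2, h3, h5, pow_succ]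
    linear_combination ((-1 : ℂ) ^ k * g (getP k (y i)) * f (insY i 0 ξ (delY i k y))) *
      ((Real.sqrt (y i).1 : ℂ)⁻¹ * (Real.sqrt (y i).1 : ℂ) * jw_sq i y + h6)
  rw [h1]
  linear_combination (g ξ * f y - jw i y * (Real.sqrt (y i).1 : ℂ)⁻¹ *
    ∑ k ∈ Finset.range (y i).1, (-1 : ℂ) ^ k * (g (getP k (y i)) * annih i ξ f (delY i k y))) *
      ((Real.sqrt ((y i).1 + 1) : ℂ) * ((Real.sqrt (((y i).1 + 1 : ℕ) : ℝ) : ℂ))⁻¹ * jw_sq i y + hs)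

theorem annih_cre_zero {n : ℕ} {j : Fin (n + 1)} (h : j ≠ 0) (ξ : Xi) (g : Xi → ℂ)
    (f : 𝓕(n)) : annih j ξ (cre 0 g f) = -cre 0 g (annih j ξ f) := by
  funext y
  have h00 : ∀ z : Conf (n + 1), jw 0 z = 1 := fun z => by simp [jw]
  rw [annih_eq, Pi.neg_apply, cre, cre, h00, h00, insY_ne h.symm, Finset.mul_sum, Finset.mul_sum,
    Finset.mul_sum, ← Finset.sum_neg_distrib]
  refine Finset.sum_congr rfl fun k hk => ?_
  have hk' : k < (y 0).1 := Finset.mem_range.1 hk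
  have h1 : y = insY 0 k (getP k (y 0)) (delY 0 k y) := (insY_delY 0 k (by omega)).symm
  have h2 : jw j y = -jw j (delY 0 k y) := by
    conv_lhs => rw [h1]
    rw [jw_insY, if_pos (Fin.pos_of_ne_zero h)]
  have h3 : delY 0 k (insY j 0 ξ y) = insY j 0 ξ (delY 0 k y) := by
    unfold insY
    rw [update_delY h]
    congr 2
    rw [delY, Function.update_of_ne h]
  rw [annih_eq, h3, h2]
  have h4 : delY 0 k y j = y j := by rw [delY, Function.update_of_ne h]
  rw [h4]
  ring

theorem Anti.create {n : ℕ} {f : Conf n → ℂ} (hf : Anti f) (i : Fin n) (g : Xi → ℂ) :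
    Anti (cre i g f) := by
  intro y j l x π
  have hj : jw i (Function.update y j ⟨l, x ∘ π⟩) = jw i (Function.update y j ⟨l, x⟩) :=
    jw_congr fun a _ => update_number y j (x ∘ π) x a
  rw [cre, cre, hj, update_number y j (x ∘ π) x i]
  by_cases h : j = i
  · subst h
    rw [mul_left_comm]
    congr 1
    simp only [Function.update_self]
    rw [Finset.sum_range, Finset.sum_range, Finset.mul_sum]
    rcases l with _ | l
    · simp
    set A : (Fin (l + 1) → Xi) → ℂ := fun z => g (z 0) * f (Function.update y j ⟨l, fun a => z a.succ⟩)
      with hA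
    have hAρ : ∀ (z : Fin (l + 1) → Xi) (ρ : Equiv.Perm (Fin (l + 1))), ρ 0 = 0 →
        A (z ∘ ρ) = ((Equiv.Perm.sign ρ : ℤ) : ℂ) * A z := by
      intro z ρ hρ
      obtain ⟨⟨p, π'⟩, rfl⟩ := Equiv.Perm.decomposeFin.symm.surjective ρ
      have hp : p = 0 := by simpa using hρ
      subst hp
      rw [sign_decomposeFin_symm_zero]
      have h2 := hf y j l (fun a => z a.succ) π'
      have h3 : (fun a : Fin l => (z ∘ (Equiv.Perm.decomposeFin.symm ((0 : Fin (l + 1)), π'))) a.succ)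
          = (fun a => z a.succ) ∘ π' := by
        funext a; simp [Equiv.Perm.decomposeFin_symm_apply_succ]
      simp only [hA]
      rw [h3, h2, Function.comp_apply, hρ]
      ring
    have hterm : ∀ (z : Fin (l + 1) → Xi) (k : Fin (l + 1)),
        (-1 : ℂ) ^ (k : ℕ) * (g (getP k ⟨l + 1, z⟩) *
          f (delY j k (Function.update y j ⟨l + 1, z⟩))) =
        ((Equiv.Perm.sign k.cycleRange : ℤ) : ℂ) * A (z ∘ k.cycleRange.symm) := by
      intro z k
      have hk : Fin.ofNat (l + 1) (k : ℕ) = k := by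
        ext; simp [Fin.ofNat, Nat.mod_eq_of_lt k.2]
      rw [Fin.sign_cycleRange]
      simp only [hA, delY, Function.update_self, delP, getP, Function.update_idem,
        Function.comp_apply, Fin.cycleRange_symm_zero, Fin.cycleRange_symm_succ, hk]
      push_cast
      rfl
    simp_rw [hterm]
    rw [← Equiv.sum_comp π (fun k => ((Equiv.Perm.sign π : ℤ) : ℂ) *
      (((Equiv.Perm.sign k.cycleRange : ℤ) : ℂ) * A (x ∘ k.cycleRange.symm)))]
    refine Finset.sum_congr rfl fun k _ => ?_
    set ρ : Equiv.Perm (Fin (l + 1)) := (π k).cycleRange * π * k.cycleRange.symm with hρ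
    have hρ0 : ρ 0 = 0 := by
      simp [hρ, Equiv.Perm.mul_apply, Fin.cycleRange_symm_zero]
    have hcomp : (x ∘ π) ∘ k.cycleRange.symm = (x ∘ (π k).cycleRange.symm) ∘ ρ := by
      funext a; simp [hρ]
    rw [hcomp, hAρ _ _ hρ0]
    have hsg : Equiv.Perm.sign ρ = Equiv.Perm.sign (π k).cycleRange * Equiv.Perm.sign π *
        Equiv.Perm.sign k.cycleRange := by
      simp [hρ, Equiv.Perm.sign_symm]
    have hsq : (Equiv.Perm.sign k.cycleRange : ℤ) * (Equiv.Perm.sign k.cycleRange : ℤ) = 1 := by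
      rw [← Units.val_mul, Int.units_mul_self]; rfl
    have hsq' : (((Equiv.Perm.sign k.cycleRange : ℤ) : ℂ)) * ((Equiv.Perm.sign k.cycleRange : ℤ) : ℂ) = 1 := by
      exact_mod_cast hsq
    rw [hsg]
    push_cast
    linear_combination (((Equiv.Perm.sign (π k).cycleRange : ℤ) : ℂ) * ((Equiv.Perm.sign π : ℤ) : ℂ) *
      A (x ∘ (π k).cycleRange.symm)) * hsq'
  · rw [mul_left_comm]
    congr 1
    rw [Finset.mul_sum]
    refine Finset.sum_congr ?_ fun k _ => ?_
    · rw [Function.update_of_ne (Ne.symm h)]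
    · rw [update_delY h, update_delY h, hf, Function.update_of_ne (Ne.symm h),
        Function.update_of_ne (Ne.symm h)]
      ring

/-- The numbers of particles of the species. -/
def num {n : ℕ} (y : Conf n) (i : Fin n) : ℕ := (y i).1

theorem measurable_num {n : ℕ} : Measurable (num : Conf n → Fin n → ℕ) :=
  measurable_pi_iff.2 fun i => measurable_numY i

theorem num_insY {n : ℕ} (i : Fin n) (k : ℕ) (ξ : Xi) (y : Conf n) :
    num (insY i k ξ y) = num y + Pi.single i 1 := by
  funext j
  by_cases h : j = i
  · subst h; simp [num, insY_same, number_insP]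
  · simp [num, insY_ne h, h]

theorem measurable_comp_num {n : ℕ} {Z : Type*} [MeasurableSpace Z] (w : (Fin n → ℕ) → Z) :
    Measurable fun y : Conf n => w (num y) :=
  (Measurable.of_discrete (f := w)).comp measurable_num

theorem measurable_jw {n : ℕ} (i : Fin n) : Measurable (jw i : Conf n → ℂ) :=
  measurable_comp_num fun N => (-1 : ℂ) ^ (∑ j ∈ Finset.univ.filter (· < i), N j)

theorem enorm_annih_sq {n : ℕ} (i : Fin n) (ξ : Xi) (f : Conf n → ℂ) (y : Conf n) :
    ‖annih i ξ f y‖ₑ ^ 2 = ((y i).1 + 1) * ‖f (insY i 0 ξ y)‖ₑ ^ 2 := by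
  have h : ‖jw i y‖ₑ = 1 := by rw [← ofReal_norm, norm_jw]; simp
  rw [annih_eq, enorm_mul, enorm_mul, h, one_mul, mul_pow]
  congr 1
  rw [← ofReal_norm, ← ENNReal.ofReal_pow (norm_nonneg _), Complex.norm_real, Real.norm_eq_abs,
    sq_abs, Real.sq_sqrt (by positivity)]
  rw [ENNReal.ofReal_add (by positivity) zero_le_one]
  simp

theorem measurable_annih_coef {n : ℕ} (i : Fin n) :
    Measurable fun y : Conf n => jw i y * (Real.sqrt ((y i).1 + 1) : ℂ) :=
  (measurable_jw i).mul (measurable_comp_num fun N => ((Real.sqrt (N i + 1) : ℝ) : ℂ))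

section
variable {n : ℕ}

theorem aestronglyMeasurable_annih_param {Z : Type*} [MeasurableSpace Z] {ζ : Measure Z} [SFinite ζ]
    (i : Fin (n + 1)) {F : Z × Conf (n + 1) → ℂ} (hF : AEStronglyMeasurable F (ζ.prod 𝓒(n))) :
    AEStronglyMeasurable (fun w : (Z × Xi) × Conf (n + 1) =>
      annih i w.1.2 (fun y => F (w.1.1, y)) w.2) ((ζ.prod xiMeasure).prod 𝓒(n)) := by
  have h1 : Measure.QuasiMeasurePreserving
      (Prod.map id (fun z : Xi × Conf (n + 1) => insY i 0 z.1 z.2))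
      (ζ.prod (xiMeasure.prod 𝓒(n))) (ζ.prod 𝓒(n)) := by
    refine ⟨measurable_id.prodMap (measurable_insY i 0), ?_⟩
    rw [← Measure.map_prod_map _ _ measurable_id (measurable_insY i 0), Measure.map_id]
    exact (Measure.AbsolutelyContinuous.refl ζ).prod (quasiMeasurePreserving_insY i).absolutelyContinuous
  have h2 := (measurePreserving_prodAssoc ζ xiMeasure 𝓒(n)).quasiMeasurePreserving
  have h3 := hF.comp_quasiMeasurePreserving (h1.comp h2)
  have h4 : Measurable fun w : (Z × Xi) × Conf (n + 1) =>
      jw i w.2 * (Real.sqrt ((w.2 i).1 + 1) : ℂ) := (measurable_annih_coef i).comp measurable_snd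
  refine (h4.aestronglyMeasurable.mul h3).congr (Eventually.of_forall fun w => ?_)
  simp only [Pi.mul_apply, annih_eq]
  rfl

theorem aestronglyMeasurable_annih (i : Fin (n + 1)) {f : 𝓕(n)} (hf : AEStronglyMeasurable f 𝓒(n)) :
    AEStronglyMeasurable (fun z : Xi × Conf (n + 1) => annih i z.1 f z.2)
      (xiMeasure.prod 𝓒(n)) := by
  have h3 := hf.comp_quasiMeasurePreserving (quasiMeasurePreserving_insY i)
  have h4 : Measurable fun w : Xi × Conf (n + 1) =>
      jw i w.2 * (Real.sqrt ((w.2 i).1 + 1) : ℂ) := (measurable_annih_coef i).comp measurable_snd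
  refine (h4.aestronglyMeasurable.mul h3).congr (Eventually.of_forall fun w => ?_)
  simp only [Pi.mul_apply, annih_eq]
  rfl

/-! ### Integration over added particles -/

theorem setLIntegral_insY (i : Fin (n + 1)) (k : ℕ) {F : Conf (n + 1) → ℝ≥0∞}
    (hF : AEMeasurable F 𝓒(n)) :
    ∫⁻ y in {y | k < (y i).1}, F y ∂𝓒(n) = ∫⁻ z in {z | k ≤ (z.2 i).1}, F (insY i k z.1 z.2)
        ∂xiMeasure.prod 𝓒(n) := by
  have hp := measurePreserving_insY i k
  rw [← hp.map_eq, lintegral_map' (by rw [hp.map_eq]; exact hF.restrict) hp.measurable.aemeasurable]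

/-- The additive functional `∑ ρ(ξ)` over the particles of species `i`. -/
def occ (ρ : Xi → ℝ≥0∞) (i : Fin n) (y : Conf n) : ℝ≥0∞ := ∑ a, ρ ((y i).2 a)

theorem getP_lt {k : ℕ} {q : Particles} (h : k < q.1) : getP k q = q.2 ⟨k, h⟩ := by
  obtain ⟨l | l, x⟩ := q
  · simp at h
  · have h' : k < l + 1 := h
    simp only [getP]
    congr 1
    ext; simp [Fin.ofNat, Nat.mod_eq_of_lt h']

theorem occ_mul_eq_tsum (ρ : Xi → ℝ≥0∞) (i : Fin n) (y : Conf n) (c : ℝ≥0∞) :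
    occ ρ i y * c = ∑' k, {y : Conf n | k < (y i).1}.indicator
      (fun y => ρ (getP k (y i)) * c) y := by
  rw [tsum_eq_sum (s := Finset.range (y i).1), Finset.sum_range, occ, Finset.sum_mul]
  · refine Finset.sum_congr rfl fun k _ => ?_
    simp only [indicator_apply, mem_ofPred_eq, if_pos k.2, getP_lt k.2]
  · intro k hk
    have h : ¬ k < (y i).1 := fun h => hk (Finset.mem_range.2 h)
    simp only [indicator_apply, mem_ofPred_eq, if_neg h]

theorem measurable_occ {ρ : Xi → ℝ≥0∞} (hρ : Measurable ρ) (i : Fin n) :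
    Measurable (occ ρ i : Conf n → ℝ≥0∞) := by
  have : (occ ρ i : Conf n → ℝ≥0∞) = fun y => occ ρ i y * 1 := by simp
  rw [this]
  simp_rw [occ_mul_eq_tsum]
  refine Measurable.tsum fun k => Measurable.indicator ?_ (measurable_numY i measurableSet_Ioi)
  exact (hρ.comp ((measurable_getP k).comp (measurable_pi_apply i))).mul_const _

theorem occ_one (i : Fin n) (y : Conf n) : occ 1 i y = (y i).1 := by simp [occ]

theorem lintegral_mecke (i : Fin (n + 1)) {ρ : Xi → ℝ≥0∞} (hρ : Measurable ρ)
    {H : Conf (n + 1) → ℝ≥0∞} (hH : AEMeasurable H 𝓒(n))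
    (hsym : ∀ k ξ y, k ≤ (y i).1 → H (insY i k ξ y) = H (insY i 0 ξ y)) :
    ∫⁻ z, ρ z.1 * (((z.2 i).1 + 1) * H (insY i 0 z.1 z.2)) ∂xiMeasure.prod 𝓒(n) =
      ∫⁻ y, occ ρ i y * H y ∂𝓒(n) := by
  have hF : ∀ k : ℕ, AEMeasurable (fun y : Conf (n + 1) => ρ (getP k (y i)) * H y)
      𝓒(n) := fun k =>
    (hρ.comp ((measurable_getP k).comp (measurable_pi_apply i))).aemeasurable.mul hH
  have hs1 : ∀ k, MeasurableSet {z : Xi × Conf (n + 1) | k ≤ (z.2 i).1} := fun k =>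
    ((measurable_numY i).comp measurable_snd) measurableSet_Ici
  have hs2 : ∀ k, MeasurableSet {y : Conf (n + 1) | k < (y i).1} := fun k =>
    measurable_numY i measurableSet_Ioi
  have hH' : AEMeasurable (fun z : Xi × Conf (n + 1) => H (insY i 0 z.1 z.2))
      (xiMeasure.prod 𝓒(n)) :=
    hH.comp_quasiMeasurePreserving (quasiMeasurePreserving_insY i)
  have h1 : ∀ y, occ ρ i y * H y = ∑' k, {y : Conf (n + 1) | k < (y i).1}.indicator
      (fun y => ρ (getP k (y i)) * H y) y := fun y => by
    rw [occ_mul_eq_tsum]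
    refine tsum_congr fun k => ?_
    by_cases h : k < (y i).1
    · rw [indicator_of_mem (show y ∈ {y : Conf (n + 1) | k < (y i).1} from h),
        indicator_of_mem (show y ∈ {y : Conf (n + 1) | k < (y i).1} from h)]
    · rw [indicator_of_notMem (show y ∉ {y : Conf (n + 1) | k < (y i).1} from h),
        indicator_of_notMem (show y ∉ {y : Conf (n + 1) | k < (y i).1} from h)]
  simp_rw [h1]
  rw [lintegral_tsum fun k => (hF k).indicator (hs2 k)]
  have h2 : ∀ k, ∫⁻ y, {y : Conf (n + 1) | k < (y i).1}.indicator
      (fun y => ρ (getP k (y i)) * H y) y ∂𝓒(n) =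
      ∫⁻ z, {z : Xi × Conf (n + 1) | k ≤ (z.2 i).1}.indicator
        (fun z => ρ z.1 * H (insY i 0 z.1 z.2)) z ∂xiMeasure.prod 𝓒(n) := by
    intro k
    rw [lintegral_indicator (hs2 k), setLIntegral_insY i k (hF k), lintegral_indicator (hs1 k)]
    refine setLIntegral_congr_fun (hs1 k) fun z hz => ?_
    simp only [insY_same, getP_insP]
    rw [hsym k z.1 z.2 hz]
  simp_rw [h2]
  refine Eq.trans ?_ (lintegral_tsum fun k =>
    ((hρ.comp measurable_fst).aemeasurable.mul hH').indicator (hs1 k))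
  refine lintegral_congr fun z => ?_
  rw [tsum_eq_sum (s := Finset.range ((z.2 i).1 + 1))]
  · rw [Finset.sum_congr rfl (g := fun _ => ρ z.1 * H (insY i 0 z.1 z.2))]
    · simp; ring
    · intro k hk
      have h : k ≤ (z.2 i).1 := Nat.lt_succ_iff.1 (Finset.mem_range.1 hk)
      simp only [indicator_apply, mem_ofPred_eq, if_pos h]
  · intro k hk
    have h : ¬ k ≤ (z.2 i).1 := fun h => hk (Finset.mem_range.2 (Nat.lt_succ_iff.2 h))
    simp only [indicator_apply, mem_ofPred_eq, if_neg h]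

theorem lintegral_annih (i : Fin (n + 1)) {ρ : Xi → ℝ≥0∞} (hρ : Measurable ρ)
    {f : 𝓕(n)} (hf : AEStronglyMeasurable f 𝓒(n)) (ha : Anti f) (w : (𝓞(n)) → ℝ≥0∞) :
    ∫⁻ z, ρ z.1 * (w (num z.2 + Pi.single i 1) * ‖annih i z.1 f z.2‖ₑ ^ 2) ∂xiMeasure.prod 𝓒(n) =
      ∫⁻ y, occ ρ i y * (w (num y) * ‖f y‖ₑ ^ 2) ∂𝓒(n) := by
  rw [← lintegral_mecke i hρ (H := fun y => w (num y) * ‖f y‖ₑ ^ 2)]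
  · refine lintegral_congr fun z => ?_
    simp only [num_insY, enorm_annih_sq]
    ring
  · exact (measurable_comp_num w).aemeasurable.mul (hf.enorm.pow_const 2)
  · intro k ξ y hk
    simp only [num_insY]
    rw [ha.insertion i ξ hk, enorm_mul]
    simp

/-- Antisymmetric square integrable functions with at most `M` particles of each species. -/
structure Nice (M : ℕ) (f : 𝓕(n)) : Prop where
  memLp : MemLp f 2 𝓒(n)
  anti : Anti f
  bdd : ∀ y, (∃ i, M < (y i).1) → f y = 0

theorem Nice.aesm {M : ℕ} {f : 𝓕(n)} (hf : Nice M f) : AEStronglyMeasurable f 𝓒(n) := hf.memLp.1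

theorem Nice.memLp_annih {M : ℕ} {f : 𝓕(n)} (hf : Nice M f) (i : Fin (n + 1)) :
    MemLp (fun z : Xi × Conf (n + 1) => annih i z.1 f z.2) 2 (xiMeasure.prod 𝓒(n)) ∧
    sqInt (xiMeasure.prod 𝓒(n))
      (fun z : Xi × Conf (n + 1) => annih i z.1 f z.2) ≤ M * sqInt 𝓒(n) f := by
  have h1 : sqInt (xiMeasure.prod 𝓒(n))
      (fun z : Xi × Conf (n + 1) => annih i z.1 f z.2) ≤ M * sqInt 𝓒(n) f := by
    have h := lintegral_annih i (ρ := 1) measurable_one hf.aesm hf.anti 1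
    simp only [Pi.one_apply, one_mul, occ_one] at h
    rw [sqInt, h, sqInt, ← lintegral_const_mul'' _ (hf.aesm.enorm.pow_const 2)]
    refine lintegral_mono fun y => ?_
    by_cases hy : M < (y i).1
    · rw [hf.bdd y ⟨i, hy⟩]; simp
    · gcongr
      exact_mod_cast not_lt.1 hy
  exact ⟨memLp_two_of_sqInt (aestronglyMeasurable_annih i hf.aesm)
    (h1.trans_lt (ENNReal.mul_lt_top (by simp) (sqInt_lt_top hf.memLp))), h1⟩

theorem annih_eq_zero {M : ℕ} {f : 𝓕(n)} (hf : ∀ y, (∃ i, M < (y i).1) → f y = 0)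
    (i : Fin (n + 1)) (ξ : Xi) {y : Conf (n + 1)} (hy : ∃ j, M < (y j).1) : annih i ξ f y = 0 := by
  obtain ⟨j, hj⟩ := hy
  rw [annih_eq, hf, mul_zero]
  refine ⟨j, ?_⟩
  have h := congrFun (num_insY i 0 ξ y) j
  simp only [num, Pi.add_apply] at h
  omega

theorem Nice.ae_annih {M : ℕ} {f : 𝓕(n)} (hf : Nice M f) (i : Fin (n + 1)) :
    ∀ᵐ ξ ∂xiMeasure, Nice M (annih i ξ f) := by
  filter_upwards [(hf.memLp_annih i).1.ae_memLp_left] with ξ hξ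
  exact ⟨hξ, hf.anti.annihilate i ξ, fun y hy => annih_eq_zero hf.bdd i ξ hy⟩

theorem memLp_swap {X Y : Type*} [MeasurableSpace X] [MeasurableSpace Y] {μ : Measure X}
    {ν : Measure Y} [SFinite μ] [SFinite ν] {f : X × Y → ℂ} (hf : MemLp f 2 (μ.prod ν)) :
    MemLp (fun z : Y × X => f (z.2, z.1)) 2 (ν.prod μ) :=
  hf.comp_measurePreserving Measure.measurePreserving_swap

/-- The smeared annihilation operator `∫ g(ξ) b_i(ξ) dξ`. -/
def sm {n : ℕ} (i : Fin n) (g : Xi → ℂ) (f : Conf n → ℂ) (y : Conf n) : ℂ :=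
  ∫ ξ, g ξ * annih i ξ f y ∂xiMeasure

theorem Nice.smear {M : ℕ} {f : 𝓕(n)} (hf : Nice M f) (i : Fin (n + 1)) {g : Xi → ℂ}
    (hg : MemLp g 2 xiMeasure) : Nice M (sm i g f) where
  memLp := by
    have hv : MemLp (fun z : Conf (n + 1) × Xi => annih i z.2 f z.1) 2
        (𝓒(n).prod xiMeasure) := memLp_swap (hf.memLp_annih i).1
    have h := memLp_integral_mul hg hv
    exact h
  anti := fun y j l x π => by
    rw [sm, sm, ← integral_const_mul]
    refine integral_congr_forall fun ξ => ?_
    rw [hf.anti.annihilate i ξ y j l x π]; ring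
  bdd := fun y hy => by
    rw [sm]
    simp [annih_eq_zero hf.bdd i _ hy]

theorem Nice.ae_memLp_annih {M : ℕ} {f : 𝓕(n)} (hf : Nice M f) (i : Fin (n + 1)) :
    ∀ᵐ y ∂𝓒(n), MemLp (fun ξ => annih i ξ f y) 2 xiMeasure :=
  (hf.memLp_annih i).1.ae_memLp_right

theorem sm_num_mul (i : Fin n) (g : Xi → ℂ) (u : (Fin n → ℕ) → ℂ) (f : Conf n → ℂ)
    (y : Conf n) : sm i g (fun y => u (num y) * f y) y = u (num y + Pi.single i 1) * sm i g f y := by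
  rw [sm, sm, ← integral_const_mul]
  refine integral_congr_forall fun ξ => ?_
  simp only [annih_eq, num_insY]; ring

theorem Nice.num_mul {M : ℕ} {f : 𝓕(n)} (hf : Nice M f)
    (u : (𝓞(n)) → ℂ) : Nice M (fun y => u (num y) * f y) where
  memLp := by
    set K : ℝ := ∑ N ∈ Fintype.piFinset (fun _ : Fin (n + 1) => Finset.range (M + 1)), ‖u N‖ with hK
    refine MemLp.of_le_mul (c := K) hf.memLp
      ((measurable_comp_num u).aestronglyMeasurable.mul hf.aesm) (Eventually.of_forall fun y => ?_)
    by_cases hy : ∃ i, M < (y i).1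
    · rw [hf.bdd y hy]; simp
    · push Not at hy
      rw [norm_mul]
      refine mul_le_mul_of_nonneg_right ?_ (norm_nonneg _)
      refine Finset.single_le_sum (f := fun N => ‖u N‖) (fun _ _ => norm_nonneg _)
        (Fintype.mem_piFinset.2 fun i => Finset.mem_range.2 (Nat.lt_succ_of_le (hy i)))
  anti := fun y i l x π => by
    have : num (Function.update y i ⟨l, x ∘ π⟩) = num (Function.update y i ⟨l, x⟩) :=
      funext fun j => update_number y i (x ∘ π) x j
    simp only [this]
    rw [hf.anti]; ring
  bdd := fun y hy => by rw [hf.bdd y hy, mul_zero]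

theorem tsum_sm_le {A : Type*} [Countable A] {e : A → Xi → ℝ} {c : A → ℝ≥0∞} {ρ : Xi → ℝ≥0∞}
    (h : CoeffBound xiMeasure e c ρ) (he : ∀ a, MemLp (fun ξ => (e a ξ : ℂ)) 2 xiMeasure)
    (hρ : Measurable ρ) {M : ℕ} {f : 𝓕(n)} (hf : Nice M f) (i : Fin (n + 1)) (w : (𝓞(n)) → ℝ≥0∞) :
    ∑' a, c a * ∫⁻ y, w (num y) * ‖sm i (fun ξ => (e a ξ : ℂ)) f y‖ₑ ^ 2 ∂𝓒(n) ≤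
      ∫⁻ z, ρ z.1 * (w (num z.2) * ‖annih i z.1 f z.2‖ₑ ^ 2) ∂xiMeasure.prod 𝓒(n) := by
  have hw := measurable_comp_num w
  have hm : ∀ a, AEMeasurable (fun y => w (num y) * ‖sm i (fun ξ => (e a ξ : ℂ)) f y‖ₑ ^ 2)
      𝓒(n) := fun a =>
    hw.aemeasurable.mul ((hf.smear i (he a)).aesm.enorm.pow_const 2)
  have hm2 : AEMeasurable (fun z : Xi × Conf (n + 1) =>
      ρ z.1 * (w (num z.2) * ‖annih i z.1 f z.2‖ₑ ^ 2)) (xiMeasure.prod 𝓒(n)) :=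
    (hρ.comp measurable_fst).aemeasurable.mul ((hw.comp measurable_snd).aemeasurable.mul
      ((aestronglyMeasurable_annih i hf.aesm).enorm.pow_const 2))
  simp_rw [← lintegral_const_mul'' _ (hm _)]
  rw [← lintegral_tsum fun a => (hm a).const_mul _, lintegral_prod_symm _ hm2]
  refine lintegral_mono_ae ?_
  filter_upwards [hf.ae_memLp_annih i] with y hy
  have h1 := h _ hy
  calc ∑' a, c a * (w (num y) * ‖sm i (fun ξ => (e a ξ : ℂ)) f y‖ₑ ^ 2)
      = w (num y) * ∑' a, c a * ‖∫ ξ, (e a ξ : ℂ) * annih i ξ f y ∂xiMeasure‖ₑ ^ 2 := by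
        rw [← ENNReal.tsum_mul_left]
        exact tsum_congr fun a => by rw [sm]; ring
    _ ≤ w (num y) * ∫⁻ ξ, ρ ξ * ‖annih i ξ f y‖ₑ ^ 2 ∂xiMeasure := by gcongr
    _ = ∫⁻ ξ, ρ ξ * (w (num y) * ‖annih i ξ f y‖ₑ ^ 2) ∂xiMeasure := by
        refine (lintegral_const_mul'' _ (hρ.aemeasurable.mul (hy.1.enorm.pow_const 2))).symm.trans ?_
        refine lintegral_congr fun ξ => ?_
        simp only [Pi.mul_apply]; ring

end

theorem integral_conj_mul_self {X : Type*} [MeasurableSpace X] {μ : Measure X} {f : X → ℂ}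
    (hf : MemLp f 2 μ) : ∫ x, conj (f x) * f x ∂μ = ((sqInt μ f).toReal : ℂ) := by
  have h1 : ∀ x, conj (f x) * f x = (((‖f x‖ₑ ^ 2).toReal : ℝ) : ℂ) := by
    intro x
    rw [Complex.conj_mul']
    simp
  simp_rw [h1]
  rw [integral_complex_ofReal, sqInt, integral_toReal (hf.1.enorm.pow_const 2)]
  exact Eventually.of_forall fun x => by simp

theorem sqInt_conj {X : Type*} [MeasurableSpace X] {μ : Measure X} (f : X → ℂ) :
    sqInt μ (fun x => conj (f x)) = sqInt μ f := by
  simp [sqInt]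

theorem MemLp_conj {X : Type*} [MeasurableSpace X] {μ : Measure X} {f : X → ℂ} (hf : MemLp f 2 μ) :
    MemLp (fun x => conj (f x)) 2 μ :=
  memLp_two_of_sqInt (Complex.continuous_conj.comp_aestronglyMeasurable hf.1)
    (by rw [sqInt_conj]; exact sqInt_lt_top hf)

section
variable {n : ℕ}

/-- A summand of the creation operator. -/
def creTerm (i : Fin n) (g : Xi → ℂ) (f : Conf n → ℂ) (k : ℕ) (y : Conf n) : ℂ :=
  jw i y * (Real.sqrt (y i).1 : ℂ)⁻¹ * ((-1) ^ k * (g (getP k (y i)) * f (delY i k y)))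

theorem cre_eq_sum {M : ℕ} {f : Conf n → ℂ} (hf : ∀ y, (∃ i, M < (y i).1) → f y = 0) (i : Fin n)
    (g : Xi → ℂ) (y : Conf n) : cre i g f y = ∑ k ∈ Finset.range (M + 1),
      {y : Conf n | k < (y i).1}.indicator (creTerm i g f k) y := by
  have h1 : ∀ k, {y : Conf n | k < (y i).1}.indicator (creTerm i g f k) y =
      if k < (y i).1 then creTerm i g f k y else 0 := fun k => by
    simp only [indicator_apply, mem_ofPred_eq]
  simp_rw [h1]
  rw [cre, Finset.mul_sum, ← Finset.sum_filter]
  by_cases hy : (y i).1 ≤ M + 1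
  · refine Finset.sum_congr ?_ fun k _ => rfl
    ext k
    simp only [Finset.mem_range, Finset.mem_filter]
    omega
  · have h0 : ∀ k, f (delY i k y) = 0 := fun k => hf _ ⟨i, by
      rw [delY, Function.update_self, number_delP]; omega⟩
    rw [Finset.sum_eq_zero fun k _ => by rw [h0]; simp,
      Finset.sum_eq_zero fun k _ => by rw [creTerm, h0]; simp]

theorem memLp_creTerm {g : Xi → ℂ} (hg : MemLp g 2 xiMeasure) {f : 𝓕(n)}
    (hf : MemLp f 2 𝓒(n)) (i : Fin (n + 1)) (k : ℕ) :
    MemLp ({y : Conf (n + 1) | k < (y i).1}.indicator (creTerm i g f k)) 2 𝓒(n) := by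
  have hs : MeasurableSet {y : Conf (n + 1) | k < (y i).1} := measurable_numY i measurableSet_Ioi
  rw [memLp_indicator_iff_restrict hs]
  have h1 : MemLp (fun y : Conf (n + 1) => g (getP k (y i)) * f (delY i k y)) 2
      (𝓒(n).restrict {y | k < (y i).1}) :=
    ((memLp_mul_prod hg hf).restrict _).comp_measurePreserving (measurePreserving_delY i k)
  have hc : Measurable fun y : Conf (n + 1) => jw i y * (Real.sqrt (y i).1 : ℂ)⁻¹ * (-1) ^ k :=
    ((measurable_jw i).mul (measurable_comp_num fun N => (((Real.sqrt (N i) : ℝ) : ℂ))⁻¹)).mul_const _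
  refine MemLp.of_le_mul (c := 1) h1 ?_ (Eventually.of_forall fun y => ?_)
  · refine (hc.aestronglyMeasurable.mul h1.1).congr (Eventually.of_forall fun y => ?_)
    simp only [Pi.mul_apply, creTerm]; ring
  · rw [creTerm, norm_mul, norm_mul, norm_jw, norm_mul ((-1 : ℂ) ^ k)]
    simp only [norm_pow, norm_neg, norm_one, one_pow, one_mul]
    refine mul_le_of_le_one_left (norm_nonneg _) ?_
    rw [norm_inv, Complex.norm_real, Real.norm_of_nonneg (Real.sqrt_nonneg _)]
    rcases Nat.eq_zero_or_pos (y i).1 with h | h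
    · rw [h]; simp
    · refine inv_le_one_of_one_le₀ (Real.one_le_sqrt.2 (by exact_mod_cast h))

theorem Nice.create {M : ℕ} {f : 𝓕(n)} (hf : Nice M f) (i : Fin (n + 1)) {g : Xi → ℂ}
    (hg : MemLp g 2 xiMeasure) : Nice (M + 1) (cre i g f) where
  memLp := by
    have h := memLp_finsetSum (Finset.range (M + 1)) fun k _ => memLp_creTerm hg hf.memLp i k
    refine (memLp_congr_ae (Eventually.of_forall fun y => ?_)).1 h
    rw [cre_eq_sum hf.bdd]
  anti := hf.anti.create i g
  bdd := fun y hy => by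
    obtain ⟨j, hj⟩ := hy
    rw [cre, Finset.sum_eq_zero, mul_zero]
    intro k _
    rw [hf.bdd (delY i k y), mul_zero, mul_zero]
    refine ⟨j, ?_⟩
    by_cases h : j = i
    · subst h; rw [delY, Function.update_self, number_delP]; omega
    · rw [delY, Function.update_of_ne h]; omega

theorem integral_conj_creTerm {g : Xi → ℂ} (hg : MemLp g 2 xiMeasure) {f h : 𝓕(n)}
    {M' : ℕ} (hf : MemLp f 2 𝓒(n)) (hh : Nice M' h) (i : Fin (n + 1)) (k : ℕ) :
    ∫ y, conj ({y : Conf (n + 1) | k < (y i).1}.indicator (creTerm i g f k) y) * h y ∂𝓒(n) =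
    ∫ z, {z : Xi × Conf (n + 1) | k ≤ (z.2 i).1}.indicator
      (fun z => (((z.2 i).1 : ℂ) + 1)⁻¹ * (conj (g z.1) * conj (f z.2) *
        annih i z.1 h z.2)) z ∂xiMeasure.prod 𝓒(n) := by
  have hs1 : MeasurableSet {z : Xi × Conf (n + 1) | k ≤ (z.2 i).1} :=
    ((measurable_numY i).comp measurable_snd) measurableSet_Ici
  have hs2 : MeasurableSet {y : Conf (n + 1) | k < (y i).1} := measurable_numY i measurableSet_Ioi
  have h1 : ∀ y, conj ({y : Conf (n + 1) | k < (y i).1}.indicator (creTerm i g f k) y) * h y =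
      {y : Conf (n + 1) | k < (y i).1}.indicator
        (fun y => conj (creTerm i g f k y) * h y) y := by
    intro y
    simp only [indicator_apply]
    split_ifs <;> simp
  have hm := memLp_creTerm hg hf i k
  rw [memLp_indicator_iff_restrict hs2] at hm
  have hp := measurePreserving_insY i k
  have ha : AEStronglyMeasurable (fun y => conj (creTerm i g f k y) * h y)
      (𝓒(n).restrict {y | k < (y i).1}) :=
    (Complex.continuous_conj.comp_aestronglyMeasurable hm.1).mul hh.aesm.restrict
  simp_rw [h1]
  rw [integral_indicator hs2, integral_indicator hs1, ← hp.map_eq,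
    integral_map hp.measurable.aemeasurable (by rw [hp.map_eq]; exact ha)]
  refine setIntegral_congr_fun hs1 fun z hz => ?_
  have hz' : k ≤ (z.2 i).1 := hz
  simp only [creTerm, insY_same, getP_insP, delY_insY, jw_insY, lt_irrefl, if_false, number_insP,
    hh.anti.insertion i z.1 hz', annih_eq]
  simp only [map_mul, map_inv₀, map_pow, map_neg, map_one, conj_jw, Complex.conj_ofReal]
  have hsq : (Real.sqrt ((z.2 i).1 + 1) : ℂ) * (Real.sqrt ((z.2 i).1 + 1) : ℂ) = (z.2 i).1 + 1 := by
    rw [← Complex.ofReal_mul, Real.mul_self_sqrt (by positivity)]; push_cast; rfl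
  have hne : (Real.sqrt ((z.2 i).1 + 1) : ℂ) ≠ 0 := by
    have : (0 : ℝ) < (z.2 i).1 + 1 := by positivity
    exact_mod_cast (Real.sqrt_pos.2 this).ne'
  have hsg : ((-1 : ℂ) ^ k) * (-1) ^ k = 1 := by rw [← mul_pow]; simp
  rw [← hsq]
  push_cast
  field_simp
  linear_combination (jw i z.2 * (conj) (g z.1) * (conj) (f z.2) * h (insY i 0 z.1 z.2)) * hsg

theorem Nice.adjoint {M M' : ℕ} {f h : 𝓕(n)} (hf : Nice M f) (hh : Nice M' h)
    (i : Fin (n + 1)) {g : Xi → ℂ} (hg : MemLp g 2 xiMeasure) :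
    ∫ y, conj (cre i g f y) * h y ∂𝓒(n) = ∫ y, conj (f y) * sm i (fun ξ => conj (g ξ)) h y
        ∂𝓒(n) := by
  have hI : Integrable (fun z : Xi × Conf (n + 1) => conj (g z.1) * conj (f z.2) *
      annih i z.1 h z.2) (xiMeasure.prod 𝓒(n)) :=
    (memLp_mul_prod (MemLp_conj hg) (MemLp_conj hf.memLp)).integrable_mul (hh.memLp_annih i).1
  have hs1 : ∀ k, MeasurableSet {z : Xi × Conf (n + 1) | k ≤ (z.2 i).1} := fun k =>
    ((measurable_numY i).comp measurable_snd) measurableSet_Ici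
  have hc : Measurable fun z : Xi × Conf (n + 1) => (((z.2 i).1 : ℂ) + 1)⁻¹ :=
    (measurable_comp_num fun N => ((N i : ℂ) + 1)⁻¹).comp measurable_snd
  have hI' : ∀ k : ℕ, Integrable ({z : Xi × Conf (n + 1) | k ≤ (z.2 i).1}.indicator
      (fun z => (((z.2 i).1 : ℂ) + 1)⁻¹ * (conj (g z.1) * conj (f z.2) *
        annih i z.1 h z.2))) (xiMeasure.prod 𝓒(n)) := by
    intro k
    refine Integrable.indicator ?_ (hs1 k)
    refine hI.bdd_mul (c := 1) hc.aestronglyMeasurable (Eventually.of_forall fun z => ?_)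
    rw [norm_inv]
    refine inv_le_one_of_one_le₀ ?_
    have : ((z.2 i).1 : ℂ) + 1 = (((z.2 i).1 + 1 : ℕ) : ℂ) := by push_cast; rfl
    rw [this, Complex.norm_natCast]
    exact_mod_cast Nat.le_add_left 1 _
  calc ∫ y, conj (cre i g f y) * h y ∂𝓒(n)
      = ∑ k ∈ Finset.range (M + 1), ∫ y, conj ({y : Conf (n + 1) | k < (y i).1}.indicator
          (creTerm i g f k) y) * h y ∂𝓒(n) := by
        rw [← integral_finsetSum]
        · refine integral_congr_forall fun y => ?_
          rw [cre_eq_sum hf.bdd, map_sum, Finset.sum_mul]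
        · intro k _
          exact (MemLp_conj (memLp_creTerm hg hf.memLp i k)).integrable_mul hh.memLp
    _ = ∫ z, conj (g z.1) * conj (f z.2) * annih i z.1 h z.2 ∂xiMeasure.prod 𝓒(n) := by
        simp_rw [integral_conj_creTerm hg hf.memLp hh i]
        rw [← integral_finsetSum _ fun k _ => hI' k]
        refine integral_congr_forall fun z => ?_
        simp only [indicator_apply, mem_ofPred_eq]
        rw [← Finset.sum_filter]
        by_cases hz : (z.2 i).1 ≤ M
        · have : (Finset.range (M + 1)).filter (fun k => k ≤ (z.2 i).1) =
              Finset.range ((z.2 i).1 + 1) := by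
            ext k; simp only [Finset.mem_range, Finset.mem_filter]; omega
          rw [this, Finset.sum_const, Finset.card_range, nsmul_eq_mul, ← mul_assoc]
          have hne : ((z.2 i).1 : ℂ) + 1 ≠ 0 := by exact_mod_cast Nat.succ_ne_zero (z.2 i).1
          push_cast
          rw [mul_inv_cancel₀ hne, one_mul]
        · rw [hf.bdd z.2 ⟨i, not_le.1 hz⟩]; simp
    _ = _ := by
        rw [integral_prod_symm _ hI]
        refine integral_congr_forall fun y => ?_
        simp only [sm]
        rw [← integral_const_mul]
        refine integral_congr_forall fun ξ => ?_
        ring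

theorem annih_sm (i j : Fin n) (ξ : Xi) (g : Xi → ℂ) (f : Conf n → ℂ) (y : Conf n) :
    annih i ξ (sm j g f) y = ∫ η, g η * annih i ξ (annih j η f) y ∂xiMeasure := by
  rw [annih_eq, sm, ← integral_const_mul]
  refine integral_congr_forall fun η => ?_
  rw [annih_eq i]; ring

theorem Nice.memLp_annih_annih {M : ℕ} {f : 𝓕(n)} (hf : Nice M f) (i j : Fin (n + 1)) :
    MemLp (fun w : (Xi × Xi) × Conf (n + 1) => annih i w.1.2 (annih j w.1.1 f) w.2) 2
      ((xiMeasure.prod xiMeasure).prod 𝓒(n)) := by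
  have hm := aestronglyMeasurable_annih_param (ζ := xiMeasure) i (aestronglyMeasurable_annih j hf.aesm)
  refine memLp_two_of_sqInt hm ?_
  rw [sqInt_prod hm]
  have hm2 := (hm.enorm.pow_const 2).lintegral_prod_right'
  simp only [sqInt]
  rw [lintegral_prod _ hm2]
  have h2 : ∀ᵐ η ∂xiMeasure, ∫⁻ ξ, sqInt 𝓒(n) (fun y =>
      annih i ξ (annih j η f) y) ∂xiMeasure ≤ M * sqInt 𝓒(n) (annih j η f) := by
    filter_upwards [hf.ae_annih j] with η hη
    have := (hη.memLp_annih i).2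
    rwa [sqInt_prod (hη.memLp_annih i).1.1] at this
  refine (lintegral_mono_ae h2).trans_lt ?_
  rw [lintegral_const_mul' _ _ (by simp)]
  refine ENNReal.mul_lt_top (by simp) ?_
  have := sqInt_lt_top (hf.memLp_annih j).1
  rwa [sqInt_prod (hf.memLp_annih j).1.1] at this

theorem Nice.sm_sm {M : ℕ} {f : 𝓕(n)} (hf : Nice M f) (i : Fin (n + 1)) {g : Xi → ℂ}
    (hg : MemLp g 2 xiMeasure) : sm i g (sm i g f) =ᵐ[𝓒(n)] 0 := by
  filter_upwards [(hf.memLp_annih_annih i i).ae_memLp_right] with y hy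
  set K : Xi → Xi → ℂ := fun ξ η => g ξ * (g η * annih i ξ (annih i η f) y)
    with hK
  have hanti : ∀ ξ η, K ξ η = -K η ξ := by
    intro ξ η
    have := congrFun (hf.anti.annih_comm i ξ η) y
    simp only [Pi.neg_apply] at this
    simp only [hK, this]; ring
  have hint : Integrable (Function.uncurry K) (xiMeasure.prod xiMeasure) := by
    refine ((memLp_mul_prod hg hg).integrable_mul (memLp_swap hy)).congr
      (Eventually.of_forall fun z => ?_)
    simp only [Pi.mul_apply, Function.uncurry, hK]; ring
  have h1 : sm i g (sm i g f) y = ∫ ξ, ∫ η, K ξ η ∂xiMeasure ∂xiMeasure := by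
    rw [sm]
    refine integral_congr_forall fun ξ => ?_
    rw [annih_sm, ← integral_const_mul]
  have h2 : ∫ ξ, ∫ η, K ξ η ∂xiMeasure ∂xiMeasure = -∫ ξ, ∫ η, K ξ η ∂xiMeasure ∂xiMeasure := by
    conv_lhs => rw [integral_integral_swap hint]
    rw [← integral_neg]
    refine integral_congr_forall fun η => ?_
    rw [← integral_neg]
    refine integral_congr_forall fun ξ => ?_
    exact hanti ξ η
  rw [h1]
  exact self_eq_neg.1 h2

theorem Nice.sqInt_cre_sm {M : ℕ} {a : 𝓕(n)} (ha : Nice M a) (i : Fin (n + 1))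
    {g : Xi → ℂ} (hg : MemLp g 2 xiMeasure) (h0 : sm i g a =ᵐ[𝓒(n)] 0) :
    sqInt 𝓒(n) (cre i (fun ξ => conj (g ξ)) a) = sqInt xiMeasure g * sqInt 𝓒(n) a := by
  set g' : Xi → ℂ := fun ξ => conj (g ξ) with hg'
  have hgL : MemLp g' 2 xiMeasure := MemLp_conj hg
  have hc := ha.create i hgL
  have h1 := ha.adjoint hc i hgL
  have hgg : (fun ξ => conj (g' ξ)) = g := by funext ξ; simp [hg']
  rw [integral_conj_mul_self hc.memLp, hgg] at h1
  have hI : Integrable (fun z : Xi × Conf (n + 1) => g z.1 * conj (a z.2) *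
      annih i z.1 (cre i g' a) z.2)
      (xiMeasure.prod 𝓒(n)) :=
    (memLp_mul_prod hg (MemLp_conj ha.memLp)).integrable_mul (hc.memLp_annih i).1
  have h2 : ∫ y, conj (a y) * sm i g (cre i g' a) y
      ∂𝓒(n) = ∫ ξ, g ξ * (g' ξ * (sqInt 𝓒(n) a).toReal)
        ∂xiMeasure := by
    have e1 : ∫ y, conj (a y) * sm i g (cre i g' a) y
        ∂𝓒(n) = ∫ z, g z.1 * conj (a z.2) * annih i z.1 (cre i g' a) z.2
          ∂xiMeasure.prod 𝓒(n) := by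
      rw [integral_prod_symm _ hI]
      refine integral_congr_forall fun y => ?_
      simp only [sm]
      rw [← integral_const_mul]
      refine integral_congr_forall fun ξ => ?_
      ring
    rw [e1, integral_prod _ hI]
    refine integral_congr_ae ?_
    filter_upwards [ha.ae_annih i] with ξ hξ
    have e2 : ∫ y, conj (a y) * cre i g' (annih i ξ a) y
        ∂𝓒(n) = 0 := by
      have h3 := hξ.adjoint ha i hgL
      rw [hgg] at h3
      have h4 : ∫ y, conj (annih i ξ a y) * sm i g a y
          ∂𝓒(n) = 0 := by
        refine integral_eq_zero_of_ae ?_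
        filter_upwards [h0] with y hy
        simp [hy]
      rw [h4] at h3
      have h5 := congrArg (conj) h3
      rw [← integral_conj, map_zero] at h5
      rw [← h5]
      refine integral_congr_forall fun y => ?_
      simp [mul_comm]
    have i1 : Integrable (fun y => conj (a y) * a y) 𝓒(n) :=
      (MemLp_conj ha.memLp).integrable_mul ha.memLp
    have i2 : Integrable (fun y => conj (a y) * cre i g' (annih i ξ a) y) 𝓒(n) :=
      (MemLp_conj ha.memLp).integrable_mul (hξ.create i hgL).memLp
    calc ∫ y, g ξ * conj (a y) * annih i ξ (cre i g' a) y
          ∂𝓒(n)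
        = ∫ y, g ξ * (g' ξ * (conj (a y) * a y) - conj (a y) * cre i g' (annih i ξ a) y) ∂𝓒(n) := by
          refine integral_congr_forall fun y => ?_
          simp only [annih_cre_same]; ring
      _ = _ := by
          rw [integral_const_mul, integral_sub (i1.const_mul _) i2, integral_const_mul, e2,
            integral_conj_mul_self ha.memLp, sub_zero]
  have h3 : ∫ ξ, g ξ * (g' ξ * ((sqInt 𝓒(n) a).toReal : ℂ)) ∂xiMeasure =
      (sqInt xiMeasure g).toReal * (sqInt 𝓒(n) a).toReal := by
    rw [← integral_conj_mul_self hg, ← integral_mul_const]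
    refine integral_congr_forall fun ξ => ?_
    simp only [hg']; ring
  rw [h2, h3] at h1
  have h4 : (sqInt 𝓒(n) (cre i g' a)).toReal =
      (sqInt xiMeasure g).toReal * (sqInt 𝓒(n) a).toReal := by exact_mod_cast h1
  rw [← ENNReal.toReal_mul] at h4
  exact (ENNReal.toReal_eq_toReal_iff' (sqInt_lt_top hc.memLp).ne
    (ENNReal.mul_lt_top (sqInt_lt_top hg) (sqInt_lt_top ha.memLp)).ne).1 h4

/-- The norm of a smeared annihilation operator is at most the norm of the smearing function. -/
theorem Nice.sqInt_sm_le {M : ℕ} {f : 𝓕(n)} (hf : Nice M f) (i : Fin (n + 1))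
    {g : Xi → ℂ} (hg : MemLp g 2 xiMeasure) :
    sqInt 𝓒(n) (sm i g f) ≤ sqInt xiMeasure g * sqInt 𝓒(n) f := by
  have ha := hf.smear i hg
  have h1 := ha.sqInt_cre_sm i hg (hf.sm_sm i hg)
  set a := sm i g f with ha_def
  have hgL : MemLp (fun ξ => conj (g ξ)) 2 xiMeasure := MemLp_conj hg
  have h2 := ha.adjoint hf i hgL
  have hgg : (fun ξ => conj (conj (g ξ))) = g := by funext ξ; simp
  rw [hgg, ← ha_def, integral_conj_mul_self ha.memLp] at h2
  have h3 := enorm_integral_mul_sq_le (MemLp_conj (ha.create i hgL).memLp).1 hf.aesm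
  rw [h2, sqInt_conj, h1] at h3
  have h4 : ‖((sqInt 𝓒(n) a).toReal : ℂ)‖ₑ = sqInt 𝓒(n) a := by
    rw [← ofReal_norm, Complex.norm_real, Real.norm_of_nonneg ENNReal.toReal_nonneg,
      ENNReal.ofReal_toReal (sqInt_lt_top ha.memLp).ne]
  rw [h4] at h3
  by_cases h0 : sqInt 𝓒(n) a = 0
  · rw [h0]; exact zero_le
  · have h5 : sqInt 𝓒(n) a * sqInt 𝓒(n) a ≤ (sqInt xiMeasure g * sqInt 𝓒(n) f) * sqInt 𝓒(n) a := by
      calc _ = sqInt 𝓒(n) a ^ 2 := (sq _).symm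
        _ ≤ _ := h3
        _ = _ := by ring
    exact (ENNReal.mul_le_mul_iff_left h0 (sqInt_lt_top ha.memLp).ne).1 h5

end

theorem rpow_interpolation {v t p q θ s : ℝ} (hv : 1 ≤ v) (ht : 0 < t) (h0 : 0 < θ) (h1 : θ < 1)
    (hs : θ * p + (1 - θ) * q ≤ s) : v ^ (-s) ≤ v ^ (-p) * t + v ^ (-q) * t ^ (-(θ / (1 - θ))) := by
  have hv0 : 0 < v := one_pos.trans_le hv
  have h1' : 0 < 1 - θ := by linarith
  have hA : 0 ≤ v ^ (-p) * t := by positivity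
  have hB : 0 ≤ v ^ (-q) * t ^ (-(θ / (1 - θ))) := by positivity
  have h := Real.geom_mean_le_arith_mean2_weighted h0.le h1'.le hA hB (by ring)
  have he : (v ^ (-p) * t) ^ θ * (v ^ (-q) * t ^ (-(θ / (1 - θ)))) ^ (1 - θ) =
      v ^ (-(θ * p + (1 - θ) * q)) := by
    rw [Real.mul_rpow (by positivity) ht.le, Real.mul_rpow (by positivity) (by positivity),
      ← Real.rpow_mul hv0.le, ← Real.rpow_mul hv0.le, ← Real.rpow_mul ht.le]
    have e1 : -(θ / (1 - θ)) * (1 - θ) = -θ := by field_simp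
    rw [e1]
    calc v ^ (-p * θ) * t ^ θ * (v ^ (-q * (1 - θ)) * t ^ (-θ))
        = (v ^ (-p * θ) * v ^ (-q * (1 - θ))) * (t ^ θ * t ^ (-θ)) := by ring
      _ = _ := by
          rw [← Real.rpow_add hv0, ← Real.rpow_add ht, add_neg_cancel, Real.rpow_zero, mul_one]
          congr 1; ring
  calc v ^ (-s) ≤ v ^ (-(θ * p + (1 - θ) * q)) :=
        Real.rpow_le_rpow_of_exponent_le hv (by linarith)
    _ ≤ θ * (v ^ (-p) * t) + (1 - θ) * (v ^ (-q) * t ^ (-(θ / (1 - θ)))) := he ▸ h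
    _ ≤ _ := by nlinarith

section
variable {n : ℕ}

/-! ### Weights depending on the particle numbers -/

/-- One plus the number of massive particles. -/
def lam (N : 𝓞(n)) : ℝ := 1 + ∑ i : Fin n, (N i.succ : ℝ)

theorem one_le_lam (N : 𝓞(n)) : 1 ≤ lam N :=
  le_add_of_nonneg_right (Finset.sum_nonneg fun _ _ => Nat.cast_nonneg _)

theorem lam_pos (N : 𝓞(n)) : 0 < lam N := one_pos.trans_le (one_le_lam N)

theorem le_lam (N : 𝓞(n)) (i : Fin n) : (N i.succ : ℝ) ≤ lam N :=
  (Finset.single_le_sum (f := fun i : Fin n => (N i.succ : ℝ)) (fun _ _ => Nat.cast_nonneg _)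
    (Finset.mem_univ i)).trans (by unfold lam; linarith)

theorem lam_add_single_zero (N : 𝓞(n)) : lam (N + Pi.single 0 1) = lam N := by
  simp [lam]

theorem lam_add_single_succ (N : 𝓞(n)) (i : Fin n) : lam (N + Pi.single i.succ 1) = lam N + 1 := by
  simp only [lam, Pi.add_apply, Nat.cast_add, Finset.sum_add_distrib]
  have : ∑ x : Fin n, ((Pi.single i.succ 1 : 𝓞(n)) x.succ : ℝ) = 1 := by
    rw [Finset.sum_eq_single i]
    · simp
    · intro j _ hj
      simp [Fin.succ_inj, hj]
    · simp
  rw [this]; ring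

theorem lam_add_single (N : 𝓞(n)) (i : Fin (n + 1)) :
    lam N ≤ lam (N + Pi.single i 1) ∧ lam (N + Pi.single i 1) ≤ 2 * lam N := by
  have := one_le_lam N
  refine Fin.cases ?_ (fun i => ?_) i
  · rw [lam_add_single_zero]; constructor <;> linarith
  · rw [lam_add_single_succ]; constructor <;> linarith

/-- A positive function of the particle numbers that changes at most by the factor `κ` when a
particle is added. -/
structure Slow (κ : ℝ) (w : (𝓞(n)) → ℝ) : Prop where
  pos : ∀ N, 0 < w N
  down : ∀ N i, w N ≤ κ * w (N + Pi.single i 1)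
  up : ∀ N i, w (N + Pi.single i 1) ≤ κ * w N

theorem Slow.nonneg {κ : ℝ} {w : (𝓞(n)) → ℝ} (h : Slow κ w) : 0 ≤ κ := by
  by_contra hκ
  have := h.down 0 0
  have h1 := h.pos 0
  have h2 := h.pos (0 + Pi.single 0 1)
  nlinarith

theorem Slow.mul {κ κ' : ℝ} {w w' : (𝓞(n)) → ℝ} (h : Slow κ w) (h' : Slow κ' w') :
    Slow (κ * κ') (fun N => w N * w' N) where
  pos := fun N => mul_pos (h.pos N) (h'.pos N)
  down := fun N i => by
    calc w N * w' N ≤ (κ * w (N + Pi.single i 1)) * (κ' * w' (N + Pi.single i 1)) :=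
          mul_le_mul (h.down N i) (h'.down N i) (h'.pos N).le
            (mul_nonneg h.nonneg (h.pos _).le)
      _ = _ := by ring
  up := fun N i => by
    calc w (N + Pi.single i 1) * w' (N + Pi.single i 1) ≤ (κ * w N) * (κ' * w' N) :=
          mul_le_mul (h.up N i) (h'.up N i) (h'.pos _).le
            (mul_nonneg h.nonneg (h.pos _).le)
      _ = _ := by ring

theorem rpow_le_two_rpow_abs {a b : ℝ} (ha : 0 < a) (hab : a ≤ b) (hb : b ≤ 2 * a) (s : ℝ) :
    a ^ s ≤ 2 ^ |s| * b ^ s ∧ b ^ s ≤ 2 ^ |s| * a ^ s := by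
  have hb0 : 0 < b := ha.trans_le hab
  have h1 : (1 : ℝ) ≤ 2 ^ |s| := Real.one_le_rpow (by norm_num) (abs_nonneg s)
  rcases le_total 0 s with hs | hs
  · rw [abs_of_nonneg hs] at *
    constructor
    · exact (Real.rpow_le_rpow ha.le hab hs).trans (le_mul_of_one_le_left (by positivity) h1)
    · rw [← Real.mul_rpow (by norm_num) ha.le]
      exact Real.rpow_le_rpow hb0.le hb hs
  · rw [abs_of_nonpos hs] at *
    constructor
    · have h2 : (2 : ℝ) ^ (-s) * b ^ s = (b / 2) ^ s := by
        rw [Real.div_rpow hb0.le (by norm_num), Real.rpow_neg (by norm_num)]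
        field_simp
      rw [h2]
      exact Real.rpow_le_rpow_of_nonpos (by positivity) (by linarith) hs
    · exact (Real.rpow_le_rpow_of_nonpos ha hab hs).trans
        (le_mul_of_one_le_left (by positivity) h1)

theorem slow_lam_rpow (s : ℝ) : Slow (2 ^ |s|) (fun N : 𝓞(n) => lam N ^ s) where
  pos := fun N => Real.rpow_pos_of_pos (lam_pos N) s
  down := fun N i => (rpow_le_two_rpow_abs (lam_pos N) (lam_add_single N i).1
    (lam_add_single N i).2 s).1
  up := fun N i => (rpow_le_two_rpow_abs (lam_pos N) (lam_add_single N i).1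
    (lam_add_single N i).2 s).2

/-- The weighted square integral. -/
def wInt (w : (𝓞(n)) → ℝ) (f : 𝓕(n)) : ℝ≥0∞ :=
  ∫⁻ y, ENNReal.ofReal (w (num y)) * ‖f y‖ₑ ^ 2 ∂𝓒(n)

theorem wInt_mono {w w' : (𝓞(n)) → ℝ} (h : ∀ N, w N ≤ w' N) (f : 𝓕(n)) : wInt w f ≤ wInt w' f :=
  lintegral_mono fun y => by gcongr; exact h _

theorem wInt_const_mul {c : ℝ} (hc : 0 ≤ c) (w : (𝓞(n)) → ℝ) (f : 𝓕(n)) :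
    wInt (fun N => c * w N) f = ENNReal.ofReal c * wInt w f := by
  rw [wInt, wInt, ← lintegral_const_mul' _ _ ENNReal.ofReal_ne_top]
  exact lintegral_congr fun y => by rw [ENNReal.ofReal_mul hc, mul_assoc]

theorem wInt_one (f : 𝓕(n)) : wInt (fun _ => 1) f = sqInt 𝓒(n) f := by
  simp [wInt, sqInt]

theorem sm_wInt_le {M : ℕ} {f : 𝓕(n)} (hf : Nice M f) (i : Fin (n + 1)) {g : Xi → ℂ}
    (hg : MemLp g 2 xiMeasure) {v : (𝓞(n)) → ℝ} (hv : ∀ N, 0 ≤ v N) :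
    wInt (fun N => v (N + Pi.single i 1)) (sm i g f) ≤ sqInt xiMeasure g * wInt v f := by
  have key : ∀ (N : 𝓞(n)), ENNReal.ofReal (v N) = ‖((Real.sqrt (v N) : ℝ) : ℂ)‖ₑ ^ 2 := by
    intro N
    rw [← ofReal_norm, Complex.norm_real, Real.norm_of_nonneg (Real.sqrt_nonneg _),
      ← ENNReal.ofReal_pow (Real.sqrt_nonneg _), Real.sq_sqrt (hv N)]
  have h := (hf.num_mul fun N => ((Real.sqrt (v N) : ℝ) : ℂ)).sqInt_sm_le i hg
  have e1 : sqInt 𝓒(n) (sm i g fun y => ((Real.sqrt (v (num y)) : ℝ) : ℂ) * f y) =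
      wInt (fun N => v (N + Pi.single i 1)) (sm i g f) := by
    refine lintegral_congr fun y => ?_
    rw [sm_num_mul i g (fun N => ((Real.sqrt (v N) : ℝ) : ℂ)), enorm_mul, mul_pow, ← key]
  have e2 : sqInt 𝓒(n) (fun y => ((Real.sqrt (v (num y)) : ℝ) : ℂ) * f y) = wInt v f := by
    refine lintegral_congr fun y => ?_
    rw [enorm_mul, mul_pow, ← key]
  rwa [e1, e2] at h

theorem sqInt_modeFun_le (b : Mode) : sqInt xiMeasure (fun ξ => (modeFun b ξ : ℂ)) ≤ 1 := by
  have h := integral_conj_mul_self (memLp_modeFun b)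
  have h2 : ∫ ξ, conj (modeFun b ξ : ℂ) * (modeFun b ξ : ℂ) ∂xiMeasure = 1 := by
    have := integral_modeFun_mul b b
    rw [if_pos rfl] at this
    calc _ = ∫ ξ, ((modeFun b ξ * modeFun b ξ : ℝ) : ℂ) ∂xiMeasure := by
          refine integral_congr_forall fun ξ => ?_
          simp
      _ = 1 := by rw [integral_complex_ofReal, this]; simp
  rw [h2] at h
  have h3 : (sqInt xiMeasure (fun ξ => (modeFun b ξ : ℂ))).toReal = 1 := by exact_mod_cast h.symm
  rw [← ENNReal.ofReal_toReal (sqInt_lt_top (memLp_modeFun b)).ne, h3]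
  simp

/-- The weighted Bessel bound for one species. -/
theorem tsum_single_le {p q θ s : ℝ} (h0 : 0 < θ) (h1 : θ < 1)
    (hs : θ * p + (1 - θ) * q ≤ s) {ρ : Xi → ℝ≥0∞} (hρ : Measurable ρ)
    (hc : CoeffBound xiMeasure modeFun (fun b => ENNReal.ofReal (modeVal b ^ (-p))) ρ)
    {M : ℕ} {f : 𝓕(n)} (hf : Nice M f) (i : Fin (n + 1))
    {w w' t : (𝓞(n)) → ℝ} (hw : ∀ N, w N ≤ w' (N + Pi.single i 1)) (hw' : ∀ N, 0 ≤ w' N)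
    (ht : ∀ N, 0 < t N) :
    ∑' b, ENNReal.ofReal (modeVal b ^ (-s)) * wInt w (sm i (fun ξ => (modeFun b ξ : ℂ)) f) ≤
      (∫⁻ y, occ ρ i y * (ENNReal.ofReal (w' (num y) * t (num y)) * ‖f y‖ₑ ^ 2) ∂𝓒(n)) +
      (∑' b : Mode, ENNReal.ofReal (modeVal b ^ (-q))) *
        wInt (fun N => w' N * t N ^ (-(θ / (1 - θ)))) f := by
  set v1 : (𝓞(n)) → ℝ := fun N => w' N * t N with hv1
  set v2 : (𝓞(n)) → ℝ := fun N => w' N * t N ^ (-(θ / (1 - θ))) with hv2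
  have hv1' : ∀ N, 0 ≤ v1 N := fun N => mul_nonneg (hw' N) (ht N).le
  have hv2' : ∀ N, 0 ≤ v2 N := fun N => mul_nonneg (hw' N) (Real.rpow_nonneg (ht N).le _)
  have hb : ∀ b : Mode, ENNReal.ofReal (modeVal b ^ (-s)) *
      wInt w (sm i (fun ξ => (modeFun b ξ : ℂ)) f) ≤
      ENNReal.ofReal (modeVal b ^ (-p)) * wInt (fun N => v1 (N + Pi.single i 1))
        (sm i (fun ξ => (modeFun b ξ : ℂ)) f) +
      ENNReal.ofReal (modeVal b ^ (-q)) * wInt (fun N => v2 (N + Pi.single i 1))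
        (sm i (fun ξ => (modeFun b ξ : ℂ)) f) := by
    intro b
    have hsm := (hf.smear i (memLp_modeFun b)).aesm
    have hpos : ∀ a : ℝ, 0 ≤ modeVal b ^ a := fun a => (Real.rpow_pos_of_pos (modeVal_pos b) a).le
    have hmeas : ∀ v : (𝓞(n)) → ℝ, AEMeasurable (fun y => ENNReal.ofReal (v (num y)) *
        ‖sm i (fun ξ => (modeFun b ξ : ℂ)) f y‖ₑ ^ 2) 𝓒(n) := fun v =>
      (measurable_comp_num fun N => ENNReal.ofReal (v N)).aemeasurable.mul (hsm.enorm.pow_const 2)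
    have e : ∀ (c : ℝ≥0∞) (v : (𝓞(n)) → ℝ),
        c * wInt v (sm i (fun ξ => (modeFun b ξ : ℂ)) f) = ∫⁻ y, c * (ENNReal.ofReal (v (num y)) *
          ‖sm i (fun ξ => (modeFun b ξ : ℂ)) f y‖ₑ ^ 2) ∂𝓒(n) := fun c v =>
      (lintegral_const_mul'' _ (hmeas v)).symm
    rw [e, e, e]
    have hadd := lintegral_add_left' (μ := 𝓒(n))
      ((hmeas fun N => v1 (N + Pi.single i 1)).const_mul (ENNReal.ofReal (modeVal b ^ (-p))))
      (fun y => ENNReal.ofReal (modeVal b ^ (-q)) * (ENNReal.ofReal (v2 (num y + Pi.single i 1)) *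
        ‖sm i (fun ξ => (modeFun b ξ : ℂ)) f y‖ₑ ^ 2))
    rw [← hadd]
    refine lintegral_mono fun y => ?_
    simp only
    rw [← mul_assoc, ← mul_assoc, ← mul_assoc, ← add_mul, ← ENNReal.ofReal_mul (hpos _),
      ← ENNReal.ofReal_mul (hpos _), ← ENNReal.ofReal_mul (hpos _), ← ENNReal.ofReal_add
        (mul_nonneg (hpos _) (hv1' _)) (mul_nonneg (hpos _) (hv2' _))]
    gcongr
    set N := num y + Pi.single i 1 with hN
    have h2 := rpow_interpolation (one_le_modeVal b) (ht N) h0 h1 hs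
    calc modeVal b ^ (-s) * w (num y) ≤ modeVal b ^ (-s) * w' N :=
          mul_le_mul_of_nonneg_left (hw _) (hpos _)
      _ ≤ (modeVal b ^ (-p) * t N + modeVal b ^ (-q) * t N ^ (-(θ / (1 - θ)))) * w' N :=
          mul_le_mul_of_nonneg_right h2 (hw' N)
      _ = _ := by simp only [hv1, hv2]; ring
  refine (ENNReal.tsum_le_tsum hb).trans ?_
  rw [ENNReal.tsum_add]
  refine add_le_add ?_ ?_
  · have h3 := tsum_sm_le hc memLp_modeFun hρ hf i
      (fun N => ENNReal.ofReal (v1 (N + Pi.single i 1)))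
    rw [lintegral_annih i hρ hf.aesm hf.anti (fun N => ENNReal.ofReal (v1 N))] at h3
    exact h3
  · rw [← ENNReal.tsum_mul_right]
    refine ENNReal.tsum_le_tsum fun b => ?_
    gcongr
    refine (sm_wInt_le hf i (memLp_modeFun b) hv2').trans ?_
    exact mul_le_of_le_one_left' (sqInt_modeFun_le b)

/-- Admissible pairs of the power `s` of the oscillators and the power `θ` of the number operator. -/
def Adm (θ s : ℝ) : Prop := (θ = 1 ∧ 0 ≤ s) ∨ (0 < θ ∧ θ < 1 ∧ ∃ q, 1 < q ∧ (1 - θ) * q ≤ s)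

theorem exists_single_massive {θ s : ℝ} (h : Adm θ s) : ∃ C : ℝ, 0 < C ∧
    ∀ (n : ℕ) (κ : ℝ) (w : (𝓞(n)) → ℝ), Slow κ w → ∀ (M : ℕ) (f : 𝓕(n)),
      Nice M f → ∀ i : Fin n, ∑' b, ENNReal.ofReal (modeVal b ^ (-s)) *
        wInt w (sm i.succ (fun ξ => (modeFun b ξ : ℂ)) f) ≤
          wInt (fun N => C * κ * (w N * lam N ^ θ)) f := by
  have hocc : ∀ (n : ℕ) (v : (𝓞(n)) → ℝ), (∀ N, 0 ≤ v N) → ∀ (f : 𝓕(n))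
      (i : Fin n), ∫⁻ y, occ 1 i.succ y * (ENNReal.ofReal (v (num y)) * ‖f y‖ₑ ^ 2)
        ∂𝓒(n) ≤ wInt (fun N => lam N * v N) f := by
    intro n v hv f i
    refine lintegral_mono fun y => ?_
    simp only
    rw [occ_one, ← mul_assoc, ENNReal.ofReal_mul (lam_pos _).le]
    gcongr
    rw [← ENNReal.ofReal_natCast]
    exact ENNReal.ofReal_le_ofReal (le_lam (num y) i)
  rcases h with ⟨rfl, hs⟩ | ⟨h0, h1, q, hq, hqs⟩
  · refine ⟨1, one_pos, fun n κ w hw M f hf i => ?_⟩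
    have h3 := tsum_sm_le modeFun_bessel memLp_modeFun measurable_one hf i.succ
      (fun N => ENNReal.ofReal (κ * w (N + Pi.single i.succ 1)))
    have h4 := lintegral_annih i.succ (ρ := 1) measurable_one hf.aesm hf.anti
      (fun N => ENNReal.ofReal (κ * w N))
    rw [h4] at h3
    refine le_trans (ENNReal.tsum_le_tsum fun b => ?_) (h3.trans ((hocc n _
      (fun N => mul_nonneg hw.nonneg (hw.pos N).le) f i).trans (wInt_mono (fun N => ?_) f)))
    · refine mul_le_mul' ?_ (wInt_mono (fun N => hw.down N i.succ) _)
      rw [Pi.one_apply, ← ENNReal.ofReal_one]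
      exact ENNReal.ofReal_le_ofReal
        (Real.rpow_le_one_of_one_le_of_nonpos (one_le_modeVal b) (by linarith))
    · rw [Real.rpow_one]; exact le_of_eq (by ring)
  · set S : ℝ≥0∞ := ∑' b : Mode, ENNReal.ofReal (modeVal b ^ (-q)) with hS
    have hSt : S ≠ ∞ := tsum_modeVal_rpow_ne_top hq
    refine ⟨1 + S.toReal, by positivity, fun n κ w hw M f hf i => ?_⟩
    have hp : CoeffBound xiMeasure modeFun (fun b => ENNReal.ofReal (modeVal b ^ (-(0 : ℝ)))) 1 := by
      have : (fun b : Mode => ENNReal.ofReal (modeVal b ^ (-(0 : ℝ)))) = 1 := by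
        funext b; simp
      rw [this]; exact modeFun_bessel
    have h1' : 0 < 1 - θ := by linarith
    have h3 := tsum_single_le (n := n) h0 h1 (p := 0) (q := q) (s := s) (by linarith) measurable_one
      hp hf i.succ (w := w) (w' := fun N => κ * w N) (t := fun N => lam N ^ (-(1 - θ)))
      (fun N => hw.down N i.succ) (fun N => mul_nonneg hw.nonneg (hw.pos N).le)
      (fun N => Real.rpow_pos_of_pos (lam_pos N) _)
    refine h3.trans ?_
    have hv : ∀ N : 𝓞(n), 0 ≤ κ * w N * lam N ^ (-(1 - θ)) := fun N =>
      mul_nonneg (mul_nonneg hw.nonneg (hw.pos N).le) (Real.rpow_pos_of_pos (lam_pos N) _).le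
    have h5 : ∀ N : 𝓞(n), lam N * lam N ^ (-(1 - θ)) = lam N ^ θ := by
      intro N
      rw [← Real.rpow_one_add' (lam_pos N).le (by linarith)]
      congr 1; ring
    have h6 : ∀ N : 𝓞(n), (lam N ^ (-(1 - θ))) ^ (-(θ / (1 - θ))) = lam N ^ θ := by
      intro N
      rw [← Real.rpow_mul (lam_pos N).le]
      congr 1; field_simp
    have h7 := hocc n _ hv f i
    simp only [h6]
    have h8 : (fun N : 𝓞(n) => lam N * (κ * w N * lam N ^ (-(1 - θ)))) =
        fun N => κ * w N * lam N ^ θ := by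
      funext N; rw [← h5]; ring
    rw [h8] at h7
    calc _ ≤ wInt (fun N => κ * w N * lam N ^ θ) f + S * wInt (fun N => κ * w N * lam N ^ θ) f := by
          gcongr
      _ = ENNReal.ofReal (1 + S.toReal) * wInt (fun N => κ * w N * lam N ^ θ) f := by
          rw [ENNReal.ofReal_add zero_le_one ENNReal.toReal_nonneg, ENNReal.ofReal_toReal hSt,
            add_mul]
          simp
      _ = _ := by
          rw [← wInt_const_mul (by positivity)]
          congr 1; funext N; ring

end

/-! ### Successive annihilations -/

/-- The annihilation operator, or the identity. -/
def optAnnih {n : ℕ} (b : Bool) (i : Fin n) (ξ : Xi) (f : Conf n → ℂ) : Conf n → ℂ :=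
  if b then annih i ξ f else f

/-- The operator `sm`, or the identity. -/
def optSm {n : ℕ} (b : Bool) (i : Fin n) (g : Xi → ℂ) (f : Conf n → ℂ) : Conf n → ℂ :=
  if b then sm i g f else f

/-- The annihilation operators of the selected species `sp i`, the first one acting first. -/
def annR {n : ℕ} : (m : ℕ) → (Fin m → Fin n) → (Fin m → Bool) → (Fin m → Xi) → (Conf n → ℂ) →
    Conf n → ℂ
  | 0, _, _, _, f => f
  | m + 1, sp, sel, x, f => annR m (fun i => sp i.succ) (fun i => sel i.succ) (fun i => x i.succ)
      (optAnnih (sel 0) (sp 0) (x 0) f)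

/-- The integrand of the pairing of `φ`, on which the selected species are annihilated, and `f`, on
which the other ones are. -/
def pairFn {n : ℕ} (m : ℕ) (sp : Fin m → Fin n) (sel : Fin m → Bool) (φ f : Conf n → ℂ)
    (z : (Fin m → Xi) × Conf n) : ℂ :=
  conj (annR m sp sel z.1 φ z.2) * annR m sp (fun i => !sel i) z.1 f z.2

/-- The coefficients of the pairing with respect to the Hermite basis. -/
def pairing {n : ℕ} : (m : ℕ) → (Fin m → Fin n) → (Fin m → Bool) → (Fin m → Mode) →
    (Conf n → ℂ) → (Conf n → ℂ) → ℂ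
  | 0, _, _, _, φ, f => ∫ y, conj (φ y) * f y ∂configMeasure n
  | m + 1, sp, sel, β, φ, f => pairing m (fun i => sp i.succ) (fun i => sel i.succ)
      (fun i => β i.succ) (optSm (sel 0) (sp 0) (fun ξ => (modeFun (β 0) ξ : ℂ)) φ)
      (optSm (!sel 0) (sp 0) (fun ξ => (modeFun (β 0) ξ : ℂ)) f)

theorem pairFn_cons {n m : ℕ} (sp : Fin (m + 1) → Fin n) (sel : Fin (m + 1) → Bool)
    (φ f : Conf n → ℂ) (ξ : Xi) (x : Fin m → Xi) (y : Conf n) :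
    pairFn (m + 1) sp sel φ f (Fin.cons ξ x, y) =
      pairFn m (fun i => sp i.succ) (fun i => sel i.succ) (optAnnih (sel 0) (sp 0) ξ φ)
        (optAnnih (!sel 0) (sp 0) ξ f) (x, y) := by
  simp [pairFn, annR]

theorem annR_anti {n m : ℕ} (sp : Fin m → Fin n) (sel : Fin m → Bool) (x : Fin m → Xi)
    {f : Conf n → ℂ} (hf : Anti f) : Anti (annR m sp sel x f) := by
  induction m generalizing f with
  | zero => exact hf
  | succ m ih =>
    refine ih _ _ _ ?_
    unfold optAnnih
    split_ifs
    · exact hf.annihilate _ _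
    · exact hf

theorem annR_eq_zero {n m : ℕ} (sp : Fin m → Fin (n + 1)) (sel : Fin m → Bool)
    (x : Fin m → Xi) {M : ℕ} {f : 𝓕(n)} (hf : ∀ y, (∃ i, M < (y i).1) → f y = 0) :
    ∀ y, (∃ i, M < (y i).1) → annR m sp sel x f y = 0 := by
  induction m generalizing f with
  | zero => exact hf
  | succ m ih =>
    refine ih _ _ _ fun y hy => ?_
    unfold optAnnih
    split_ifs
    · exact annih_eq_zero hf _ _ hy
    · exact hf y hy

theorem annR_integral {n m : ℕ} (sp : Fin m → Fin n) (sel : Fin m → Bool) (x : Fin m → Xi)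
    {Z : Type*} [MeasurableSpace Z] (ζ : Measure Z) (c : Z → ℂ) (F : Z → Conf n → ℂ) :
    annR m sp sel x (fun y => ∫ z, c z * F z y ∂ζ) =
      fun y => ∫ z, c z * annR m sp sel x (F z) y ∂ζ := by
  induction m generalizing F with
  | zero => rfl
  | succ m ih =>
    simp only [annR]
    rw [← ih]
    congr 1
    unfold optAnnih
    split_ifs
    · funext y
      simp only [annih_eq]
      rw [← integral_const_mul]
      exact integral_congr_ae (Eventually.of_forall fun z => by simp only; ring)
    · rfl

section
variable {n : ℕ}

theorem aestronglyMeasurable_optAnnih_param {Z : Type} [MeasurableSpace Z] {ζ : Measure Z}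
    [SFinite ζ] (b : Bool) (i : Fin (n + 1)) {F : Z × Conf (n + 1) → ℂ}
    (hF : AEStronglyMeasurable F (ζ.prod 𝓒(n))) :
    AEStronglyMeasurable (fun w : (Z × Xi) × Conf (n + 1) =>
      optAnnih b i w.1.2 (fun y => F (w.1.1, y)) w.2) ((ζ.prod xiMeasure).prod 𝓒(n)) := by
  cases b
  · have h : Measure.QuasiMeasurePreserving (fun w : (Z × Xi) × Conf (n + 1) => (w.1.1, w.2))
        ((ζ.prod xiMeasure).prod 𝓒(n)) (ζ.prod 𝓒(n)) := by
      have h1 : Measure.QuasiMeasurePreserving (Prod.map Prod.fst id : (Z × Xi) × Conf (n + 1) → _)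
          ((ζ.prod xiMeasure).prod 𝓒(n)) (ζ.prod 𝓒(n)) := by
        refine ⟨measurable_fst.prodMap measurable_id, ?_⟩
        rw [← Measure.map_prod_map _ _ measurable_fst measurable_id, Measure.map_id]
        exact Measure.quasiMeasurePreserving_fst.absolutelyContinuous.prod
          (Measure.AbsolutelyContinuous.refl _)
      exact h1
    exact (hF.comp_quasiMeasurePreserving h)
  · exact aestronglyMeasurable_annih_param i hF

theorem aestronglyMeasurable_annR_param {m : ℕ} (sp : Fin m → Fin (n + 1)) (sel : Fin m → Bool)
    {Z : Type} [MeasurableSpace Z] {ζ : Measure Z} [SFinite ζ] {F : Z × Conf (n + 1) → ℂ}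
    (hF : AEStronglyMeasurable F (ζ.prod 𝓒(n))) :
    AEStronglyMeasurable (fun w : (Z × (Fin m → Xi)) × Conf (n + 1) =>
      annR m sp sel w.1.2 (fun y => F (w.1.1, y)) w.2) ((ζ.prod 𝓚(m)).prod 𝓒(n)) := by
  induction m generalizing Z with
  | zero =>
    have h1 : Measure.QuasiMeasurePreserving
        (Prod.map Prod.fst id : (Z × (Fin 0 → Xi)) × Conf (n + 1) → _)
        ((ζ.prod 𝓚(0)).prod 𝓒(n))
        (ζ.prod 𝓒(n)) := by
      refine ⟨measurable_fst.prodMap measurable_id, ?_⟩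
      rw [← Measure.map_prod_map _ _ measurable_fst measurable_id, Measure.map_id]
      exact Measure.quasiMeasurePreserving_fst.absolutelyContinuous.prod
        (Measure.AbsolutelyContinuous.refl _)
    exact hF.comp_quasiMeasurePreserving h1
  | succ m ih =>
    have h := ih (fun i => sp i.succ) (fun i => sel i.succ)
      (aestronglyMeasurable_optAnnih_param (sel 0) (sp 0) hF)
    have hmp : MeasurePreserving (Prod.map
        (fun z : (Z × Xi) × (Fin m → Xi) => (z.1.1, (Fin.cons z.1.2 z.2 : Fin (m + 1) → Xi))) id)
        (((ζ.prod xiMeasure).prod 𝓚(m)).prod 𝓒(n))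
        ((ζ.prod 𝓚(m + 1)).prod 𝓒(n)) :=
      (((MeasurePreserving.id ζ).prod (measurePreserving_cons m)).comp
        (measurePreserving_prodAssoc ζ xiMeasure 𝓚(m))).prod
        (MeasurePreserving.id _)
    have hme : MeasurableEmbedding (Prod.map
        (fun z : (Z × Xi) × (Fin m → Xi) => (z.1.1, (Fin.cons z.1.2 z.2 : Fin (m + 1) → Xi)))
        (id : Conf (n + 1) → Conf (n + 1))) :=
      ((MeasurableEmbedding.id.prodMap (measurableEmbedding_cons m)).comp
        MeasurableEquiv.prodAssoc.measurableEmbedding).prodMap MeasurableEmbedding.id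
    rw [← hmp.aestronglyMeasurable_comp_iff hme]
    refine h.congr (Eventually.of_forall fun w => ?_)
    simp [annR]

theorem aestronglyMeasurable_annR {m : ℕ} (sp : Fin m → Fin (n + 1)) (sel : Fin m → Bool)
    {f : 𝓕(n)} (hf : AEStronglyMeasurable f 𝓒(n)) :
    AEStronglyMeasurable (fun w : (Fin m → Xi) × Conf (n + 1) => annR m sp sel w.1 f w.2)
      (𝓚(m).prod 𝓒(n)) := by
  have hf' : AEStronglyMeasurable (fun w : Unit × Conf (n + 1) => f w.2)
      ((Measure.dirac ()).prod 𝓒(n)) := hf.comp_snd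
  have h := aestronglyMeasurable_annR_param sp sel hf'
  have h2 := h.comp_measurePreserving (measurePreserving_prodAssoc (Measure.dirac ())
    𝓚(m) 𝓒(n)).symm
  have h3 := h2.prodMk_left
  obtain ⟨u, hu⟩ := h3.exists
  exact hu

theorem aestronglyMeasurable_pairFn {m : ℕ} (sp : Fin m → Fin (n + 1)) (sel : Fin m → Bool)
    {φ f : 𝓕(n)} (hφ : AEStronglyMeasurable φ 𝓒(n)) (hf : AEStronglyMeasurable f 𝓒(n)) :
    AEStronglyMeasurable (pairFn m sp sel φ f) (𝓚(m).prod 𝓒(n)) :=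
  (Complex.continuous_conj.comp_aestronglyMeasurable (aestronglyMeasurable_annR sp sel hφ)).mul
    (aestronglyMeasurable_annR sp _ hf)

theorem Nice.ae_optAnnih {M : ℕ} {f : 𝓕(n)} (hf : Nice M f) (b : Bool)
    (i : Fin (n + 1)) : ∀ᵐ ξ ∂xiMeasure, Nice M (optAnnih b i ξ f) := by
  cases b
  · exact Eventually.of_forall fun _ => hf
  · exact hf.ae_annih i

theorem Nice.optSm {M : ℕ} {f : 𝓕(n)} (hf : Nice M f) (b : Bool) (i : Fin (n + 1))
    {g : Xi → ℂ} (hg : MemLp g 2 xiMeasure) : Nice M (optSm b i g f) := by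
  cases b
  · exact hf
  · exact hf.smear i hg

theorem Nice.ae_annR {m : ℕ} (sp : Fin m → Fin (n + 1)) (sel : Fin m → Bool) {M : ℕ}
    {f : 𝓕(n)} (hf : Nice M f) : ∀ᵐ x ∂𝓚(m), Nice M (annR m sp sel x f) := by
  suffices h : ∀ᵐ x ∂𝓚(m), sqInt 𝓒(n) (annR m sp sel x f) < ∞ by
    filter_upwards [h, (aestronglyMeasurable_annR sp sel hf.aesm).prodMk_left] with x hx hx'
    exact ⟨memLp_two_of_sqInt hx' hx, annR_anti sp sel x hf.anti, annR_eq_zero sp sel x hf.bdd⟩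
  induction m generalizing f with
  | zero => exact Eventually.of_forall fun _ => sqInt_lt_top hf.memLp
  | succ m ih =>
    rw [← (measurePreserving_cons m).map_eq, (measurableEmbedding_cons m).ae_map_iff]
    have hmeas : AEMeasurable (fun z : Xi × (Fin m → Xi) => sqInt 𝓒(n)
        (annR (m + 1) sp sel (Fin.cons z.1 z.2) f)) (xiMeasure.prod 𝓚(m)) :=
      ((aestronglyMeasurable_annR sp sel hf.aesm).enorm.pow_const 2).lintegral_prod_right'
        |>.comp_quasiMeasurePreserving (measurePreserving_cons m).quasiMeasurePreserving
    have h1 : ∀ᵐ ξ ∂xiMeasure, ∀ᵐ x ∂𝓚(m), sqInt 𝓒(n)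
        (annR (m + 1) sp sel (Fin.cons ξ x) f) < ∞ := by
      filter_upwards [hf.ae_optAnnih (sel 0) (sp 0)] with ξ hξ
      simpa [annR] using ih (fun i => sp i.succ) (fun i => sel i.succ) hξ
    have h2 := Measure.ae_ae_of_ae_prod hmeas.ae_eq_mk
    have h3 : ∀ᵐ z ∂(xiMeasure.prod 𝓚(m)), hmeas.mk _ z < ∞ := by
      rw [Measure.ae_prod_iff_ae_ae (measurableSet_lt hmeas.measurable_mk measurable_const)]
      filter_upwards [h1, h2] with ξ h1 h2
      filter_upwards [h1, h2] with x h1 h2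
      rwa [← h2]
    filter_upwards [h3, hmeas.ae_eq_mk] with z h3 h4
    rwa [h4]

theorem lintegral_optAnnih_le {M : ℕ} {φ f : 𝓕(n)} (hφ : Nice M φ) (hf : Nice M f)
    (b : Bool) (i : Fin (n + 1)) :
    ∫⁻ ξ, sqInt 𝓒(n) (optAnnih b i ξ φ) * sqInt 𝓒(n) (optAnnih (!b) i ξ f) ∂xiMeasure ≤
      M * (sqInt 𝓒(n) φ * sqInt 𝓒(n) f) := by
  have key : ∀ {g : 𝓕(n)}, Nice M g → ∫⁻ ξ, sqInt 𝓒(n)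
      (annih i ξ g) ∂xiMeasure ≤ M * sqInt 𝓒(n) g := by
    intro g hg
    refine le_trans (le_of_eq ?_) (hg.memLp_annih i).2
    exact (sqInt_prod (hg.memLp_annih i).1.1).symm
  cases b
  · simp only [optAnnih, Bool.not_false, if_true, Bool.false_eq_true, if_false]
    rw [lintegral_const_mul' _ _ (sqInt_lt_top hφ.memLp).ne]
    calc _ ≤ sqInt 𝓒(n) φ * (M * sqInt 𝓒(n) f) := by
          gcongr; exact key hf
      _ = _ := by ring
  · simp only [optAnnih, Bool.not_true, if_true, Bool.false_eq_true, if_false]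
    rw [lintegral_mul_const' _ _ (sqInt_lt_top hf.memLp).ne]
    calc _ ≤ (M * sqInt 𝓒(n) φ) * sqInt 𝓒(n) f := by
          gcongr; exact key hφ
      _ = _ := by ring

theorem lintegral_pairFn_sq_le {m : ℕ} (sp : Fin m → Fin (n + 1)) (sel : Fin m → Bool) {M : ℕ}
    {φ f : 𝓕(n)} (hφ : Nice M φ) (hf : Nice M f) :
    ∫⁻ x, (∫⁻ y, ‖pairFn m sp sel φ f (x, y)‖ₑ ∂𝓒(n)) ^ 2 ∂𝓚(m) ≤
      M ^ m * (sqInt 𝓒(n) φ * sqInt 𝓒(n) f) := by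
  induction m generalizing φ f with
  | zero =>
    have h : 𝓚(0) = Measure.dirac (default : Fin 0 → Xi) :=
      Measure.pi_of_empty _ _
    rw [h, lintegral_dirac, pow_zero, one_mul]
    simp only [pairFn, annR, enorm_mul]
    refine (lintegral_mul_sq_le (f := fun y => ‖conj (φ y)‖ₑ) ?_ hf.aesm.enorm).trans ?_
    · exact (Complex.continuous_conj.comp_aestronglyMeasurable hφ.aesm).enorm
    · exact le_of_eq (by rw [← sqInt_conj φ]; rfl)
  | succ m ih =>
    have hmeas : AEMeasurable (fun x => (∫⁻ y, ‖pairFn (m + 1) sp sel φ f (x, y)‖ₑ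
        ∂𝓒(n)) ^ 2) 𝓚(m + 1) :=
      ((aestronglyMeasurable_pairFn sp sel hφ.aesm hf.aesm).enorm.lintegral_prod_right').pow_const 2
    rw [← (measurePreserving_cons m).map_eq, (measurableEmbedding_cons m).lintegral_map,
      lintegral_prod]
    · calc _ ≤ ∫⁻ ξ, M ^ m * (sqInt 𝓒(n) (optAnnih (sel 0) (sp 0) ξ φ) *
            sqInt 𝓒(n) (optAnnih (!sel 0) (sp 0) ξ f)) ∂xiMeasure := by
            refine lintegral_mono_ae ?_
            filter_upwards [hφ.ae_optAnnih (sel 0) (sp 0), hf.ae_optAnnih (!sel 0) (sp 0)]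
              with ξ h1 h2
            simp only [pairFn_cons]
            exact ih _ _ h1 h2
        _ ≤ _ := by
            rw [lintegral_const_mul' _ _ (by simp), pow_succ, mul_assoc]
            gcongr
            exact lintegral_optAnnih_le hφ hf _ _
    · exact hmeas.comp_quasiMeasurePreserving (measurePreserving_cons m).quasiMeasurePreserving

theorem integrable_mul_pairFn {m : ℕ} (sp : Fin m → Fin (n + 1)) (sel : Fin m → Bool) {M : ℕ}
    {φ f : 𝓕(n)} (hφ : Nice M φ) (hf : Nice M f) {g : (Fin m → Xi) → ℂ} (hg : MemLp g 2 𝓚(m)) :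
    Integrable (fun z => g z.1 * pairFn m sp sel φ f z) (𝓚(m).prod 𝓒(n)) := by
  have hp := aestronglyMeasurable_pairFn sp sel hφ.aesm hf.aesm
  have hm : AEStronglyMeasurable (fun z => g z.1 * pairFn m sp sel φ f z)
      (𝓚(m).prod 𝓒(n)) := hg.1.comp_fst.mul hp
  refine ⟨hm, ?_⟩
  rw [HasFiniteIntegral, lintegral_prod _ hm.enorm]
  simp only [enorm_mul]
  have h1 : ∀ x, ∫⁻ y, ‖g x‖ₑ * ‖pairFn m sp sel φ f (x, y)‖ₑ ∂𝓒(n) =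
      ‖g x‖ₑ * ∫⁻ y, ‖pairFn m sp sel φ f (x, y)‖ₑ ∂𝓒(n) := fun x =>
    lintegral_const_mul' _ _ (by simp)
  simp only [h1]
  have h2 := lintegral_mul_sq_le (μ := 𝓚(m)) hg.1.enorm hp.enorm.lintegral_prod_right'
  have h3 : (∫⁻ x, ‖g x‖ₑ * ∫⁻ y, ‖pairFn m sp sel φ f (x, y)‖ₑ ∂𝓒(n)
      ∂𝓚(m)) ^ 2 < ∞ := by
    refine h2.trans_lt (ENNReal.mul_lt_top (sqInt_lt_top hg) ?_)
    refine (lintegral_pairFn_sq_le sp sel hφ hf).trans_lt ?_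
    exact ENNReal.mul_lt_top (by simp)
      (ENNReal.mul_lt_top (sqInt_lt_top hφ.memLp) (sqInt_lt_top hf.memLp))
  exact lt_top_iff_ne_top.2 fun h => by simp [h] at h3

theorem memLp_integral_pairFn {m : ℕ} (sp : Fin m → Fin (n + 1)) (sel : Fin m → Bool) {M : ℕ}
    {φ f : 𝓕(n)} (hφ : Nice M φ) (hf : Nice M f) :
    MemLp (fun x => ∫ y, pairFn m sp sel φ f (x, y) ∂𝓒(n)) 2 𝓚(m) := by
  have hp := aestronglyMeasurable_pairFn sp sel hφ.aesm hf.aesm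
  refine memLp_two_of_sqInt hp.integral_prod_right' ?_
  refine lt_of_le_of_lt (lintegral_mono fun x => ?_) ((lintegral_pairFn_sq_le sp sel hφ hf).trans_lt
    (ENNReal.mul_lt_top (by simp)
      (ENNReal.mul_lt_top (sqInt_lt_top hφ.memLp) (sqInt_lt_top hf.memLp))))
  exact ENNReal.pow_le_pow_left (enorm_integral_le_lintegral_enorm _)

theorem integral_modesFun_mul_pairFn {m : ℕ} (sp : Fin m → Fin (n + 1)) (sel : Fin m → Bool)
    {M : ℕ} {φ f : 𝓕(n)} (hφ : Nice M φ) (hf : Nice M f) (β : Fin m → Mode) :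
    ∫ z, (modesFun β z.1 : ℂ) * pairFn m sp sel φ f z ∂𝓚(m).prod 𝓒(n) = pairing m sp sel β φ f := by
  induction m generalizing φ f with
  | zero =>
    have h : 𝓚(0) = Measure.dirac (default : Fin 0 → Xi) :=
      Measure.pi_of_empty _ _
    have hi := integrable_mul_pairFn sp sel hφ hf (memLp_modesFun β)
    rw [integral_prod _ hi]
    simp only [h, pairing, pairFn, annR, modesFun]
    simp
  | succ m ih =>
    have hi := integrable_mul_pairFn sp sel hφ hf (memLp_modesFun β)
    have hmp : MeasurePreserving (fun w : Xi × ((Fin m → Xi) × Conf (n + 1)) =>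
        ((Fin.cons w.1 w.2.1 : Fin (m + 1) → Xi), w.2.2))
        (xiMeasure.prod (𝓚(m).prod 𝓒(n)))
        (𝓚(m + 1).prod 𝓒(n)) :=
      ((measurePreserving_cons m).prod (MeasurePreserving.id 𝓒(n))).comp
        (measurePreserving_prodAssoc xiMeasure 𝓚(m) 𝓒(n)).symm
    have hme : MeasurableEmbedding (fun w : Xi × ((Fin m → Xi) × Conf (n + 1)) =>
        ((Fin.cons w.1 w.2.1 : Fin (m + 1) → Xi), w.2.2)) :=
      ((measurableEmbedding_cons m).prodMap MeasurableEmbedding.id).comp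
        MeasurableEquiv.prodAssoc.symm.measurableEmbedding
    rw [← hmp.integral_comp hme]
    rw [← hmp.integrable_comp_emb hme] at hi
    simp only [Function.comp_def] at hi
    have e1 := memLp_modeFun (β 0)
    rw [integral_prod_symm _ hi, pairing, ← ih _ _ (hφ.optSm (sel 0) (sp 0) e1)
      (hf.optSm (!sel 0) (sp 0) e1)]
    refine integral_congr_forall fun z => ?_
    obtain ⟨x, y⟩ := z
    have hmf : ∀ ξ, (modesFun β (Fin.cons ξ x) : ℂ) =
        (modeFun (β 0) ξ : ℂ) * (modesFun (fun i => β i.succ) x : ℂ) := by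
      intro ξ; simp [modesFun, Fin.prod_univ_succ]
    simp only [pairFn_cons, hmf]
    set c := (modesFun (fun i => β i.succ) x : ℂ)
    cases hs : sel 0
    · simp only [optAnnih, optSm, Bool.not_false, if_true, Bool.false_eq_true, if_false, pairFn]
      have := congrFun (annR_integral (fun i => sp i.succ) (fun i => !sel i.succ) x xiMeasure
        (fun ξ => (modeFun (β 0) ξ : ℂ)) (fun ξ => annih (sp 0) ξ f)) y
      have h2 : sm (sp 0) (fun ξ => (modeFun (β 0) ξ : ℂ)) f =
        fun y => ∫ ξ, (modeFun (β 0) ξ : ℂ) * annih (sp 0) ξ f y ∂xiMeasure := rfl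
      rw [h2, this, ← mul_assoc, ← integral_const_mul]
      refine integral_congr_forall fun ξ => ?_
      ring
    · simp only [optAnnih, optSm, Bool.not_true, if_true, Bool.false_eq_true, if_false, pairFn]
      have := congrFun (annR_integral (fun i => sp i.succ) (fun i => sel i.succ) x xiMeasure
        (fun ξ => (modeFun (β 0) ξ : ℂ)) (fun ξ => annih (sp 0) ξ φ)) y
      have h2 : sm (sp 0) (fun ξ => (modeFun (β 0) ξ : ℂ)) φ =
        fun y => ∫ ξ, (modeFun (β 0) ξ : ℂ) * annih (sp 0) ξ φ y ∂xiMeasure := rfl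
      rw [h2, this, ← integral_conj, mul_comm (∫ _, _ ∂_), ← mul_assoc, ← integral_const_mul]
      refine integral_congr_forall fun ξ => ?_
      simp only [map_mul, Complex.conj_ofReal]; ring

end

open NNReal

section
variable {n : ℕ}

/-! ### Pairings with one free species -/

theorem integral_mul_conj_annih {M : ℕ} {φ f : 𝓕(n)} (hφ : Nice M φ)
    (hf : MemLp f 2 𝓒(n)) (i : Fin (n + 1)) {g : Xi → ℂ} (hg : MemLp g 2 xiMeasure) :
    ∫ ξ, g ξ * ∫ y, conj (annih i ξ φ y) * f y ∂𝓒(n) ∂xiMeasure =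
      ∫ y, conj (sm i (fun ξ => conj (g ξ)) φ y) * f y ∂𝓒(n) := by
  have hi := (memLp_mul_prod hg hf).integrable_mul (MemLp_conj (hφ.memLp_annih i).1)
  calc _ = ∫ ξ, ∫ y, (g ξ * f y) * conj (annih i ξ φ y) ∂𝓒(n)
        ∂xiMeasure := by
        refine integral_congr_forall fun ξ => ?_
        rw [← integral_const_mul]
        refine integral_congr_forall fun y => ?_
        ring
    _ = ∫ y, ∫ ξ, (g ξ * f y) * conj (annih i ξ φ y) ∂xiMeasure
        ∂𝓒(n) := integral_integral_swap hi
    _ = _ := by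
        refine integral_congr_forall fun y => ?_
        simp only [sm]
        rw [← integral_conj, ← integral_mul_const]
        refine integral_congr_forall fun ξ => ?_
        simp only [map_mul, Complex.conj_conj]; ring

theorem tsum_free_le {M : ℕ} {φ f : 𝓕(n)} (hφ : Nice M φ) (hf : MemLp f 2 𝓒(n)) (i : Fin (n + 1)) :
    ∑' b, ‖∫ y, conj (sm i (fun ξ => (modeFun b ξ : ℂ)) φ y) * f y ∂𝓒(n)‖ₑ ^ 2 ≤
      sqInt 𝓒(n) φ * sqInt 𝓒(n) f := by
  set J : Xi → ℂ := fun ξ => ∫ y, conj (annih i ξ φ y) * f y ∂𝓒(n) with hJ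
  have hJL : MemLp J 2 xiMeasure := by
    have := memLp_integral_mul hf (MemLp_conj (hφ.memLp_annih i).1)
    refine this.ae_eq (Eventually.of_forall fun ξ => ?_)
    exact integral_congr_ae (Eventually.of_forall fun y => mul_comm _ _)
  have h1 := modeFun_bessel J hJL
  have h2 : ∀ b, ∫ ξ, (modeFun b ξ : ℂ) * J ξ ∂xiMeasure = ∫ y, conj
      (sm i (fun ξ => (modeFun b ξ : ℂ)) φ y) * f y ∂𝓒(n) := by
    intro b
    rw [hJ, integral_mul_conj_annih hφ hf i (memLp_modeFun b)]
    simp only [Complex.conj_ofReal]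
  simp only [h2, Pi.one_apply, one_mul] at h1
  refine h1.trans ?_
  have h3 := integral_mul_conj_annih hφ hf i (MemLp_conj hJL)
  rw [integral_conj_mul_self hJL] at h3
  simp only [Complex.conj_conj] at h3
  have h4 := enorm_integral_mul_sq_le (MemLp_conj (hφ.smear i hJL).memLp).1 hf.1
  rw [← h3, sqInt_conj] at h4
  have h5 := h4.trans (mul_le_mul_left (hφ.sqInt_sm_le i hJL) _)
  have hfin := (sqInt_lt_top hJL).ne
  have h6 : ‖((sqInt xiMeasure J).toReal : ℂ)‖ₑ = sqInt xiMeasure J := by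
    rw [← ofReal_norm, Complex.norm_real, Real.norm_of_nonneg ENNReal.toReal_nonneg,
      ENNReal.ofReal_toReal hfin]
  rw [h6, sq, mul_assoc] at h5
  change sqInt xiMeasure J ≤ _
  rcases eq_or_ne (sqInt xiMeasure J) 0 with h0 | h0
  · rw [h0]; exact zero_le
  · exact (ENNReal.mul_le_mul_iff_right h0 hfin).1 h5

/-! ### Bounds for the coefficients of pairings -/

/-- The weighted square sum of the coefficients of the pairing. -/
def pairSum (m : ℕ) (sp : Fin m → Fin n) (sel : Fin m → Bool) (r : Fin m → ℝ)
    (φ f : Conf n → ℂ) : ℝ≥0∞ :=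
  ∑' β, (ENNReal.ofReal (oscWeight r β)⁻¹) ^ 2 * ‖pairing m sp sel β φ f‖ₑ ^ 2

theorem pairSum_zero (sp : Fin 0 → Fin n) (sel : Fin 0 → Bool) (r : Fin 0 → ℝ) (φ f : Conf n → ℂ) :
    pairSum 0 sp sel r φ f = ‖∫ y, conj (φ y) * f y ∂configMeasure n‖ₑ ^ 2 := by
  simp [pairSum, pairing, oscWeight]

theorem pairSum_succ {m : ℕ} (sp : Fin (m + 1) → Fin n) (sel : Fin (m + 1) → Bool)
    (r : Fin (m + 1) → ℝ) (φ f : Conf n → ℂ) :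
    pairSum (m + 1) sp sel r φ f = ∑' b, ENNReal.ofReal (modeVal b ^ (-(2 * r 0))) *
      pairSum m (fun i => sp i.succ) (fun i => sel i.succ) (fun i => r i.succ)
        (optSm (sel 0) (sp 0) (fun ξ => (modeFun b ξ : ℂ)) φ)
        (optSm (!sel 0) (sp 0) (fun ξ => (modeFun b ξ : ℂ)) f) := by
  rw [pairSum, ← (Fin.consEquiv fun _ => Mode).tsum_eq]
  rw [ENNReal.tsum_prod (f := fun b (β : Fin m → Mode) =>
    (ENNReal.ofReal (oscWeight r (Fin.consEquiv (fun _ => Mode) (b, β)))⁻¹) ^ 2 *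
      ‖pairing (m + 1) sp sel (Fin.consEquiv (fun _ => Mode) (b, β)) φ f‖ₑ ^ 2)]
  refine tsum_congr fun b => ?_
  rw [pairSum, ← ENNReal.tsum_mul_left]
  refine tsum_congr fun β => ?_
  have h1 : oscWeight r (Fin.consEquiv (fun _ => Mode) (b, β)) =
      modeVal b ^ r 0 * oscWeight (fun i => r i.succ) β := by
    simp [oscWeight, Fin.prod_univ_succ, Fin.consEquiv]
  have h2 : (ENNReal.ofReal (modeVal b ^ r 0)⁻¹) ^ 2 = ENNReal.ofReal (modeVal b ^ (-(2 * r 0))) := by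
    rw [← ENNReal.ofReal_pow (inv_nonneg.2 (Real.rpow_pos_of_pos (modeVal_pos b) _).le)]
    congr 1
    rw [← Real.rpow_neg (modeVal_pos b).le, ← Real.rpow_natCast, ← Real.rpow_mul (modeVal_pos b).le]
    congr 1; push_cast; ring
  rw [h1, mul_inv, ENNReal.ofReal_mul (inv_nonneg.2 (Real.rpow_pos_of_pos (modeVal_pos b) _).le),
    mul_pow, h2, mul_assoc]
  rfl

theorem Slow.mono {κ κ' : ℝ} {w : (𝓞(n)) → ℝ} (h : Slow κ w) (hκ : κ ≤ κ') : Slow κ' w where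
  pos := h.pos
  down := fun N i => (h.down N i).trans (mul_le_mul_of_nonneg_right hκ (h.pos _).le)
  up := fun N i => (h.up N i).trans (mul_le_mul_of_nonneg_right hκ (h.pos _).le)

/-- The coefficients of the pairing are bounded by two weighted norms, provided that the product of
the weights is at least the power `A` of the number of massive particles. -/
def PairBound (m : ℕ) (sp : Fin m → Fin (n + 1)) (sel : Fin m → Bool) (r : Fin m → ℝ)
    (A : ℝ) : Prop :=
  ∀ κ : ℝ, ∃ C : ℝ≥0, ∀ w₁ w₂ : (𝓞(n)) → ℝ, Slow κ w₁ → Slow κ w₂ →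
    (∀ N, lam N ^ A ≤ w₁ N * w₂ N) → ∀ (M : ℕ) (φ f : 𝓕(n)), Nice M φ → Nice M f →
      pairSum m sp sel r φ f ≤ C * (wInt w₁ φ * wInt w₂ f)

theorem enorm_integral_sq_le_wInt {φ f : 𝓕(n)} (hφ : AEStronglyMeasurable φ 𝓒(n))
    (hf : AEStronglyMeasurable f 𝓒(n)) {w₁ w₂ : (𝓞(n)) → ℝ}
    (h1 : ∀ N, 0 ≤ w₁ N) (h2 : ∀ N, 0 ≤ w₂ N) (h : ∀ N, 1 ≤ w₁ N * w₂ N) :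
    ‖∫ y, conj (φ y) * f y ∂𝓒(n)‖ₑ ^ 2 ≤ wInt w₁ φ * wInt w₂ f := by
  have hm : ∀ (w : (𝓞(n)) → ℝ) {g : 𝓕(n)}, AEStronglyMeasurable g 𝓒(n) →
      AEMeasurable (fun y => ENNReal.ofReal (Real.sqrt (w (num y))) * ‖g y‖ₑ)
        𝓒(n) := fun w g hg =>
    (measurable_comp_num fun N => ENNReal.ofReal (Real.sqrt (w N))).aemeasurable.mul hg.enorm
  have hw : ∀ (w : (𝓞(n)) → ℝ) (_ : ∀ N, 0 ≤ w N) (g : 𝓕(n)),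
      ∫⁻ y, (ENNReal.ofReal (Real.sqrt (w (num y))) * ‖g y‖ₑ) ^ 2 ∂𝓒(n) =
        wInt w g := fun w hw g => lintegral_congr fun y => by
    rw [mul_pow, ← ENNReal.ofReal_pow (Real.sqrt_nonneg _), Real.sq_sqrt (hw _)]
  rw [← hw w₁ h1, ← hw w₂ h2]
  refine le_trans ?_ (lintegral_mul_sq_le (hm w₁ hφ) (hm w₂ hf))
  refine ENNReal.pow_le_pow_left ((enorm_integral_le_lintegral_enorm _).trans
    (lintegral_mono fun y => ?_))
  simp only [enorm_mul, RCLike.enorm_conj]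
  calc ‖φ y‖ₑ * ‖f y‖ₑ = 1 * (‖φ y‖ₑ * ‖f y‖ₑ) := (one_mul _).symm
    _ ≤ (ENNReal.ofReal (Real.sqrt (w₁ (num y))) * ENNReal.ofReal (Real.sqrt (w₂ (num y)))) *
        (‖φ y‖ₑ * ‖f y‖ₑ) := by
        gcongr
        rw [← ENNReal.ofReal_mul (Real.sqrt_nonneg _), ← Real.sqrt_mul (h1 _), ← ENNReal.ofReal_one]
        exact ENNReal.ofReal_le_ofReal (Real.one_le_sqrt.2 (h _))
    _ = _ := by ring

theorem pairBound_zero (sp : Fin 0 → Fin (n + 1)) (sel : Fin 0 → Bool) (r : Fin 0 → ℝ) :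
    PairBound 0 sp sel r 0 := by
  refine fun κ => ⟨1, fun w₁ w₂ hw₁ hw₂ hw M φ f hφ hf => ?_⟩
  rw [pairSum_zero, ENNReal.coe_one, one_mul]
  exact enorm_integral_sq_le_wInt hφ.aesm hf.aesm (fun N => (hw₁.pos N).le)
    (fun N => (hw₂.pos N).le) (fun N => by simpa using hw N)

theorem tsum_free_wInt_le {κ : ℝ} {w₁ w₂ : (𝓞(n)) → ℝ} (hw₁ : Slow κ w₁)
    (hw₂ : Slow κ w₂) (hw : ∀ N, 1 ≤ w₁ N * w₂ N) {M : ℕ} {φ f : 𝓕(n)} (hφ : Nice M φ)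
    (hf : Nice M f) (i : Fin (n + 1)) :
    ∑' b, ‖∫ y, conj (sm i (fun ξ => (modeFun b ξ : ℂ)) φ y) * f y
      ∂𝓒(n)‖ₑ ^ 2 ≤ ENNReal.ofReal κ * (wInt w₁ φ * wInt w₂ f) := by
  set u : (𝓞(n)) → ℂ := fun N => ((Real.sqrt (w₁ N) : ℝ) : ℂ) with hu
  set v : (𝓞(n)) → ℂ := fun N => (u (N + Pi.single i 1))⁻¹ with hv
  have hu0 : ∀ N, u N ≠ 0 := fun N => by
    simp only [hu, ne_eq, Complex.ofReal_eq_zero]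
    exact (Real.sqrt_pos.2 (hw₁.pos N)).ne'
  have hconj : ∀ N, conj (u N) = u N := fun N => Complex.conj_ofReal _
  have h := tsum_free_le (hφ.num_mul u) (hf.num_mul v).memLp i
  have hnorm : ∀ N, ‖u N‖ₑ ^ 2 = ENNReal.ofReal (w₁ N) := by
    intro N
    rw [← ofReal_norm, Complex.norm_real, Real.norm_of_nonneg (Real.sqrt_nonneg _),
      ← ENNReal.ofReal_pow (Real.sqrt_nonneg _), Real.sq_sqrt (hw₁.pos N).le]
  refine le_trans (le_of_eq (tsum_congr fun b => ?_)) (h.trans ?_)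
  · congr 2
    refine integral_congr_forall fun y => ?_
    simp only [sm_num_mul, map_mul, hconj, hv]
    field_simp [hu0]
  · have e1 : sqInt 𝓒(n) (fun y => u (num y) * φ y) = wInt w₁ φ :=
      lintegral_congr fun y => by rw [enorm_mul, mul_pow, hnorm]
    have e2 : sqInt 𝓒(n) (fun y => v (num y) * f y) ≤ wInt (fun N => κ * w₂ N) f := by
      refine lintegral_mono fun y => ?_
      simp only
      rw [enorm_mul, mul_pow, hv]
      gcongr
      rw [enorm_inv (hu0 _), ← ENNReal.inv_pow, hnorm, ← ENNReal.ofReal_inv_of_pos (hw₁.pos _)]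
      refine ENNReal.ofReal_le_ofReal ?_
      rw [inv_le_iff_one_le_mul₀ (hw₁.pos _)]
      calc 1 ≤ w₁ (num y) * w₂ (num y) := hw _
        _ ≤ (κ * w₁ (num y + Pi.single i 1)) * w₂ (num y) :=
          mul_le_mul_of_nonneg_right (hw₁.down _ _) (hw₂.pos _).le
        _ = _ := by ring
    rw [e1]
    refine (mul_le_mul_right e2 _).trans (le_of_eq ?_)
    rw [wInt_const_mul hw₁.nonneg]
    ring

theorem pairBound_free (sp : Fin 1 → Fin (n + 1)) (sel : Fin 1 → Bool) {r : Fin 1 → ℝ}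
    (hr : r 0 = 0) : PairBound 1 sp sel r 0 := by
  refine fun κ => ⟨κ.toNNReal, fun w₁ w₂ hw₁ hw₂ hw M φ f hφ hf => ?_⟩
  have hw' : ∀ N, 1 ≤ w₁ N * w₂ N := fun N => by simpa using hw N
  rw [pairSum_succ]
  simp only [hr, mul_zero, neg_zero, Real.rpow_zero, ENNReal.ofReal_one, one_mul, pairSum_zero]
  cases sel 0
  · simp only [optSm, Bool.not_false, if_true, Bool.false_eq_true, if_false]
    refine le_trans (le_of_eq (tsum_congr fun b => ?_)) ((tsum_free_wInt_le hw₂ hw₁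
      (fun N => by rw [mul_comm]; exact hw' N) hf hφ (sp 0)).trans (le_of_eq ?_))
    · rw [← RCLike.enorm_conj, ← integral_conj]
      congr 2
      refine integral_congr_forall fun y => ?_
      simp only [map_mul, Complex.conj_conj]; ring
    · rw [mul_comm (wInt w₂ f)]; rfl
  · simp only [optSm, Bool.not_true, if_true, Bool.false_eq_true, if_false]
    exact tsum_free_wInt_le hw₁ hw₂ hw' hφ hf (sp 0)

theorem Slow.mul_lam_rpow {κ : ℝ} {w : (𝓞(n)) → ℝ} (h : Slow κ w) (s : ℝ) :
    Slow (κ * 2 ^ |s|) (fun N => w N * lam N ^ s) := h.mul (slow_lam_rpow s)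

theorem le_mul_two_rpow_abs {κ : ℝ} (hκ : 0 ≤ κ) (s : ℝ) : κ ≤ κ * 2 ^ |s| :=
  le_mul_of_one_le_right hκ (Real.one_le_rpow (by norm_num) (abs_nonneg s))

theorem PairBound.cons {m : ℕ} {sp : Fin (m + 1) → Fin (n + 1)} {sel : Fin (m + 1) → Bool}
    {r : Fin (m + 1) → ℝ} {A θ : ℝ}
    (h : PairBound m (fun i => sp i.succ) (fun i => sel i.succ) (fun i => r i.succ) A)
    {j : Fin n} (hj : sp 0 = j.succ) (hθ : Adm θ (2 * r 0)) :
    PairBound (m + 1) sp sel r (A + θ) := by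
  intro κ
  obtain ⟨C, hC⟩ := h (κ * 2 ^ |-θ|)
  obtain ⟨C', hC'0, hC'⟩ := exists_single_massive hθ
  refine ⟨C * (C' * (κ * 2 ^ |-θ|)).toNNReal, fun w₁ w₂ hw₁ hw₂ hw M φ f hφ hf => ?_⟩
  have hk : 0 ≤ C' * (κ * 2 ^ |-θ|) :=
    mul_nonneg hC'0.le (mul_nonneg hw₁.nonneg (by positivity))
  have hlam : ∀ (w : (𝓞(n)) → ℝ) N, w N * lam N ^ (-θ) * lam N ^ θ = w N := by
    intro w N
    rw [mul_assoc, ← Real.rpow_add (lam_pos N), neg_add_cancel, Real.rpow_zero, mul_one]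
  have hpow : ∀ N : 𝓞(n), lam N ^ A = lam N ^ (A + θ) * lam N ^ (-θ) := fun N => by
    rw [← Real.rpow_add (lam_pos N)]; congr 1; ring
  have hpos : ∀ N : 𝓞(n), 0 ≤ lam N ^ (-θ) := fun N =>
    (Real.rpow_pos_of_pos (lam_pos N) _).le
  rw [pairSum_succ, hj]
  have e1 := fun b => memLp_modeFun b
  have key : ∀ (w : (𝓞(n)) → ℝ) (hw : Slow κ w) {g : 𝓕(n)} (hg : Nice M g),
      ∑' b, ENNReal.ofReal (modeVal b ^ (-(2 * r 0))) * wInt (fun N => w N * lam N ^ (-θ))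
        (sm j.succ (fun ξ => (modeFun b ξ : ℂ)) g) ≤
      ENNReal.ofReal (C' * (κ * 2 ^ |-θ|)) * wInt w g := by
    intro w hw g hg
    refine (hC' n _ _ (hw.mul_lam_rpow (-θ)) M g hg j).trans ?_
    simp only [hlam]
    rw [wInt_const_mul hk]
  cases sel 0
  · simp only [optSm, Bool.not_false, if_true, Bool.false_eq_true, if_false]
    calc _ ≤ ∑' b, C * wInt w₁ φ * (ENNReal.ofReal (modeVal b ^ (-(2 * r 0))) *
          wInt (fun N => w₂ N * lam N ^ (-θ)) (sm j.succ (fun ξ => (modeFun b ξ : ℂ)) f)) := by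
          refine ENNReal.tsum_le_tsum fun b => ?_
          refine (mul_le_mul_right (hC _ _ (hw₁.mono (le_mul_two_rpow_abs hw₁.nonneg _))
            (hw₂.mul_lam_rpow (-θ)) (fun N => ?_) M _ _ hφ (hf.smear j.succ (e1 b))) _).trans
              (le_of_eq (by ring))
          rw [hpow, ← mul_assoc]
          exact mul_le_mul_of_nonneg_right (hw N) (hpos N)
      _ ≤ C * wInt w₁ φ * (ENNReal.ofReal (C' * (κ * 2 ^ |-θ|)) * wInt w₂ f) := by
          rw [ENNReal.tsum_mul_left]; gcongr; exact key w₂ hw₂ hf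
      _ = _ := by rw [ENNReal.ofReal]; push_cast; ring
  · simp only [optSm, Bool.not_true, if_true, Bool.false_eq_true, if_false]
    calc _ ≤ ∑' b, C * wInt w₂ f * (ENNReal.ofReal (modeVal b ^ (-(2 * r 0))) *
          wInt (fun N => w₁ N * lam N ^ (-θ)) (sm j.succ (fun ξ => (modeFun b ξ : ℂ)) φ)) := by
          refine ENNReal.tsum_le_tsum fun b => ?_
          refine (mul_le_mul_right (hC _ _ (hw₁.mul_lam_rpow (-θ))
            (hw₂.mono (le_mul_two_rpow_abs hw₂.nonneg _)) (fun N => ?_) M _ _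
              (hφ.smear j.succ (e1 b)) hf) _).trans (le_of_eq (by ring))
          rw [hpow, mul_right_comm]
          exact mul_le_mul_of_nonneg_right (hw N) (hpos N)
      _ ≤ C * wInt w₂ f * (ENNReal.ofReal (C' * (κ * 2 ^ |-θ|)) * wInt w₁ φ) := by
          rw [ENNReal.tsum_mul_left]; gcongr; exact key w₁ hw₁ hφ
      _ = _ := by rw [ENNReal.ofReal]; push_cast; ring

theorem pairBound_massive {θ : ℝ} {m : ℕ} (sp : Fin m → Fin (n + 1)) (sel : Fin m → Bool)
    (r : Fin m → ℝ) (h : ∀ i, sp i ≠ 0 ∧ Adm θ (2 * r i)) : PairBound m sp sel r (m * θ) := by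
  induction m with
  | zero => simpa using pairBound_zero sp sel r
  | succ m ih =>
    have h1 := ih (fun i => sp i.succ) (fun i => sel i.succ) (fun i => r i.succ) fun i => h i.succ
    obtain ⟨j, hj⟩ := Fin.exists_succ_eq.2 (h 0).1
    have h2 := h1.cons hj.symm (h 0).2
    convert h2 using 1
    push_cast; ring

theorem pairBound_massive_free {θ : ℝ} {m : ℕ} (sp : Fin (m + 1) → Fin (n + 1))
    (sel : Fin (m + 1) → Bool) (r : Fin (m + 1) → ℝ) (hr : r (Fin.last m) = 0)
    (h : ∀ i : Fin m, sp i.castSucc ≠ 0 ∧ Adm θ (2 * r i.castSucc)) :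
    PairBound (m + 1) sp sel r (m * θ) := by
  induction m with
  | zero => simpa using pairBound_free sp sel hr
  | succ m ih =>
    have h1 := ih (fun i => sp i.succ) (fun i => sel i.succ) (fun i => r i.succ) hr fun i => by
      rw [Fin.succ_castSucc]; exact h i.succ
    obtain ⟨j, hj⟩ := Fin.exists_succ_eq.2 (h 0).1
    have h2 := h1.cons hj.symm (h 0).2
    convert h2 using 1
    push_cast; ring

/-! ### Energy bounds -/

/-- The weighted energy: the number of massive particles and the momenta of the massless ones. -/
def eInt (w : (𝓞(n)) → ℝ) (f : 𝓕(n)) : ℝ≥0∞ :=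
  ∫⁻ y, (ENNReal.ofReal (lam (num y)) + occ (fun ξ => ‖ξ.1‖ₑ) 0 y) *
    (ENNReal.ofReal (w (num y)) * ‖f y‖ₑ ^ 2) ∂𝓒(n)

theorem rpow_le_mul_add {a δ : ℝ} (ha : a < 1) (hδ : 0 < δ) :
    ∃ C : ℝ, 0 < C ∧ ∀ x : ℝ, 1 ≤ x → x ^ a ≤ δ * x + C := by
  set X : ℝ := δ ^ (-(1 - a)⁻¹) with hX
  have hX0 : 0 < X := Real.rpow_pos_of_pos hδ _
  refine ⟨X ^ |a|, Real.rpow_pos_of_pos hX0 _, fun x hx => ?_⟩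
  have hx0 : 0 < x := one_pos.trans_le hx
  rcases le_total X x with h | h
  · have h1 : x ^ a = x ^ (a - 1) * x := by
      rw [← Real.rpow_add_one hx0.ne']; congr 1; ring
    have h2 : X ^ (a - 1) = δ := by
      rw [hX, ← Real.rpow_mul hδ.le]
      have h3 : -(1 - a)⁻¹ * (a - 1) = 1 := by
        have : 1 - a ≠ 0 := by linarith
        field_simp; ring
      rw [h3, Real.rpow_one]
    have h4 := Real.rpow_le_rpow_of_nonpos hX0 h (by linarith : a - 1 ≤ 0)
    rw [h2] at h4
    rw [h1]
    have h5 : 0 < X ^ |a| := Real.rpow_pos_of_pos hX0 _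
    nlinarith
  · calc x ^ a ≤ x ^ |a| := Real.rpow_le_rpow_of_exponent_le hx (le_abs_self a)
      _ ≤ X ^ |a| := Real.rpow_le_rpow hx0.le h (abs_nonneg a)
      _ ≤ _ := le_add_of_nonneg_left (by positivity)

theorem eInt_lam_le {w : (𝓞(n)) → ℝ} (f : 𝓕(n)) : wInt (fun N => lam N * w N) f ≤ eInt w f := by
  refine lintegral_mono fun y => ?_
  simp only
  rw [ENNReal.ofReal_mul (lam_pos _).le, mul_assoc]
  gcongr
  exact le_self_add

theorem eInt_occ_le {w : (𝓞(n)) → ℝ} (f : 𝓕(n)) :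
    ∫⁻ y, occ (fun ξ => ‖ξ.1‖ₑ) 0 y * (ENNReal.ofReal (w (num y)) * ‖f y‖ₑ ^ 2)
      ∂𝓒(n) ≤ eInt w f := by
  refine lintegral_mono fun y => ?_
  simp only
  gcongr
  exact le_add_self

theorem wInt_add {f : 𝓕(n)} (hf : AEStronglyMeasurable f 𝓒(n))
    {w w' : (𝓞(n)) → ℝ} (hw : ∀ N, 0 ≤ w N) (hw' : ∀ N, 0 ≤ w' N) :
    wInt (fun N => w N + w' N) f = wInt w f + wInt w' f := by
  have hm : AEMeasurable (fun y => ENNReal.ofReal (w (num y)) * ‖f y‖ₑ ^ 2)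
      𝓒(n) :=
    (measurable_comp_num fun N => ENNReal.ofReal (w N)).aemeasurable.mul (hf.enorm.pow_const 2)
  rw [wInt, wInt, wInt, ← lintegral_add_left' hm]
  refine lintegral_congr fun y => ?_
  rw [ENNReal.ofReal_add (hw _) (hw' _), add_mul]

theorem exists_wInt_lam_rpow_le {a δ : ℝ} (ha : a < 1) (hδ : 0 < δ) : ∃ C : ℝ≥0,
    ∀ (w : (𝓞(n)) → ℝ), (∀ N, 0 ≤ w N) → ∀ f : 𝓕(n), AEStronglyMeasurable f 𝓒(n) →
      wInt (fun N => w N * lam N ^ a) f ≤ ENNReal.ofReal δ * eInt w f + C * wInt w f := by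
  obtain ⟨C, hC, h⟩ := rpow_le_mul_add ha hδ
  refine ⟨C.toNNReal, fun w hw f hf => ?_⟩
  have h0 : ∀ N : 𝓞(n), 0 ≤ lam N * w N := fun N => mul_nonneg (lam_pos N).le (hw N)
  calc wInt (fun N => w N * lam N ^ a) f
      ≤ wInt (fun N => δ * (lam N * w N) + C * w N) f := by
        refine wInt_mono (fun N => ?_) f
        calc w N * lam N ^ a ≤ w N * (δ * lam N + C) :=
              mul_le_mul_of_nonneg_left (h _ (one_le_lam N)) (hw N)
          _ = _ := by ring
    _ = ENNReal.ofReal δ * wInt (fun N => lam N * w N) f + ENNReal.ofReal C * wInt w f := by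
        rw [wInt_add hf (fun N => mul_nonneg hδ.le (h0 N)) (fun N => mul_nonneg hC.le (hw N)),
          wInt_const_mul hδ.le, wInt_const_mul hC.le]
    _ ≤ _ := by
        gcongr
        · exact eInt_lam_le f
        · exact le_rfl

/-- The bound for the species whose mass may vanish. -/
theorem exists_single_massless {p q θ s a : ℝ} (h0 : 0 < θ) (h1 : θ < 1) (hp : 1 / 6 < p)
    (hq : 1 < q) (hs : θ * p + (1 - θ) * q ≤ s) (ha : a < 1 - θ) (κ : ℝ) (hκ : 0 ≤ κ) {δ : ℝ}
    (hδ : 0 < δ) : ∃ C : ℝ≥0, ∀ w : (𝓞(n)) → ℝ, Slow κ w → ∀ (M : ℕ) (f : 𝓕(n)), Nice M f →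
      ∑' b, ENNReal.ofReal (modeVal b ^ (-s)) * wInt (fun N => w N * lam N ^ a)
        (sm 0 (fun ξ => (modeFun b ξ : ℂ)) f) ≤ ENNReal.ofReal δ * eInt w f + C * wInt w f := by
  obtain ⟨CH, hCH, hH⟩ := exists_modeFun_hardy hp
  set S : ℝ≥0∞ := ∑' b : Mode, ENNReal.ofReal (modeVal b ^ (-q)) with hS
  have hSt : S ≠ ∞ := tsum_modeVal_rpow_ne_top hq
  have h1' : 0 < 1 - θ := by linarith
  set κ' : ℝ := κ * 2 ^ |a| with hκ'
  have hκ'0 : 0 ≤ κ' := mul_nonneg hκ (by positivity)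
  set δ₁ : ℝ := δ / 2 / (1 + CH.toReal * κ') with hδ₁
  have hA : 0 < 1 + CH.toReal * κ' := by
    have := mul_nonneg (ENNReal.toReal_nonneg (a := CH)) hκ'0
    linarith
  have hδ₁0 : 0 < δ₁ := by positivity
  set B : ℝ := κ' * δ₁ ^ (-(θ / (1 - θ))) with hB
  have hB0 : 0 ≤ B := mul_nonneg hκ'0 (Real.rpow_pos_of_pos hδ₁0 _).le
  set δ₂ : ℝ := δ / 2 / (1 + S.toReal * B) with hδ₂
  have hA2 : 0 < 1 + S.toReal * B := by
    have := mul_nonneg (ENNReal.toReal_nonneg (a := S)) hB0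
    linarith
  have hδ₂0 : 0 < δ₂ := by positivity
  obtain ⟨C, hC⟩ := exists_wInt_lam_rpow_le (n := n) (a := a / (1 - θ)) (by rwa [div_lt_one h1']) hδ₂0
  refine ⟨(S.toReal * B).toNNReal * C, fun w hw M f hf => ?_⟩
  have hv := hw.mul_lam_rpow a
  have h3 := tsum_single_le (n := n) h0 h1 hs (ρ := fun ξ => CH * ‖ξ.1‖ₑ)
    (by fun_prop) hH hf 0 (w := fun N => w N * lam N ^ a)
    (w' := fun N => κ' * (w N * lam N ^ a)) (t := fun N => δ₁ * lam N ^ (-a))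
    (fun N => hv.down N 0) (fun N => mul_nonneg hκ'0 (hv.pos N).le)
    (fun N => mul_pos hδ₁0 (Real.rpow_pos_of_pos (lam_pos N) _))
  refine h3.trans ?_
  have e1 : ∀ N : 𝓞(n), κ' * (w N * lam N ^ a) * (δ₁ * lam N ^ (-a)) = κ' * δ₁ * w N := by
    intro N
    have : lam N ^ a * lam N ^ (-a) = 1 := by
      rw [← Real.rpow_add (lam_pos N), add_neg_cancel, Real.rpow_zero]
    linear_combination κ' * δ₁ * w N * this
  have e2 : ∀ N : 𝓞(n), κ' * (w N * lam N ^ a) * (δ₁ * lam N ^ (-a)) ^ (-(θ / (1 - θ))) =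
      B * (w N * lam N ^ (a / (1 - θ))) := by
    intro N
    rw [Real.mul_rpow hδ₁0.le (Real.rpow_pos_of_pos (lam_pos N) _).le, ← Real.rpow_mul (lam_pos N).le,
      hB]
    have : lam N ^ a * lam N ^ (-a * -(θ / (1 - θ))) = lam N ^ (a / (1 - θ)) := by
      rw [← Real.rpow_add (lam_pos N)]
      congr 1; field_simp; ring
    linear_combination κ' * δ₁ ^ (-(θ / (1 - θ))) * w N * this
  have hocc : ∀ y : Conf (n + 1), occ (fun ξ => CH * ‖ξ.1‖ₑ) 0 y =
      CH * occ (fun ξ => ‖ξ.1‖ₑ) 0 y := fun y => by simp only [occ, Finset.mul_sum]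
  simp only [e1, e2, hocc]
  have i1 : ∫⁻ y, CH * occ (fun ξ => ‖ξ.1‖ₑ) 0 y * (ENNReal.ofReal (κ' * δ₁ * w (num y)) *
      ‖f y‖ₑ ^ 2) ∂𝓒(n) ≤ ENNReal.ofReal (δ / 2) * eInt w f := by
    have : ∀ y : Conf (n + 1), CH * occ (fun ξ => ‖ξ.1‖ₑ) 0 y *
        (ENNReal.ofReal (κ' * δ₁ * w (num y)) * ‖f y‖ₑ ^ 2) = (CH * ENNReal.ofReal (κ' * δ₁)) *
        (occ (fun ξ => ‖ξ.1‖ₑ) 0 y * (ENNReal.ofReal (w (num y)) * ‖f y‖ₑ ^ 2)) := fun y => by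
      rw [ENNReal.ofReal_mul (mul_nonneg hκ'0 hδ₁0.le)]; ring
    simp only [this]
    rw [lintegral_const_mul' _ _ (ENNReal.mul_ne_top hCH ENNReal.ofReal_ne_top)]
    refine mul_le_mul' ?_ (eInt_occ_le f)
    rw [← ENNReal.ofReal_toReal hCH, ← ENNReal.ofReal_mul ENNReal.toReal_nonneg]
    refine ENNReal.ofReal_le_ofReal ?_
    have : CH.toReal * (κ' * δ₁) = (CH.toReal * κ') * (δ / 2 / (1 + CH.toReal * κ')) := by
      rw [hδ₁]; ring
    rw [this, mul_div_assoc', div_le_iff₀ hA]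
    nlinarith
  have i2 : S * wInt (fun N => B * (w N * lam N ^ (a / (1 - θ)))) f ≤
      ENNReal.ofReal (δ / 2) * eInt w f + (S.toReal * B).toNNReal * C * wInt w f := by
    rw [wInt_const_mul hB0]
    calc S * (ENNReal.ofReal B * wInt (fun N => w N * lam N ^ (a / (1 - θ))) f)
        ≤ S * (ENNReal.ofReal B * (ENNReal.ofReal δ₂ * eInt w f + C * wInt w f)) := by
          gcongr; exact hC w (fun N => (hw.pos N).le) f hf.aesm
      _ = ENNReal.ofReal (S.toReal * B * δ₂) * eInt w f +
          ENNReal.ofReal (S.toReal * B) * C * wInt w f := by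
          rw [ENNReal.ofReal_mul (mul_nonneg ENNReal.toReal_nonneg hB0),
            ENNReal.ofReal_mul ENNReal.toReal_nonneg, ENNReal.ofReal_toReal hSt]
          ring
      _ ≤ _ := by
          refine add_le_add (mul_le_mul_left (ENNReal.ofReal_le_ofReal ?_) _) le_rfl
          rw [hδ₂, mul_div_assoc', div_le_iff₀ hA2]
          nlinarith
  calc _ ≤ ENNReal.ofReal (δ / 2) * eInt w f + (ENNReal.ofReal (δ / 2) * eInt w f +
        (S.toReal * B).toNNReal * C * wInt w f) := add_le_add i1 i2
    _ = _ := by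
        rw [← add_assoc, ← add_mul, ← ENNReal.ofReal_add (by positivity) (by positivity), add_halves]
        push_cast; rfl

/-- The coefficients of the pairing are bounded by the weighted energies, with an arbitrarily small
constant. -/
def PairEnergyBound (m : ℕ) (sp : Fin m → Fin (n + 1)) (sel : Fin m → Bool) (r : Fin m → ℝ) : Prop :=
  ∀ κ δ : ℝ, 0 < δ → ∃ C : ℝ≥0, ∀ w₁ w₂ : (𝓞(n)) → ℝ, Slow κ w₁ → Slow κ w₂ →
    (∀ N, 1 ≤ w₁ N * w₂ N) → ∀ (M : ℕ) (φ f : 𝓕(n)), Nice M φ → Nice M f →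
      pairSum m sp sel r φ f ≤ (ENNReal.ofReal δ * eInt w₁ φ + C * wInt w₁ φ) *
        (ENNReal.ofReal δ * eInt w₂ f + C * wInt w₂ f)

theorem const_mul_form_le {C₀ C C' : ℝ≥0} {δ δ' : ℝ}
    (h1 : C₀ * δ ≤ δ') (h2 : C₀ * C ≤ C') (a b : ℝ≥0∞) :
    (C₀ : ℝ≥0∞) * (ENNReal.ofReal δ * a + C * b) ≤ ENNReal.ofReal δ' * a + C' * b := by
  rw [mul_add, ← mul_assoc, ← mul_assoc]
  gcongr
  · rw [← ENNReal.ofReal_coe_nnreal, ← ENNReal.ofReal_mul C₀.coe_nonneg]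
    exact ENNReal.ofReal_le_ofReal h1
  · exact_mod_cast h2

theorem PairBound.energy {m : ℕ} {sp : Fin m → Fin (n + 1)} {sel : Fin m → Bool} {r : Fin m → ℝ}
    {A : ℝ} (h : PairBound m sp sel r A) (hA : A < 2) : PairEnergyBound m sp sel r := by
  intro κ δ hδ
  obtain ⟨C₀, hC₀⟩ := h (κ * 2 ^ |A / 2|)
  have hC1 : (0 : ℝ) < C₀ + 1 := by positivity
  obtain ⟨C, hC⟩ := exists_wInt_lam_rpow_le (n := n) (a := A / 2) (δ := δ / (C₀ + 1)) (by linarith)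
    (by positivity)
  refine ⟨(C₀ + 1) * C, fun w₁ w₂ hw₁ hw₂ hw M φ f hφ hf => ?_⟩
  refine (hC₀ _ _ (hw₁.mul_lam_rpow _) (hw₂.mul_lam_rpow _) (fun N => ?_) M φ f hφ hf).trans ?_
  · have : lam N ^ A = lam N ^ (A / 2) * lam N ^ (A / 2) := by
      rw [← Real.rpow_add (lam_pos N), add_halves]
    rw [this]
    have h2 : 0 < lam N ^ (A / 2) := Real.rpow_pos_of_pos (lam_pos N) _
    calc _ = 1 * (lam N ^ (A / 2) * lam N ^ (A / 2)) := (one_mul _).symm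
      _ ≤ (w₁ N * w₂ N) * (lam N ^ (A / 2) * lam N ^ (A / 2)) := by
        gcongr; exact hw N
      _ = _ := by ring
  · have h1 := hC w₁ (fun N => (hw₁.pos N).le) φ hφ.aesm
    have h2 := hC w₂ (fun N => (hw₂.pos N).le) f hf.aesm
    rw [← mul_assoc]
    refine mul_le_mul' ((mul_le_mul_right h1 _).trans ?_) (h2.trans ?_)
    · refine const_mul_form_le ?_ ?_ _ _
      · rw [mul_div_assoc', div_le_iff₀ hC1]; nlinarith
      · gcongr; exact le_self_add
    · rw [← one_mul (_ + _), ← ENNReal.coe_one]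
      refine const_mul_form_le ?_ ?_ _ _
      · rw [NNReal.coe_one, one_mul, div_le_iff₀ hC1]
        nlinarith [C₀.coe_nonneg]
      · gcongr; exact le_add_self

theorem PairBound.cons_zero {m : ℕ} {sp : Fin (m + 1) → Fin (n + 1)} {sel : Fin (m + 1) → Bool}
    {r : Fin (m + 1) → ℝ} {p q θ a b : ℝ} (h0 : 0 < θ) (h1 : θ < 1) (hp : 1 / 6 < p) (hq : 1 < q)
    (hs : θ * p + (1 - θ) * q ≤ 2 * r 0) (ha : a < 1 - θ) (hb : b < 1) (hsp : sp 0 = 0)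
    (h : PairBound m (fun i => sp i.succ) (fun i => sel i.succ) (fun i => r i.succ) (a + b)) :
    PairEnergyBound (m + 1) sp sel r := by
  intro κ δ hδ
  rcases lt_or_ge κ 0 with hκ | hκ
  · exact ⟨0, fun w₁ _ hw₁ => absurd hw₁.nonneg (not_le.2 hκ)⟩
  obtain ⟨C₀, hC₀⟩ := h (κ * 2 ^ |a| * 2 ^ |b|)
  have hC1 : (0 : ℝ) < C₀ + 1 := by positivity
  obtain ⟨C, hC⟩ := exists_wInt_lam_rpow_le (n := n) (a := b) (δ := δ / (C₀ + 1)) hb (by positivity)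
  obtain ⟨C', hC'⟩ := exists_single_massless (n := n) h0 h1 hp hq hs ha κ hκ hδ
  refine ⟨(C₀ + 1) * C + C', fun w₁ w₂ hw₁ hw₂ hw M φ f hφ hf => ?_⟩
  have ka : κ * 2 ^ |a| ≤ κ * 2 ^ |a| * 2 ^ |b| := le_mul_two_rpow_abs (by positivity) b
  have kb : κ * 2 ^ |b| ≤ κ * 2 ^ |a| * 2 ^ |b| := by
    rw [mul_right_comm]; exact le_mul_two_rpow_abs (by positivity) a
  have hww : ∀ N : 𝓞(n), lam N ^ (a + b) ≤ (w₁ N * w₂ N) * (lam N ^ a * lam N ^ b) := by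
    intro N
    rw [Real.rpow_add (lam_pos N)]
    have h2 : 0 < lam N ^ a * lam N ^ b :=
      mul_pos (Real.rpow_pos_of_pos (lam_pos N) _) (Real.rpow_pos_of_pos (lam_pos N) _)
    exact le_mul_of_one_le_left h2.le (hw N)
  have free : ∀ (w : (𝓞(n)) → ℝ), Slow κ w → ∀ g : 𝓕(n), Nice M g →
      C₀ * wInt (fun N => w N * lam N ^ b) g ≤
        ENNReal.ofReal δ * eInt w g + ((C₀ + 1) * C + C' : ℝ≥0) * wInt w g := by
    intro w hw g hg
    refine (mul_le_mul_right (hC w (fun N => (hw.pos N).le) g hg.aesm) _).trans ?_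
    refine const_mul_form_le ?_ ?_ _ _
    · rw [mul_div_assoc', div_le_iff₀ hC1]; nlinarith
    · refine le_add_right ?_
      gcongr; exact le_self_add
  have head : ∀ (w : (𝓞(n)) → ℝ), Slow κ w → ∀ g : 𝓕(n), Nice M g →
      ∑' b, ENNReal.ofReal (modeVal b ^ (-(2 * r 0))) * wInt (fun N => w N * lam N ^ a)
        (sm 0 (fun ξ => (modeFun b ξ : ℂ)) g) ≤
        ENNReal.ofReal δ * eInt w g + ((C₀ + 1) * C + C' : ℝ≥0) * wInt w g := by
    intro w hw g hg
    refine (hC' w hw M g hg).trans ?_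
    gcongr
    exact le_add_self
  rw [pairSum_succ, hsp]
  cases sel 0
  · simp only [optSm, Bool.not_false, if_true, Bool.false_eq_true, if_false]
    calc _ ≤ ∑' b', C₀ * wInt (fun N => w₁ N * lam N ^ b) φ *
          (ENNReal.ofReal (modeVal b' ^ (-(2 * r 0))) *
          wInt (fun N => w₂ N * lam N ^ a) (sm 0 (fun ξ => (modeFun b' ξ : ℂ)) f)) := by
          refine ENNReal.tsum_le_tsum fun b' => ?_
          refine (mul_le_mul_right (hC₀ _ _ ((hw₁.mul_lam_rpow b).mono kb)
            ((hw₂.mul_lam_rpow a).mono ka) (fun N => ?_) M _ _ hφ (hf.smear 0 (memLp_modeFun b'))) _).trans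
              (le_of_eq (by ring))
          exact (hww N).trans (le_of_eq (by ring))
      _ ≤ _ := by
          rw [ENNReal.tsum_mul_left]
          exact mul_le_mul' (free w₁ hw₁ φ hφ) (head w₂ hw₂ f hf)
  · simp only [optSm, Bool.not_true, if_true, Bool.false_eq_true, if_false]
    calc _ ≤ ∑' b', C₀ * wInt (fun N => w₂ N * lam N ^ b) f *
          (ENNReal.ofReal (modeVal b' ^ (-(2 * r 0))) *
          wInt (fun N => w₁ N * lam N ^ a) (sm 0 (fun ξ => (modeFun b' ξ : ℂ)) φ)) := by
          refine ENNReal.tsum_le_tsum fun b' => ?_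
          refine (mul_le_mul_right (hC₀ _ _ ((hw₁.mul_lam_rpow a).mono ka)
            ((hw₂.mul_lam_rpow b).mono kb) (fun N => ?_) M _ _ (hφ.smear 0 (memLp_modeFun b')) hf) _).trans
              (le_of_eq (by ring))
          exact (hww N).trans (le_of_eq (by ring))
      _ ≤ _ := by
          rw [ENNReal.tsum_mul_left, mul_comm (ENNReal.ofReal δ * eInt w₁ φ + _)]
          exact mul_le_mul' (free w₂ hw₂ f hf) (head w₁ hw₁ φ hφ)

end

/-! ### Lists of annihilation operators -/

theorem annihList_cons {n : ℕ} (i : Fin n) (L : List (Fin n)) (z : Fin n → Xi) (f : Conf n → ℂ) :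
    annihList (i :: L) z f = annih i (z i) (annihList L z f) := rfl

theorem annihList_append {n : ℕ} (L L' : List (Fin n)) (z : Fin n → Xi) (f : Conf n → ℂ) :
    annihList (L ++ L') z f = annihList L z (annihList L' z f) := by
  simp [annihList, List.foldr_append]

theorem annih_smul {n : ℕ} (i : Fin n) (ξ : Xi) (c : ℂ) (f : Conf n → ℂ) :
    annih i ξ (c • f) = c • annih i ξ f := by
  funext y; simp only [annih, Pi.smul_apply, smul_eq_mul]; ring

theorem annihList_perm {n : ℕ} {L L' : List (Fin n)} (h : L.Perm L') (hL : L.Nodup) :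
    ∃ s : ℂ, (s = 1 ∨ s = -1) ∧ ∀ z f, annihList L z f = s • annihList L' z f := by
  induction h with
  | nil => exact ⟨1, Or.inl rfl, fun z f => (one_smul _ _).symm⟩
  | cons a _ ih =>
    obtain ⟨s, hs, h⟩ := ih (List.nodup_cons.1 hL).2
    refine ⟨s, hs, fun z f => ?_⟩
    rw [annihList_cons, annihList_cons, h, annih_smul]
  | swap a b l =>
    refine ⟨-1, Or.inr rfl, fun z f => ?_⟩
    have hab : b ≠ a := by
      intro h
      simp [h] at hL
    simp only [annihList_cons]
    rw [annih_comm hab]; simp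
  | trans h₁ _ ih₁ ih₂ =>
    obtain ⟨s, hs, h⟩ := ih₁ hL
    obtain ⟨t, ht, h'⟩ := ih₂ (h₁.nodup_iff.1 hL)
    refine ⟨s * t, ?_, fun z f => by rw [h, h', smul_smul]⟩
    rcases hs with rfl | rfl <;> rcases ht with rfl | rfl <;> simp

/-- The list of the selected species, in the order of `annR`. -/
def selList {n : ℕ} : (m : ℕ) → (Fin m → Fin n) → (Fin m → Bool) → List (Fin n)
  | 0, _, _ => []
  | m + 1, sp, sel => selList m (fun i => sp i.succ) (fun i => sel i.succ) ++
      (if sel 0 then [sp 0] else [])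

theorem annR_eq_annihList {n m : ℕ} (sp : Fin m → Fin n) (sel : Fin m → Bool) (z : Fin n → Xi)
    (f : Conf n → ℂ) : annR m sp sel (fun i => z (sp i)) f = annihList (selList m sp sel) z f := by
  induction m generalizing f with
  | zero => rfl
  | succ m ih =>
    rw [annR, selList, annihList_append, ih]
    cases sel 0 <;> simp [optAnnih, annihList]

theorem mem_selList {n m : ℕ} (sp : Fin m → Fin n) (sel : Fin m → Bool) (j : Fin n) :
    j ∈ selList m sp sel ↔ ∃ i, sel i = true ∧ sp i = j := by
  induction m with
  | zero => simp [selList]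
  | succ m ih =>
    have h0 : (j ∈ if sel 0 then [sp 0] else []) ↔ sel 0 = true ∧ sp 0 = j := by
      cases sel 0
      · simp
      · simp only [if_true, List.mem_singleton, true_and]; exact eq_comm
    rw [selList, List.mem_append, ih, Fin.exists_fin_succ, or_comm, h0]

theorem nodup_selList {n m : ℕ} {sp : Fin m → Fin n} (hsp : Function.Injective sp)
    (sel : Fin m → Bool) : (selList m sp sel).Nodup := by
  induction m with
  | zero => simp [selList]
  | succ m ih =>
    rw [selList, List.nodup_append]
    refine ⟨ih (hsp.comp (Fin.succ_injective m)) _, by cases sel 0 <;> simp, ?_⟩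
    intro a ha b hb
    obtain ⟨i, -, rfl⟩ := (mem_selList _ _ _).1 ha
    have : b = sp 0 := by
      cases h : sel 0
      · simp [h] at hb
      · simpa [h] using hb
    rw [this]
    exact fun h => Fin.succ_ne_zero i (hsp h)

theorem exists_sign_pairFn {n m : ℕ} {sp : Fin m → Fin n} (hsp : Function.Injective sp)
    {L₁ L₂ : List (Fin n)} (hL : (L₁ ++ L₂).Nodup) (hmem : ∀ j, j ∈ L₁ ++ L₂ ↔ ∃ i, sp i = j) :
    ∃ s : ℂ, (s = 1 ∨ s = -1) ∧ ∀ z φ f y, conj (annihList L₁ z φ y) * annihList L₂ z f y =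
        s * pairFn m sp (fun i => decide (sp i ∈ L₁)) φ f (fun i => z (sp i), y) := by
  obtain ⟨hn1, hn2, hdis⟩ := List.nodup_append.1 hL
  have p1 : L₁.Perm (selList m sp fun i => decide (sp i ∈ L₁)) := by
    rw [List.perm_ext_iff_of_nodup hn1 (nodup_selList hsp _)]
    intro j
    rw [mem_selList]
    constructor
    · intro hj
      obtain ⟨i, hi⟩ := (hmem j).1 (List.mem_append_left _ hj)
      exact ⟨i, by simpa [hi] using hj, hi⟩
    · rintro ⟨i, hi, rfl⟩
      simpa using hi
  have p2 : L₂.Perm (selList m sp fun i => !decide (sp i ∈ L₁)) := by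
    rw [List.perm_ext_iff_of_nodup hn2 (nodup_selList hsp _)]
    intro j
    rw [mem_selList]
    constructor
    · intro hj
      obtain ⟨i, hi⟩ := (hmem j).1 (List.mem_append_right _ hj)
      refine ⟨i, ?_, hi⟩
      have : sp i ∉ L₁ := fun h => hdis _ h _ hj hi
      simpa using this
    · rintro ⟨i, hi, rfl⟩
      have h1 : sp i ∉ L₁ := by simpa using hi
      exact (List.mem_append.1 ((hmem _).2 ⟨i, rfl⟩)).resolve_left h1
  obtain ⟨s, hs, h1⟩ := annihList_perm p1 hn1
  obtain ⟨t, ht, h2⟩ := annihList_perm p2 hn2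
  have hs' : conj s = s := by rcases hs with rfl | rfl <;> simp
  refine ⟨s * t, ?_, fun z φ f y => ?_⟩
  · rcases hs with rfl | rfl <;> rcases ht with rfl | rfl <;> simp
  · simp only [h1, h2, Pi.smul_apply, smul_eq_mul, map_mul, hs', pairFn, annR_eq_annihList]
    ring

/-! ### The forms of the interaction terms -/

/-- The form of the operator with kernel `g` that creates the species in `L₁` and annihilates those
in `L₂`. -/
def tForm {n : ℕ} (g : (Fin n → Xi) → ℂ) (L₁ L₂ : List (Fin n)) (φ f : Conf n → ℂ) : ℂ :=
  ∫ z, g z.1 * conj (annihList L₁ z.1 φ z.2) * annihList L₂ z.1 f z.2 ∂formMeasure n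

/-- The two lists contain every species exactly once. -/
structure IsSplit {n : ℕ} (L₁ L₂ : List (Fin n)) : Prop where
  nodup : (L₁ ++ L₂).Nodup
  mem : ∀ i, i ∈ L₁ ++ L₂

theorem measurePreserving_comp_perm {n : ℕ} (τ : Equiv.Perm (Fin n)) :
    MeasurePreserving (fun x : Fin n → Xi => fun i => x (τ i)) 𝓚(n) 𝓚(n) := by
  have h := measurePreserving_piCongrLeft (fun _ : Fin n => xiMeasure) τ.symm
  have e : (fun x : Fin n → Xi => fun i => x (τ i)) =
      MeasurableEquiv.piCongrLeft (fun _ : Fin n => Xi) τ.symm := by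
    funext x i
    simp [MeasurableEquiv.coe_piCongrLeft, Equiv.piCongrLeft_apply]
  rw [e]
  exact h

theorem measurableEmbedding_comp_perm {n : ℕ} (τ : Equiv.Perm (Fin n)) :
    MeasurableEmbedding (fun x : Fin n → Xi => fun i => x (τ i)) := by
  have h := (MeasurableEquiv.piCongrLeft (fun _ : Fin n => Xi) τ.symm).measurableEmbedding
  have e : (fun x : Fin n → Xi => fun i => x (τ i)) =
      MeasurableEquiv.piCongrLeft (fun _ : Fin n => Xi) τ.symm := by
    funext x i
    simp [MeasurableEquiv.coe_piCongrLeft, Equiv.piCongrLeft_apply]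
  rw [e]
  exact h

section
variable {n : ℕ}

theorem IsSplit.integrable {L₁ L₂ : List (Fin (n + 1))} (hL : IsSplit L₁ L₂) {M : ℕ}
    {φ f : 𝓕(n)} (hφ : Nice M φ) (hf : Nice M f) {g : (Fin (n + 1) → Xi) → ℂ}
    (hg : MemLp g 2 𝓚(n + 1)) :
    Integrable (fun z => g z.1 * conj (annihList L₁ z.1 φ z.2) * annihList L₂ z.1 f z.2)
      (formMeasure (n + 1)) := by
  obtain ⟨s, -, h⟩ := exists_sign_pairFn (sp := id) Function.injective_id hL.nodup
    (fun j => ⟨fun _ => ⟨j, rfl⟩, fun _ => hL.mem j⟩)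
  refine ((integrable_mul_pairFn id (fun i => decide (i ∈ L₁)) hφ hf hg).const_mul s).congr
    (Eventually.of_forall fun z => ?_)
  have := h z.1 φ f z.2
  simp only [id] at this ⊢
  rw [mul_assoc (g z.1), this]
  ring

theorem enorm_integral_mul_pairFn_sq_le {m : ℕ} (sp : Fin m → Fin (n + 1)) (sel : Fin m → Bool)
    (τ : Equiv.Perm (Fin m)) {r : Fin m → ℝ} {G K : Kernel (Fin m)}
    (hG : IsOscPow r G K) {M : ℕ} {φ f : 𝓕(n)} (hφ : Nice M φ) (hf : Nice M f) :
    ‖∫ x, G x * ∫ y, pairFn m sp sel φ f (fun i => x (τ i), y) ∂𝓒(n)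
      ∂𝓚(m)‖ₑ ^ 2 ≤ sqInt 𝓚(m) K * pairSum m sp sel (fun i => r (τ i)) φ f := by
  set J : (Fin m → Xi) → ℂ := fun x =>
    ∫ y, pairFn m sp sel φ f (x, y) ∂𝓒(n) with hJ
  have hJL : MemLp J 2 𝓚(m) := memLp_integral_pairFn _ sel hφ hf
  have hJτ : MemLp (fun x : Fin m → Xi => J fun i => x (τ i)) 2 𝓚(m) :=
    hJL.comp_measurePreserving (measurePreserving_comp_perm τ)
  refine (enorm_integral_mul_sq_le_tsum hG hJτ).trans (mul_le_mul_right (le_of_eq ?_) _)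
  refine Eq.trans ?_ ((Equiv.arrowCongr τ.symm (Equiv.refl Mode)).tsum_eq _)
  refine tsum_congr fun β => ?_
  have hβ : (Equiv.arrowCongr τ.symm (Equiv.refl Mode)) β = fun i => β (τ i) := by
    funext i; simp [Equiv.arrowCongr]
  have e2 : oscWeight (fun i => r (τ i)) (fun i => β (τ i)) = oscWeight r β :=
    Equiv.prod_comp τ fun i => modeVal (β i) ^ r i
  have e4 := (measurePreserving_comp_perm τ).integral_comp (measurableEmbedding_comp_perm τ)
    fun x => ∫ y, (modesFun (fun i => β (τ i)) x : ℂ) * pairFn m sp sel φ f (x, y)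
      ∂𝓒(n)
  rw [hβ, e2, ← integral_modesFun_mul_pairFn _ sel hφ hf,
    integral_prod _ (integrable_mul_pairFn _ sel hφ hf (memLp_modesFun _)), ← e4]
  congr 3
  refine integral_congr_forall fun x => ?_
  simp only [hJ]
  rw [← integral_const_mul]
  refine integral_congr_forall fun y => ?_
  have e3 : modesFun (fun i => β (τ i)) (fun i => x (τ i)) = modesFun β x :=
    Equiv.prod_comp τ fun i => modeFun (β i) (x i)
  simp only [e3]

theorem IsSplit.enorm_tForm_sq_le {L₁ L₂ : List (Fin (n + 1))} (hL : IsSplit L₁ L₂)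
    (τ : Equiv.Perm (Fin (n + 1))) {r : Fin (n + 1) → ℝ} {G K : Kernel (Fin (n + 1))}
    (hG : IsOscPow r G K) {M : ℕ} {φ f : 𝓕(n)} (hφ : Nice M φ) (hf : Nice M f) :
    ‖tForm G L₁ L₂ φ f‖ₑ ^ 2 ≤ sqInt 𝓚(n + 1) K *
      pairSum (n + 1) τ (fun i => decide (τ i ∈ L₁)) (fun i => r (τ i)) φ f := by
  obtain ⟨s, hs, h⟩ := exists_sign_pairFn (sp := τ) τ.injective hL.nodup
    (fun j => ⟨fun _ => ⟨τ.symm j, by simp⟩, fun _ => hL.mem j⟩)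
  refine le_trans (le_of_eq ?_) (enorm_integral_mul_pairFn_sq_le τ (fun i => decide (τ i ∈ L₁)) τ hG
    hφ hf)
  have hs1 : ‖s‖ₑ = 1 := by rcases hs with rfl | rfl <;> simp
  rw [← one_mul ‖∫ _, _ ∂_‖ₑ, ← hs1, ← enorm_mul, tForm, formMeasure,
    integral_prod _ (hL.integrable hφ hf (Lp.memLp G)), ← integral_const_mul]
  congr 2
  refine integral_congr_forall fun x => ?_
  rw [← integral_const_mul, ← integral_const_mul]
  refine integral_congr_forall fun y => ?_
  simp only [mul_assoc, h]
  ring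

theorem tForm_conj (g : (Fin n → Xi) → ℂ) (L₁ L₂ : List (Fin n)) (φ f : Conf n → ℂ) :
    conj (tForm g L₁ L₂ φ f) = tForm (fun x => conj (g x)) L₂ L₁ f φ := by
  rw [tForm, tForm, ← integral_conj]
  refine integral_congr_forall fun z => ?_
  simp only [map_mul, Complex.conj_conj]; ring

theorem isSplit_created (p : ℕ) (σ : Equiv.Perm (Fin n)) :
    IsSplit (created p σ).reverse (annihilated p σ) := by
  have hp : ((created p σ).reverse ++ annihilated p σ).Perm ((List.finRange n).map σ) := by
    refine ((List.reverse_perm _).append_right _).trans ?_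
    rw [created, annihilated, List.take_append_drop]
  have hn : ((List.finRange n).map σ).Nodup := (List.nodup_finRange n).map σ.injective
  refine ⟨hp.nodup_iff.2 hn, fun i => hp.mem_iff.2 ?_⟩
  rw [List.mem_map]
  exact ⟨σ.symm i, List.mem_finRange _, by simp⟩

theorem IsSplit.symm {L₁ L₂ : List (Fin n)} (h : IsSplit L₁ L₂) : IsSplit L₂ L₁ :=
  ⟨(List.perm_append_comm).nodup_iff.1 h.nodup, fun i => (List.perm_append_comm).mem_iff.1 (h.mem i)⟩

/-! ### Dependence on representatives and on particle numbers -/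

theorem ae_optAnnih_param {Z : Type} [MeasurableSpace Z] {ζ : Measure Z} [SFinite ζ] (b : Bool)
    (i : Fin (n + 1)) {F : Z × Conf (n + 1) → ℂ} (hF : F =ᵐ[ζ.prod 𝓒(n)] 0) :
    (fun w : (Z × Xi) × Conf (n + 1) => optAnnih b i w.1.2 (fun y => F (w.1.1, y)) w.2)
      =ᵐ[(ζ.prod xiMeasure).prod 𝓒(n)] 0 := by
  cases b
  · have h1 : Measure.QuasiMeasurePreserving (Prod.map Prod.fst id : (Z × Xi) × Conf (n + 1) → _)
        ((ζ.prod xiMeasure).prod 𝓒(n)) (ζ.prod 𝓒(n)) := by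
      refine ⟨measurable_fst.prodMap measurable_id, ?_⟩
      rw [← Measure.map_prod_map _ _ measurable_fst measurable_id, Measure.map_id]
      exact Measure.quasiMeasurePreserving_fst.absolutelyContinuous.prod
        (Measure.AbsolutelyContinuous.refl _)
    exact h1.ae_eq_comp hF
  · have h1 : Measure.QuasiMeasurePreserving
        (Prod.map id (fun z : Xi × Conf (n + 1) => insY i 0 z.1 z.2))
        (ζ.prod (xiMeasure.prod 𝓒(n))) (ζ.prod 𝓒(n)) := by
      refine ⟨measurable_id.prodMap (measurable_insY i 0), ?_⟩
      rw [← Measure.map_prod_map _ _ measurable_id (measurable_insY i 0), Measure.map_id]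
      exact (Measure.AbsolutelyContinuous.refl ζ).prod
        (quasiMeasurePreserving_insY i).absolutelyContinuous
    have h2 := (measurePreserving_prodAssoc ζ xiMeasure
      𝓒(n)).quasiMeasurePreserving
    filter_upwards [(h1.comp h2).ae_eq_comp hF] with w hw
    have : F (w.1.1, insY i 0 w.1.2 w.2) = 0 := hw
    simp [optAnnih, annih_eq, this]

theorem ae_annR_param {m : ℕ} (sp : Fin m → Fin (n + 1)) (sel : Fin m → Bool)
    {Z : Type} [MeasurableSpace Z] {ζ : Measure Z} [SFinite ζ] {F : Z × Conf (n + 1) → ℂ}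
    (hF : F =ᵐ[ζ.prod 𝓒(n)] 0) : (fun w : (Z × (Fin m → Xi)) × Conf (n + 1) =>
      annR m sp sel w.1.2 (fun y => F (w.1.1, y)) w.2) =ᵐ[(ζ.prod 𝓚(m)).prod 𝓒(n)] 0 := by
  induction m generalizing Z with
  | zero =>
    have h1 : Measure.QuasiMeasurePreserving
        (Prod.map Prod.fst id : (Z × (Fin 0 → Xi)) × Conf (n + 1) → _)
        ((ζ.prod 𝓚(0)).prod 𝓒(n))
        (ζ.prod 𝓒(n)) := by
      refine ⟨measurable_fst.prodMap measurable_id, ?_⟩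
      rw [← Measure.map_prod_map _ _ measurable_fst measurable_id, Measure.map_id]
      exact Measure.quasiMeasurePreserving_fst.absolutelyContinuous.prod
        (Measure.AbsolutelyContinuous.refl _)
    exact h1.ae_eq_comp hF
  | succ m ih =>
    have h := ih (fun i => sp i.succ) (fun i => sel i.succ) (ae_optAnnih_param (sel 0) (sp 0) hF)
    have hmp : MeasurePreserving (Prod.map
        (fun z : (Z × Xi) × (Fin m → Xi) => (z.1.1, (Fin.cons z.1.2 z.2 : Fin (m + 1) → Xi))) id)
        (((ζ.prod xiMeasure).prod 𝓚(m)).prod 𝓒(n))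
        ((ζ.prod 𝓚(m + 1)).prod 𝓒(n)) :=
      (((MeasurePreserving.id ζ).prod (measurePreserving_cons m)).comp
        (measurePreserving_prodAssoc ζ xiMeasure 𝓚(m))).prod
        (MeasurePreserving.id _)
    have hme : MeasurableEmbedding (Prod.map
        (fun z : (Z × Xi) × (Fin m → Xi) => (z.1.1, (Fin.cons z.1.2 z.2 : Fin (m + 1) → Xi)))
        (id : Conf (n + 1) → Conf (n + 1))) :=
      ((MeasurableEmbedding.id.prodMap (measurableEmbedding_cons m)).comp
        MeasurableEquiv.prodAssoc.measurableEmbedding).prodMap MeasurableEmbedding.id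
    rw [← hmp.map_eq, Filter.EventuallyEq, hme.ae_map_iff]
    filter_upwards [h] with w hw
    simpa [annR] using hw

theorem ae_annihList {L : List (Fin (n + 1))} (hL : L.Nodup) {f f' : 𝓕(n)} (h : f =ᵐ[𝓒(n)] f') :
    ∀ᵐ z ∂formMeasure (n + 1), annihList L z.1 f z.2 = annihList L z.1 f' z.2 := by
  have hp : L.Perm (selList (n + 1) id fun i => decide (i ∈ L)) := by
    rw [List.perm_ext_iff_of_nodup hL (nodup_selList Function.injective_id _)]
    intro j
    simp [mem_selList]
  obtain ⟨s, -, hs⟩ := annihList_perm hp hL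
  have hF : (fun w : Unit × Conf (n + 1) => (f + (-1 : ℂ) • f') w.2)
      =ᵐ[(Measure.dirac ()).prod 𝓒(n)] 0 := by
    refine Measure.quasiMeasurePreserving_snd.ae_eq_comp (g := f + (-1 : ℂ) • f') (g' := 0) ?_
    filter_upwards [h] with y hy
    simp [hy]
  have h1 := ae_annR_param id (fun i : Fin (n + 1) => decide (i ∈ L)) hF
  have h2 : ∀ᵐ z ∂formMeasure (n + 1),
      annR (n + 1) id (fun i => decide (i ∈ L)) z.1 (f + (-1 : ℂ) • f') z.2 = 0 := by
    have hmp := (measurePreserving_prodAssoc (Measure.dirac ()) 𝓚(n + 1)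
      𝓒(n)).symm
    have h3 := hmp.quasiMeasurePreserving.ae_eq_comp h1
    have h4 := Measure.ae_ae_of_ae_prod h3
    obtain ⟨u, hu⟩ := h4.exists
    exact hu
  filter_upwards [h2] with z hz
  have h5 := annR_eq_annihList (id : Fin (n + 1) → Fin (n + 1)) (fun i => decide (i ∈ L)) z.1
    (f + (-1 : ℂ) • f')
  simp only [id] at h5
  have h6 : annihList L z.1 (f + (-1 : ℂ) • f') z.2 = 0 := by
    rw [hs, Pi.smul_apply, ← h5]
    exact (congrArg (s • ·) hz).trans (smul_zero s)
  rw [annihList_add, annihList_smul] at h6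
  simp only [Pi.add_apply, Pi.smul_apply, smul_eq_mul] at h6
  linear_combination h6

/-- The numbers of particles that the operators of a list annihilate. -/
def listNum (L : List (Fin n)) : Fin n → ℕ := (L.map fun i => Pi.single i 1).sum

theorem annihList_num_mul (L : List (Fin n)) (z : Fin n → Xi) (u : (Fin n → ℕ) → ℂ)
    (f : Conf n → ℂ) (y : Conf n) :
    annihList L z (fun y => u (num y) * f y) y = u (num y + listNum L) * annihList L z f y := by
  induction L generalizing y with
  | nil => simp [annihList, listNum]
  | cons i L ih =>
    simp only [annihList_cons, annih_eq]
    have e : listNum (i :: L) = Pi.single i 1 + listNum L := by simp [listNum]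
    rw [ih, num_insY, e, ← add_assoc]
    ring

theorem listNum_le {L : List (Fin n)} (hL : L.Nodup) (i : Fin n) : listNum L i ≤ 1 := by
  induction L with
  | nil => simp [listNum]
  | cons j L ih =>
    have h2 := ih (List.nodup_cons.1 hL).2
    have h3 : listNum (j :: L) i = (Pi.single j 1 : Fin n → ℕ) i + listNum L i := by
      simp [listNum]
    rw [h3]
    by_cases hij : i = j
    · subst hij
      have : listNum L i = 0 := by
        have h4 : ∀ L : List (Fin n), i ∉ L → listNum L i = 0 := by
          intro L hi
          induction L with
          | nil => simp [listNum]
          | cons k L ih' =>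
            simp only [List.mem_cons, not_or] at hi
            have := ih' hi.2
            simp only [listNum, List.map_cons, List.sum_cons, Pi.add_apply] at this ⊢
            rw [this]; simp [hi.1]
        exact h4 L (List.nodup_cons.1 hL).1
      rw [this]; simp
    · simp [hij, h2]

end

/-! ### The exponents of the oscillators -/

/-- The powers of the oscillators in the assumption on the kernels. -/
def kernelExp (d : ℕ) (i₀ : Fin (d + 1)) (ε : ℝ) (i : Fin (d + 1)) : ℝ :=
  if i = i₀ then 0 else if i = 0 then 1 / 2 - 5 / 6 * (1 / (d : ℝ)) + ε
    else 1 / 2 - 1 / (d : ℝ) + ε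

/-- The powers of the oscillators of the massive species. -/
def sliceExp (d : ℕ) (i₀ : Fin (d + 1)) (ε : ℝ) (i : Fin d) : ℝ :=
  if i.succ = i₀ then 0 else 1 / 2 - 1 / (d : ℝ) + ε

theorem exists_adm_params {d : ℕ} (hd : 2 ≤ d) {ε : ℝ} (hε : 0 < ε) :
    ∃ e : ℝ, 0 < e ∧ e ≤ 1 / d ∧ e ≤ ε ∧ Adm (2 / d - e) (2 * (1 / 2 - 1 / (d : ℝ) + ε)) := by
  have hd2 : (2 : ℝ) ≤ d := by exact_mod_cast hd
  have hd0 : (0 : ℝ) < d := by linarith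
  have h1 : (1 : ℝ) / d ≤ 1 / 2 := one_div_le_one_div_of_le two_pos hd2
  have h10 : (0 : ℝ) < 1 / d := by positivity
  have e1 : (2 : ℝ) / d = 2 * (1 / d) := by ring
  refine ⟨min (2 * ε / 3) (1 / d), by positivity, min_le_right _ _,
    (min_le_left _ _).trans (by linarith), Or.inr ?_⟩
  set e := min (2 * ε / 3) (1 / (d : ℝ)) with he
  have he0 : 0 < e := by positivity
  have hea : e ≤ 2 * ε / 3 := min_le_left _ _
  have heb : e ≤ 1 / d := min_le_right _ _
  refine ⟨by linarith, by linarith, 1 + e, by linarith, ?_⟩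
  rw [e1]
  set x := (1 : ℝ) / d
  nlinarith

theorem exists_adm_slice {d : ℕ} (hd : 1 ≤ d) {ε : ℝ} (hε : 0 < ε) (h : d = 1 → 1 / 2 ≤ ε) :
    ∃ θ : ℝ, 0 < θ ∧ d * θ ≤ 2 ∧ Adm θ (2 * (1 / 2 - 1 / (d : ℝ) + ε)) := by
  rcases hd.eq_or_lt with h1 | h1
  · subst h1
    have := h rfl
    refine ⟨1, one_pos, by norm_num, Or.inl ⟨rfl, ?_⟩⟩
    push_cast; linarith
  · obtain ⟨e, he, hed, -, hA⟩ := exists_adm_params h1 hε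
    have hd0 : (0 : ℝ) < d := by positivity
    refine ⟨2 / d - e, ?_, ?_, hA⟩
    · have h2 : (2 : ℝ) / d = 2 * (1 / d) := by ring
      have h3 : (0 : ℝ) < 1 / d := by positivity
      linarith
    · rw [mul_sub, mul_div_cancel₀ _ hd0.ne']
      nlinarith

theorem exists_pairBound_slice {d : ℕ} (hd : 1 ≤ d) (i₀ : Fin (d + 1)) {ε : ℝ} (hε : 0 < ε)
    (h : d = 1 → i₀ = 0 → 1 / 2 ≤ ε) : ∃ (τ : Equiv.Perm (Fin d)) (A : ℝ), A ≤ 2 ∧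
      ∀ sel, PairBound d (fun i => (τ i).succ) sel (fun i => sliceExp d i₀ ε (τ i)) A := by
  induction i₀ using Fin.cases with
  | zero =>
    obtain ⟨θ, hθ, hA, hAdm⟩ := exists_adm_slice hd hε fun h1 => h h1 rfl
    refine ⟨1, d * θ, hA, fun sel => pairBound_massive _ _ _ fun i => ⟨Fin.succ_ne_zero _, ?_⟩⟩
    simpa [sliceExp] using hAdm
  | succ j =>
    obtain ⟨k, rfl⟩ : ∃ k, d = k + 1 := ⟨d - 1, by omega⟩
    have hτ : ∀ i : Fin k, Equiv.swap j (Fin.last k) i.castSucc ≠ j := by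
      intro i hi
      rw [Equiv.swap_apply_eq_iff, Equiv.swap_apply_left] at hi
      exact (Fin.castSucc_lt_last i).ne hi
    rcases Nat.eq_zero_or_pos k with rfl | hk
    · refine ⟨1, (0 : ℕ) * 0, by norm_num, fun sel => pairBound_massive_free _ _ _ ?_ fun i => i.elim0⟩
      have : j = 0 := Fin.ext (by have := j.2; simp)
      simp [sliceExp, this]
    · obtain ⟨θ, hθ, hA, hAdm⟩ := exists_adm_slice (d := k + 1) hd hε (by omega)
      refine ⟨Equiv.swap j (Fin.last k), k * θ, ?_, fun sel => pairBound_massive_free _ _ _ ?_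
        fun i => ⟨Fin.succ_ne_zero _, ?_⟩⟩
      · push_cast at hA; linarith
      · simp [sliceExp]
      · have := hτ i
        simpa [sliceExp, this] using hAdm

theorem exists_pairEnergyBound {d : ℕ} (hd : 1 ≤ d) (i₀ : Fin (d + 1)) {ε : ℝ} (hε : 0 < ε) :
    ∃ (τ : Equiv.Perm (Fin (d + 1))) (r : Fin (d + 1) → ℝ),
      (∀ G K, IsOscPow (kernelExp d i₀ ε) G K → ∃ K', IsOscPow r G K') ∧
      ∀ sel, PairEnergyBound (d + 1) τ sel fun i => r (τ i) := by
  rcases hd.eq_or_lt with h1 | hd2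
  · subst h1
    refine ⟨Equiv.swap 0 (Fin.last 1), fun _ => 0, fun G K _ => ⟨G, ?_⟩, fun sel => ?_⟩
    · exact isOscPow_zero (fun _ => rfl) G
    · refine (pairBound_massive_free (θ := 1) (m := 1) _ sel _ rfl fun i => ⟨?_, Or.inl ⟨rfl, ?_⟩⟩).energy
        (by norm_num)
      · have : i = 0 := Subsingleton.elim _ _
        subst this
        decide
      · norm_num
  · obtain ⟨e, he, hed, heε, hAdm⟩ := exists_adm_params hd2 hε
    have hd2' : (2 : ℝ) ≤ d := by exact_mod_cast hd2
    have hd0 : (0 : ℝ) < d := by linarith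
    have e1 : (2 : ℝ) / d = 2 * (1 / d) := by ring
    have h10 : (0 : ℝ) < 1 / d := by positivity
    have h12 : (1 : ℝ) / d ≤ 1 / 2 := one_div_le_one_div_of_le two_pos hd2'
    have hd1 : (d : ℝ) * (1 / d) = 1 := by field_simp
    have hτ : ∀ i : Fin d, Equiv.swap i₀ (Fin.last d) i.castSucc ≠ i₀ := by
      intro i hi
      rw [Equiv.swap_apply_eq_iff, Equiv.swap_apply_left] at hi
      exact (Fin.castSucc_lt_last i).ne hi
    refine ⟨Equiv.swap i₀ (Fin.last d), kernelExp d i₀ ε, fun G K h => ⟨K, h⟩, fun sel => ?_⟩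
    by_cases hi : i₀ = 0
    · subst hi
      refine (pairBound_massive_free (θ := 2 / d - e) _ sel _ ?_ fun i => ⟨hτ i, ?_⟩).energy ?_
      · simp [kernelExp]
      · simpa [kernelExp, hτ i] using hAdm
      · rw [e1]; nlinarith
    · obtain ⟨k, rfl⟩ : ∃ k, d = k + 1 := ⟨d - 1, by omega⟩
      have h0 : Equiv.swap i₀ (Fin.last (k + 1)) 0 = 0 :=
        Equiv.swap_apply_of_ne_of_ne (Ne.symm hi) (Fin.last_pos.ne)
      have hne : ∀ i : Fin (k + 1), Equiv.swap i₀ (Fin.last (k + 1)) i.succ ≠ 0 := by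
        intro i hh
        rw [← h0] at hh
        exact Fin.succ_ne_zero i ((Equiv.swap i₀ (Fin.last (k + 1))).injective hh)
      have e2 : (2 : ℝ) / (k + 1 : ℕ) = 2 * (1 / (k + 1 : ℕ)) := by ring
      have hk : ((k + 1 : ℕ) : ℝ) = k + 1 := by push_cast; ring
      refine PairBound.cons_zero (p := 1 / 6 + e) (q := 1 + e)
        (θ := 2 / (k + 1 : ℕ) - 6 / 5 * e) (a := k * (2 / (k + 1 : ℕ) - e) - (1 - e)) (b := 1 - e)
        ?_ ?_ ?_ ?_ ?_ ?_ ?_ h0 ?_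
      · linarith
      · linarith
      · linarith
      · linarith
      · rw [h0]
        simp only [kernelExp, Ne.symm hi, if_false, if_true]
        set x := (1 : ℝ) / (k + 1 : ℕ)
        rw [e2]
        nlinarith
      · rw [e2]
        set x := (1 : ℝ) / (k + 1 : ℕ)
        rw [hk] at hd1
        have hk1 : (1 : ℝ) ≤ k := by
          have : 1 ≤ k := by omega
          exact_mod_cast this
        nlinarith
      · linarith
      · rw [sub_add_cancel]
        refine pairBound_massive_free _ _ _ ?_ fun i => ⟨hne _, ?_⟩
        · rw [Fin.succ_last]; simp [kernelExp]
        · have h2 := hτ i.succ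
          rw [← Fin.succ_castSucc] at h2
          simpa [kernelExp, h2, hne] using hAdm

section
variable {n : ℕ}

/-! ### Representatives of the vectors of the Fock space -/

/-- Square integrable antisymmetric functions. -/
structure Vec (f : 𝓕(n)) : Prop where
  memLp : MemLp f 2 𝓒(n)
  anti : Anti f

theorem Nice.vec {M : ℕ} {f : 𝓕(n)} (h : Nice M f) : Vec f := ⟨h.memLp, h.anti⟩

theorem exists_vec (Ψ : fockSpace (n + 1)) : ∃ f, Vec f ∧ fn Ψ =ᵐ[𝓒(n)] f := by
  obtain ⟨f, hf, hΨ⟩ := Ψ.2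
  exact ⟨f, ⟨(memLp_congr_ae hΨ).1 (Lp.memLp _), antisymmetric_iff.1 hf⟩, hΨ⟩

/-- An antisymmetric function that represents a vector of the Fock space. -/
def rep (Ψ : fockSpace (n + 1)) : 𝓕(n) := (exists_vec Ψ).choose

theorem vec_rep (Ψ : fockSpace (n + 1)) : Vec (rep Ψ) := (exists_vec Ψ).choose_spec.1

theorem fn_ae_rep (Ψ : fockSpace (n + 1)) : fn Ψ =ᵐ[𝓒(n)] rep Ψ :=
  (exists_vec Ψ).choose_spec.2

/-- The vector of the Fock space that a function represents. -/
def Vec.toFock {f : 𝓕(n)} (hf : Vec f) : fockSpace (n + 1) :=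
  ⟨hf.memLp.toLp f, f, antisymmetric_iff.2 hf.anti, hf.memLp.coeFn_toLp⟩

theorem Vec.fn_toFock {f : 𝓕(n)} (hf : Vec f) : fn hf.toFock =ᵐ[𝓒(n)] f := hf.memLp.coeFn_toLp

theorem inner_eq_integral {Φ Ψ : fockSpace (n + 1)} {f g : 𝓕(n)}
    (hf : fn Φ =ᵐ[𝓒(n)] f) (hg : fn Ψ =ᵐ[𝓒(n)] g) : inner ℂ Φ Ψ = ∫ y, conj (f y) * g y ∂𝓒(n) := by
  rw [Submodule.coe_inner, L2.inner_def]
  refine integral_congr_ae ?_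
  filter_upwards [hf, hg] with y h1 h2
  rw [RCLike.inner_apply']
  change conj (fn Φ y) * fn Ψ y = _
  rw [h1, h2]

theorem enorm_sq_eq_sqInt {Φ : fockSpace (n + 1)} {f : 𝓕(n)}
    (hf : fn Φ =ᵐ[𝓒(n)] f) : ‖Φ‖ₑ ^ 2 = sqInt 𝓒(n) f := by
  rw [← sqInt_congr_ae hf]
  have := sqInt_eq_enorm (Φ : Lp ℂ 2 𝓒(n))
  exact this.symm

theorem ext_fn {Φ Ψ : fockSpace (n + 1)} (h : fn Φ =ᵐ[𝓒(n)] fn Ψ) : Φ = Ψ :=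
  Subtype.ext (Lp.ext h)

/-! ### Truncation of the particle numbers -/

/-- The indicator function of the sectors with at most `M` particles of each species. -/
def boxInd (M : ℕ) (N : 𝓞(n)) : ℂ := if ∀ i, N i ≤ M then 1 else 0

/-- The restriction to the sectors with at most `M` particles of each species. -/
def trunc (M : ℕ) (f : 𝓕(n)) (y : Conf (n + 1)) : ℂ := boxInd M (num y) * f y

theorem enorm_boxInd_le (M : ℕ) (N : 𝓞(n)) : ‖boxInd M N‖ₑ ≤ 1 := by
  unfold boxInd; split_ifs <;> simp

theorem enorm_trunc_le (M : ℕ) (f : 𝓕(n)) (y : Conf (n + 1)) : ‖trunc M f y‖ₑ ≤ ‖f y‖ₑ := by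
  rw [trunc, enorm_mul]
  exact mul_le_of_le_one_left' (enorm_boxInd_le _ _)

theorem Vec.num_mul {f : 𝓕(n)} (hf : Vec f) (u : (𝓞(n)) → ℂ) {c : ℝ≥0}
    (hu : ∀ N, ‖u N‖ₑ ≤ c) : Vec (fun y => u (num y) * f y) where
  memLp := by
    refine memLp_two_of_sqInt ((measurable_comp_num u).aestronglyMeasurable.mul hf.memLp.1) ?_
    calc _ ≤ ∫⁻ y, (c : ℝ≥0∞) ^ 2 * ‖f y‖ₑ ^ 2 ∂𝓒(n) := by
          refine lintegral_mono fun y => ?_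
          rw [enorm_mul, mul_pow]
          gcongr; exact hu _
      _ = (c : ℝ≥0∞) ^ 2 * sqInt 𝓒(n) f :=
          lintegral_const_mul' _ _ (by simp)
      _ < ∞ := ENNReal.mul_lt_top (by simp) (sqInt_lt_top hf.memLp)
  anti := fun y i l x π => by
    have h := hf.anti y i l x π
    have hn : num (Function.update y i (⟨l, x ∘ π⟩ : Particles)) =
        num (Function.update y i (⟨l, x⟩ : Particles)) := funext fun a => update_number y i _ _ a
    simp only [h, hn]; ring

theorem Vec.truncate {f : 𝓕(n)} (hf : Vec f) (M : ℕ) : Nice M (trunc M f) where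
  memLp := (hf.num_mul (boxInd M) (c := 1) fun N => by simpa using enorm_boxInd_le M N).memLp
  anti := (hf.num_mul (boxInd M) (c := 1) fun N => by simpa using enorm_boxInd_le M N).anti
  bdd := fun y ⟨i, hi⟩ => by
    rw [trunc, boxInd, if_neg (fun h => not_lt.2 (h i) hi), zero_mul]

theorem Nice.mono {M M' : ℕ} (h : M ≤ M') {f : 𝓕(n)} (hf : Nice M f) : Nice M' f :=
  ⟨hf.memLp, hf.anti, fun y ⟨i, hi⟩ => hf.bdd y ⟨i, h.trans_lt hi⟩⟩

theorem Nice.finiteParticle {M : ℕ} {f : 𝓕(n)} (hf : Nice M f) : FiniteParticle hf.vec.toFock :=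
  ⟨M, hf.vec.fn_toFock.mono fun y hy h => by rw [hy]; exact hf.bdd y h⟩

/-! ### The interaction form -/

theorem annihList_zero_of_bdd (L : List (Fin (n + 1))) (z : Fin (n + 1) → Xi) {M : ℕ}
    {f : 𝓕(n)} (hf : ∀ y, (∃ i, M < (y i).1) → f y = 0) {y : Conf (n + 1)}
    (hy : ∃ i, M < (y i).1) : annihList L z f y = 0 := by
  induction L generalizing y with
  | nil => exact hf y hy
  | cons i L ih => exact annih_eq_zero (fun y hy => ih hy) i _ hy

theorem annihList_trunc {L : List (Fin (n + 1))} (hL : L.Nodup) (z : Fin (n + 1) → Xi) {M : ℕ}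
    (f : 𝓕(n)) {y : Conf (n + 1)} (hy : ∀ i, (y i).1 ≤ M) :
    annihList L z (trunc (M + 1) f) y = annihList L z f y := by
  have h := annihList_num_mul L z (boxInd (M + 1)) f y
  have h1 : boxInd (M + 1) (num y + listNum L) = 1 := by
    rw [boxInd, if_pos]
    intro i
    exact add_le_add (hy i) (listNum_le hL i)
  rw [h1, one_mul] at h
  exact h

theorem IsSplit.left {L₁ L₂ : List (Fin n)} (h : IsSplit L₁ L₂) : L₁.Nodup :=
  (List.nodup_append.1 h.nodup).1

theorem IsSplit.right {L₁ L₂ : List (Fin n)} (h : IsSplit L₁ L₂) : L₂.Nodup :=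
  (List.nodup_append.1 h.nodup).2.1

theorem formMul_trunc_right {L₁ L₂ : List (Fin (n + 1))} (hL : L₂.Nodup) {M : ℕ}
    {φ : 𝓕(n)} (hφ : ∀ y, (∃ i, M < (y i).1) → φ y = 0) (f : 𝓕(n))
    (z : Fin (n + 1) → Xi) (y : Conf (n + 1)) :
    conj (annihList L₁ z φ y) * annihList L₂ z (trunc (M + 1) f) y =
      conj (annihList L₁ z φ y) * annihList L₂ z f y := by
  by_cases hy : ∀ i, (y i).1 ≤ M
  · rw [annihList_trunc hL z f hy]
  · push Not at hy
    rw [annihList_zero_of_bdd L₁ z hφ hy]; simp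

theorem tForm_trunc_right (g : (Fin (n + 1) → Xi) → ℂ) {L₁ L₂ : List (Fin (n + 1))}
    (hL : L₂.Nodup) {M : ℕ} {φ : 𝓕(n)} (hφ : ∀ y, (∃ i, M < (y i).1) → φ y = 0)
    (f : 𝓕(n)) : tForm g L₁ L₂ φ (trunc (M + 1) f) = tForm g L₁ L₂ φ f := by
  refine integral_congr_forall fun z => ?_
  simp only [mul_assoc, formMul_trunc_right hL hφ f]

theorem tForm_trunc_left (g : (Fin (n + 1) → Xi) → ℂ) {L₁ L₂ : List (Fin (n + 1))}
    (hL : L₁.Nodup) {M : ℕ} {φ : 𝓕(n)} (hφ : ∀ y, (∃ i, M < (y i).1) → φ y = 0)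
    (f : 𝓕(n)) : tForm g L₁ L₂ (trunc (M + 1) f) φ = tForm g L₁ L₂ f φ := by
  rw [← Complex.conj_conj (tForm g L₁ L₂ _ φ), tForm_conj, tForm_trunc_right _ hL hφ, ← tForm_conj,
    Complex.conj_conj]

theorem tForm_congr_ae (g : (Fin (n + 1) → Xi) → ℂ) {L₁ L₂ : List (Fin (n + 1))}
    (h1 : L₁.Nodup) (h2 : L₂.Nodup) {φ φ' f f' : 𝓕(n)} (hφ : φ =ᵐ[𝓒(n)] φ') (hf : f =ᵐ[𝓒(n)] f') :
    tForm g L₁ L₂ φ f = tForm g L₁ L₂ φ' f' := by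
  refine integral_congr_ae ?_
  filter_upwards [ae_annihList h1 hφ, ae_annihList h2 hf] with z e1 e2
  rw [e1, e2]

/-- The quadratic form of the interaction. -/
def qForm (G : ℕ → Equiv.Perm (Fin n) → Kernel (Fin n)) (φ f : Conf n → ℂ) : ℂ :=
  ∑ p ∈ Finset.range (n + 1), ∑ σ ∈ processes n p,
    (tForm (G p σ) (created p σ).reverse (annihilated p σ) φ f +
      conj (tForm (G p σ) (created p σ).reverse (annihilated p σ) f φ))

theorem qForm_congr_ae (G : ℕ → Equiv.Perm (Fin (n + 1)) → Kernel (Fin (n + 1)))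
    {φ φ' f f' : 𝓕(n)} (hφ : φ =ᵐ[𝓒(n)] φ') (hf : f =ᵐ[𝓒(n)] f') : qForm G φ f = qForm G φ' f' := by
  refine Finset.sum_congr rfl fun p _ => Finset.sum_congr rfl fun σ _ => ?_
  have h := isSplit_created p σ
  rw [tForm_congr_ae _ h.left h.right hφ hf, tForm_congr_ae _ h.left h.right hf hφ]

theorem qForm_trunc_right (G : ℕ → Equiv.Perm (Fin (n + 1)) → Kernel (Fin (n + 1))) {M : ℕ}
    {φ : 𝓕(n)} (hφ : ∀ y, (∃ i, M < (y i).1) → φ y = 0) (f : 𝓕(n)) :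
    qForm G φ (trunc (M + 1) f) = qForm G φ f := by
  refine Finset.sum_congr rfl fun p _ => Finset.sum_congr rfl fun σ _ => ?_
  have h := isSplit_created p σ
  rw [tForm_trunc_right _ h.right hφ, tForm_trunc_left _ h.left hφ]

theorem qForm_conj (G : ℕ → Equiv.Perm (Fin n) → Kernel (Fin n)) (φ f : Conf n → ℂ) :
    conj (qForm G φ f) = qForm G f φ := by
  simp only [qForm, map_sum, map_add, Complex.conj_conj]
  exact Finset.sum_congr rfl fun p _ => Finset.sum_congr rfl fun σ _ => add_comm _ _

/-! ### The Hamiltonian -/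

theorem fn_freeHamiltonian (m : Fin (n + 1) → ℝ) (Ψ : (freeHamiltonian m).domain) :
    fn (freeHamiltonian m Ψ) =ᵐ[𝓒(n)] fun y => (freeEnergy m y : ℂ) * fn Ψ.1 y := by
  have hm := Submodule.mem_graph_toLinearPMap (hg := ?_) Ψ
  · exact hm
  · rintro ⟨a, b⟩ hab (h0 : a = 0)
    subst h0
    refine ext_fn ?_
    have h1 : fn b =ᵐ[𝓒(n)]
      fun y => (freeEnergy m y : ℂ) * fn (0 : fockSpace (n + 1)) y := hab
    filter_upwards [h1, fn_zero (n := n + 1)] with y e1 e2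
    rw [e1, e2]; simp

theorem inner_interaction (G : ℕ → Equiv.Perm (Fin (n + 1)) → Kernel (Fin (n + 1)))
    (Ψ : (interaction G).domain) {M : ℕ} {φ : 𝓕(n)} (hφ : Nice M φ) :
    inner ℂ hφ.vec.toFock (interaction G Ψ) = qForm G φ (rep Ψ.1) := by
  have key : ∀ (q : fockSpace (n + 1) × fockSpace (n + 1)) (f : 𝓕(n)),
      fn q.1 =ᵐ[𝓒(n)] f → (∀ φ : fockSpace (n + 1), FiniteParticle φ →
        (∀ p ∈ Finset.range (n + 1 + 1), ∀ σ ∈ processes (n + 1) p,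
          Integrable (formIntegrand p σ (G p σ) (fn φ) f) (formMeasure (n + 1)) ∧
          Integrable (formIntegrandHC p σ (G p σ) (fn φ) f) (formMeasure (n + 1))) ∧
        inner ℂ φ q.2 = ∑ p ∈ Finset.range (n + 1 + 1), ∑ σ ∈ processes (n + 1) p,
          ((∫ z, formIntegrand p σ (G p σ) (fn φ) f z ∂formMeasure (n + 1)) +
            ∫ z, formIntegrandHC p σ (G p σ) (fn φ) f z ∂formMeasure (n + 1))) →
      ∀ {M : ℕ} {φ : 𝓕(n)} (hφ : Nice M φ), inner ℂ hφ.vec.toFock q.2 = qForm G φ f := by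
    intro q f _ h M φ hφ
    rw [(h _ hφ.finiteParticle).2, ← qForm_congr_ae G hφ.vec.fn_toFock (ae_eq_refl f)]
    refine Finset.sum_congr rfl fun p _ => Finset.sum_congr rfl fun σ _ => ?_
    congr 1
    exact integral_conj
  have hm := Submodule.mem_graph_toLinearPMap (hg := ?_) Ψ
  · obtain ⟨f, hf, h⟩ := hm
    refine (key _ f hf h hφ).trans ?_
    exact qForm_congr_ae G (ae_eq_refl φ) (hf.symm.trans (fn_ae_rep _))
  · rintro ⟨a, b⟩ ⟨f, hf, h⟩ (h0 : a = 0)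
    subst h0
    have hf0 : f =ᵐ[𝓒(n)] 0 := hf.symm.trans fn_zero
    have hz : ∀ {M : ℕ} {φ : 𝓕(n)} (hφ : Nice M φ), inner ℂ hφ.vec.toFock b = 0 := by
      intro M φ hφ
      rw [key (0, b) f hf h hφ, qForm_congr_ae G (ae_eq_refl φ) hf0]
      have e0 : ∀ (L : List (Fin (n + 1))) (ξ : Fin (n + 1) → Xi), annihList L ξ 0 = 0 :=
        fun L ξ => by simpa using annihList_smul L ξ 0 0
      simp [qForm, tForm, e0]
    have hb := vec_rep b
    have hM : ∀ M, ∀ᵐ y ∂𝓒(n), trunc M (rep b) y = 0 := by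
      intro M
      have h1 := hz (hb.truncate M)
      rw [inner_eq_integral (hb.truncate M).vec.fn_toFock (fn_ae_rep b)] at h1
      have h2 : ∫ y, conj (trunc M (rep b) y) * trunc M (rep b) y
          ∂𝓒(n) = 0 := by
        rw [← h1]
        refine integral_congr_forall fun y => ?_
        simp only [trunc, boxInd]
        split_ifs <;> simp
      rw [integral_conj_mul_self (hb.truncate M).memLp, Complex.ofReal_eq_zero,
        ENNReal.toReal_eq_zero_iff] at h2
      have h3 := h2.resolve_right (sqInt_lt_top (hb.truncate M).memLp).ne
      rw [sqInt, lintegral_eq_zero_iff' ((hb.truncate M).memLp.1.enorm.pow_const 2)] at h3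
      filter_upwards [h3] with y hy
      simpa using hy
    refine ext_fn ?_
    filter_upwards [ae_all_iff.2 hM, fn_ae_rep b, fn_zero (n := n + 1)] with y h1 h2 h3
    rw [h2, h3, Pi.zero_apply]
    have h4 := h1 (∑ i, num y i)
    rwa [trunc, boxInd, if_pos (fun i => Finset.single_le_sum (f := num y) (fun _ _ => Nat.zero_le _)
      (Finset.mem_univ i)), one_mul] at h4

theorem hamiltonian_spec {m : Fin (n + 1) → ℝ}
    {G : ℕ → Equiv.Perm (Fin (n + 1)) → Kernel (Fin (n + 1))} (Ψ : (hamiltonian m G).domain) :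
    Vec (fun y => (freeEnergy m y : ℂ) * rep Ψ.1 y) ∧
    ∀ (M : ℕ) (φ : 𝓕(n)), Nice M φ → ∫ y, conj (φ y) * rep (hamiltonian m G Ψ) y ∂𝓒(n) =
        (∫ y, conj (φ y) * ((freeEnergy m y : ℂ) * rep Ψ.1 y) ∂𝓒(n)) + qForm G φ (rep Ψ.1) := by
  have h1 : Ψ.1 ∈ (freeHamiltonian m).domain := (Submodule.mem_inf.1 Ψ.2).1
  have h2 : Ψ.1 ∈ (interaction G).domain := (Submodule.mem_inf.1 Ψ.2).2
  have e : hamiltonian m G Ψ = freeHamiltonian m ⟨Ψ, h1⟩ + interaction G ⟨Ψ, h2⟩ :=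
    LinearPMap.add_apply _ _ _
  have hfree : fn (freeHamiltonian m ⟨Ψ, h1⟩) =ᵐ[𝓒(n)]
      fun y => (freeEnergy m y : ℂ) * rep Ψ.1 y := by
    filter_upwards [fn_freeHamiltonian m ⟨Ψ, h1⟩, fn_ae_rep Ψ.1] with y e1 e2
    rw [e1, e2]
  refine ⟨⟨(memLp_congr_ae hfree).1 (Lp.memLp _), fun y i l x π => ?_⟩, fun M φ hφ => ?_⟩
  · have h := (vec_rep Ψ.1).anti y i l x π
    have hE : freeEnergy m (Function.update y i (⟨l, x ∘ π⟩ : Particles)) =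
        freeEnergy m (Function.update y i (⟨l, x⟩ : Particles)) := by
      have hs : ∀ z : Conf (n + 1), freeEnergy m z =
        ∑ j, (fun q : Particles => ∑ a, omega (m j) (q.2 a).1) (z j) := fun _ => rfl
      rw [hs, hs]
      refine Finset.sum_congr rfl fun j _ => ?_
      rcases eq_or_ne j i with rfl | hj
      · rw [Function.update_self, Function.update_self]
        exact Equiv.sum_comp π fun a => omega (m j) (x a).1
      · rw [Function.update_of_ne hj, Function.update_of_ne hj]
    simp only [h, hE]; ring
  · have a1 := inner_interaction G ⟨Ψ, h2⟩ hφ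
    have a2 := inner_eq_integral hφ.vec.fn_toFock hfree
    have a3 := inner_eq_integral hφ.vec.fn_toFock (fn_ae_rep (hamiltonian m G Ψ))
    rw [← a3, ← a2, e, inner_add_right, a1]

end

section
variable {n : ℕ}

/-! ### Forms that are small relative to the energy -/

/-- The form is bounded by the weighted energies, with an arbitrarily small constant. -/
def FormBound (t : (𝓕(n)) → (𝓕(n)) → ℂ) : Prop :=
  ∀ κ δ : ℝ, 0 < δ → ∃ C : ℝ≥0, ∀ w₁ w₂ : (𝓞(n)) → ℝ, Slow κ w₁ → Slow κ w₂ →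
    (∀ N, 1 ≤ w₁ N * w₂ N) → ∀ (M : ℕ) (φ f : 𝓕(n)), Nice M φ → Nice M f →
      ‖t φ f‖ₑ ^ 2 ≤ (ENNReal.ofReal δ * eInt w₁ φ + C * wInt w₁ φ) *
        (ENNReal.ofReal δ * eInt w₂ f + C * wInt w₂ f)

theorem formBound_zero : FormBound (n := n) fun _ _ => 0 := fun _ _ _ =>
  ⟨0, fun _ _ _ _ _ _ _ _ _ _ => by simp⟩

theorem FormBound.conj {t : (𝓕(n)) → (𝓕(n)) → ℂ} (h : FormBound t) :
    FormBound fun φ f => conj (t f φ) := by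
  intro κ δ hδ
  obtain ⟨C, hC⟩ := h κ δ hδ
  refine ⟨C, fun w₁ w₂ hw₁ hw₂ hw M φ f hφ hf => ?_⟩
  rw [RCLike.enorm_conj, mul_comm]
  exact hC w₂ w₁ hw₂ hw₁ (fun N => by rw [mul_comm]; exact hw N) M f φ hf hφ

theorem FormBound.add {t t' : (𝓕(n)) → (𝓕(n)) → ℂ} (h : FormBound t)
    (h' : FormBound t') : FormBound fun φ f => t φ f + t' φ f := by
  intro κ δ hδ
  obtain ⟨C, hC⟩ := h κ (δ / 2) (half_pos hδ)
  obtain ⟨C', hC'⟩ := h' κ (δ / 2) (half_pos hδ)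
  refine ⟨2 * max C C', fun w₁ w₂ hw₁ hw₂ hw M φ f hφ hf => ?_⟩
  have h1 := hC w₁ w₂ hw₁ hw₂ hw M φ f hφ hf
  have h2 := hC' w₁ w₂ hw₁ hw₂ hw M φ f hφ hf
  set a := ENNReal.ofReal (δ / 2) * eInt w₁ φ + (max C C' : ℝ≥0) * wInt w₁ φ with ha
  set b := ENNReal.ofReal (δ / 2) * eInt w₂ f + (max C C' : ℝ≥0) * wInt w₂ f with hb
  have h1' : ‖t φ f‖ₑ ^ 2 ≤ a * b := h1.trans (by
    rw [ha, hb]; gcongr <;> exact le_max_left _ _)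
  have h2' : ‖t' φ f‖ₑ ^ 2 ≤ a * b := h2.trans (by
    rw [ha, hb]; gcongr <;> exact le_max_right _ _)
  have h3 : ‖t φ f + t' φ f‖ₑ ^ 2 ≤ 2 * (‖t φ f‖ₑ ^ 2 + ‖t' φ f‖ₑ ^ 2) := by
    refine (ENNReal.pow_le_pow_left (enorm_add_le _ _)).trans ?_
    have := ENNReal.rpow_add_le_mul_rpow_add_rpow (‖t φ f‖ₑ) (‖t' φ f‖ₑ) (p := 2) (by norm_num)
    norm_num at this
    exact this
  have e : ∀ A B : ℝ≥0∞, ENNReal.ofReal δ * A + (2 * max C C' : ℝ≥0) * B =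
      2 * (ENNReal.ofReal (δ / 2) * A + (max C C' : ℝ≥0) * B) := by
    intro A B
    have : ENNReal.ofReal δ = 2 * ENNReal.ofReal (δ / 2) := by
      rw [← ENNReal.ofReal_ofNat, ← ENNReal.ofReal_mul (by norm_num)]
      congr 1; ring
    rw [this]; push_cast; ring
  calc _ ≤ 2 * (a * b + a * b) := h3.trans (by gcongr)
    _ = (2 * a) * (2 * b) := by ring
    _ = _ := by rw [e, e]

theorem FormBound.sum {ι : Type*} (s : Finset ι)
    {t : ι → (𝓕(n)) → (𝓕(n)) → ℂ} (h : ∀ i ∈ s, FormBound (t i)) :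
    FormBound fun φ f => ∑ i ∈ s, t i φ f := by
  classical
  induction s using Finset.induction_on with
  | empty => simpa using formBound_zero
  | insert a s ha ih =>
    simp only [Finset.sum_insert ha]
    exact (h a (Finset.mem_insert_self a s)).add (ih fun i hi => h i (Finset.mem_insert_of_mem hi))

theorem formBound_tForm {L₁ L₂ : List (Fin (n + 1))} (hL : IsSplit L₁ L₂)
    {τ : Equiv.Perm (Fin (n + 1))} {r : Fin (n + 1) → ℝ} {G K : Kernel (Fin (n + 1))}
    (hG : IsOscPow r G K) (h : ∀ sel, PairEnergyBound (n + 1) τ sel fun i => r (τ i)) :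
    FormBound fun φ f => tForm G L₁ L₂ φ f := by
  intro κ δ hδ
  set k : ℝ≥0 := (sqInt 𝓚(n + 1) K).toNNReal with hk
  have hk' : (k : ℝ≥0∞) = sqInt 𝓚(n + 1) K :=
    ENNReal.coe_toNNReal (sqInt_lt_top (Lp.memLp K)).ne
  have hk1 : (0 : ℝ) < k + 1 := by positivity
  obtain ⟨C, hC⟩ := h (fun i => decide (τ i ∈ L₁)) κ (δ / (k + 1)) (by positivity)
  refine ⟨(k + 1) * C, fun w₁ w₂ hw₁ hw₂ hw M φ f hφ hf => ?_⟩
  refine (hL.enorm_tForm_sq_le τ hG hφ hf).trans ((mul_le_mul_right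
    (hC w₁ w₂ hw₁ hw₂ hw M φ f hφ hf) _).trans ?_)
  rw [← hk', ← mul_assoc]
  refine mul_le_mul' ?_ ?_
  · refine const_mul_form_le ?_ ?_ _ _
    · rw [mul_div_assoc', div_le_iff₀ hk1]; nlinarith
    · gcongr; exact le_self_add
  · rw [← one_mul (_ + _), ← ENNReal.coe_one]
    refine const_mul_form_le ?_ ?_ _ _
    · rw [NNReal.coe_one, one_mul, div_le_iff₀ hk1]
      nlinarith [k.coe_nonneg]
    · gcongr; exact le_add_self

/-- The interaction is small relative to the energy. -/
theorem formBound_qForm {d : ℕ} (hd : 1 ≤ d) (i₀ : Fin (d + 1)) {ε : ℝ} (hε : 0 < ε)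
    {G : ℕ → Equiv.Perm (Fin (d + 1)) → Kernel (Fin (d + 1))}
    (hG : ∀ p ∈ Finset.range (d + 1 + 1), ∀ σ ∈ processes (d + 1) p,
      ∃ K, IsOscPow (kernelExp d i₀ ε) (G p σ) K) : FormBound (qForm G) := by
  obtain ⟨τ, r, hr, h⟩ := exists_pairEnergyBound hd i₀ hε
  refine FormBound.sum _ fun p hp => FormBound.sum _ fun σ hσ => ?_
  obtain ⟨K, hK⟩ := hG p hp σ hσ
  obtain ⟨K', hK'⟩ := hr _ _ hK
  have h1 := formBound_tForm (isSplit_created p σ) hK' h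
  exact h1.add h1.conj

/-! ### Commutation relations -/

theorem cre_smul (i : Fin n) (g : Xi → ℂ) (c : ℂ) (f : Conf n → ℂ) :
    cre i g (c • f) = c • cre i g f := by
  funext y
  simp only [cre, Pi.smul_apply, smul_eq_mul, Finset.mul_sum]
  exact Finset.sum_congr rfl fun k _ => by ring

theorem annihList_cre {L : List (Fin (n + 1))} (hL : (0 : Fin (n + 1)) ∉ L)
    (z : Fin (n + 1) → Xi) (g : Xi → ℂ) (f : 𝓕(n)) :
    annihList L z (cre 0 g f) = (-1 : ℂ) ^ L.length • cre 0 g (annihList L z f) := by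
  induction L with
  | nil => simp [annihList]
  | cons i L ih =>
    simp only [List.mem_cons, not_or] at hL
    rw [annihList_cons, ih hL.2, annih_smul, annih_cre_zero (Ne.symm hL.1), List.length_cons, pow_succ,
      annihList_cons]
    simp

theorem annihList_cre_append {L : List (Fin (n + 1))} (hL : (0 : Fin (n + 1)) ∉ L)
    (z : Fin (n + 1) → Xi) (g : Xi → ℂ) (f : 𝓕(n)) :
    annihList (L ++ [0]) z (cre 0 g f) = g (z 0) • annihList L z f +
      (-1 : ℂ) ^ (L.length + 1) • cre 0 g (annihList (L ++ [0]) z f) := by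
  have h : annih 0 (z 0) (cre 0 g f) = g (z 0) • f + (-1 : ℂ) • cre 0 g (annih 0 (z 0) f) := by
    funext y
    rw [annih_cre_same]
    simp only [Pi.add_apply, Pi.smul_apply, smul_eq_mul]
    ring
  have e : ∀ u : 𝓕(n), annihList [0] z u = annih 0 (z 0) u := fun _ => rfl
  rw [annihList_append, annihList_append, e, e, h, annihList_add, annihList_smul, annihList_smul,
    annihList_cre hL, smul_smul, pow_succ']

theorem annih_sm_zero {f : 𝓕(n)} (hf : Anti f) (i : Fin (n + 1)) (ξ : Xi) (g : Xi → ℂ) :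
    annih i ξ (sm 0 g f) = (-1 : ℂ) • sm 0 g (annih i ξ f) := by
  funext y
  have h : ∀ η, annih i ξ (annih 0 η f) = -annih 0 η (annih i ξ f) := by
    intro η
    rcases eq_or_ne i 0 with rfl | hi
    · exact hf.annih_comm 0 ξ η
    · exact annih_comm hi ξ η f
  rw [annih_sm, Pi.smul_apply, sm, smul_eq_mul, ← integral_const_mul]
  refine integral_congr_forall fun η => ?_
  simp only [h, Pi.neg_apply]; ring

theorem Anti.annihList {f : Conf n → ℂ} (hf : Anti f) (L : List (Fin n)) (z : Fin n → Xi) :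
    Anti (annihList L z f) := by
  induction L with
  | nil => exact hf
  | cons i L ih => exact ih.annihilate i _

theorem annihList_sm {f : 𝓕(n)} (hf : Anti f) (L : List (Fin (n + 1)))
    (z : Fin (n + 1) → Xi) (g : Xi → ℂ) :
    annihList L z (sm 0 g f) = (-1 : ℂ) ^ L.length • sm 0 g (annihList L z f) := by
  induction L with
  | nil => simp [annihList]
  | cons i L ih =>
    rw [annihList_cons, ih, annih_smul, annih_sm_zero (hf.annihList L z), smul_smul, List.length_cons,
      pow_succ, annihList_cons]

theorem Nice.smul {M : ℕ} {f : 𝓕(n)} (hf : Nice M f) (c : ℂ) : Nice M (c • f) :=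
  hf.num_mul fun _ => c

theorem Nice.ae_annihList {L : List (Fin (n + 1))} (hL : L.Nodup) {M : ℕ} {f : 𝓕(n)}
    (hf : Nice M f) : ∀ᵐ z ∂𝓚(n + 1), Nice M (annihList L z f) := by
  have hp : L.Perm (selList (n + 1) id fun i => decide (i ∈ L)) := by
    rw [List.perm_ext_iff_of_nodup hL (nodup_selList Function.injective_id _)]
    intro j
    simp [mem_selList]
  obtain ⟨s, -, hs⟩ := annihList_perm hp hL
  filter_upwards [hf.ae_annR id (fun i => decide (i ∈ L))] with z hz
  have h5 := annR_eq_annihList (id : Fin (n + 1) → Fin (n + 1)) (fun i => decide (i ∈ L)) z f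
  rw [hs, ← h5]
  exact hz.smul s

/-- The pull-through formula for one term of the interaction, when the species `0` is
annihilated. -/
theorem IsSplit.tForm_cre_right {L₁ L₂ : List (Fin (n + 1))} (hL : IsSplit L₁ L₂)
    (h0 : (0 : Fin (n + 1)) ∉ L₁) {M : ℕ} {φ f : 𝓕(n)} (hφ : Nice M φ) (hf : Nice M f)
    {g : (Fin (n + 1) → Xi) → ℂ} (hg : MemLp g 2 𝓚(n + 1)) {h : Xi → ℂ} (hh : MemLp h 2 xiMeasure) :
    tForm g L₁ L₂ (cre 0 h φ) f =
      (-1) ^ (n + 1) * tForm g L₁ L₂ φ (sm 0 (fun ξ => conj (h ξ)) f) := by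
  have hlen : L₁.length + L₂.length = n + 1 := by
    rw [← List.length_append, ← List.toFinset_card_of_nodup hL.nodup,
      Finset.eq_univ_of_forall fun i => List.mem_toFinset.2 (hL.mem i), Finset.card_univ,
      Fintype.card_fin]
  have hpow : (-1 : ℂ) ^ (n + 1) = (-1) ^ L₁.length * (-1) ^ L₂.length :=
    (congrArg (fun l => (-1 : ℂ) ^ l) hlen.symm).trans (pow_add _ _ _)
  have hs : ∀ l : ℕ, starRingEnd ℂ ((-1) ^ l) = (-1) ^ l := fun l => by simp
  rw [tForm, tForm, formMeasure, integral_prod _ (hL.integrable (hφ.create 0 hh)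
    (hf.mono (Nat.le_succ M)) hg), integral_prod _ (hL.integrable hφ (hf.smear 0 (MemLp_conj hh)) hg),
    ← integral_const_mul]
  refine integral_congr_ae ?_
  filter_upwards [hφ.ae_annihList hL.left, hf.ae_annihList hL.right] with x h1 h2
  have h3 := h1.adjoint h2 0 hh
  have e1 : ∀ y, g x * conj (annihList L₁ x (cre 0 h φ) y) * annihList L₂ x f y =
      ((-1) ^ L₁.length * g x) * (conj (cre 0 h (annihList L₁ x φ) y) * annihList L₂ x f y) := by
    intro y
    rw [annihList_cre h0, Pi.smul_apply, smul_eq_mul, map_mul, hs]; ring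
  have e2 : ∀ y, g x * conj (annihList L₁ x φ y) *
      annihList L₂ x (sm 0 (fun ξ => conj (h ξ)) f) y = ((-1) ^ L₂.length * g x) *
        (conj (annihList L₁ x φ y) * sm 0 (fun ξ => conj (h ξ)) (annihList L₂ x f) y) := by
    intro y
    rw [annihList_sm hf.anti, Pi.smul_apply, smul_eq_mul]; ring
  simp only [e1, e2]
  rw [integral_const_mul, integral_const_mul, h3, hpow]
  have : ((-1 : ℂ) ^ L₂.length) * (-1) ^ L₂.length = 1 := by
    rw [← mul_pow]; simp
  linear_combination (-(-1 : ℂ) ^ L₁.length * g x * ∫ y, conj (annihList L₁ x φ y) *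
    sm 0 (fun ξ => conj (h ξ)) (annihList L₂ x f) y ∂𝓒(n)) * this

/-- The pull-through formula for one term of the interaction, when the species `0` is created. -/
theorem IsSplit.tForm_cre_left {L₁ L₂ : List (Fin (n + 1))} (hL : IsSplit L₁ L₂)
    (h0 : (0 : Fin (n + 1)) ∈ L₁) : ∃ s : ℂ, ‖s‖ₑ = 1 ∧ ∀ {M : ℕ} {φ f : 𝓕(n)},
    Nice M φ → Nice M f → ∀ {g : (Fin (n + 1) → Xi) → ℂ},
    MemLp g 2 𝓚(n + 1) → ∀ {h : Xi → ℂ}, MemLp h 2 xiMeasure →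
    Integrable (fun x => conj (h (x 0)) * (g x * ∫ y, conj
        (annihList (L₁.erase 0) x φ y) * annihList L₂ x f y ∂𝓒(n))) 𝓚(n + 1) ∧
    tForm g L₁ L₂ (cre 0 h φ) f = (-1) ^ (n + 1) * tForm g L₁ L₂ φ (sm 0 (fun ξ => conj (h ξ)) f) +
      s * ∫ x, conj (h (x 0)) * (g x * ∫ y, conj
        (annihList (L₁.erase 0) x φ y) * annihList L₂ x f y ∂𝓒(n)) ∂𝓚(n + 1) := by
  have hp : L₁.Perm (L₁.erase 0 ++ [0]) :=
    (List.perm_cons_erase h0).trans (List.perm_append_comm (l₁ := [0]))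
  obtain ⟨s, hs1, hs⟩ := annihList_perm hp hL.left
  have hs0 : (0 : Fin (n + 1)) ∉ L₁.erase 0 := fun hmem =>
    (List.Nodup.not_mem_erase hL.left) hmem
  have hlen : L₁.length + L₂.length = n + 1 := by
    rw [← List.length_append, ← List.toFinset_card_of_nodup hL.nodup,
      Finset.eq_univ_of_forall fun i => List.mem_toFinset.2 (hL.mem i), Finset.card_univ,
      Fintype.card_fin]
  have hpow : (-1 : ℂ) ^ (n + 1) = (-1) ^ L₁.length * (-1) ^ L₂.length :=
    (congrArg (fun l => (-1 : ℂ) ^ l) hlen.symm).trans (pow_add _ _ _)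
  have hlen1 : (L₁.erase 0).length + 1 = L₁.length := by
    rw [hp.length_eq]; simp
  have hsc : conj s = s := by rcases hs1 with rfl | rfl <;> simp
  have hss : s * s = 1 := by rcases hs1 with rfl | rfl <;> simp
  have hsn : ‖s‖ₑ = 1 := by rcases hs1 with rfl | rfl <;> simp
  refine ⟨s, hsn, fun {M φ f} hφ hf {g} hg {h} hh => ?_⟩
  have hs' : ∀ l : ℕ, starRingEnd ℂ ((-1) ^ l) = (-1) ^ l := fun l => by simp
  have hcre : ∀ x y, annihList L₁ x (cre 0 h φ) y = s * (h (x 0) * annihList (L₁.erase 0) x φ y) +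
      (-1) ^ L₁.length * cre 0 h (annihList L₁ x φ) y := by
    intro x y
    rw [hs, annihList_cre_append hs0, hs x φ, cre_smul, hlen1]
    simp only [Pi.add_apply, Pi.smul_apply, smul_eq_mul]
    ring
  have i1 := hL.integrable (hφ.create 0 hh) (hf.mono (Nat.le_succ M)) hg
  have i2 := hL.integrable hφ (hf.smear 0 (MemLp_conj hh)) hg
  rw [formMeasure] at i1 i2
  have key : ∀ᵐ x ∂𝓚(n + 1), ∫ y, g x * conj (annihList L₁ x (cre 0 h φ) y) * annihList L₂ x f y
        ∂𝓒(n) =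
      (-1) ^ (n + 1) * ∫ y, g x * conj (annihList L₁ x φ y) *
        annihList L₂ x (sm 0 (fun ξ => conj (h ξ)) f) y ∂𝓒(n) +
      s * (conj (h (x 0)) * (g x * ∫ y, conj
        (annihList (L₁.erase 0) x φ y) * annihList L₂ x f y ∂𝓒(n))) := by
    filter_upwards [hφ.ae_annihList hL.left, hf.ae_annihList hL.right,
      hφ.ae_annihList (hL.left.erase 0)] with x h1 h2 h4
    have h3 := h1.adjoint h2 0 hh
    have e1 : ∀ y, g x * conj (annihList L₁ x (cre 0 h φ) y) * annihList L₂ x f y =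
        ((-1) ^ L₁.length * g x) * (conj (cre 0 h (annihList L₁ x φ) y) * annihList L₂ x f y) +
        (s * conj (h (x 0)) * g x) *
          (conj (annihList (L₁.erase 0) x φ y) * annihList L₂ x f y) := by
      intro y
      rw [hcre, map_add, map_mul, map_mul, map_mul, hs', hsc]; ring
    have e2 : ∀ y, g x * conj (annihList L₁ x φ y) *
        annihList L₂ x (sm 0 (fun ξ => conj (h ξ)) f) y = ((-1) ^ L₂.length * g x) *
          (conj (annihList L₁ x φ y) * sm 0 (fun ξ => conj (h ξ)) (annihList L₂ x f) y) := by
      intro y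
      rw [annihList_sm hf.anti, Pi.smul_apply, smul_eq_mul]; ring
    have i3 : Integrable (fun y => conj (cre 0 h (annihList L₁ x φ) y) * annihList L₂ x f y) 𝓒(n) :=
      (MemLp_conj (h1.create 0 hh).memLp).integrable_mul h2.memLp
    have i4 : Integrable (fun y => conj (annihList (L₁.erase 0) x φ y) * annihList L₂ x f y) 𝓒(n) :=
      (MemLp_conj h4.memLp).integrable_mul h2.memLp
    simp only [e1, e2]
    rw [integral_add (i3.const_mul _) (i4.const_mul _), integral_const_mul, integral_const_mul,
      integral_const_mul, h3, hpow]
    have : ((-1 : ℂ) ^ L₂.length) * (-1) ^ L₂.length = 1 := by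
      rw [← mul_pow]; simp
    linear_combination (-(-1 : ℂ) ^ L₁.length * g x * ∫ y, conj (annihList L₁ x φ y) *
      sm 0 (fun ξ => conj (h ξ)) (annihList L₂ x f) y ∂𝓒(n)) * this
  have j1 := i1.integral_prod_left
  have j2 := i2.integral_prod_left
  have j3 : Integrable (fun x => conj (h (x 0)) * (g x * ∫ y, conj
        (annihList (L₁.erase 0) x φ y) * annihList L₂ x f y ∂𝓒(n)))
        𝓚(n + 1) := by
    refine ((j1.sub (j2.const_mul ((-1) ^ (n + 1)))).const_mul s).congr ?_
    filter_upwards [key] with x hx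
    simp only [Pi.sub_apply]
    rw [hx]
    linear_combination (conj (h (x 0)) * (g x * ∫ y, conj
        (annihList (L₁.erase 0) x φ y) * annihList L₂ x f y ∂𝓒(n))) * hss
  refine ⟨j3, ?_⟩
  rw [tForm, tForm, formMeasure, integral_prod _ i1, integral_prod _ i2, integral_congr_ae key,
    integral_add (j2.const_mul _) (j3.const_mul _), integral_const_mul, integral_const_mul]

end

section
variable {n : ℕ}

/-! ### The commutator of the interaction with a creation operator -/

/-- Both entries of the pairing of the massive species may carry the weight. -/
def SliceBound (τ : Equiv.Perm (Fin n)) (r : Fin n → ℝ) (C : ℝ≥0) : Prop :=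
  ∀ (sel : Fin n → Bool) (M : ℕ) (φ f : 𝓕(n)), Nice M φ → Nice M f →
    pairSum n (fun i => (τ i).succ) sel (fun i => r (τ i)) φ f ≤
      C * (sqInt 𝓒(n) φ * wInt (fun N => lam N ^ (2 : ℝ)) f) ∧
    pairSum n (fun i => (τ i).succ) sel (fun i => r (τ i)) φ f ≤
      C * (wInt (fun N => lam N ^ (2 : ℝ)) φ * sqInt 𝓒(n) f)

theorem slow_one {κ : ℝ} (hκ : 1 ≤ κ) : Slow (n := n) κ fun _ => 1 :=
  ⟨fun _ => one_pos, fun _ _ => by simpa using hκ, fun _ _ => by simpa using hκ⟩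

theorem exists_sliceBound {d : ℕ} (hd : 1 ≤ d) (i₀ : Fin (d + 1)) {ε : ℝ} (hε : 0 < ε)
    (h : d = 1 → i₀ = 0 → 1 / 2 ≤ ε) : ∃ τ C, SliceBound τ (sliceExp d i₀ ε) C := by
  obtain ⟨τ, A, hA, hb⟩ := exists_pairBound_slice hd i₀ hε h
  choose C hC using fun sel => hb sel (2 ^ |(2 : ℝ)|)
  have hle : ∀ N : 𝓞(d), lam N ^ A ≤ lam N ^ (2 : ℝ) := fun N =>
    Real.rpow_le_rpow_of_exponent_le (one_le_lam N) hA
  have hone : Slow (n := d) (2 ^ |(2 : ℝ)|) fun _ => 1 :=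
    slow_one (Real.one_le_rpow (by norm_num) (abs_nonneg _))
  refine ⟨τ, ∑ sel, C sel, fun sel M φ f hφ hf => ?_⟩
  have hs : (C sel : ℝ≥0∞) ≤ (∑ sel, C sel : ℝ≥0) :=
    ENNReal.coe_le_coe.2 (Finset.single_le_sum (f := C) (fun _ _ => zero_le) (Finset.mem_univ sel))
  rw [← wInt_one φ, ← wInt_one f]
  exact ⟨(hC sel _ _ hone (slow_lam_rpow 2) (fun N => by simpa using hle N) M φ f hφ hf).trans
    (mul_le_mul_left hs _), (hC sel _ _ (slow_lam_rpow 2) hone (fun N => by simpa using hle N) M φ f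
      hφ hf).trans (mul_le_mul_left hs _)⟩

/-- The norm of a slice of a kernel. -/
def sliceNorm (K : Kernel (Fin (n + 1))) (ξ : Xi) : ℝ≥0∞ :=
  sqInt 𝓚(n) (fun x => K (Fin.cons ξ x)) ^ (1 / 2 : ℝ)

theorem le_rpow_half_mul {a b c : ℝ≥0∞} (h : a ^ 2 ≤ b * c) :
    a ≤ b ^ (1 / 2 : ℝ) * c ^ (1 / 2 : ℝ) := by
  rw [← ENNReal.mul_rpow_of_nonneg _ _ (by norm_num)]
  calc a = (a ^ 2) ^ (1 / 2 : ℝ) := by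
        rw [← ENNReal.rpow_natCast, ← ENNReal.rpow_mul]; norm_num
    _ ≤ _ := ENNReal.rpow_le_rpow h (by norm_num)

theorem ae_slice_le {τ : Equiv.Perm (Fin n)} {r : Fin n → ℝ} {C : ℝ≥0} (hτ : SliceBound τ r C)
    {L₁ L₂ : List (Fin (n + 1))} (hL : (L₁ ++ L₂).Nodup) (hmem : ∀ j, j ∈ L₁ ++ L₂ ↔ j ≠ 0)
    {G K : Kernel (Fin (n + 1))} (h : IsOscPow (Fin.cons 0 r) G K) :
    ∀ᵐ ξ ∂xiMeasure, ∀ (M : ℕ) (φ f : 𝓕(n)), Nice M φ → Nice M f →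
      ‖∫ x, G (Fin.cons ξ x) * ∫ y, conj (annihList L₁ (Fin.cons ξ x) φ y) *
        annihList L₂ (Fin.cons ξ x) f y ∂𝓒(n) ∂𝓚(n)‖ₑ ≤
        sliceNorm K ξ * (C * (sqInt 𝓒(n) φ * wInt (fun N => lam N ^ (2 : ℝ)) f)) ^ (1 / 2 : ℝ) ∧
      ‖∫ x, G (Fin.cons ξ x) * ∫ y, conj (annihList L₁ (Fin.cons ξ x) φ y) *
        annihList L₂ (Fin.cons ξ x) f y ∂𝓒(n) ∂𝓚(n)‖ₑ ≤
        sliceNorm K ξ * (C * (sqInt 𝓒(n) f * wInt (fun N => lam N ^ (2 : ℝ)) φ)) ^ (1 / 2 : ℝ) := by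
  obtain ⟨s, hs, hp⟩ := exists_sign_pairFn (sp := fun i => (τ i).succ)
    (fun i j hij => τ.injective (Fin.succ_injective _ hij)) hL (fun j => by
      rw [hmem]
      constructor
      · intro hj
        obtain ⟨i, rfl⟩ := Fin.exists_succ_eq.2 hj
        exact ⟨τ.symm i, by simp⟩
      · rintro ⟨i, rfl⟩
        exact Fin.succ_ne_zero _)
  filter_upwards [ae_isOscPow_slice (r := r) (Fin.cons_zero _ _) (fun i => Fin.cons_succ _ _ i) h]
    with ξ ⟨F, L, hFL, hF, hK⟩ M φ f hφ hf
  have e : ∫ x, G (Fin.cons ξ x) * ∫ y, conj (annihList L₁ (Fin.cons ξ x) φ y) *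
        annihList L₂ (Fin.cons ξ x) f y ∂𝓒(n) ∂𝓚(n) = s * ∫ x, F x * ∫ y,
        pairFn n (fun i => (τ i).succ) (fun i => decide ((τ i).succ ∈ L₁)) φ f
          (fun i => x (τ i), y) ∂𝓒(n) ∂𝓚(n) := by
    rw [← integral_const_mul]
    refine integral_congr_ae ?_
    filter_upwards [hF] with x hx
    simp only [hp, Fin.cons_succ, integral_const_mul, hx]
    ring
  have hsn : ‖s‖ₑ = 1 := by rcases hs with rfl | rfl <;> simp
  have hb := enorm_integral_mul_pairFn_sq_le (fun i => (τ i).succ)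
    (fun i => decide ((τ i).succ ∈ L₁)) τ hFL hφ hf
  rw [e, enorm_mul, hsn, one_mul, sliceNorm, ← sqInt_congr_ae hK, mul_comm (sqInt 𝓒(n) f)]
  have h2 := hτ (fun i => decide ((τ i).succ ∈ L₁)) M φ f hφ hf
  exact ⟨le_rpow_half_mul (hb.trans (mul_le_mul_right h2.1 _)),
    le_rpow_half_mul (hb.trans (mul_le_mul_right h2.2 _))⟩

theorem enorm_integral_cons_le {g : (Fin (n + 1) → Xi) → ℂ} {h : Xi → ℂ}
    {B : Xi → ℝ≥0∞} (hi : Integrable (fun x => h (x 0) * g x) 𝓚(n + 1))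
    (hB : ∀ᵐ ξ ∂xiMeasure, ‖∫ x, g (Fin.cons ξ x) ∂𝓚(n)‖ₑ ≤ B ξ) :
    ‖∫ x, h (x 0) * g x ∂𝓚(n + 1)‖ₑ ≤ ∫⁻ ξ, ‖h ξ‖ₑ * B ξ ∂xiMeasure := by
  have hi' : Integrable (fun z : Xi × (Fin n → Xi) => h ((Fin.cons z.1 z.2 : Fin (n + 1) → Xi) 0) *
      g (Fin.cons z.1 z.2)) (xiMeasure.prod 𝓚(n)) :=
    ((measurePreserving_cons n).integrable_comp_emb (measurableEmbedding_cons n)).2 hi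
  rw [← (measurePreserving_cons n).integral_comp (measurableEmbedding_cons n), integral_prod _ hi']
  refine (enorm_integral_le_lintegral_enorm _).trans (lintegral_mono_ae ?_)
  filter_upwards [hB] with ξ hξ
  simp only [Fin.cons_zero, integral_const_mul, enorm_mul]
  gcongr

theorem IsSplit.erase_left {L₁ L₂ : List (Fin (n + 1))} (hL : IsSplit L₁ L₂)
    (h0 : (0 : Fin (n + 1)) ∈ L₁) : (L₁.erase 0 ++ L₂).Nodup ∧
      ∀ j, j ∈ L₁.erase 0 ++ L₂ ↔ j ≠ 0 := by
  have h := hL.nodup.erase 0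
  rw [List.erase_append_left _ h0] at h
  refine ⟨h, fun j => ?_⟩
  rw [← List.erase_append_left _ h0, hL.nodup.mem_erase_iff]
  exact ⟨fun hj => hj.1, fun hj => ⟨hj, hL.mem j⟩⟩

theorem IsSplit.enorm_tForm_cre_sub_le {L₁ L₂ : List (Fin (n + 1))} (hL : IsSplit L₁ L₂)
    (h0 : (0 : Fin (n + 1)) ∈ L₁) {M : ℕ} {φ f : 𝓕(n)} (hφ : Nice M φ) (hf : Nice M f)
    {g : (Fin (n + 1) → Xi) → ℂ} (hg : MemLp g 2 𝓚(n + 1)) {h : Xi → ℂ}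
    (hh : MemLp h 2 xiMeasure) {B : Xi → ℝ≥0∞} (hB : ∀ᵐ ξ ∂xiMeasure, ‖∫ x, g (Fin.cons ξ x) *
      ∫ y, conj (annihList (L₁.erase 0) (Fin.cons ξ x) φ y) * annihList L₂ (Fin.cons ξ x) f y ∂𝓒(n)
        ∂𝓚(n)‖ₑ ≤ B ξ) : ‖tForm g L₁ L₂ (cre 0 h φ) f -
      (-1) ^ (n + 1) * tForm g L₁ L₂ φ (sm 0 (fun ξ => conj (h ξ)) f)‖ₑ ≤
      ∫⁻ ξ, ‖h ξ‖ₑ * B ξ ∂xiMeasure := by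
  obtain ⟨s, hs, key⟩ := hL.tForm_cre_left h0
  obtain ⟨hi, he⟩ := key hφ hf hg hh
  rw [he, add_sub_cancel_left, enorm_mul, hs, one_mul]
  refine (enorm_integral_cons_le (h := fun ξ => conj (h ξ)) hi hB).trans (le_of_eq ?_)
  simp only [RCLike.enorm_conj]

theorem enorm_term_cre_sub_le {τ : Equiv.Perm (Fin n)} {r : Fin n → ℝ} {C : ℝ≥0}
    (hτ : SliceBound τ r C) {L₁ L₂ : List (Fin (n + 1))} (hL : IsSplit L₁ L₂)
    {G K : Kernel (Fin (n + 1))} (hGK : IsOscPow (Fin.cons 0 r) G K) {M : ℕ}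
    {φ f : 𝓕(n)} (hφ : Nice M φ) (hf : Nice M f) {h : Xi → ℂ} (hh : MemLp h 2 xiMeasure) :
    ‖tForm G L₁ L₂ (cre 0 h φ) f + conj (tForm G L₁ L₂ f (cre 0 h φ)) - (-1) ^ (n + 1) *
      (tForm G L₁ L₂ φ (sm 0 (fun ξ => conj (h ξ)) f) +
        conj (tForm G L₁ L₂ (sm 0 (fun ξ => conj (h ξ)) f) φ))‖ₑ ≤ ∫⁻ ξ, ‖h ξ‖ₑ * (sliceNorm K ξ *
        (C * (sqInt 𝓒(n) φ * wInt (fun N => lam N ^ (2 : ℝ)) f)) ^ (1 / 2 : ℝ)) ∂xiMeasure := by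
  rw [tForm_conj, tForm_conj]
  have hdis := List.disjoint_of_nodup_append hL.nodup
  by_cases h0 : (0 : Fin (n + 1)) ∈ L₁
  · rw [hL.symm.tForm_cre_right (fun h => hdis h0 h) hφ hf (MemLp_conj (Lp.memLp G)) hh]
    have h1 := hL.enorm_tForm_cre_sub_le h0 hφ hf (Lp.memLp G) hh
      ((ae_slice_le hτ (hL.erase_left h0).1 (hL.erase_left h0).2 hGK).mono
        fun ξ hξ => (hξ M φ f hφ hf).1)
    convert h1 using 2
    ring
  · have h0' : (0 : Fin (n + 1)) ∈ L₂ := (List.mem_append.1 (hL.mem 0)).resolve_left h0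
    rw [hL.tForm_cre_right h0 hφ hf (Lp.memLp G) hh]
    have hL' := hL.symm.erase_left h0'
    have h1 := hL.symm.enorm_tForm_cre_sub_le h0' hφ hf (MemLp_conj (Lp.memLp G)) hh
      (B := fun ξ => sliceNorm K ξ *
        (C * (sqInt 𝓒(n) φ * wInt (fun N => lam N ^ (2 : ℝ)) f)) ^ (1 / 2 : ℝ)) (by
        filter_upwards [ae_slice_le hτ (List.nodup_append_comm.1 hL'.1)
          (fun j => by rw [List.mem_append, or_comm, ← List.mem_append, hL'.2]) hGK] with ξ hξ
        have h2 := (hξ M f φ hf hφ).2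
        rw [← RCLike.enorm_conj, ← integral_conj] at h2
        refine le_trans (le_of_eq ?_) h2
        congr 2
        funext x
        rw [map_mul, ← integral_conj]
        simp only [map_mul, Complex.conj_conj, mul_comm])
    convert h1 using 2
    ring

theorem enorm_qForm_cre_sub_le {τ : Equiv.Perm (Fin n)} {r : Fin n → ℝ} {C : ℝ≥0}
    (hτ : SliceBound τ r C) {G K : ℕ → Equiv.Perm (Fin (n + 1)) → Kernel (Fin (n + 1))}
    (hGK : ∀ p ∈ Finset.range (n + 1 + 1), ∀ σ ∈ processes (n + 1) p,
      IsOscPow (Fin.cons 0 r) (G p σ) (K p σ)) {M : ℕ}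
    {φ f : 𝓕(n)} (hφ : Nice M φ) (hf : Nice M f) {h : Xi → ℂ} (hh : MemLp h 2 xiMeasure) :
    ‖qForm G (cre 0 h φ) f - (-1) ^ (n + 1) * qForm G φ (sm 0 (fun ξ => conj (h ξ)) f)‖ₑ ≤
      ∑ p ∈ Finset.range (n + 1 + 1), ∑ σ ∈ processes (n + 1) p,
        ∫⁻ ξ, ‖h ξ‖ₑ * (sliceNorm (K p σ) ξ *
          (C * (sqInt 𝓒(n) φ * wInt (fun N => lam N ^ (2 : ℝ)) f)) ^ (1 / 2 : ℝ)) ∂xiMeasure := by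
  simp only [qForm, Finset.mul_sum, ← Finset.sum_sub_distrib]
  refine (enorm_sum_le _ _).trans (Finset.sum_le_sum fun p hp => (enorm_sum_le _ _).trans
    (Finset.sum_le_sum fun σ hσ => ?_))
  exact enorm_term_cre_sub_le hτ (isSplit_created p σ) (hGK p hp σ hσ) hφ hf hh

end

section
variable {n : ℕ}

/-! ### Energy estimates -/

theorem omega_nonneg (m : ℝ) (k : EuclideanSpace ℝ (Fin 3)) : 0 ≤ omega m k := Real.sqrt_nonneg _

theorem norm_le_omega (m : ℝ) (k : EuclideanSpace ℝ (Fin 3)) : ‖k‖ ≤ omega m k :=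
  Real.le_sqrt_of_sq_le (by nlinarith [sq_nonneg m])

theorem le_omega {m : ℝ} (k : EuclideanSpace ℝ (Fin 3)) : m ≤ omega m k :=
  Real.le_sqrt_of_sq_le (by nlinarith [sq_nonneg ‖k‖])

theorem continuous_omega (m : ℝ) : Continuous (omega m) := by
  unfold omega; fun_prop

theorem freeEnergy_nonneg (m : Fin n → ℝ) (y : Conf n) : 0 ≤ freeEnergy m y :=
  Finset.sum_nonneg fun _ _ => Finset.sum_nonneg fun _ _ => omega_nonneg _ _

theorem measurable_freeEnergy (m : Fin n → ℝ) : Measurable (freeEnergy m) := by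
  have e : freeEnergy m = fun y => ∑ i, (occ (fun ξ => ENNReal.ofReal (omega (m i) ξ.1)) i y).toReal := by
    funext y
    refine Finset.sum_congr rfl fun i _ => ?_
    rw [occ, ENNReal.toReal_sum fun _ _ => ENNReal.ofReal_ne_top]
    simp [ENNReal.toReal_ofReal (omega_nonneg _ _)]
  rw [e]
  refine Finset.measurable_sum _ fun i _ => (measurable_occ ?_ i).ennreal_toReal
  exact ENNReal.measurable_ofReal.comp ((continuous_omega _).measurable.comp measurable_fst)

/-- The mean value of the free energy in the weighted norm. -/
def freeInt (m : Fin (n + 1) → ℝ) (w : (𝓞(n)) → ℝ) (f : 𝓕(n)) : ℝ≥0∞ :=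
  ∫⁻ y, ENNReal.ofReal (w (num y) * freeEnergy m y) * ‖f y‖ₑ ^ 2 ∂𝓒(n)

theorem eInt_le_freeInt {ms : ℝ} (hms : 0 < ms) {m : Fin (n + 1) → ℝ} (hm : ∀ i : Fin n, ms ≤ m i.succ)
    {w : (𝓞(n)) → ℝ} (hw : ∀ N, 0 ≤ w N) {f : 𝓕(n)} (hf : AEStronglyMeasurable f 𝓒(n)) :
    eInt w f ≤ wInt w f + ENNReal.ofReal (1 + 1 / ms) * freeInt m w f := by
  have hmeas : AEMeasurable (fun y => ENNReal.ofReal (w (num y)) * ‖f y‖ₑ ^ 2) 𝓒(n) :=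
    (measurable_comp_num fun N => ENNReal.ofReal (w N)).aemeasurable.mul (hf.enorm.pow_const 2)
  rw [wInt, freeInt, ← lintegral_const_mul' _ _ ENNReal.ofReal_ne_top, ← lintegral_add_left' hmeas]
  refine lintegral_mono fun y => ?_
  have h1 : ENNReal.ofReal (lam (num y)) + occ (fun ξ => ‖ξ.1‖ₑ) 0 y ≤
      ENNReal.ofReal (1 + (1 + 1 / ms) * freeEnergy m y) := by
    have e : occ (fun ξ => ‖ξ.1‖ₑ) 0 y = ENNReal.ofReal (∑ a, ‖((y 0).2 a).1‖) := by
      rw [occ, ENNReal.ofReal_sum_of_nonneg fun _ _ => norm_nonneg _]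
      simp only [ofReal_norm]
    have h0 : ∑ a, ‖((y 0).2 a).1‖ ≤ ∑ a, omega (m 0) ((y 0).2 a).1 :=
      Finset.sum_le_sum fun _ _ => norm_le_omega _ _
    have hs : ∀ i : Fin n, ((y i.succ).1 : ℝ) * ms ≤ ∑ a, omega (m i.succ) ((y i.succ).2 a).1 := by
      intro i
      have := Finset.card_nsmul_le_sum Finset.univ
        (fun a => omega (m i.succ) ((y i.succ).2 a).1) ms fun a _ => (hm i).trans (le_omega _)
      simpa using this
    have hs' := Finset.sum_le_sum fun i (_ : i ∈ Finset.univ) => hs i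
    rw [← Finset.sum_mul] at hs'
    rw [e, ← ENNReal.ofReal_add (lam_pos _).le (Finset.sum_nonneg fun _ _ => norm_nonneg _)]
    refine ENNReal.ofReal_le_ofReal ?_
    rw [freeEnergy, Fin.sum_univ_succ, lam]
    have h4 : ∑ i : Fin n, (num y i.succ : ℝ) ≤
        (∑ i : Fin n, ∑ a, omega (m i.succ) ((y i.succ).2 a).1) / ms := by
      rw [le_div_iff₀ hms]; exact hs'
    have h5 : 0 ≤ ∑ a, omega (m 0) ((y 0).2 a).1 := Finset.sum_nonneg fun _ _ => omega_nonneg _ _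
    have h6 : 0 ≤ ∑ i : Fin n, ∑ a, omega (m i.succ) ((y i.succ).2 a).1 :=
      Finset.sum_nonneg fun _ _ => Finset.sum_nonneg fun _ _ => omega_nonneg _ _
    have h7 : 0 ≤ (∑ a, omega (m 0) ((y 0).2 a).1) / ms := by positivity
    rw [add_mul, one_mul, one_div_mul_eq_div, add_div]
    linarith
  calc _ ≤ ENNReal.ofReal (1 + (1 + 1 / ms) * freeEnergy m y) *
        (ENNReal.ofReal (w (num y)) * ‖f y‖ₑ ^ 2) := mul_le_mul_left h1 _
    _ = _ := by
      have := freeEnergy_nonneg m y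
      rw [ENNReal.ofReal_add one_pos.le (by positivity), ENNReal.ofReal_mul (by positivity),
        ENNReal.ofReal_mul (hw _), ENNReal.ofReal_one]
      ring

theorem freeInt_lt_top {m : Fin (n + 1) → ℝ} {f : 𝓕(n)} (hf : Vec f)
    (hf' : MemLp (fun y => (freeEnergy m y : ℂ) * f y) 2 𝓒(n)) {w : (𝓞(n)) → ℝ} {T : ℝ}
    (hw : ∀ N, w N ≤ T) (hT : 0 ≤ T) : freeInt m w f < ∞ := by
  have h1 := lintegral_mul_sq_le hf.memLp.1.enorm hf'.1.enorm
  have h2 : ∫⁻ y, ‖f y‖ₑ * ‖(freeEnergy m y : ℂ) * f y‖ₑ ∂𝓒(n) < ∞ := by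
    have := h1.trans_lt (ENNReal.mul_lt_top (sqInt_lt_top hf.memLp) (sqInt_lt_top hf'))
    by_contra h
    rw [not_lt, top_le_iff] at h
    rw [h] at this
    exact absurd this (by simp)
  refine lt_of_le_of_lt ?_ (ENNReal.mul_lt_top (ENNReal.ofReal_lt_top (r := T)) h2)
  rw [← lintegral_const_mul' _ _ ENNReal.ofReal_ne_top]
  refine lintegral_mono fun y => ?_
  rw [enorm_mul, ← ofReal_norm (freeEnergy m y : ℂ), Complex.norm_real,
    Real.norm_of_nonneg (freeEnergy_nonneg m y)]
  calc _ ≤ ENNReal.ofReal (T * freeEnergy m y) * ‖f y‖ₑ ^ 2 := by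
        gcongr
        exacts [freeEnergy_nonneg m y, hw _]
    _ = _ := by rw [ENNReal.ofReal_mul hT]; ring

theorem ofReal_re_integral_conj {u : Conf (n + 1) → ℝ} (hu : ∀ y, 0 ≤ u y) {f : 𝓕(n)}
    (hi : Integrable (fun y => (u y : ℂ) * (conj (f y) * f y)) 𝓒(n)) :
    ENNReal.ofReal (∫ y, (u y : ℂ) * (conj (f y) * f y) ∂𝓒(n)).re =
      ∫⁻ y, ENNReal.ofReal (u y) * ‖f y‖ₑ ^ 2 ∂𝓒(n) := by
  have e : ∀ y, ((u y : ℂ) * (conj (f y) * f y)).re = u y * ‖f y‖ ^ 2 := fun y => by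
    rw [mul_comm (conj _), Complex.mul_conj, Complex.normSq_eq_norm_sq, ← Complex.ofReal_mul,
      Complex.ofReal_re]
  rw [← RCLike.re_to_complex, ← integral_re hi, ofReal_integral_eq_lintegral_ofReal hi.re (Eventually.of_forall fun y => ?_)]
  · refine lintegral_congr fun y => ?_
    rw [RCLike.re_to_complex, e, ENNReal.ofReal_mul (hu y), ENNReal.ofReal_pow (norm_nonneg _),
      ofReal_norm]
  · simp only [RCLike.re_to_complex, e, Pi.zero_apply]
    have := hu y
    positivity

theorem Slow.inv {κ : ℝ} {w : (𝓞(n)) → ℝ} (h : Slow κ w) : Slow κ fun N => (w N)⁻¹ where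
  pos := fun N => inv_pos.2 (h.pos N)
  down := fun N i => by
    rw [← div_eq_mul_inv, le_div_iff₀ (h.pos _), inv_mul_eq_div, div_le_iff₀ (h.pos N)]
    exact h.up N i
  up := fun N i => by
    rw [← div_eq_mul_inv, le_div_iff₀ (h.pos _), inv_mul_eq_div, div_le_iff₀ (h.pos _)]
    exact h.down N i

theorem enorm_mul_trunc_le (w : (𝓞(n)) → ℝ) (M : ℕ) (f : 𝓕(n))
    (y : Conf (n + 1)) : ‖(w (num y) : ℂ) * trunc M f y‖ₑ ≤ ‖(w (num y) : ℂ)‖ₑ * ‖f y‖ₑ := by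
  rw [enorm_mul]; gcongr; exact enorm_trunc_le M f y

theorem inv_weight_le {w : (𝓞(n)) → ℝ} (hw : ∀ N, 0 < w N) (M : ℕ) (f : 𝓕(n)) (y : Conf (n + 1)) :
    ENNReal.ofReal (w (num y))⁻¹ * ‖(w (num y) : ℂ) * trunc M f y‖ₑ ^ 2 ≤
      ENNReal.ofReal (w (num y)) * ‖f y‖ₑ ^ 2 := by
  have h := hw (num y)
  calc _ ≤ ENNReal.ofReal (w (num y))⁻¹ * (‖(w (num y) : ℂ)‖ₑ * ‖f y‖ₑ) ^ 2 := by
        gcongr; exact enorm_mul_trunc_le w M f y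
    _ = _ := by
      rw [← ofReal_norm (w (num y) : ℂ), Complex.norm_real, Real.norm_of_nonneg h.le, mul_pow, sq
        (ENNReal.ofReal _), ← mul_assoc, ← mul_assoc, ← ENNReal.ofReal_mul (inv_pos.2 h).le,
        inv_mul_cancel₀ h.ne', ENNReal.ofReal_one, one_mul]

/-- The interaction is form bounded with respect to the free Hamiltonian, with bounds that do not
depend on the small mass. -/
theorem exists_energy_bound {G : ℕ → Equiv.Perm (Fin (n + 1)) → Kernel (Fin (n + 1))}
    (hG : FormBound (qForm G)) {ms : ℝ} (hms : 0 < ms) : ∃ C : ℝ≥0, ∀ m : Fin (n + 1) → ℝ,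
    (∀ i : Fin n, ms ≤ m i.succ) → ∀ Ψ : (hamiltonian m G).domain,
      ∀ (w : (𝓞(n)) → ℝ) (T : ℝ), Slow 2 w → (∀ N, w N ≤ T) → ∀ b : ℝ≥0∞,
      (∀ M, ENNReal.ofReal (∫ y, conj ((w (num y) : ℂ) * trunc M (rep Ψ.1) y) *
        rep (hamiltonian m G Ψ) y ∂𝓒(n)).re ≤ b) →
      eInt w (rep Ψ.1) ≤ C * (b + wInt w (rep Ψ.1)) := by
  have ha : 0 < 1 + 1 / ms := by positivity
  obtain ⟨C, hC⟩ := hG 2 (1 / (2 * (1 + 1 / ms))) (by positivity)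
  set δ : ℝ≥0∞ := ENNReal.ofReal (1 / (2 * (1 + 1 / ms))) with hδ
  have hδa : δ * ENNReal.ofReal (1 + 1 / ms) = 2⁻¹ := by
    rw [hδ, ← ENNReal.ofReal_mul (by positivity), show 1 / (2 * (1 + 1 / ms)) * (1 + 1 / ms) = 2⁻¹ by
      field_simp, ENNReal.ofReal_inv_of_pos two_pos, ENNReal.ofReal_ofNat]
  refine ⟨1 + Real.toNNReal (1 + 1 / ms) * 2 * (1 + Real.toNNReal (1 / (2 * (1 + 1 / ms))) + C),
    fun m hm Ψ w T hw hwT b hb => ?_⟩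
  obtain ⟨hv, hspec⟩ := hamiltonian_spec Ψ
  set f := rep Ψ.1 with hf
  have hvf : Vec f := vec_rep _
  have hT : 0 ≤ T := (hw.pos 0).le.trans (hwT 0)
  have hfin := freeInt_lt_top hvf hv.memLp hwT hT
  have hX := eInt_le_freeInt hms hm (fun N => (hw.pos N).le) hvf.memLp.1
  set X := eInt w f
  set Y := wInt w f with hY
  set Z := freeInt m w f with hZ
  have hM : ∀ M, ∫⁻ y, ENNReal.ofReal ((if ∀ i, num y i ≤ M then w (num y) else 0) *
      freeEnergy m y) * ‖f y‖ₑ ^ 2 ∂𝓒(n) ≤ b + (δ * X + C * Y) := by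
    intro M
    set φ : 𝓕(n) := fun y => (w (num y) : ℂ) * trunc M f y with hφ
    have hφn : Nice M φ := (hvf.truncate M).num_mul fun N => (w N : ℂ)
    have hs := hspec M φ hφn
    have e : ∀ y, conj (φ y) * ((freeEnergy m y : ℂ) * f y) =
        (((if ∀ i, num y i ≤ M then w (num y) else 0) * freeEnergy m y : ℝ) : ℂ) *
          (conj (f y) * f y) := by
      intro y
      simp only [hφ, trunc, boxInd]
      split_ifs <;> simp; ring
    have hi : Integrable (fun y => conj (φ y) * ((freeEnergy m y : ℂ) * f y)) 𝓒(n) :=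
      (MemLp_conj hφn.memLp).integrable_mul hv.memLp
    simp only [e] at hs hi
    have hre := ofReal_re_integral_conj (fun y => mul_nonneg (by
      split_ifs
      exacts [(hw.pos _).le, le_rfl]) (freeEnergy_nonneg m y)) hi
    rw [← hre, ← sub_eq_iff_eq_add.2 hs, Complex.sub_re, sub_eq_add_neg]
    refine ENNReal.ofReal_add_le.trans (add_le_add (hb M) ?_)
    have hq : ‖qForm G φ f‖ₑ ≤ δ * X + C * Y := by
      rw [← qForm_trunc_right G hφn.bdd f]
      have h1 := hC _ w hw.inv hw (fun N => by rw [inv_mul_cancel₀ (hw.pos N).ne']) (M + 1) φ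
        (trunc (M + 1) f) (hφn.mono (Nat.le_succ M)) (hvf.truncate _)
      have h2 : eInt (fun N => (w N)⁻¹) φ ≤ X :=
        lintegral_mono fun y => mul_le_mul_right (inv_weight_le hw.pos M f y) _
      have h3 : wInt (fun N => (w N)⁻¹) φ ≤ Y := lintegral_mono fun y => inv_weight_le hw.pos M f y
      have h4 : eInt w (trunc (M + 1) f) ≤ X := lintegral_mono fun y => by
        gcongr; exact enorm_trunc_le _ f y
      have h5 : wInt w (trunc (M + 1) f) ≤ Y := lintegral_mono fun y => by
        gcongr; exact enorm_trunc_le _ f y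
      refine (ENNReal.pow_le_pow_left_iff two_ne_zero).1 (h1.trans ?_)
      rw [sq]
      gcongr
    refine le_trans ?_ hq
    rw [← ofReal_norm]
    exact ENNReal.ofReal_le_ofReal ((neg_le_abs _).trans (Complex.abs_re_le_norm _))
  have hZb : Z ≤ b + (δ * X + C * Y) := by
    refine le_of_tendsto' (lintegral_tendsto_of_tendsto_of_monotone (F := fun y =>
      ENNReal.ofReal (w (num y) * freeEnergy m y) * ‖f y‖ₑ ^ 2) (fun M => ?_)
      (Eventually.of_forall fun y M M' h => ?_) (Eventually.of_forall fun y => ?_)) hM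
    · refine AEMeasurable.mul (ENNReal.measurable_ofReal.comp (Measurable.mul ?_
        (measurable_freeEnergy m))).aemeasurable (hvf.memLp.1.enorm.pow_const 2)
      exact measurable_comp_num fun N : 𝓞(n) => if ∀ i, N i ≤ M then w N else 0
    · have := freeEnergy_nonneg m y
      have := (hw.pos (num y)).le
      simp only
      gcongr
      split_ifs with h1 h2
      · exact le_rfl
      · exact absurd (fun i => (h1 i).trans h) h2
      · assumption
      · exact le_rfl
    · refine tendsto_const_nhds.congr' ?_
      filter_upwards [eventually_ge_atTop (∑ i, num y i)] with M hM
      rw [if_pos fun i => (Finset.single_le_sum (f := num y) (fun _ _ => Nat.zero_le _)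
        (Finset.mem_univ i)).trans hM]
  have hZ2 : Z ≤ 2 * (b + (δ + C) * Y) := by
    have h1 : Z ≤ (b + (δ + C) * Y) + 2⁻¹ * Z := by
      refine hZb.trans ?_
      calc _ ≤ b + (δ * (Y + ENNReal.ofReal (1 + 1 / ms) * Z) + C * Y) := by gcongr
        _ = _ := by rw [← hδa]; ring
    have h2 : 2⁻¹ * Z + 2⁻¹ * Z = Z := by rw [← add_mul, ENNReal.inv_two_add_inv_two, one_mul]
    have h3 : 2⁻¹ * Z ≤ b + (δ + C) * Y := by
      have hne : 2⁻¹ * Z ≠ ∞ := ENNReal.mul_ne_top (by simp) hfin.ne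
      refine (ENNReal.add_le_add_iff_right hne).1 ?_
      rw [h2]; exact h1
    calc Z = 2 * (2⁻¹ * Z) := by
          rw [← mul_assoc, ENNReal.mul_inv_cancel (by simp) (by simp), one_mul]
      _ ≤ _ := by gcongr
  calc X ≤ Y + ENNReal.ofReal (1 + 1 / ms) * (2 * (b + (δ + C) * Y)) := hX.trans (by gcongr)
    _ ≤ (b + Y) + ENNReal.ofReal (1 + 1 / ms) * (2 * ((1 + δ + C) * (b + Y))) := by
      gcongr ?_ + _ * (2 * ?_)
      · exact le_add_self
      · calc b + (δ + C) * Y ≤ (b + Y) + (δ + C) * (b + Y) := by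
              gcongr
              exacts [le_self_add, le_add_self]
          _ = _ := by ring
    _ = _ := by
      rw [hδ, ENNReal.ofReal, ENNReal.ofReal]; push_cast; ring

/-- A truncation of the number of massive particles. -/
def minLam (T : ℝ) (N : 𝓞(n)) : ℝ := min (lam N) T

theorem slow_minLam {T : ℝ} (hT : 1 ≤ T) : Slow (n := n) 2 (minLam T) where
  pos := fun N => lt_min (lam_pos N) (by linarith)
  down := fun N i => (min_le_min_right T (lam_add_single N i).1).trans (by
    have : 0 < min (lam (N + Pi.single i 1)) T := lt_min (lam_pos _) (by linarith)
    change _ ≤ 2 * min _ _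
    linarith)
  up := fun N i => by
    have h := (lam_add_single N i).2
    change min _ _ ≤ 2 * min _ _
    rw [mul_min_of_nonneg _ _ two_pos.le]
    exact min_le_min h (by linarith)

theorem exists_second_moment_bound {G : ℕ → Equiv.Perm (Fin (n + 1)) → Kernel (Fin (n + 1))}
    (hG : FormBound (qForm G)) {ms : ℝ} (hms : 0 < ms) (E : ℝ) : ∃ C : ℝ≥0,
    ∀ m : Fin (n + 1) → ℝ, (∀ i : Fin n, ms ≤ m i.succ) → ∀ (Ψ : (hamiltonian m G).domain) (e : ℝ),
      e ≤ E → hamiltonian m G Ψ = (e : ℂ) • Ψ.1 →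
      wInt (fun N => lam N ^ (2 : ℝ)) (rep Ψ.1) ≤ C * sqInt 𝓒(n) (rep Ψ.1) := by
  obtain ⟨C, hC⟩ := exists_energy_bound hG hms
  set D : ℝ≥0 := C * (Real.toNNReal E + 1) with hD
  refine ⟨D * D, fun m hm Ψ e he hΨ => ?_⟩
  set f := rep Ψ.1 with hf
  have hvf : Vec f := vec_rep _
  have key : ∀ T : ℝ, 1 ≤ T → wInt (fun N => lam N * minLam T N) f ≤ D * wInt (minLam T) f := by
    intro T hT
    refine (eInt_lam_le f).trans ((hC m hm Ψ (minLam T) T (slow_minLam hT) (fun N => min_le_right _ _)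
      (ENNReal.ofReal E * wInt (minLam T) f) fun M => ?_).trans (le_of_eq ?_))
    · have hpos := fun N => ((slow_minLam (n := n) hT).pos N).le
      have hi : Integrable (fun y => ((if ∀ i, num y i ≤ M then minLam T (num y) else 0 : ℝ) : ℂ) *
          (conj (f y) * f y)) 𝓒(n) := by
        have h := (MemLp_conj ((hvf.truncate M).num_mul fun N => (minLam T N : ℂ)).memLp).integrable_mul
          hvf.memLp
        refine h.congr (Eventually.of_forall fun y => ?_)
        simp only [trunc, boxInd, Pi.mul_apply]
        split_ifs <;> simp; ring
      have h1 : ∫ y, conj ((minLam T (num y) : ℂ) * trunc M f y) * rep (hamiltonian m G Ψ) y ∂𝓒(n) =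
          e * ∫ y, ((if ∀ i, num y i ≤ M then minLam T (num y) else 0 : ℝ) : ℂ) *
            (conj (f y) * f y) ∂𝓒(n) := by
        rw [← integral_const_mul]
        refine integral_congr_ae ?_
        have h2 := fn_smul (e : ℂ) Ψ.1
        rw [← hΨ] at h2
        filter_upwards [h2, fn_ae_rep (hamiltonian m G Ψ), fn_ae_rep Ψ.1]
          with y h3 h4 h5
        rw [← h4, h3, Pi.smul_apply, smul_eq_mul, h5, ← hf]
        simp only [trunc, boxInd]
        split_ifs <;> simp; ring
      rw [h1, Complex.re_ofReal_mul]
      have h6 := ofReal_re_integral_conj (fun y => by split_ifs; exacts [hpos _, le_rfl]) hi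
      set x := (∫ y, ((if ∀ i, num y i ≤ M then minLam T (num y) else 0 : ℝ) : ℂ) *
            (conj (f y) * f y) ∂𝓒(n)).re
      have h7 : ENNReal.ofReal x ≤ wInt (minLam T) f := by
        rw [h6]
        refine lintegral_mono fun y => ?_
        gcongr
        split_ifs
        exacts [le_rfl, hpos _]
      rcases le_or_gt e 0 with h0 | h0
      · rcases le_or_gt 0 x with hx | hx
        · rw [ENNReal.ofReal_of_nonpos (mul_nonpos_of_nonpos_of_nonneg h0 hx)]; exact zero_le
        · exfalso
          have : 0 ≤ x := by
            rw [show x = ∫ y, (((if ∀ i, num y i ≤ M then minLam T (num y) else 0 : ℝ) : ℂ) *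
              (conj (f y) * f y)).re ∂𝓒(n) from (integral_re hi).symm]
            refine integral_nonneg fun y => ?_
            rw [mul_comm (conj _), Complex.mul_conj, ← Complex.ofReal_mul, Complex.ofReal_re]
            refine mul_nonneg ?_ (Complex.normSq_nonneg _)
            split_ifs
            exacts [hpos _, le_rfl]
          linarith
      · rw [ENNReal.ofReal_mul h0.le]
        gcongr
    · rw [hD, ENNReal.ofReal]; push_cast; ring
  have hone : (minLam 1 : (𝓞(n)) → ℝ) = fun _ => 1 := funext fun N =>
    min_eq_right (one_le_lam N)
  have h1 := key 1 le_rfl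
  rw [hone, wInt_one] at h1
  simp only [mul_one] at h1
  have h2 : ∀ k : ℕ, wInt (fun N => lam N * minLam (k + 1) N) f ≤ (D * D : ℝ≥0) * sqInt 𝓒(n) f := by
    intro k
    refine (key (k + 1) (by linarith [k.cast_nonneg (α := ℝ)])).trans ?_
    calc _ ≤ (D : ℝ≥0∞) * (D * sqInt 𝓒(n) f) := by
          gcongr
          exact (wInt_mono (fun N => min_le_left _ _) f).trans h1
      _ = _ := by push_cast; ring
  refine le_of_tendsto' (lintegral_tendsto_of_tendsto_of_monotone (F := fun y =>
      ENNReal.ofReal (lam (num y) ^ (2 : ℝ)) * ‖f y‖ₑ ^ 2) (fun k => ?_)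
      (Eventually.of_forall fun y k k' h => ?_) (Eventually.of_forall fun y => ?_)) h2
  · exact AEMeasurable.mul (ENNReal.measurable_ofReal.comp (measurable_comp_num
      fun N : 𝓞(n) => lam N * minLam (k + 1) N)).aemeasurable (hvf.memLp.1.enorm.pow_const 2)
  · have := (lam_pos (num y)).le
    simp only [minLam]
    gcongr
  · refine tendsto_const_nhds.congr' ?_
    obtain ⟨k₀, hk₀⟩ := exists_nat_ge (lam (num y))
    filter_upwards [eventually_ge_atTop k₀] with k hk
    have : (k₀ : ℝ) ≤ k := by exact_mod_cast hk
    rw [minLam, min_eq_left (by linarith), Real.rpow_two, sq]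

end

/-! ### Resolvents of symmetric operators -/

/-- The resolvent of a symmetric operator below its spectrum. -/
theorem IsResolvent.le_norm {E : Type} [NormedAddCommGroup E] [InnerProductSpace ℂ E]
    {T : E →ₗ.[ℂ] E} (hT : ∀ x y : T.domain, inner ℂ (T x) (y : E) = inner ℂ (x : E) (T y)) {e : ℝ}
    (he : ∀ x : ℝ, x < e → ∃ R, IsResolvent T (x : ℂ) R) {x : ℝ} (hx : x < e) {R : E →L[ℂ] E}
    (hR : IsResolvent T (x : ℂ) R) (u : E) : (e - x) * ‖R u‖ ≤ ‖u‖ := by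
  by_contra! hu
  have hsymm : ∀ u v, inner ℂ (R u) v = inner ℂ u (R v) := by
    intro u v
    obtain ⟨h1, e1⟩ := hR.1 u
    obtain ⟨h2, e2⟩ := hR.1 v
    have h := hT ⟨R u, h1⟩ ⟨R v, h2⟩
    rw [sub_eq_iff_eq_add.1 e1, sub_eq_iff_eq_add.1 e2, inner_add_left, inner_add_right,
      inner_smul_left, inner_smul_right, Complex.conj_ofReal] at h
    exact (add_right_cancel h).symm
  have hRu : 0 < ‖R u‖ := by
    by_contra! h
    have := norm_nonneg u
    nlinarith [norm_nonneg (R u)]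
  have hu0 : 0 < ‖u‖ := by
    rw [norm_pos_iff]; rintro rfl; simp at hRu
  have hν : 0 < ‖R‖ := by
    have := R.le_opNorm u
    by_contra! h
    nlinarith
  have ht0 : 0 < ‖R‖⁻¹ := inv_pos.2 hν
  have ht1 : ‖R‖⁻¹ < e - x := by
    rw [inv_lt_iff_one_lt_mul₀ hν]
    have := R.le_opNorm u
    have h3 : ‖u‖ < ((e - x) * ‖R‖) * ‖u‖ := by nlinarith
    have := (lt_mul_iff_one_lt_left hu0).1 h3
    linarith
  set t := ‖R‖⁻¹ with ht
  have htν : t * ‖R‖ = 1 := inv_mul_cancel₀ hν.ne'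
  have key : ∀ s : ℝ, |s| = t → ∃ c : ℝ, 1 ≤ c ∧ ∀ u, ‖u‖ ≤ c * ‖u - (s : ℂ) • R u‖ := by
    intro s hs
    obtain ⟨S, hS⟩ := he (x + s) (by linarith [le_abs_self s])
    refine ⟨1 + t * ‖S‖, by have := norm_nonneg S; nlinarith, fun u => ?_⟩
    obtain ⟨h1, e1⟩ := hR.1 u
    have h2 := hS.2 ⟨R u, h1⟩
    rw [sub_eq_iff_eq_add.1 e1] at h2
    have h3 : u + (x : ℂ) • R u - ((x + s : ℝ) : ℂ) • R u = u - (s : ℂ) • R u := by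
      push_cast; rw [add_smul]; abel
    simp only [h3] at h2
    calc ‖u‖ = ‖(u - (s : ℂ) • R u) + (s : ℂ) • S (u - (s : ℂ) • R u)‖ := by
          rw [h2, sub_add_cancel]
      _ ≤ ‖u - (s : ℂ) • R u‖ + t * (‖S‖ * ‖u - (s : ℂ) • R u‖) := by
          refine (norm_add_le _ _).trans ?_
          rw [norm_smul, Complex.norm_real, Real.norm_eq_abs, hs]
          gcongr
          exact S.le_opNorm _
      _ = _ := by ring
  obtain ⟨c, hc, hc'⟩ := key t (abs_of_pos ht0)
  obtain ⟨d, hd, hd'⟩ := key (-t) (by rw [abs_neg, abs_of_pos ht0])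
  have hmain : ∀ u, ‖R u‖ ≤ (‖R‖ * Real.sqrt (1 - 1 / (c * d) ^ 2)) * ‖u‖ := by
    intro u
    have h1 : ‖u‖ ≤ c * d * ‖u - ((t ^ 2 : ℝ) : ℂ) • R (R u)‖ := by
      refine (hc' u).trans ?_
      rw [mul_assoc]
      gcongr
      refine (hd' _).trans (le_of_eq ?_)
      congr 2
      simp only [map_sub, map_smul, smul_sub, smul_smul]
      push_cast
      simp only [neg_smul]
      rw [show (t : ℂ) ^ 2 = t * t by ring, neg_mul, neg_smul]
      abel
    have h2 : ‖u - ((t ^ 2 : ℝ) : ℂ) • R (R u)‖ ^ 2 ≤ ‖u‖ ^ 2 - t ^ 2 * ‖R u‖ ^ 2 := by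
      rw [@norm_sub_sq ℂ, inner_smul_right, ← hsymm, inner_self_eq_norm_sq_to_K, norm_smul,
        Complex.norm_real, Real.norm_of_nonneg (sq_nonneg t)]
      have h3 : t * ‖R (R u)‖ ≤ ‖R u‖ := by
        calc t * ‖R (R u)‖ ≤ t * (‖R‖ * ‖R u‖) := by gcongr; exact R.le_opNorm _
          _ = ‖R u‖ := by rw [← mul_assoc, htν, one_mul]
      have h4 : RCLike.re (((t ^ 2 : ℝ) : ℂ) * ((‖R u‖ : ℝ) : ℂ) ^ 2) = t ^ 2 * ‖R u‖ ^ 2 := by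
        rw [← Complex.ofReal_pow, ← Complex.ofReal_mul]; exact Complex.ofReal_re _
      have h5 : (t * ‖R (R u)‖) ^ 2 ≤ ‖R u‖ ^ 2 := by gcongr
      have h6 : (t ^ 2 * ‖R (R u)‖) ^ 2 ≤ t ^ 2 * ‖R u‖ ^ 2 := by
        calc _ = t ^ 2 * (t * ‖R (R u)‖) ^ 2 := by ring
          _ ≤ _ := by gcongr
      erw [h4]
      linarith
    have hcd : 1 ≤ c * d := by nlinarith
    have h7 : ‖u‖ ^ 2 ≤ (c * d) ^ 2 * (‖u‖ ^ 2 - t ^ 2 * ‖R u‖ ^ 2) := by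
      calc ‖u‖ ^ 2 ≤ (c * d * ‖u - ((t ^ 2 : ℝ) : ℂ) • R (R u)‖) ^ 2 := by gcongr
        _ = (c * d) ^ 2 * ‖u - ((t ^ 2 : ℝ) : ℂ) • R (R u)‖ ^ 2 := by ring
        _ ≤ _ := by gcongr
    have h8 : t ^ 2 * ‖R u‖ ^ 2 ≤ (1 - 1 / (c * d) ^ 2) * ‖u‖ ^ 2 := by
      rw [mul_comm ((c * d) ^ 2), ← div_le_iff₀ (by positivity)] at h7
      rw [sub_mul, one_mul, one_div_mul_eq_div]
      linarith
    have h9 : (0 : ℝ) ≤ 1 - 1 / (c * d) ^ 2 := by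
      rw [sub_nonneg, div_le_one (by positivity)]
      nlinarith
    refine abs_le_of_sq_le_sq' ?_ (by positivity) |>.2
    calc ‖R u‖ ^ 2 = ‖R‖ ^ 2 * (t ^ 2 * ‖R u‖ ^ 2) := by
          rw [← mul_assoc, ← mul_pow, mul_comm ‖R‖, htν, one_pow, one_mul]
      _ ≤ ‖R‖ ^ 2 * ((1 - 1 / (c * d) ^ 2) * ‖u‖ ^ 2) := by gcongr
      _ = _ := by rw [mul_pow _ ‖u‖, mul_pow ‖R‖, Real.sq_sqrt h9, mul_assoc]
  have h1 := R.opNorm_le_bound (by positivity) hmain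
  have hcd : 1 ≤ c * d := by nlinarith
  have h2 : Real.sqrt (1 - 1 / (c * d) ^ 2) < 1 := by
    rw [Real.sqrt_lt' one_pos, one_pow, sub_lt_self_iff]
    positivity
  nlinarith

section
variable {n : ℕ}

/-! ### The Hamiltonian is symmetric -/

theorem IsSplit.tForm_add_right {L₁ L₂ : List (Fin (n + 1))} (hL : IsSplit L₁ L₂) {M : ℕ}
    {φ f f' : 𝓕(n)} (hφ : Nice M φ) (hf : Nice M f) (hf' : Nice M f')
    {g : (Fin (n + 1) → Xi) → ℂ} (hg : MemLp g 2 𝓚(n + 1)) :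
    tForm g L₁ L₂ φ (f + f') = tForm g L₁ L₂ φ f + tForm g L₁ L₂ φ f' := by
  simp only [tForm, annihList_add, Pi.add_apply, mul_add]
  exact integral_add (hL.integrable hφ hf hg) (hL.integrable hφ hf' hg)

theorem qForm_add_right (G : ℕ → Equiv.Perm (Fin (n + 1)) → Kernel (Fin (n + 1))) {M : ℕ}
    {φ f f' : 𝓕(n)} (hφ : Nice M φ) (hf : Nice M f) (hf' : Nice M f') :
    qForm G φ (f + f') = qForm G φ f + qForm G φ f' := by
  simp only [qForm, ← Finset.sum_add_distrib]
  refine Finset.sum_congr rfl fun p _ => Finset.sum_congr rfl fun σ _ => ?_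
  have hL := isSplit_created p σ
  simp only [tForm_conj]
  rw [hL.tForm_add_right hφ hf hf' (Lp.memLp _),
    hL.symm.tForm_add_right hφ hf hf' (MemLp_conj (Lp.memLp _))]
  ring

theorem exists_qForm_le {G : ℕ → Equiv.Perm (Fin (n + 1)) → Kernel (Fin (n + 1))}
    (hG : FormBound (qForm G)) : ∃ D : ℝ≥0, ∀ (M : ℕ) (φ f : 𝓕(n)), Nice M φ →
      Nice M f → ‖qForm G φ f‖ₑ ^ 2 ≤ D * (eInt (fun _ => 1) φ * eInt (fun _ => 1) f) := by
  obtain ⟨C, hC⟩ := hG 1 1 one_pos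
  refine ⟨(1 + C) * (1 + C), fun M φ f hφ hf => ?_⟩
  have h1 := hC _ _ (slow_one le_rfl) (slow_one le_rfl) (fun N => by norm_num) M φ f hφ hf
  have h2 : ∀ u : 𝓕(n), wInt (fun _ => 1) u ≤ eInt (fun _ => 1) u := fun u =>
    (wInt_mono (fun N => by simpa using one_le_lam N) u).trans (eInt_lam_le u)
  refine h1.trans ?_
  rw [ENNReal.ofReal_one, one_mul, one_mul]
  calc _ ≤ (eInt (fun _ => 1) φ + C * eInt (fun _ => 1) φ) *
        (eInt (fun _ => 1) f + C * eInt (fun _ => 1) f) := by gcongr <;> exact h2 _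
    _ = _ := by push_cast; ring

theorem eventually_boxInd (N : 𝓞(n)) : ∀ᶠ M in atTop, boxInd M N = 1 := by
  filter_upwards [eventually_ge_atTop (∑ i, N i)] with M hM
  rw [boxInd, if_pos fun i => (Finset.single_le_sum (f := N) (fun _ _ => Nat.zero_le _)
    (Finset.mem_univ i)).trans hM]

/-- The part of a function in the sectors between two consecutive truncations. -/
def shell (M : ℕ) (f : 𝓕(n)) (y : Conf (n + 1)) : ℂ :=
  (1 - boxInd M (num y)) * trunc (M + 1) f y

theorem trunc_add_shell (M : ℕ) (f : 𝓕(n)) : trunc M f + shell M f = trunc (M + 1) f := by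
  funext y
  simp only [Pi.add_apply, shell, trunc, boxInd]
  by_cases h : ∀ i, num y i ≤ M
  · simp [h, fun i => (h i).trans (Nat.le_succ M)]
  · simp [h]

theorem Vec.shell {f : 𝓕(n)} (hf : Vec f) (M : ℕ) : Nice (M + 1) (shell M f) :=
  (hf.truncate (M + 1)).num_mul fun N => 1 - boxInd M N

theorem eInt_trunc_le (w : (𝓞(n)) → ℝ) (M : ℕ) (f : 𝓕(n)) : eInt w (trunc M f) ≤ eInt w f :=
  lintegral_mono fun y => by gcongr; exact enorm_trunc_le _ f y

theorem tendsto_eInt_shell {f : 𝓕(n)} (hf : Vec f) (h : eInt (fun _ => 1) f < ∞) :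
    Tendsto (fun M => eInt (fun _ => 1) (shell M f)) atTop (𝓝 0) := by
  have hm : ∀ {u : 𝓕(n)}, AEStronglyMeasurable u 𝓒(n) → AEMeasurable (fun y =>
      (ENNReal.ofReal (lam (num y)) + occ (fun ξ => ‖ξ.1‖ₑ) 0 y) *
        (ENNReal.ofReal 1 * ‖u y‖ₑ ^ 2)) 𝓒(n) := fun hu =>
    ((measurable_comp_num fun N => ENNReal.ofReal (lam N)).add
      (measurable_occ measurable_fst.enorm 0)).aemeasurable.mul ((hu.enorm.pow_const 2).const_mul _)
  have h0 : ∫⁻ _ : Conf (n + 1), 0 ∂𝓒(n) = 0 := lintegral_zero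
  rw [← h0]
  refine tendsto_lintegral_of_dominated_convergence' _ (fun M => hm (hf.shell M).aesm)
    (fun M => Eventually.of_forall fun y => ?_) h.ne (Eventually.of_forall fun y => ?_)
  · have h1 : ‖shell M f y‖ₑ ≤ ‖f y‖ₑ := by
      simp only [shell, trunc, boxInd]
      split_ifs <;> simp
    simp only
    gcongr
  · refine tendsto_const_nhds.congr' ?_
    filter_upwards [eventually_boxInd (num y)] with M hM
    simp [shell, hM]

theorem tendsto_integral_trunc {u v : 𝓕(n)} (hu : MemLp u 2 𝓒(n)) (hv : MemLp v 2 𝓒(n)) :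
    Tendsto (fun M => ∫ y, u y * trunc M v y ∂𝓒(n)) atTop (𝓝 (∫ y, u y * v y ∂𝓒(n))) := by
  refine tendsto_integral_of_dominated_convergence (fun y => ‖u y * v y‖)
    (fun M => hu.1.mul ((measurable_comp_num (boxInd M)).aestronglyMeasurable.mul hv.1))
    (hu.integrable_mul hv).norm (fun M => Eventually.of_forall fun y => ?_)
    (Eventually.of_forall fun y => ?_)
  · rw [norm_mul, norm_mul]
    gcongr
    have := enorm_trunc_le M v y
    rwa [enorm_le_iff_norm_le] at this
  · refine tendsto_const_nhds.congr' ?_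
    filter_upwards [eventually_boxInd (num y)] with M hM
    rw [trunc, hM, one_mul]

variable {G : ℕ → Equiv.Perm (Fin (n + 1)) → Kernel (Fin (n + 1))}

theorem tendsto_zero_of_enorm_sq {z : ℕ → ℂ} {a : ℕ → ℝ≥0∞} {c : ℝ≥0∞} (hc : c ≠ ∞)
    (h : ∀ M, ‖z M‖ₑ ^ 2 ≤ c * a M) (ha : Tendsto a atTop (𝓝 0)) : Tendsto z atTop (𝓝 0) := by
  rw [tendsto_zero_iff_enorm_tendsto_zero]
  have h1 : Tendsto (fun M => (c * a M) ^ (1 / 2 : ℝ)) atTop (𝓝 0) := by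
    have := (ENNReal.Tendsto.const_mul ha (Or.inr hc)).ennrpow_const (1 / 2)
    simpa using this
  refine tendsto_of_tendsto_of_tendsto_of_le_of_le tendsto_const_nhds h1 (fun _ => zero_le)
    fun M => ?_
  have := le_rpow_half_mul (b := 1) (c := c * a M) (by rw [one_mul]; exact h M)
  simpa using this

theorem tendsto_qForm_trunc_sub (hG : FormBound (qForm G)) {φ f : 𝓕(n)} (hφ : Vec φ)
    (hf : Vec f) (eφ : eInt (fun _ => 1) φ < ∞) (ef : eInt (fun _ => 1) f < ∞) :
    Tendsto (fun M => qForm G (trunc M φ) f - qForm G φ (trunc M f)) atTop (𝓝 0) := by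
  obtain ⟨D, hD⟩ := exists_qForm_le hG
  have key : ∀ {φ f : 𝓕(n)}, Vec φ → Vec f → eInt (fun _ => 1) φ < ∞ →
      eInt (fun _ => 1) f < ∞ → Tendsto (fun M => qForm G (trunc M φ) (shell M f)) atTop (𝓝 0) := by
    intro φ f hφ hf eφ ef
    refine tendsto_zero_of_enorm_sq (c := D * eInt (fun _ => 1) φ)
      (ENNReal.mul_ne_top ENNReal.coe_ne_top eφ.ne) (fun M => ?_) (tendsto_eInt_shell hf ef)
    refine (hD (M + 1) _ _ ((hφ.truncate M).mono (Nat.le_succ M)) (hf.shell M)).trans ?_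
    rw [mul_assoc]
    gcongr
    exact eInt_trunc_le _ M φ
  have h2 := (Complex.continuous_conj.tendsto 0).comp (key hf hφ ef eφ)
  rw [map_zero] at h2
  have h3 := (key hφ hf eφ ef).sub h2
  rw [sub_zero] at h3
  refine h3.congr fun M => ?_
  have hφ' := (hφ.truncate M).mono (Nat.le_succ M)
  have hf' := (hf.truncate M).mono (Nat.le_succ M)
  rw [← qForm_trunc_right G (hφ.truncate M).bdd f, ← trunc_add_shell M f,
    qForm_add_right G hφ' hf' (hf.shell M), ← qForm_conj G (trunc M f) φ,
    ← qForm_trunc_right G (hf.truncate M).bdd φ, ← trunc_add_shell M φ,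
    qForm_add_right G hf' hφ' (hφ.shell M), map_add, qForm_conj, Function.comp_apply, qForm_conj]
  ring

variable {m : Fin (n + 1) → ℝ} {ms : ℝ}

theorem eInt_lt_top (hms : 0 < ms) (hm : ∀ i : Fin n, ms ≤ m i.succ) {f : 𝓕(n)}
    (hf : Vec f) (hf' : MemLp (fun y => (freeEnergy m y : ℂ) * f y) 2 𝓒(n)) : eInt (fun _ => 1) f < ∞ := by
  refine (eInt_le_freeInt hms hm (fun _ => zero_le_one) hf.memLp.1).trans_lt ?_
  rw [wInt_one]
  exact ENNReal.add_lt_top.2 ⟨sqInt_lt_top hf.memLp, ENNReal.mul_lt_top ENNReal.ofReal_lt_top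
    (freeInt_lt_top hf hf' (fun _ => le_rfl) zero_le_one)⟩

theorem integrable_conj_mul {a b : 𝓕(n)} (ha : MemLp a 2 𝓒(n)) (hb : MemLp b 2 𝓒(n)) :
    Integrable (fun y => conj (a y) * b y) 𝓒(n) := (MemLp_conj ha).integrable_mul hb

theorem conj_integral_conj_mul (a b : 𝓕(n)) :
    conj (∫ y, conj (a y) * b y ∂𝓒(n)) = ∫ y, conj (b y) * a y ∂𝓒(n) := by
  rw [← integral_conj]
  simp only [map_mul, Complex.conj_conj, mul_comm]

/-- The interaction part of the Hamiltonian. -/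
def interRep (Ψ : (hamiltonian m G).domain) (y : Conf (n + 1)) : ℂ :=
  rep (hamiltonian m G Ψ) y - freeEnergy m y * rep Ψ.1 y

theorem memLp_interRep (Ψ : (hamiltonian m G).domain) : MemLp (interRep Ψ) 2 𝓒(n) :=
  (vec_rep _).memLp.sub (hamiltonian_spec Ψ).1.memLp

theorem qForm_eq_integral_interRep (Ψ : (hamiltonian m G).domain) {M : ℕ} {φ : 𝓕(n)}
    (hφ : Nice M φ) : qForm G φ (rep Ψ.1) = ∫ y, conj (φ y) * interRep Ψ y ∂𝓒(n) := by
  simp only [interRep, mul_sub]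
  rw [integral_sub (integrable_conj_mul hφ.memLp (vec_rep _).memLp)
    (integrable_conj_mul hφ.memLp (hamiltonian_spec Ψ).1.memLp),
    (hamiltonian_spec Ψ).2 M φ hφ, add_sub_cancel_left]

theorem tendsto_qForm_trunc (hG : FormBound (qForm G)) (hms : 0 < ms)
    (hm : ∀ i : Fin n, ms ≤ m i.succ) (φ : (hamiltonian m G).domain) {f : 𝓕(n)}
    (hf : Vec f) (ef : eInt (fun _ => 1) f < ∞) :
    Tendsto (fun M => qForm G (trunc M (rep φ.1)) f) atTop
      (𝓝 (∫ y, conj (interRep φ y) * f y ∂𝓒(n))) := by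
  have h1 := tendsto_qForm_trunc_sub hG (vec_rep φ.1) hf
    (eInt_lt_top hms hm (vec_rep _) (hamiltonian_spec φ).1.memLp) ef
  have h2 := h1.add (tendsto_integral_trunc (MemLp_conj (memLp_interRep φ)) hf.memLp)
  rw [zero_add] at h2
  refine h2.congr fun M => ?_
  have h3 : qForm G (rep φ.1) (trunc M f) = ∫ y, conj (interRep φ y) * trunc M f y ∂𝓒(n) := by
    rw [← qForm_conj, qForm_eq_integral_interRep φ (hf.truncate M), conj_integral_conj_mul]
  rw [h3, sub_add_cancel]

theorem hamiltonian_symmetric (hG : FormBound (qForm G)) (hms : 0 < ms)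
    (hm : ∀ i : Fin n, ms ≤ m i.succ) (φ Ψ : (hamiltonian m G).domain) :
    inner ℂ (hamiltonian m G φ) Ψ.1 = inner ℂ φ.1 (hamiltonian m G Ψ) := by
  have hφ := vec_rep φ.1
  have hΨ := vec_rep Ψ.1
  have h1 := tendsto_qForm_trunc hG hms hm φ hΨ (eInt_lt_top hms hm hΨ (hamiltonian_spec Ψ).1.memLp)
  have h2 := tendsto_integral_trunc (MemLp_conj (memLp_interRep Ψ)) hφ.memLp
  have h2' := (Complex.continuous_conj.tendsto _).comp h2
  rw [inner_eq_integral (fn_ae_rep _) (fn_ae_rep _), inner_eq_integral (fn_ae_rep _) (fn_ae_rep _)]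
  have i1 := integrable_conj_mul (vec_rep (hamiltonian m G φ)).memLp hΨ.memLp
  have i2 := integrable_conj_mul hφ.memLp (vec_rep (hamiltonian m G Ψ)).memLp
  have i3 := integrable_conj_mul hφ.memLp (hamiltonian_spec Ψ).1.memLp
  have h4 : ∫ y, conj (interRep φ y) * rep Ψ.1 y ∂𝓒(n) =
      (∫ y, conj (rep (hamiltonian m G φ) y) * rep Ψ.1 y ∂𝓒(n)) -
      ∫ y, conj (rep φ.1 y) * (freeEnergy m y * rep Ψ.1 y) ∂𝓒(n) := by
    rw [← integral_sub i1 i3]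
    refine integral_congr_forall fun y => ?_
    simp only [interRep, map_sub, map_mul, Complex.conj_ofReal]; ring
  have h5 : ∫ y, conj (rep φ.1 y) * interRep Ψ y ∂𝓒(n) =
      (∫ y, conj (rep φ.1 y) * rep (hamiltonian m G Ψ) y ∂𝓒(n)) -
      ∫ y, conj (rep φ.1 y) * (freeEnergy m y * rep Ψ.1 y) ∂𝓒(n) := by
    rw [← integral_sub i2 i3]
    refine integral_congr_forall fun y => ?_
    simp only [interRep]; ring
  have h6 : ∫ y, conj (interRep φ y) * rep Ψ.1 y ∂𝓒(n) =
      ∫ y, conj (rep φ.1 y) * interRep Ψ y ∂𝓒(n) := by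
    refine (tendsto_nhds_unique h1 (h2'.congr fun M => ?_)).trans (conj_integral_conj_mul _ _)
    rw [Function.comp_apply, qForm_eq_integral_interRep Ψ (hφ.truncate M), conj_integral_conj_mul]
  rw [h4, h5] at h6
  exact sub_left_injective h6

end

section
variable {n : ℕ}

/-! ### An upper bound for the ground state energies -/

/-- The vacuum. -/
def vac (y : Conf (n + 1)) : ℂ := boxInd 0 (num y)

theorem sqInt_vac : sqInt 𝓒(n) vac = 1 := by
  have hs : MeasurableSet {q : Particles | q.1 ≤ 0} := measurable_number measurableSet_Iic
  have h0 : particlesMeasure {q : Particles | q.1 ≤ 0} = 1 := by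
    rw [← lintegral_indicator_one hs, lintegral_particles (measurable_one.indicator hs),
      tsum_eq_single 0 fun l hl => by simp [indicator, hl]]
    simp [kernelMeasure]
  have e : ∀ y : Conf (n + 1), ‖vac y‖ₑ ^ 2 =
      (Set.univ.pi fun _ => {q : Particles | q.1 ≤ 0}).indicator 1 y := by
    intro y
    by_cases h : ∀ i, num y i ≤ 0
    · have hy : y ∈ Set.univ.pi fun _ => {q : Particles | q.1 ≤ 0} := fun i _ => h i
      rw [vac, boxInd, if_pos h, indicator_of_mem hy]; simp
    · have hy : y ∉ Set.univ.pi fun _ => {q : Particles | q.1 ≤ 0} := fun h' => h fun i => h' i trivial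
      rw [vac, boxInd, if_neg h, indicator_of_notMem hy]; simp
  rw [sqInt, lintegral_congr e, lintegral_indicator_one (MeasurableSet.univ_pi fun _ => hs),
    configMeasure, Measure.pi_pi]
  simp only [h0, Finset.prod_const_one]

theorem nice_vac : Nice 0 (vac : 𝓕(n)) where
  memLp := memLp_two_of_sqInt (measurable_comp_num (boxInd 0)).aestronglyMeasurable
    (by rw [sqInt_vac]; simp)
  anti := fun y i l x π => by
    rcases l with _ | l
    · rw [Subsingleton.elim π 1]; simp
    · have h : ∀ x' : Fin (l + 1) → Xi, vac (Function.update y i ⟨l + 1, x'⟩) = 0 := fun x' => by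
        rw [vac, boxInd, if_neg]
        intro h
        have := h i
        simp [num] at this
      rw [h, h, mul_zero]
  bdd := fun y ⟨i, hi⟩ => by rw [vac, boxInd, if_neg fun h => not_lt.2 (h i) hi]

theorem freeEnergy_mul_vac (m : Fin (n + 1) → ℝ) (y : Conf (n + 1)) :
    (freeEnergy m y : ℂ) * vac y = 0 := by
  by_cases h : ∀ i, num y i ≤ 0
  · have : freeEnergy m y = 0 := Finset.sum_eq_zero fun i _ => by
      have : IsEmpty (Fin (y i).1) := ⟨fun a => absurd a.2 (not_lt.2 ((h i).trans (Nat.zero_le _)))⟩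
      exact Fintype.sum_empty _
    rw [this]; simp
  · rw [vac, boxInd, if_neg h, mul_zero]

variable {G : ℕ → Equiv.Perm (Fin (n + 1)) → Kernel (Fin (n + 1))}

theorem qForm_vac {m : Fin (n + 1) → ℝ} {ψ : (hamiltonian m G).domain}
    (hψ : rep (hamiltonian m G ψ) =ᵐ[𝓒(n)] vac) : qForm G vac (rep ψ.1) = 1 := by
  rw [qForm_eq_integral_interRep ψ nice_vac]
  have h4 := integral_conj_mul_self (nice_vac (n := n)).memLp
  rw [sqInt_vac, ENNReal.toReal_one, Complex.ofReal_one] at h4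
  rw [← h4]
  refine integral_congr_ae ?_
  filter_upwards [hψ] with y hy
  have h5 := congrArg conj (freeEnergy_mul_vac m y)
  rw [map_mul, Complex.conj_ofReal, map_zero] at h5
  rw [interRep, hy, mul_sub, ← mul_assoc, mul_comm _ (freeEnergy m y : ℂ), h5, zero_mul, sub_zero]

theorem enorm_re_integral_trunc_le {f v : 𝓕(n)} (hf : MemLp f 2 𝓒(n))
    (hv : v =ᵐ[𝓒(n)] vac) (M : ℕ) :
    ENNReal.ofReal (∫ y, conj (((1 : ℝ) : ℂ) * trunc M f y) * v y ∂𝓒(n)).re ^ 2 ≤ sqInt 𝓒(n) f := by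
  have hf' : MemLp (trunc M f) 2 𝓒(n) := hf.of_le
    ((measurable_comp_num (boxInd M)).aestronglyMeasurable.mul hf.1)
    (Eventually.of_forall fun y => by simpa [enorm_le_iff_norm_le] using enorm_trunc_le M f y)
  have h1 : ENNReal.ofReal (∫ y, conj (((1 : ℝ) : ℂ) * trunc M f y) * v y ∂𝓒(n)).re ≤
      ‖∫ y, conj (trunc M f y) * v y ∂𝓒(n)‖ₑ := by
    simp only [Complex.ofReal_one, one_mul]
    rw [← ofReal_norm]
    exact ENNReal.ofReal_le_ofReal (Complex.re_le_norm _)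
  have h3 := enorm_integral_mul_sq_le (MemLp_conj hf').1
    ((measurable_comp_num (boxInd 0)).aestronglyMeasurable.congr hv.symm)
  rw [sqInt_conj, sqInt_congr_ae hv, sqInt_vac, mul_one] at h3
  refine (pow_le_pow_left' h1 2).trans (h3.trans (lintegral_mono fun y => ?_))
  exact pow_le_pow_left' (enorm_trunc_le M f y) 2

theorem exists_ground_energy_le (hG : FormBound (qForm G)) {ms : ℝ} (hms : 0 < ms) : ∃ E : ℝ,
    ∀ m : Fin (n + 1) → ℝ, (∀ i : Fin n, ms ≤ m i.succ) → ∀ e : ℝ,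
      (∀ x : ℝ, x < e → ∃ R, IsResolvent (hamiltonian m G) (x : ℂ) R) → e ≤ E := by
  obtain ⟨C, hC⟩ := exists_energy_bound hG hms
  obtain ⟨D, hD⟩ := exists_qForm_le hG
  have hvac : eInt (fun _ => 1) (vac : 𝓕(n)) < ∞ :=
    eInt_lt_top (m := fun _ => 1) one_pos (fun _ => le_rfl) nice_vac.vec (by
      simp only [freeEnergy_mul_vac]; exact MemLp.zero')
  obtain ⟨a, ha⟩ : ∃ a : ℝ≥0, (a : ℝ≥0∞) = D * eInt (fun _ => 1) (vac : 𝓕(n)) *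
      (C * 2) := ENNReal.canLift.prf _ (ENNReal.mul_ne_top (ENNReal.mul_ne_top ENNReal.coe_ne_top
        hvac.ne) (ENNReal.mul_ne_top ENNReal.coe_ne_top (by simp)))
  refine ⟨max 1 a, fun m hm e he => ?_⟩
  rcases le_or_gt e 1 with h1 | h1
  · exact h1.trans (le_max_left _ _)
  refine le_trans ?_ (le_max_right _ _)
  have he0 : 0 < e := by linarith
  obtain ⟨R, hR⟩ := he 0 he0
  obtain ⟨Ω, hΩ⟩ : ∃ Ω : fockSpace (n + 1), fn Ω =ᵐ[𝓒(n)] vac := ⟨_, nice_vac.vec.fn_toFock⟩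
  obtain ⟨hdom, hψ⟩ := hR.1 Ω
  have hnorm := hR.le_norm (hamiltonian_symmetric hG hms hm) he he0 Ω
  obtain ⟨ψ, hψR⟩ : ∃ ψ : (hamiltonian m G).domain, ψ.1 = R Ω :=
    ⟨⟨R Ω, hdom⟩, rfl⟩
  have hψΩ : hamiltonian m G ψ = Ω := by
    rw [Complex.ofReal_zero, zero_smul, sub_zero] at hψ
    rw [← hψ]; congr 1; exact Subtype.ext hψR
  have h2 : ‖Ω‖ = 1 := by
    have h := congrArg ENNReal.toReal ((enorm_sq_eq_sqInt hΩ).trans sqInt_vac)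
    rw [ENNReal.toReal_pow, toReal_enorm, ENNReal.toReal_one] at h
    exact (pow_eq_one_iff_of_nonneg (norm_nonneg _) two_ne_zero).1 h
  have hrep : rep (hamiltonian m G ψ) =ᵐ[𝓒(n)] vac := by
    rw [hψΩ]; exact (fn_ae_rep Ω).symm.trans hΩ
  obtain ⟨b, hb⟩ : ∃ b : ℝ≥0∞, b = ‖ψ.1‖ₑ := ⟨_, rfl⟩
  have hs : sqInt 𝓒(n) (rep ψ.1) = b ^ 2 := by
    rw [hb]; exact (enorm_sq_eq_sqInt (fn_ae_rep ψ.1)).symm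
  have hRe : b ≤ ENNReal.ofReal e⁻¹ := by
    rw [hb, ← ofReal_norm]
    refine ENNReal.ofReal_le_ofReal ?_
    rw [h2, sub_zero, ← hψR] at hnorm
    rw [← one_div, le_div_iff₀ he0]
    linarith
  have hR1 : b ≤ 1 := hRe.trans (by
    rw [← ENNReal.ofReal_one]
    exact ENNReal.ofReal_le_ofReal (inv_le_one_of_one_le₀ h1.le))
  have hE : eInt (fun _ => 1) (rep ψ.1) ≤ C * 2 * b := by
    have h8 := hC m hm ψ (fun _ => 1) 1 (slow_one one_le_two) (fun _ => le_rfl) b fun M =>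
      (ENNReal.pow_le_pow_left_iff two_ne_zero).1
        ((enorm_re_integral_trunc_le (vec_rep ψ.1).memLp hrep M).trans hs.le)
    rw [wInt_one, hs] at h8
    refine h8.trans ?_
    rw [mul_assoc]
    refine mul_le_mul' le_rfl ?_
    calc b + b ^ 2 ≤ b + 1 * b := by
          rw [sq]; exact add_le_add le_rfl (mul_le_mul' hR1 le_rfl)
      _ = 2 * b := by ring
  have h6 := hD (0 + 1) vac _ (nice_vac.mono zero_le_one) ((vec_rep ψ.1).truncate _)
  rw [qForm_trunc_right G nice_vac.bdd, qForm_vac hrep] at h6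
  have h7 : 1 ≤ (a : ℝ≥0∞) * ENNReal.ofReal e⁻¹ := by
    calc (1 : ℝ≥0∞) = ‖(1 : ℂ)‖ₑ ^ 2 := by simp
      _ ≤ D * (eInt (fun _ => 1) (vac : 𝓕(n)) * (C * 2 * ENNReal.ofReal e⁻¹)) :=
        h6.trans (mul_le_mul' le_rfl (mul_le_mul' le_rfl ((eInt_trunc_le _ _ _).trans
          (hE.trans (mul_le_mul' le_rfl hRe)))))
      _ = _ := by rw [ha]; ring
  rw [← ENNReal.ofReal_coe_nnreal, ← ENNReal.ofReal_mul a.coe_nonneg, ← div_eq_mul_inv,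
    ← ENNReal.ofReal_one, ENNReal.ofReal_le_ofReal_iff (by positivity), le_div_iff₀ he0] at h7
  linarith

/-! ### Separability of the Fock space -/

instance (k : ℕ) : MeasurableSpace.CountablyGenerated (Conf k) := by
  set f : Conf k → Fin k × ℕ → ℕ × Xi := fun y j => ((y j.1).1, getP j.2 (y j.1)) with hf
  set g : (Fin k × ℕ → ℕ × Xi) → Conf k := fun z i => ⟨(z (i, 0)).1, fun a => (z (i, a)).2⟩ with hg
  have hfm : Measurable f := measurable_pi_lambda _ fun j => Measurable.prodMk
    (measurable_number.comp (measurable_pi_apply j.1))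
    ((measurable_getP j.2).comp (measurable_pi_apply j.1))
  have hgm : Measurable g := by
    refine measurable_pi_lambda _ fun i => ?_
    have h : Measurable fun z : ℕ × (ℕ → Xi) => mkP z.1 fun a => z.2 a :=
      measurable_from_prod_countable_right fun l => (measurable_mkP l).comp
        (measurable_pi_lambda _ fun a => measurable_pi_apply (a : ℕ))
    have h' : Measurable fun z : Fin k × ℕ → ℕ × Xi => fun a : ℕ => (z (i, a)).2 :=
      measurable_pi_lambda _ fun a => Measurable.snd (measurable_pi_apply (i, a))
    exact h.comp (Measurable.prodMk (Measurable.fst (measurable_pi_apply (i, 0))) h')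
  have hgf : ∀ y, g (f y) = y := fun y => funext fun i => by
    simp only [hf, hg]
    refine Sigma.ext rfl (heq_of_eq (funext fun a => ?_))
    change getP a (y i) = (y i).2 a
    exact getP_lt (q := y i) a.2
  have e : (inferInstance : MeasurableSpace (Conf k)) = MeasurableSpace.comap f inferInstance :=
    le_antisymm (fun s hs => ⟨g ⁻¹' s, hgm hs, by ext y; simp [hgf]⟩) hfm.comap_le
  exact Eq.mpr (congrArg (fun m => @MeasurableSpace.CountablyGenerated (Conf k) m) e)
    (MeasurableSpace.CountablyGenerated.comap f)

instance (k : ℕ) : SecondCountableTopology (Lp ℂ 2 (configMeasure k)) :=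
  haveI : Fact ((2 : ℝ≥0∞) ≠ ∞) := ⟨by simp⟩
  Lp.SecondCountableTopology

/-! ### The pull-through formula -/

theorem Vec.smear {f : 𝓕(n)} (hf : Vec f) {g : Xi → ℂ} (hg : MemLp g 2 xiMeasure) :
    Vec (sm 0 g f) where
  memLp := by
    have hm : AEStronglyMeasurable (sm 0 g f) 𝓒(n) :=
      AEStronglyMeasurable.integral_prod_right' (f := fun z : Conf (n + 1) × Xi =>
        g z.2 * annih 0 z.2 f z.1) ((hg.1.comp_fst.mul
          (aestronglyMeasurable_annih 0 hf.memLp.1)).prod_swap)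
    refine memLp_two_of_sqInt hm (lt_of_le_of_lt ?_
      (ENNReal.mul_lt_top (sqInt_lt_top hg) (sqInt_lt_top hf.memLp)))
    refine le_of_tendsto' (lintegral_tendsto_of_tendsto_of_monotone (f := fun M y =>
      ‖sm 0 g (trunc M f) y‖ₑ ^ 2) (fun M => ?_)
      (Eventually.of_forall fun y M M' h => ?_) (Eventually.of_forall fun y => ?_))
      fun M => (((hf.truncate M).sqInt_sm_le 0 hg).trans ?_)
    · exact ((hf.truncate M).smear 0 hg).aesm.enorm.pow_const 2
    · have e := fun M => sm_num_mul 0 g (boxInd M) f y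
      change ‖sm 0 g (fun y => boxInd M (num y) * f y) y‖ₑ ^ 2 ≤
        ‖sm 0 g (fun y => boxInd M' (num y) * f y) y‖ₑ ^ 2
      rw [e, e, enorm_mul, enorm_mul]
      gcongr
      simp only [boxInd]
      split_ifs with h1 h2
      · exact le_rfl
      · exact absurd (fun i => (h1 i).trans h) h2
      · simp
      · exact le_rfl
    · refine tendsto_const_nhds.congr' ?_
      filter_upwards [eventually_boxInd (num y + Pi.single 0 1)] with M hM
      change _ = ‖sm 0 g (fun y => boxInd M (num y) * f y) y‖ₑ ^ 2
      rw [sm_num_mul, hM, one_mul]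
    · gcongr
      exact lintegral_mono fun y => by gcongr; exact enorm_trunc_le _ _ y
  anti := fun y j l x π => by
    rw [sm, sm, ← integral_const_mul]
    refine integral_congr_forall fun ξ => ?_
    rw [hf.anti.annihilate 0 ξ y j l x π]; ring

/-- The sign by which an odd interaction is made to commute with the fields. -/
def par (N : 𝓞(n)) : ℂ := ((-1) ^ (n + 1)) ^ (∑ i, N i)

theorem par_mul_self (N : 𝓞(n)) : par N * par N = 1 := by
  rw [par, ← mul_pow, ← mul_pow]; simp

theorem conj_par (N : 𝓞(n)) : conj (par N) = par N := by simp [par]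

theorem enorm_par (N : 𝓞(n)) : ‖par N‖ₑ = 1 := by simp [par, enorm_pow]

theorem par_add (N N' : 𝓞(n)) : par (N + N') = par N * par N' := by
  simp only [par, Pi.add_apply, Finset.sum_add_distrib, pow_add]

theorem par_listNum (L : List (Fin (n + 1))) : par (listNum L) = ((-1) ^ (n + 1)) ^ L.length := by
  induction L with
  | nil => simp [par, listNum]
  | cons i L ih =>
    have : listNum (i :: L) = Pi.single i 1 + listNum L := by simp [listNum]
    have h1 : par (Pi.single i 1 : 𝓞(n)) = (-1) ^ (n + 1) := by
      rw [par, Finset.sum_pi_single', if_pos (Finset.mem_univ i), pow_one]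
    rw [this, par_add, ih, h1, List.length_cons, pow_succ' _ L.length]

theorem IsSplit.tForm_par {L₁ L₂ : List (Fin (n + 1))} (hL : IsSplit L₁ L₂)
    (g : (Fin (n + 1) → Xi) → ℂ) (φ f : 𝓕(n)) :
    tForm g L₁ L₂ (fun y => par (num y) * φ y) (fun y => par (num y) * f y) =
      (-1) ^ (n + 1) * tForm g L₁ L₂ φ f := by
  have hlen : L₁.length + L₂.length = n + 1 := by
    rw [← List.length_append, ← List.toFinset_card_of_nodup hL.nodup,
      Finset.eq_univ_of_forall fun i => List.mem_toFinset.2 (hL.mem i), Finset.card_univ,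
      Fintype.card_fin]
  have hp : par (listNum L₁) * par (listNum L₂) = (-1 : ℂ) ^ (n + 1) := by
    rw [par_listNum, par_listNum, ← pow_add]
    refine (congrArg (fun l => ((-1 : ℂ) ^ (n + 1)) ^ l) hlen).trans ?_
    rcases Nat.even_or_odd (n + 1) with h | h
    · simp [h.neg_one_pow]
    · simp [h.neg_one_pow]
  rw [tForm, tForm, ← integral_const_mul]
  refine integral_congr_forall fun z => ?_
  simp only [annihList_num_mul, par_add, map_mul, conj_par]
  linear_combination (par (listNum L₁) * par (listNum L₂) * g z.1 * conj (annihList L₁ z.1 φ z.2) *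
    annihList L₂ z.1 f z.2) * par_mul_self (num z.2) +
    (g z.1 * conj (annihList L₁ z.1 φ z.2) * annihList L₂ z.1 f z.2) * hp

theorem qForm_par (G : ℕ → Equiv.Perm (Fin (n + 1)) → Kernel (Fin (n + 1))) (φ f : 𝓕(n)) :
    qForm G (fun y => par (num y) * φ y) (fun y => par (num y) * f y) =
      (-1) ^ (n + 1) * qForm G φ f := by
  simp only [qForm, Finset.mul_sum]
  refine Finset.sum_congr rfl fun p _ => Finset.sum_congr rfl fun σ _ => ?_
  rw [(isSplit_created p σ).tForm_par, (isSplit_created p σ).tForm_par]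
  simp [mul_add]

theorem boxInd_add_single {M : ℕ} {N : 𝓞(n)} (h : ∀ i, N i ≤ M) :
    boxInd (M + 1) (N + Pi.single 0 1) = 1 := by
  rw [boxInd, if_pos]
  intro i
  rw [Pi.add_apply]
  exact add_le_add (h i) (by rw [Pi.single_apply]; split_ifs <;> simp)

theorem enorm_ground_pull_le {τ : Equiv.Perm (Fin n)} {r : Fin n → ℝ} {C : ℝ≥0}
    (hτ : SliceBound τ r C) {K : ℕ → Equiv.Perm (Fin (n + 1)) → Kernel (Fin (n + 1))}
    (hGK : ∀ p ∈ Finset.range (n + 1 + 1), ∀ σ ∈ processes (n + 1) p,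
      IsOscPow (Fin.cons 0 r) (G p σ) (K p σ)) {m : Fin (n + 1) → ℝ} (Ψ : (hamiltonian m G).domain)
    {u : 𝓕(n)} (hu : Vec u) (hΨ : interRep Ψ =ᵐ[𝓒(n)] u)
    {M : ℕ} {φ : 𝓕(n)} (hφ : Nice M φ) {h : Xi → ℂ} (hh : MemLp h 2 xiMeasure) :
    ‖(∫ y, conj (φ y) * (par (num y) * sm 0 (fun ξ => conj (h ξ)) u y) ∂𝓒(n)) -
      qForm G φ (fun y => par (num y) * sm 0 (fun ξ => conj (h ξ)) (rep Ψ.1) y)‖ₑ ≤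
      ∑ p ∈ Finset.range (n + 1 + 1), ∑ σ ∈ processes (n + 1) p,
        ∫⁻ ξ, ‖h ξ‖ₑ * (sliceNorm (K p σ) ξ * (C * (sqInt 𝓒(n) φ *
          wInt (fun N => lam N ^ (2 : ℝ)) (rep Ψ.1))) ^ (1 / 2 : ℝ)) ∂xiMeasure := by
  set f := rep Ψ.1 with hf
  have hvf : Vec f := vec_rep _
  have hφ' : Nice M (fun y => par (num y) * φ y) := hφ.num_mul par
  have hX := hφ'.create 0 hh
  have hbox : ∀ {y}, φ y ≠ 0 → ∀ i, num y i ≤ M := fun {y} hy i => by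
    by_contra! hi
    exact hy (hφ.bdd y ⟨i, hi⟩)
  have h1 : qForm G (cre 0 h fun y => par (num y) * φ y) f =
      ∫ y, conj (φ y) * (par (num y) * sm 0 (fun ξ => conj (h ξ)) u y) ∂𝓒(n) := by
    rw [qForm_eq_integral_interRep Ψ hX]
    calc _ = ∫ y, conj (cre 0 h (fun y => par (num y) * φ y) y) * trunc (M + 1) u y ∂𝓒(n) := by
          refine integral_congr_ae ?_
          filter_upwards [hΨ] with y hy
          rw [hy, trunc, boxInd]
          split_ifs with hN
          · rw [one_mul]
          · push Not at hN
            rw [hX.bdd y hN]; simp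
      _ = _ := by
          rw [hφ'.adjoint (hu.truncate (M + 1)) 0 hh]
          refine integral_congr_forall fun y => ?_
          rcases eq_or_ne (φ y) 0 with h0 | h0
          · rw [h0]; simp
          · have := sm_num_mul 0 (fun ξ => conj (h ξ)) (boxInd (M + 1)) u y
            rw [boxInd_add_single (hbox h0), one_mul] at this
            change _ * sm 0 (fun ξ => conj (h ξ)) (fun y => boxInd (M + 1) (num y) * u y) y = _
            rw [this, map_mul, conj_par]; ring
  have h2 : (-1) ^ (n + 1) * qForm G (fun y => par (num y) * φ y)
      (sm 0 (fun ξ => conj (h ξ)) (trunc (M + 1 + 1) f)) =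
      qForm G φ (fun y => par (num y) * sm 0 (fun ξ => conj (h ξ)) f y) := by
    have e1 : sm 0 (fun ξ => conj (h ξ)) (trunc (M + 1 + 1) f) = fun y => par (num y) *
        (par (num y) * sm 0 (fun ξ => conj (h ξ)) (trunc (M + 1 + 1) f) y) := funext fun y => by
      rw [← mul_assoc, par_mul_self, one_mul]
    rw [e1, qForm_par, ← mul_assoc, ← mul_pow, neg_one_mul, neg_neg, one_pow, one_mul,
      ← qForm_trunc_right G hφ.bdd, ← qForm_trunc_right G hφ.bdd (fun y => par (num y) * sm 0 _ f y)]
    congr 1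
    funext y
    change boxInd (M + 1) (num y) * (par (num y) * sm 0 (fun ξ => conj (h ξ))
      (fun y => boxInd (M + 1 + 1) (num y) * f y) y) = boxInd (M + 1) (num y) * _
    rw [sm_num_mul]
    by_cases hN : ∀ i, num y i ≤ M + 1
    · rw [boxInd_add_single hN, one_mul]
    · rw [boxInd, if_neg hN, zero_mul, zero_mul]
  have h3 := enorm_qForm_cre_sub_le hτ hGK (hφ'.mono (by omega : M ≤ M + 1 + 1))
    (hvf.truncate (M + 1 + 1)) hh
  rw [h2, qForm_trunc_right G hX.bdd, h1] at h3
  refine h3.trans (Finset.sum_le_sum fun p _ => Finset.sum_le_sum fun σ _ => ?_)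
  gcongr
  · exact lintegral_mono fun y => by rw [enorm_mul, enorm_par, one_mul]
  · exact lintegral_mono fun y => by gcongr; exact enorm_trunc_le _ _ y

end

/-! ### Consequences of the bound from below -/

theorem IsResolvent.norm_le_of_pairing {E : Type} [NormedAddCommGroup E] [InnerProductSpace ℂ E]
    {T : E →ₗ.[ℂ] E} (hT : ∀ x y : T.domain, inner ℂ (T x) (y : E) = inner ℂ (x : E) (T y)) {e : ℝ}
    (he : ∀ x : ℝ, x < e → ∃ R, IsResolvent T (x : ℂ) R) {x : ℝ} (hx : x < e) {η : E} {κ : ℝ}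
    (hκ : 0 ≤ κ) (h : ∀ φ : T.domain, ‖inner ℂ (T φ - (x : ℂ) • (φ : E)) η‖ ≤ κ * ‖(φ : E)‖) :
    (e - x) * ‖η‖ ≤ κ := by
  obtain ⟨R, hR⟩ := he x hx
  obtain ⟨hd, h1⟩ := hR.1 η
  have h2 := h ⟨R η, hd⟩
  rw [h1, inner_self_eq_norm_sq_to_K, ← RCLike.ofReal_pow, RCLike.norm_ofReal,
    abs_of_nonneg (by positivity)] at h2
  have h3 := hR.le_norm hT he hx η
  have hx' := sub_pos.2 hx
  rcases (norm_nonneg η).eq_or_lt with h0 | h0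
  · rwa [← h0, mul_zero]
  · have h5 : (e - x) * ‖η‖ ^ 2 ≤ κ * ‖η‖ := by nlinarith
    nlinarith

theorem exists_seq_dense_graph {E : Type} [NormedAddCommGroup E] [InnerProductSpace ℂ E]
    [SecondCountableTopology E] (T : E →ₗ.[ℂ] E) : ∃ s : ℕ → T.domain, ∀ (x : ℂ) (η : E) (κ : ℝ),
      (∀ j, ‖inner ℂ (T (s j) - x • (s j : E)) η‖ ≤ κ * ‖(s j : E)‖) →
        ∀ φ : T.domain, ‖inner ℂ (T φ - x • (φ : E)) η‖ ≤ κ * ‖(φ : E)‖ := by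
  have hs : ∀ p : T.graph, ∃ φ : T.domain, (φ : E) = p.1.1 ∧ T φ = p.1.2 := fun p =>
    (LinearPMap.mem_graph_iff T).1 p.2
  choose s hs1 hs2 using hs
  refine ⟨fun j => s (TopologicalSpace.denseSeq T.graph j), fun x η κ h φ => ?_⟩
  have hc : IsClosed {p : T.graph | ‖inner ℂ (p.1.2 - x • p.1.1) η‖ ≤ κ * ‖p.1.1‖} :=
    isClosed_le (by fun_prop) (by fun_prop)
  have := (TopologicalSpace.denseRange_denseSeq T.graph).induction_on
    (p := fun p : T.graph => ‖inner ℂ (p.1.2 - x • p.1.1) η‖ ≤ κ * ‖p.1.1‖)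
    ⟨((φ : E), T φ), T.mem_graph φ⟩ hc fun j => by
      have := h j
      rwa [hs1, hs2] at this
  exact this

theorem enorm_integral_eq_of_nonneg {X : Type*} [MeasurableSpace X] {μ : Measure X} {f : X → ℂ}
    (hf : Integrable f μ) (h : ∀ᵐ x ∂μ, f x = (‖f x‖ : ℂ)) : ‖∫ x, f x ∂μ‖ₑ = ∫⁻ x, ‖f x‖ₑ ∂μ := by
  rw [integral_congr_ae h, integral_complex_ofReal, ← ofReal_norm, Complex.norm_real,
    Real.norm_of_nonneg (integral_nonneg fun _ => norm_nonneg _),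
    ofReal_integral_norm_eq_lintegral_enorm hf]

theorem integral_sub_sub {X : Type*} [MeasurableSpace X] {μ : Measure X} {a b c : X → ℂ}
    (ha : Integrable a μ) (hb : Integrable b μ) (hc : Integrable c μ) :
    ∫ x, a x - b x - c x ∂μ = ∫ x, a x ∂μ - ∫ x, b x ∂μ - ∫ x, c x ∂μ := by
  rw [← integral_sub ha hb]; exact integral_sub (ha.sub hb) hc

section
variable {n : ℕ}

/-! ### The annihilated ground state -/

theorem freeEnergy_insert (m : Fin (n + 1) → ℝ) (ξ : Xi) (y : Conf (n + 1)) :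
    freeEnergy m (Function.update y 0 ⟨(y 0).1 + 1, Fin.cons ξ (y 0).2⟩) =
      omega (m 0) ξ.1 + freeEnergy m y := by
  rw [freeEnergy, freeEnergy, Fin.sum_univ_succ, Fin.sum_univ_succ, Function.update_self,
    Fin.sum_univ_succ, add_assoc]
  refine congrArg₂ _ rfl (congrArg₂ _ rfl (Finset.sum_congr rfl fun i _ => ?_))
  rw [Function.update_of_ne (Fin.succ_ne_zero i)]

theorem annih_sub_freeEnergy_mul (m : Fin (n + 1) → ℝ) (e : ℂ) (f : 𝓕(n)) (ξ : Xi)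
    (y : Conf (n + 1)) : annih 0 ξ (fun y => (e - freeEnergy m y) * f y) y =
      (e - freeEnergy m y - omega (m 0) ξ.1) * annih 0 ξ f y := by
  simp only [annih, freeEnergy_insert]
  push_cast
  ring

theorem card_mul_le_freeEnergy (m : Fin (n + 1) → ℝ) (y : Conf (n + 1)) :
    m 0 * (y 0).1 ≤ freeEnergy m y := by
  rw [freeEnergy]
  refine le_trans ?_ (Finset.single_le_sum (f := fun i => ∑ a, omega (m i) ((y i).2 a).1)
    (fun i _ => Finset.sum_nonneg fun _ _ => omega_nonneg _ _) (Finset.mem_univ 0))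
  calc m 0 * (y 0).1 = ∑ _a : Fin (y 0).1, m 0 := by simp [mul_comm]
    _ ≤ _ := Finset.sum_le_sum fun _ _ => le_omega _

theorem memLp_annih_prod {m : Fin (n + 1) → ℝ} (h0 : 0 < m 0) {f : 𝓕(n)} (hf : Vec f)
    (hf' : MemLp (fun y => (freeEnergy m y : ℂ) * f y) 2 𝓒(n)) :
    MemLp (fun z : Xi × Conf (n + 1) => annih 0 z.1 f z.2) 2 (xiMeasure.prod 𝓒(n)) := by
  refine memLp_two_of_sqInt (aestronglyMeasurable_annih 0 hf.memLp.1) ?_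
  have h := lintegral_annih 0 (measurable_one) hf.memLp.1 hf.anti fun _ => 1
  simp only [Pi.one_apply, one_mul, occ_one] at h
  rw [sqInt, h]
  refine lt_of_le_of_lt (lintegral_mono fun y => ?_)
    (freeInt_lt_top hf hf' (w := fun _ => (m 0)⁻¹) (fun _ => le_rfl) (inv_pos.2 h0).le)
  gcongr
  rw [← ENNReal.ofReal_natCast]
  refine ENNReal.ofReal_le_ofReal ?_
  rw [inv_mul_eq_div, le_div_iff₀ h0, mul_comm]
  exact card_mul_le_freeEnergy m y

/-- The scalar product of `a` with `b₁(ξ) f`, up to the sign of the interaction. -/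
def annihPairing (f a : 𝓕(n)) (ξ : Xi) : ℂ :=
  ∫ y, conj (a y) * (par (num y) * annih 0 ξ f y) ∂𝓒(n)

theorem enorm_par_mul (N : 𝓞(n)) (z : ℂ) : ‖par N * z‖ₑ = ‖z‖ₑ := by
  rw [enorm_mul, enorm_par, one_mul]

theorem memLp_par_mul {a : 𝓕(n)} (ha : MemLp a 2 𝓒(n)) :
    MemLp (fun y => par (num y) * a y) 2 𝓒(n) :=
  memLp_two_of_sqInt ((measurable_comp_num par).aestronglyMeasurable.mul ha.1) (by
    simpa only [sqInt, enorm_par_mul] using sqInt_lt_top ha)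

variable {f : 𝓕(n)}

theorem memLp_annihPairing (hB : MemLp (fun z : Xi × Conf (n + 1) => annih 0 z.1 f z.2) 2
    (xiMeasure.prod 𝓒(n))) {a : 𝓕(n)} (ha : MemLp a 2 𝓒(n)) :
    MemLp (annihPairing f a) 2 xiMeasure := by
  have e : annihPairing f a = fun ξ => ∫ y, par (num y) * conj (a y) * annih 0 ξ f y ∂𝓒(n) :=
    funext fun ξ => integral_congr_ae (Eventually.of_forall fun y => by simp only; ring)
  rw [e]
  exact memLp_integral_mul (memLp_par_mul (MemLp_conj ha)) hB

theorem integral_mul_sm (hB : MemLp (fun z : Xi × Conf (n + 1) => annih 0 z.1 f z.2) 2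
    (xiMeasure.prod 𝓒(n))) {a : 𝓕(n)} (ha : MemLp a 2 𝓒(n)) {g : Xi → ℂ}
    (hg : MemLp g 2 xiMeasure) :
    ∫ y, conj (a y) * (par (num y) * sm 0 g f y) ∂𝓒(n) = ∫ ξ, g ξ * annihPairing f a ξ ∂xiMeasure := by
  have hi : Integrable (fun z : Xi × Conf (n + 1) => g z.1 * (par (num z.2) * conj (a z.2)) *
      annih 0 z.1 f z.2) (xiMeasure.prod 𝓒(n)) :=
    (memLp_mul_prod hg (memLp_par_mul (MemLp_conj ha))).integrable_mul hB
  calc _ = ∫ y, ∫ ξ, g ξ * (par (num y) * conj (a y)) * annih 0 ξ f y ∂xiMeasure ∂𝓒(n) := by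
        refine integral_congr_forall fun y => ?_
        simp only [sm]
        rw [← mul_assoc, ← integral_const_mul]
        exact integral_congr_ae (Eventually.of_forall fun ξ => by simp only; ring)
    _ = ∫ ξ, ∫ y, g ξ * (par (num y) * conj (a y)) * annih 0 ξ f y ∂𝓒(n) ∂xiMeasure :=
        integral_integral_swap hi.swap
    _ = _ := by
        refine integral_congr_forall fun ξ => ?_
        simp only [annihPairing]
        rw [← integral_const_mul]
        exact integral_congr_ae (Eventually.of_forall fun y => by simp only; ring)

theorem ae_sm_sub_freeEnergy_mul (m : Fin (n + 1) → ℝ) (e : ℂ)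
    (hB : MemLp (fun z : Xi × Conf (n + 1) => annih 0 z.1 f z.2) 2 (xiMeasure.prod 𝓒(n))) {g : Xi → ℂ}
    (hg : MemLp g 2 xiMeasure) (hg' : MemLp (fun ξ => (omega (m 0) ξ.1 : ℂ) * g ξ) 2 xiMeasure) :
    ∀ᵐ y ∂𝓒(n), sm 0 g (fun y => (e - freeEnergy m y) * f y) y =
      (e - freeEnergy m y) * sm 0 g f y - sm 0 (fun ξ => (omega (m 0) ξ.1 : ℂ) * g ξ) f y := by
  filter_upwards [hB.ae_memLp_right] with y hy
  have h1 : Integrable (fun ξ => (e - freeEnergy m y) * (g ξ * annih 0 ξ f y)) xiMeasure :=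
    (hg.integrable_mul hy).const_mul _
  have h2 : Integrable (fun ξ => (omega (m 0) ξ.1 : ℂ) * g ξ * annih 0 ξ f y) xiMeasure :=
    hg'.integrable_mul hy
  simp only [sm, annih_sub_freeEnergy_mul]
  rw [← integral_const_mul, ← integral_sub h1 h2]
  exact integral_congr_ae (Eventually.of_forall fun ξ => by simp only; ring)

theorem Vec.sub_freeEnergy_mul (hf : Vec f) {m : Fin (n + 1) → ℝ}
    (hf' : Vec fun y => (freeEnergy m y : ℂ) * f y) (e : ℂ) :
    Vec fun y => (e - freeEnergy m y) * f y where
  memLp := by simp only [sub_mul]; exact (hf.memLp.const_mul e).sub hf'.memLp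
  anti := fun y i l x π => by
    have h1 := hf.anti y i l x π
    have h2 := hf'.anti y i l x π
    simp only at h1 h2 ⊢
    linear_combination e * h1 - h2

theorem conj_trunc_mul (M : ℕ) (φ v : 𝓕(n)) (y : Conf (n + 1)) :
    conj (trunc M φ y) * v y = conj (φ y) * trunc M v y := by
  have : conj (boxInd M (num y)) = boxInd M (num y) := by rw [boxInd]; split_ifs <;> simp
  rw [trunc, trunc, map_mul, this]; ring

variable {G : ℕ → Equiv.Perm (Fin (n + 1)) → Kernel (Fin (n + 1))} {m : Fin (n + 1) → ℝ} {ms : ℝ}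

theorem integral_sub_integral_interRep {e : ℝ} (hf : Vec f)
    (hf' : Vec fun y => (freeEnergy m y : ℂ) * f y)
    (hB : MemLp (fun z : Xi × Conf (n + 1) => annih 0 z.1 f z.2) 2 (xiMeasure.prod 𝓒(n)))
    (φ : (hamiltonian m G).domain) {g : Xi → ℂ} (hg : MemLp g 2 xiMeasure)
    (hg' : MemLp (fun ξ => (omega (m 0) ξ.1 : ℂ) * g ξ) 2 xiMeasure) :
    (∫ y, conj (rep φ.1 y) * (par (num y) *
        sm 0 g (fun y => ((e : ℂ) - freeEnergy m y) * f y) y) ∂𝓒(n)) -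
      ∫ y, conj (interRep φ y) * (par (num y) * sm 0 g f y) ∂𝓒(n) =
    -∫ ξ, g ξ * (annihPairing f (rep (hamiltonian m G φ)) ξ -
      ((e - omega (m 0) ξ.1 : ℝ) : ℂ) * annihPairing f (rep φ.1) ξ) ∂xiMeasure := by
  have hφ := (vec_rep φ.1).memLp
  have hH := (vec_rep (hamiltonian m G φ)).memLp
  have hu := hf.sub_freeEnergy_mul hf' e
  have hv := memLp_par_mul (hf.smear hg).memLp
  have i1 := (integrable_conj_mul hφ hv).const_mul (e : ℂ)
  have i2 := integrable_conj_mul hφ (memLp_par_mul (hf.smear hg').memLp)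
  have i3 := integrable_conj_mul hH hv
  rw [← integral_sub (integrable_conj_mul hφ (memLp_par_mul (hu.smear hg).memLp))
    (integrable_conj_mul (memLp_interRep φ) hv)]
  have j1 := (hg.integrable_mul (memLp_annihPairing hB hφ)).const_mul (e : ℂ)
  have j2 := hg'.integrable_mul (memLp_annihPairing hB hφ)
  have j3 := hg.integrable_mul (memLp_annihPairing hB hH)
  simp only [Pi.mul_def] at j1 j2 j3
  calc _ = ∫ y, (e : ℂ) * (conj (rep φ.1 y) * (par (num y) * sm 0 g f y)) -
        conj (rep φ.1 y) * (par (num y) * sm 0 (fun ξ => (omega (m 0) ξ.1 : ℂ) * g ξ) f y) -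
        conj (rep (hamiltonian m G φ) y) * (par (num y) * sm 0 g f y) ∂𝓒(n) := by
        refine integral_congr_ae ?_
        filter_upwards [ae_sm_sub_freeEnergy_mul m e hB hg hg'] with y hy
        rw [hy, interRep, map_sub, map_mul, Complex.conj_ofReal]; ring
    _ = ∫ ξ, (e : ℂ) * (g ξ * annihPairing f (rep φ.1) ξ) -
        (omega (m 0) ξ.1 : ℂ) * g ξ * annihPairing f (rep φ.1) ξ -
        g ξ * annihPairing f (rep (hamiltonian m G φ)) ξ ∂xiMeasure := by
        rw [integral_sub_sub i1 i2 i3, integral_sub_sub j1 j2 j3, integral_const_mul, integral_const_mul, integral_mul_sm hB hφ hg,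
          integral_mul_sm hB hφ hg', integral_mul_sm hB hH hg]
    _ = _ := by
        rw [← integral_neg]
        exact integral_congr_ae (Eventually.of_forall fun ξ => by simp only; push_cast; ring)

theorem memLp_freeEnergy_mul_sm (hf : Vec f) (hf' : Vec fun y => (freeEnergy m y : ℂ) * f y)
    (hB : MemLp (fun z : Xi × Conf (n + 1) => annih 0 z.1 f z.2) 2 (xiMeasure.prod 𝓒(n))) {g : Xi → ℂ}
    (hg : MemLp g 2 xiMeasure) (hg' : MemLp (fun ξ => (omega (m 0) ξ.1 : ℂ) * g ξ) 2 xiMeasure) :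
    MemLp (fun y => (freeEnergy m y : ℂ) * (par (num y) * sm 0 g f y)) 2 𝓒(n) := by
  have h := memLp_par_mul ((((hf.sub_freeEnergy_mul hf' 0).smear hg).memLp.add
    (hf.smear hg').memLp).neg)
  refine (memLp_congr_ae ?_).1 h
  filter_upwards [ae_sm_sub_freeEnergy_mul m 0 hB hg hg'] with y hy
  simp only [Pi.neg_apply, Pi.add_apply]
  rw [hy]; ring

theorem enorm_integral_pairing_le (hG : FormBound (qForm G)) (hms : 0 < ms)
    (hm : ∀ i : Fin n, ms ≤ m i.succ) {τ : Equiv.Perm (Fin n)} {r : Fin n → ℝ} {C : ℝ≥0}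
    (hτ : SliceBound τ r C) {K : ℕ → Equiv.Perm (Fin (n + 1)) → Kernel (Fin (n + 1))}
    (hGK : ∀ p ∈ Finset.range (n + 1 + 1), ∀ σ ∈ processes (n + 1) p,
      IsOscPow (Fin.cons 0 r) (G p σ) (K p σ)) {Ψ : (hamiltonian m G).domain} {e : ℝ}
    (hΨ : hamiltonian m G Ψ = (e : ℂ) • Ψ.1)
    (hB : MemLp (fun z : Xi × Conf (n + 1) => annih 0 z.1 (rep Ψ.1) z.2) 2
      (xiMeasure.prod 𝓒(n))) (φ : (hamiltonian m G).domain) {h : Xi → ℂ} (hh : MemLp h 2 xiMeasure)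
    (hh' : MemLp (fun ξ => (omega (m 0) ξ.1 : ℂ) * h ξ) 2 xiMeasure) :
    ‖∫ ξ, conj (h ξ) * (annihPairing (rep Ψ.1) (rep (hamiltonian m G φ)) ξ -
      ((e - omega (m 0) ξ.1 : ℝ) : ℂ) * annihPairing (rep Ψ.1) (rep φ.1) ξ) ∂xiMeasure‖ₑ ≤
      ∑ p ∈ Finset.range (n + 1 + 1), ∑ σ ∈ processes (n + 1) p,
        ∫⁻ ξ, ‖h ξ‖ₑ * (sliceNorm (K p σ) ξ * (C * (sqInt 𝓒(n) (rep φ.1) *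
          wInt (fun N => lam N ^ (2 : ℝ)) (rep Ψ.1))) ^ (1 / 2 : ℝ)) ∂xiMeasure := by
  set f := rep Ψ.1 with hfdef
  have hf : Vec f := vec_rep _
  have hf' : Vec fun y => (freeEnergy m y : ℂ) * f y := (hamiltonian_spec Ψ).1
  have hu := hf.sub_freeEnergy_mul hf' e
  have hΨu : interRep Ψ =ᵐ[𝓒(n)] fun y => ((e : ℂ) - freeEnergy m y) * f y := by
    filter_upwards [fn_ae_rep (hamiltonian m G Ψ), fn_smul (e : ℂ) Ψ.1,
      fn_ae_rep Ψ.1] with y h1 h2 h3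
    rw [interRep, ← h1, hΨ, h2, Pi.smul_apply, h3, smul_eq_mul, sub_mul]
  have hg : MemLp (fun ξ => conj (h ξ)) 2 xiMeasure := MemLp_conj hh
  have hg' : MemLp (fun ξ => (omega (m 0) ξ.1 : ℂ) * conj (h ξ)) 2 xiMeasure :=
    by simpa using MemLp_conj hh' 
  have hv : Vec fun y => par (num y) * sm 0 (fun ξ => conj (h ξ)) f y :=
    (hf.smear hg).num_mul par (c := 1) fun N => by rw [enorm_par]; simp
  have hlim := (tendsto_integral_trunc (MemLp_conj (vec_rep φ.1).memLp)
    (memLp_par_mul (hu.smear hg).memLp)).sub (tendsto_qForm_trunc hG hms hm φ hv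
      (eInt_lt_top hms hm hv (memLp_freeEnergy_mul_sm hf hf' hB hg hg')))
  rw [integral_sub_integral_interRep hf hf' hB φ hg hg'] at hlim
  rw [← enorm_neg]
  refine le_of_tendsto' hlim.enorm fun M => ?_
  have h3 := enorm_ground_pull_le hτ hGK Ψ hu hΨu ((vec_rep φ.1).truncate M) hh
  simp only [conj_trunc_mul M (rep φ.1)
    (fun y => par (num y) * sm 0 (fun ξ => conj (h ξ))
      (fun y => ((e : ℂ) - freeEnergy m y) * f y) y)] at h3
  refine h3.trans (Finset.sum_le_sum fun p _ => Finset.sum_le_sum fun σ _ => ?_)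
  gcongr
  exact lintegral_mono fun y => by gcongr; exact enorm_trunc_le _ _ y

end

/-! ### The bound for almost every momentum -/

theorem sum_lintegral_le {X ι : Type*} [MeasurableSpace X] {μ : Measure X} (s : Finset ι)
    (f : ι → X → ℝ≥0∞) : ∑ i ∈ s, ∫⁻ x, f i x ∂μ ≤ ∫⁻ x, ∑ i ∈ s, f i x ∂μ := by
  classical
  induction s using Finset.induction_on with
  | empty => simp
  | insert i s hi ih =>
    simp only [Finset.sum_insert hi]
    exact (add_le_add le_rfl ih).trans (le_lintegral_add _ _)

theorem ae_enorm_le_of_forall_integral {X : Type*} [MeasurableSpace X] {μ : Measure X}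
    [SigmaFinite μ] {g : X → ℂ} (hg : AEStronglyMeasurable g μ) {w : X → ℝ} (hw : Measurable w)
    {κ : X → ℝ≥0∞} (H : ∀ h : X → ℂ, MemLp h 2 μ → MemLp (fun x => (w x : ℂ) * h x) 2 μ →
      ‖∫ x, conj (h x) * g x ∂μ‖ₑ ≤ ∫⁻ x, ‖h x‖ₑ * κ x ∂μ) : ∀ᵐ x ∂μ, ‖g x‖ₑ ≤ κ x := by
  obtain ⟨g', hg', hgg⟩ := hg
  have hm := hg'.measurable
  have key : ∀ R : ℕ, ∀ᵐ x ∂μ, x ∈ {x | ‖g' x‖ ≤ R ∧ |w x| ≤ R} → ‖g' x‖ₑ ≤ κ x := by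
    intro R
    have hB : MeasurableSet {x | ‖g' x‖ ≤ R ∧ |w x| ≤ R} :=
      (measurableSet_le hm.norm measurable_const).inter
        (measurableSet_le (continuous_abs.measurable.comp hw) measurable_const)
    refine (ae_restrict_iff' hB).1 (ae_le_of_forall_setLIntegral_le_of_sigmaFinite₀
      hm.enorm.aemeasurable fun s hs hfin => ?_)
    rw [Measure.restrict_restrict hs]
    rw [Measure.restrict_apply hs] at hfin
    set t := s ∩ {x | ‖g' x‖ ≤ R ∧ |w x| ≤ R} with ht
    have htm : MeasurableSet t := hs.inter hB
    set h : X → ℂ := t.indicator fun x => g' x / ‖g' x‖ with hh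
    have hhm : Measurable h := (hm.div (Complex.measurable_ofReal.comp hm.norm)).indicator htm
    have hle : ∀ x, ‖h x‖ ≤ t.indicator (fun _ => 1) x := fun x => by
      by_cases hx : x ∈ t
      · rw [hh, indicator_of_mem hx, indicator_of_mem hx, norm_div, Complex.norm_real, norm_norm]
        exact div_self_le_one _
      · rw [hh, indicator_of_notMem hx, indicator_of_notMem hx, norm_zero]
    have h1 : MemLp h 2 μ := (memLp_indicator_const 2 htm (1 : ℝ) (Or.inr hfin.ne)).of_le
      hhm.aestronglyMeasurable (Eventually.of_forall fun x => (hle x).trans (le_abs_self _))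
    have h2 : MemLp (fun x => (w x : ℂ) * h x) 2 μ := h1.of_le_mul (c := R)
      ((Complex.measurable_ofReal.comp hw).mul hhm).aestronglyMeasurable
      (Eventually.of_forall fun x => by
        by_cases hx : x ∈ t
        · rw [norm_mul, Complex.norm_real]
          exact mul_le_mul_of_nonneg_right hx.2.2 (norm_nonneg _)
        · rw [hh, indicator_of_notMem hx]; simp)
    have e1 : ∫ x, conj (h x) * g x ∂μ = ∫ x in t, (‖g' x‖ : ℂ) ∂μ := by
      rw [← integral_indicator htm]
      refine integral_congr_ae ?_
      filter_upwards [hgg] with x hx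
      rw [hx]
      by_cases hxt : x ∈ t
      · rw [hh, indicator_of_mem hxt, indicator_of_mem hxt, map_div₀, Complex.conj_ofReal,
          div_mul_eq_mul_div, mul_comm, Complex.mul_conj, Complex.normSq_eq_norm_sq]
        push_cast
        rcases eq_or_ne (‖g' x‖ : ℂ) 0 with h0 | h0
        · rw [h0]; simp
        · field_simp
      · rw [hh, indicator_of_notMem hxt, indicator_of_notMem hxt]; simp
    have hint : Integrable (fun x => (‖g' x‖ : ℂ)) (μ.restrict t) :=
      Measure.integrableOn_of_bounded (M := R) hfin.ne
        (Complex.measurable_ofReal.comp hm.norm).aestronglyMeasurable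
        ((ae_restrict_iff' htm).2 (Eventually.of_forall fun x hx => by simpa using hx.2.1))
    have h3 := H h h1 h2
    rw [e1, enorm_integral_eq_of_nonneg hint (Eventually.of_forall fun x => by simp)] at h3
    refine le_trans (le_of_eq ?_) (h3.trans ?_)
    · exact lintegral_congr fun x => by rw [← ofReal_norm, ← ofReal_norm]; simp
    · rw [← lintegral_indicator htm]
      refine lintegral_mono fun x => ?_
      by_cases hx : x ∈ t
      · rw [indicator_of_mem hx]
        refine mul_le_of_le_one_left' ?_
        have := hle x
        rw [indicator_of_mem hx] at this
        rw [← ofReal_norm]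
        exact ENNReal.ofReal_le_one.2 this
      · rw [hh, indicator_of_notMem hx, enorm_zero, zero_mul]; exact zero_le
  filter_upwards [hgg, ae_all_iff.2 key] with x hx hk
  obtain ⟨R, hR⟩ := exists_nat_ge (max ‖g' x‖ |w x|)
  rw [hx]
  exact hk R ⟨(le_max_left _ _).trans hR, (le_max_right _ _).trans hR⟩

section
variable {n : ℕ}

variable {G K : ℕ → Equiv.Perm (Fin (n + 1)) → Kernel (Fin (n + 1))} {m : Fin (n + 1) → ℝ} {ms : ℝ}
  {τ : Equiv.Perm (Fin n)} {r : Fin n → ℝ} {C : ℝ≥0}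

theorem ae_enorm_pairing_le (hG : FormBound (qForm G)) (hms : 0 < ms)
    (hm : ∀ i : Fin n, ms ≤ m i.succ) (hτ : SliceBound τ r C)
    (hGK : ∀ p ∈ Finset.range (n + 1 + 1), ∀ σ ∈ processes (n + 1) p,
      IsOscPow (Fin.cons 0 r) (G p σ) (K p σ)) {Ψ : (hamiltonian m G).domain} {e : ℝ}
    (hΨ : hamiltonian m G Ψ = (e : ℂ) • Ψ.1)
    (hB : MemLp (fun z : Xi × Conf (n + 1) => annih 0 z.1 (rep Ψ.1) z.2) 2
      (xiMeasure.prod 𝓒(n))) (φ : (hamiltonian m G).domain) : ∀ᵐ ξ ∂xiMeasure,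
    ‖annihPairing (rep Ψ.1) (rep (hamiltonian m G φ)) ξ -
      ((e - omega (m 0) ξ.1 : ℝ) : ℂ) * annihPairing (rep Ψ.1) (rep φ.1) ξ‖ₑ ≤
      ∑ p ∈ Finset.range (n + 1 + 1), ∑ σ ∈ processes (n + 1) p,
        sliceNorm (K p σ) ξ * (C * (sqInt 𝓒(n) (rep φ.1) *
          wInt (fun N => lam N ^ (2 : ℝ)) (rep Ψ.1))) ^ (1 / 2 : ℝ) := by
  have hw : Measurable fun ξ : Xi => omega (m 0) ξ.1 :=
    (continuous_omega (m 0)).measurable.comp measurable_fst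
  refine ae_enorm_le_of_forall_integral ?_ hw fun h hh hh' => ?_
  · refine (memLp_annihPairing hB (vec_rep _).memLp).1.sub (AEStronglyMeasurable.mul ?_
      (memLp_annihPairing hB (vec_rep _).memLp).1)
    exact (Complex.measurable_ofReal.comp (measurable_const.sub hw)).aestronglyMeasurable
  · refine (enorm_integral_pairing_le hG hms hm hτ hGK hΨ hB φ hh hh').trans ?_
    refine (Finset.sum_le_sum fun p _ => sum_lintegral_le _ _).trans ((sum_lintegral_le _ _).trans
      (lintegral_mono fun ξ => ?_))
    simp only [Finset.mul_sum, le_refl]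

theorem exists_ground_annih_le (hG : FormBound (qForm G)) (hms : 0 < ms) (hτ : SliceBound τ r C)
    (hGK : ∀ p ∈ Finset.range (n + 1 + 1), ∀ σ ∈ processes (n + 1) p,
      IsOscPow (Fin.cons 0 r) (G p σ) (K p σ)) :
    ∃ A : ℝ≥0, ∀ m : Fin (n + 1) → ℝ, 0 < m 0 → (∀ i : Fin n, ms ≤ m i.succ) →
      ∀ Φ, IsGroundState (hamiltonian m G) Φ → ∀ᵐ ξ ∂xiMeasure, ξ.1 ≠ 0 →
        ∃ bΦ : fockSpace (n + 1), fn bΦ =ᵐ[𝓒(n)] annih 0 ξ (fn Φ) ∧ ∀ κ : ℝ≥0,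
          ∑ p ∈ Finset.range (n + 1 + 1), ∑ σ ∈ processes (n + 1) p, sliceNorm (K p σ) ξ = κ →
            ‖bΦ‖ ≤ A * ‖ξ.1‖⁻¹ * κ := by
  obtain ⟨E, hE⟩ := exists_ground_energy_le hG hms
  obtain ⟨C₂, hC₂⟩ := exists_second_moment_bound hG hms E
  refine ⟨(C * C₂) ^ (1 / 2 : ℝ), fun m h0 hm Φ hΦ => ?_⟩
  obtain ⟨hn, e, he, hd, hΦe⟩ := hΦ
  have hres : ∀ x : ℝ, x < e → ∃ R, IsResolvent (hamiltonian m G) (x : ℂ) R := fun x hx => by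
    by_contra h
    exact absurd (he.1 h) (not_le.2 hx)
  have hW := hC₂ m hm ⟨Φ, hd⟩ e (hE m hm e hres) hΦe
  rw [← enorm_sq_eq_sqInt (fn_ae_rep Φ), ← ofReal_norm, hn, ENNReal.ofReal_one, one_pow,
    mul_one] at hW
  have hB := memLp_annih_prod h0 (vec_rep Φ) (hamiltonian_spec ⟨Φ, hd⟩).1.memLp
  obtain ⟨s, hs⟩ := exists_seq_dense_graph (hamiltonian m G)
  have hfn := Measure.ae_ae_of_ae_prod ((quasiMeasurePreserving_insY (n := n) 0).ae_eq (fn_ae_rep Φ))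
  filter_upwards [hfn, hB.ae_memLp_left, ae_all_iff.2 fun j =>
    ae_enorm_pairing_le hG hms hm hτ hGK hΦe hB (s j)] with ξ h1 h2 h3 hξ
  have hb : Vec (annih 0 ξ (rep Φ)) := ⟨h2, (vec_rep Φ).anti.annihilate 0 ξ⟩
  have hη : Vec fun y => par (num y) * annih 0 ξ (rep Φ) y :=
    hb.num_mul par (c := 1) fun N => by rw [enorm_par]; simp
  refine ⟨hb.toFock, hb.fn_toFock.trans ?_, fun κ hκ => ?_⟩
  · filter_upwards [h1] with y hy
    rw [annih_eq, annih_eq]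
    exact congrArg _ hy.symm
  have hnorm : ‖hb.toFock‖ = ‖hη.toFock‖ := by
    rw [← toReal_enorm, ← toReal_enorm]
    refine congrArg _ ((ENNReal.pow_right_strictMono two_ne_zero).injective ?_)
    change ‖hb.toFock‖ₑ ^ 2 = ‖hη.toFock‖ₑ ^ 2
    rw [enorm_sq_eq_sqInt hb.fn_toFock, enorm_sq_eq_sqInt hη.fn_toFock]
    simp only [sqInt, enorm_par_mul]
  have hω : 0 < ‖ξ.1‖ := norm_pos_iff.2 hξ
  have hωk := norm_le_omega (m 0) ξ.1
  have key : (e - (e - omega (m 0) ξ.1)) * ‖hη.toFock‖ ≤ ((C * C₂) ^ (1 / 2 : ℝ) * κ : ℝ≥0) := by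
    refine IsResolvent.norm_le_of_pairing (hamiltonian_symmetric hG hms hm) hres (by linarith)
      (NNReal.coe_nonneg _) (hs _ _ _ fun j => ?_)
    have h4 := h3 j
    rw [← Finset.sum_congr rfl fun p _ => Finset.sum_mul _ _ _, ← Finset.sum_mul, hκ,
      ← enorm_sq_eq_sqInt (fn_ae_rep (s j).1)] at h4
    have h5 : ((C : ℝ≥0∞) * (‖(s j).1‖ₑ ^ 2 * wInt (fun N => lam N ^ (2 : ℝ))
        (rep Φ))) ^ (1 / 2 : ℝ) ≤ ((C * C₂) ^ (1 / 2 : ℝ) : ℝ≥0) * ‖(s j).1‖ₑ := by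
      calc _ ≤ ((C : ℝ≥0∞) * (‖(s j).1‖ₑ ^ 2 * C₂)) ^ (1 / 2 : ℝ) := by gcongr
        _ = ((C * C₂ : ℝ≥0) : ℝ≥0∞) ^ (1 / 2 : ℝ) * (‖(s j).1‖ₑ ^ (2 : ℝ)) ^ (1 / 2 : ℝ) := by
            rw [← ENNReal.mul_rpow_of_nonneg _ _ (by norm_num), ENNReal.rpow_two]
            push_cast; ring_nf
        _ = _ := by
            rw [← ENNReal.rpow_mul, ENNReal.coe_rpow_of_nonneg _ (by norm_num)]; norm_num
    have h6 := h4.trans (mul_le_mul' le_rfl h5)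
    rw [inner_sub_left, inner_smul_left, Complex.conj_ofReal,
      inner_eq_integral (fn_ae_rep _) hη.fn_toFock, inner_eq_integral (fn_ae_rep _) hη.fn_toFock]
    have h7 : ‖annihPairing (rep Φ) (rep (hamiltonian m G (s j))) ξ -
      ((e - omega (m 0) ξ.1 : ℝ) : ℂ) * annihPairing (rep Φ)
        (rep (s j).1) ξ‖₊ ≤
        κ * ((C * C₂) ^ (1 / 2 : ℝ) * ‖(s j).1‖₊) := by
      rw [← ENNReal.coe_le_coe, ENNReal.coe_mul, ENNReal.coe_mul]; exact h6
    refine (NNReal.coe_le_coe.2 h7).trans (le_of_eq ?_)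
    push_cast
    ring
  rw [_root_.sub_sub_cancel] at key
  rw [hnorm]
  push_cast at key ⊢
  have h8 : ‖ξ.1‖ * ‖hη.toFock‖ ≤ ((C : ℝ) * C₂) ^ (1 / 2 : ℝ) * κ :=
    (mul_le_mul_of_nonneg_right hωk (norm_nonneg _)).trans key
  rw [mul_comm _ (‖ξ.1‖⁻¹), mul_assoc, inv_mul_eq_div, le_div_iff₀ hω]
  linarith

end

/-! ### The exponents -/

theorem exists_isOscPow_cons {d : ℕ} (hd : 1 ≤ d) (i₀ : Fin (d + 1)) {ε : ℝ} (hε : 0 < ε)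
    {G K : Kernel (Fin (d + 1))} (h : IsOscPow (kernelExp d i₀ ε) G K) :
    ∃ K', IsOscPow (Fin.cons 0 (sliceExp d i₀ ε)) G K' := by
  by_cases hc : d = 1 ∧ i₀ ≠ 0
  · obtain ⟨rfl, hi⟩ := hc
    refine ⟨G, isOscPow_zero (Fin.cases rfl fun i => ?_) G⟩
    rw [Fin.cons_succ, sliceExp, if_pos]
    have h0 : i₀.1 ≠ 0 := fun h0 => hi (Fin.ext h0)
    exact Fin.ext (by rw [Fin.val_succ]; omega)
  · refine exists_isOscPow_mono (Fin.cases ?_ fun i => ?_) h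
    · rw [Fin.cons_zero, kernelExp]
      split_ifs with h0 h1
      · exact le_rfl
      rotate_left
      · exact absurd rfl h1
      · have h2 : (2 : ℝ) ≤ d := by
          have : d ≠ 1 := fun h1 => hc ⟨h1, fun h2 => h0 h2.symm⟩
          exact_mod_cast (by omega : 2 ≤ d)
        have h3 : 1 / (d : ℝ) ≤ 1 / 2 := by gcongr
        linarith
    · rw [Fin.cons_succ, sliceExp, kernelExp, if_neg (Fin.succ_ne_zero i)]

theorem sliceNorm_eq_enorm {n : ℕ} {K : Kernel (Fin (n + 1))} {ξ : Xi} {L : Kernel (Fin n)}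
    (h : L =ᵐ[𝓚(n)] fun x => K (Fin.cons ξ x)) : sliceNorm K ξ = ‖L‖ₑ := by
  rw [sliceNorm, ← sqInt_congr_ae h, sqInt_eq_enorm, ← ENNReal.rpow_two, ← ENNReal.rpow_mul]
  norm_num

end FermionModel

/-- There are `n = d + 1` species, numbered `0, …, d`; the species `0` is the one whose mass `m₁`
is sent to zero, and `m` lists the fixed masses of the other ones. -/
theorem proposition3p4 (d : ℕ) (hd : 1 ≤ d) (m : Fin d → ℝ) (hm : ∀ i, 0 < m i)
    (i₀ : Fin (d + 1)) (ε : ℝ) (hε : 0 < ε) (hdε : d = 1 → i₀ = 0 → 1 / 2 ≤ ε)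
    (G : ℕ → Equiv.Perm (Fin (d + 1)) → FermionModel.Kernel (Fin (d + 1)))
    (hG : ∀ p ∈ Finset.range (d + 1 + 1), ∀ σ ∈ FermionModel.processes (d + 1) p,
      G p σ ∈ (FermionModel.oscPow fun i : Fin (d + 1) =>
        if i = i₀ then 0
        else if i = 0 then 1 / 2 - 5 / 6 * (1 / (d : ℝ)) + ε
        else 1 / 2 - 1 / (d : ℝ) + ε).domain) :
    ∃ C₀ : ℝ, 0 < C₀ ∧ ∀ m₁ : ℝ, 0 < m₁ → ∀ Φ : FermionModel.fockSpace (d + 1),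
      FermionModel.IsGroundState
        (FermionModel.hamiltonian (Fin.cons m₁ m : Fin (d + 1) → ℝ) G) Φ →
      ∀ᵐ ξ ∂FermionModel.xiMeasure, ξ.1 ≠ 0 →
        ∃ (bΦ : FermionModel.fockSpace (d + 1))
          (F : ℕ → Equiv.Perm (Fin (d + 1)) → (FermionModel.oscPow fun i : Fin d =>
            if i.succ = i₀ then 0 else 1 / 2 - 1 / (d : ℝ) + ε).domain),
          FermionModel.fn bΦ =ᵐ[FermionModel.configMeasure (d + 1)]
            FermionModel.annih 0 ξ (FermionModel.fn Φ) ∧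
          (∀ p ∈ Finset.range (d + 1 + 1), ∀ σ ∈ FermionModel.processes (d + 1) p,
            (F p σ : FermionModel.Kernel (Fin d))
              =ᵐ[FermionModel.kernelMeasure (Fin d)] fun x => G p σ (Fin.cons ξ x)) ∧
          ‖bΦ‖ ≤ C₀ * ‖ξ.1‖⁻¹ *
            ∑ p ∈ Finset.range (d + 1 + 1), ∑ σ ∈ FermionModel.processes (d + 1) p,
              ‖FermionModel.oscPow (fun i : Fin d =>
                if i.succ = i₀ then 0 else 1 / 2 - 1 / (d : ℝ) + ε) (F p σ)‖ := by
  classical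
  open FermionModel in
  · have hG' : ∀ p ∈ Finset.range (d + 1 + 1), ∀ σ ∈ processes (d + 1) p,
        ∃ K, IsOscPow (kernelExp d i₀ ε) (G p σ) K := fun p hp σ hσ =>
      ⟨_, isOscPow_oscPow ⟨G p σ, hG p hp σ hσ⟩⟩
    have hK : ∀ p σ, ∃ K, p ∈ Finset.range (d + 1 + 1) → σ ∈ processes (d + 1) p →
        IsOscPow (Fin.cons 0 (sliceExp d i₀ ε)) (G p σ) K := fun p σ => by
      by_cases h : p ∈ Finset.range (d + 1 + 1) ∧ σ ∈ processes (d + 1) p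
      · obtain ⟨K, hK⟩ := hG' p h.1 σ h.2
        obtain ⟨K', hK'⟩ := exists_isOscPow_cons hd i₀ hε hK
        exact ⟨K', fun _ _ => hK'⟩
      · exact ⟨0, fun h1 h2 => absurd ⟨h1, h2⟩ h⟩
    choose K hK using hK
    obtain ⟨τ, C, hτ⟩ := exists_sliceBound hd i₀ hε hdε
    have hms : ∃ ms, 0 < ms ∧ ∀ i, ms ≤ m i := by
      have : Nonempty (Fin d) := ⟨⟨0, hd⟩⟩
      obtain ⟨i, hi⟩ := Finite.exists_min m
      exact ⟨m i, hm i, hi⟩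
    obtain ⟨ms, hms, hmm⟩ := hms
    obtain ⟨A, hA⟩ := exists_ground_annih_le
      (formBound_qForm hd i₀ hε hG') hms hτ fun p hp σ hσ => hK p σ hp hσ
    refine ⟨A + 1, by positivity, fun m₁ hm₁ Φ hΦ => ?_⟩
    have hsl : ∀ᵐ ξ ∂xiMeasure, ∀ p σ, ∃ F : (oscPow
        (sliceExp d i₀ ε)).domain, p ∈ Finset.range (d + 1 + 1) →
        σ ∈ processes (d + 1) p →
          (F : Kernel (Fin d)) =ᵐ[kernelMeasure (Fin d)]
            (fun x => G p σ (Fin.cons ξ x)) ∧ sliceNorm (K p σ) ξ =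
              ‖oscPow (sliceExp d i₀ ε) F‖ₑ := by
      refine ae_all_iff.2 fun p => ae_all_iff.2 fun σ => ?_
      by_cases h : p ∈ Finset.range (d + 1 + 1) ∧ σ ∈ processes (d + 1) p
      · filter_upwards [ae_isOscPow_slice (Fin.cons_zero _ _)
          (fun i => Fin.cons_succ _ _ i) (hK p σ h.1 h.2)] with ξ ⟨F, L, h1, h2, h3⟩
        obtain ⟨hF, rfl⟩ := oscPow_eq_of_isOscPow h1
        exact ⟨⟨F, hF⟩, fun _ _ => ⟨h2, sliceNorm_eq_enorm h3⟩⟩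
      · exact Filter.Eventually.of_forall fun ξ => ⟨0, fun h1 h2 => absurd ⟨h1, h2⟩ h⟩
    filter_upwards [hsl, hA _ hm₁ (fun i => hmm i) Φ hΦ] with ξ h1 h2 hξ
    choose F hF using h1
    obtain ⟨bΦ, hb, hle⟩ := h2 hξ
    refine ⟨bΦ, F, hb, fun p hp σ hσ => (hF p σ hp hσ).1, ?_⟩
    refine (hle (∑ p ∈ Finset.range (d + 1 + 1), ∑ σ ∈ processes (d + 1) p,
      ‖oscPow (sliceExp d i₀ ε) (F p σ)‖₊) ?_).trans ?_
    · push_cast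
      exact Finset.sum_congr rfl fun p hp => Finset.sum_congr rfl fun σ hσ => (hF p σ hp hσ).2
    · push_cast
      refine mul_le_mul_of_nonneg_right (mul_le_mul_of_nonneg_right (by linarith)
        (inv_nonneg.2 (norm_nonneg _))) ?_
      exact Finset.sum_nonneg fun p _ => Finset.sum_nonneg fun σ _ => norm_nonneg _
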